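/- **Conventions.** Manifolds are smooth, Hausdorff and second countable. An *$L_\infty$-bundle* $\mathscr M=(M,L,\lambda)$ is a manifold $M$ with a graded vector bundle $L=L^1\oplus\dots\oplus L^n$ of finite rank and smooth fibrewise multilinear operations $\lambda_k:\operatorname{Sym}^kL\to L$ ($k\ge 0$) of degree $1$ making every fibre a curved $L_\infty[1]$-algebra; its *Maurer–Cartan locus* is $\pi_0(\mathscr M)=\{\lambda_0=0\}$. A *morphism* $(f,\phi):(M,L,\lambda)\to(N,L',\lambda')$ is a smooth map $f:M\to N$ with smooth bundle maps $\phi_k:\operatorname{Sym}^kL\to L'$ over $f$ ($k\ge 1$) of degree $0$, forming on each fibre a morphism of curved $L_\infty[1]$-algebras. It is *linear* if $\phi_k=0$ for $k>1$; a *fibration* if $f$ is a submersion and $\phi_1:L\to f^*L'$ is surjective in each degree; *étale at* $P\in\pi_0(\mathscr M)$ if it induces a quasi-isomorphism of the tangent complexes $TM|_P\xrightarrow{D_P\lambda_0}L^1|_P\xrightarrow{\lambda_1}L^2|_P\to\cdots$ at $P$ and $f(P)$; a *trivial fibration* if it is a fibration, is étale at every point of $\pi_0(\mathscr M)$ and maps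 $\pi_0(\mathscr M)$ bijectively to $\pi_0(\mathscr N)$, where $\mathscr N=(N,L',\lambda')$ is the target. *Transfer.* On $\mathscr L=(U,L,\lambda)$ let $\delta$ be a smooth differential of degree $1$ on $L$, $\eta$ a smooth bundle map of degree $-1$ with $\eta^2=0$, $\eta\delta\eta=\eta$, and $L=F_0\supset F_1\supset\cdots\supset F_m=0$ a finite filtration by graded subbundles preserved by $\delta$ and $\eta$ such that $\lambda-\delta$ maps $F_{a_1}\times\dots\times F_{a_k}$ to $F_{1+\max_j a_j}$ (to $F_1$ if $k=0$). Let $\iota$ be the inclusion of $H=\ker[\delta,\eta]$ in $L$ and $\pi=\mathrm{id}-[\delta,\eta]:L\to H$. The transferred structure on $H$ is $\delta+\pi(\lambda-\delta)\bullet\phi$, where $\phi:H\to L$ solves $\phi=\iota-\eta(\lambda-\delta)\bullet\phi$, and $(\mathrm{id},\phi)$ is the inclusion morphism. For $Z\subset M$, a *transfer embedding relative to $Z$*, $(U,H,\mu)\to(M,L,\lambda)$, is such an inclusion morphism for $\mathscr M|_U$, where $U\subset M$ is open with $Z\subset U$, followed by $\mathscr M|_U\hookrightarrow\mathscr M$.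 A *simple subbundle* $(Y,E,\nu)\subset(U,H,\mu)$ consists of a submanifold $Y\subset U$ and $E=E^1\oplus H^{\ge2}|_Y$ with the restricted operations, where $E^1\subset H^1|_Y$ is a subbundle containing $\mu_0|_Y$; its inclusion is a linear morphism. **Theorem.** Let $(f,\phi):\mathscr M=(M,L,\lambda)\to\mathscr N=(N,L',\lambda')$ be a linear fibration of $L_\infty$-bundles. (1) Let $Z\subset\pi_0(\mathscr M)$ be a subset such that $(f,\phi)$ is étale at every point of $Z$. Then there exist a finite sequence of transfer embeddings relative to $Z$, $(U,H,\mu)\to\cdots\to(M,L,\lambda)$, and a simple subbundle $(Y,E,\nu)\subset(U,H,\mu)$ such that - $Z\subset Y$; - the composition $(U,H,\mu)\to(M,L,\lambda)\to(N,L',\lambda')$ is a linear fibration, and $H^{i}\to f^*(L')^{i}|_U$ is an isomorphism of vector bundles for every $i\ge2$; - $f(Y)$ is open in $N$, and the composition $(Y,E,\nu)\to(N,L',\lambda')|_{f(Y)}$ is a linear local isomorphism of $L_\infty$-bundles: every point of $Y$ has an open neighbourhood in $Y$ on which it restricts to an isomorphism onto the restriction of $\mathscr N$ to an open subset of $N$.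 (2) If $(f,\phi)$ is a trivial fibration, then for $Z=\pi_0(\mathscr M)$ (hence with $\pi_0(\mathscr M)\subset Y$) the transfer embeddings and the simple subbundle in (1) can be chosen so that $f(Y)$ is open in $N$ and $(Y,E,\nu)\to(N,L',\lambda')|_{f(Y)}$ is a linear isomorphism of $L_\infty$-bundles. -/

import Mathlib

open scoped Manifold ContDiff
open Bundle Set

noncomputable section

/-! ### Curved `L∞[1]`-algebras

A graded vector space is a real vector space `A` with a family `G : ℕ → Submodule ℝ A` of
homogeneous parts.  A family `lam k : A ^ k → B`, `k = 0, 1, 2, …`, of multilinear maps stands for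
an element of `Sym (A, B)`; all identities are imposed on homogeneous arguments `x j ∈ G (d j)`. -/

section Algebra

/-- The Koszul sign of the rearrangement of homogeneous elements `x 0, …, x (n-1)` of degrees
`d 0, …, d (n-1)` that sorts them (stably) by `pos`: one factor `(-1) ^ (d a * d b)` for each pair
`a < b` that is interchanged. -/
def koszulSign {n : ℕ} {α : Type*} [LinearOrder α] (d : Fin n → ℕ) (pos : Fin n → α) : ℝ :=
  ∏ a : Fin n, ∏ b : Fin n, if a < b ∧ pos b < pos a then (-1 : ℝ) ^ (d a * d b) else 1

variable {A B C : Type*} [AddCommGroup A] [Module ℝ A] [AddCommGroup B] [Module ℝ B]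
  [AddCommGroup C] [Module ℝ C]

/-- A sequence of `k`-ary multilinear operations, one for each `k ≥ 0`. -/
abbrev Operations (A B : Type*) [AddCommGroup A] [Module ℝ A] [AddCommGroup B] [Module ℝ B] :=
  ∀ k : ℕ, MultilinearMap ℝ (fun _ : Fin k => A) B

/-- The sequence of operations whose only component is the linear map `g`, in arity one. -/
def ofLinear (g : A →ₗ[ℝ] B) : Operations A B
  | 1 => MultilinearMap.ofSubsingleton ℝ A B (0 : Fin 1) g
  | _ => 0

/-- The unary operation of a sequence of operations, as a linear map. -/
def unary (phi : Operations A B) : A →ₗ[ℝ] B :=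
  (MultilinearMap.ofSubsingleton ℝ A B (0 : Fin 1)).symm (phi 1)

/-- `(lam • phi)_n (x) = ∑ ± lam_r (phi (x_{B_1}), …, phi (x_{B_r}))`, the sum over all partitions
of the arguments into nonempty blocks. -/
def bullet (lam : Operations B C) (phi : Operations A B) {n : ℕ} (d : Fin n → ℕ)
    (x : Fin n → A) : C :=
  ∑ c : OrderedFinpartition n, koszulSign d c.index •
    lam c.length (fun m => phi (c.partSize m) (fun j => x (c.emb m j)))

/-- `(phi ∘ lam)_n (x) = ∑ ± phi (lam (x_S), x_{Sᶜ})`, the sum over all subsets `S` of the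
arguments (equivalently, over all unshuffles), the empty one included. -/
def insertOp (phi : Operations A B) (lam : Operations A A) {n : ℕ} (d : Fin n → ℕ)
    (x : Fin n → A) : B :=
  ∑ S : Finset (Fin n), koszulSign d (fun a => if a ∈ S then (0 : ℕ) else 1) •
    phi (Sᶜ.card + 1) (Fin.cons (lam S.card (fun j => x (S.orderEmbOfFin rfl j)))
      (fun j => x (Sᶜ.orderEmbOfFin rfl j)))

/-- Graded symmetry: the operations factor through the graded symmetric powers of `A`. -/
def IsGradedSymmetric (G : ℕ → Submodule ℝ A) (phi : Operations A B) : Prop :=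
  ∀ (k : ℕ) (d : Fin k → ℕ) (x : Fin k → A), (∀ j, x j ∈ G (d j)) → ∀ σ : Equiv.Perm (Fin k),
    phi k (fun j => x (σ j)) = koszulSign d (fun a => σ.symm a) • phi k x

/-- A curved `L∞[1]`-structure: graded symmetric operations of degree one, beginning with the
curvature `lam 0`, subject to the generalized Jacobi identities `lam ∘ lam = 0`. -/
structure IsCurvedLInfty (G : ℕ → Submodule ℝ A) (lam : Operations A A) : Prop where
  symmetric : IsGradedSymmetric G lam
  degree : ∀ (k : ℕ) (d : Fin k → ℕ) (x : Fin k → A), (∀ j, x j ∈ G (d j)) →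
    lam k x ∈ G ((∑ j, d j) + 1)
  jacobi : ∀ (n : ℕ) (d : Fin n → ℕ) (x : Fin n → A), (∀ j, x j ∈ G (d j)) →
    insertOp lam lam d x = 0

/-- A morphism of curved `L∞[1]`-algebras: graded symmetric operations `phi k`, `k ≥ 1`, of degree
zero, with `phi ∘ lam = lam' • phi`. -/
structure IsLInftyMorphism (G : ℕ → Submodule ℝ A) (lam : Operations A A)
    (G' : ℕ → Submodule ℝ B) (lam' : Operations B B) (phi : Operations A B) : Prop where
  zero : phi 0 = 0
  symmetric : IsGradedSymmetric G phi
  degree : ∀ (k : ℕ) (d : Fin k → ℕ) (x : Fin k → A), (∀ j, x j ∈ G (d j)) →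
    phi k x ∈ G' (∑ j, d j)
  comm : ∀ (n : ℕ) (d : Fin n → ℕ) (x : Fin n → A), (∀ j, x j ∈ G (d j)) →
    insertOp phi lam d x = bullet lam' phi d x

/-- The input of the homotopy transfer theorem on a curved `L∞[1]`-algebra `(B, lam)`, graded by
`G`: a differential `δ`, a contraction `η` of `δ`, and a finite descending filtration
`F_k = ⨁ i, Fil k i` (with `Fil k i = F_k ∩ B ^ i`), compatible with `δ` and `η`, such that the
structure `lam - δ` on `(B, δ)` is filtered, i.e. increases the filtration degree by one:
`F_{a 1} × ⋯ × F_{a k}` is mapped to `F_{1 + max a}`. -/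
structure IsTransferInput (G : ℕ → Submodule ℝ B) (lam : Operations B B) (δ η : B →ₗ[ℝ] B)
    (Fil : ℕ → ℕ → Submodule ℝ B) : Prop where
  δ_degree : ∀ i, ∀ x ∈ G i, δ x ∈ G (i + 1)
  δ_sq : ∀ x, δ (δ x) = 0
  η_degree : ∀ i, ∀ x ∈ G (i + 1), η x ∈ G i
  η_zero : ∀ x ∈ G 0, η x = 0
  η_sq : ∀ x, η (η x) = 0
  contraction : ∀ x, η (δ (η x)) = η x
  fil_zero : ∀ i, Fil 0 i = G i
  fil_anti : ∀ k i, Fil (k + 1) i ≤ Fil k i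
  fil_δ : ∀ k i, ∀ x ∈ Fil k i, δ x ∈ Fil k (i + 1)
  fil_η : ∀ k i, ∀ x ∈ Fil k (i + 1), η x ∈ Fil k i
  filtered : ∀ (k : ℕ) (a : Fin k → ℕ) (x : Fin k → B), (∀ j, x j ∈ ⨆ i, Fil (a j) i) →
    (lam k - ofLinear δ k) x ∈ ⨆ i, Fil (Finset.univ.sup a + 1) i

/-- The output of the homotopy transfer theorem: `incl` is the inclusion of `H = ker [δ, η]` in
`B`, the morphism `phi` from `H` to `B` satisfies `phi = incl - η (lam - δ) • phi`, and the
transferred structure `mu` on `H` is `δ + π (lam - δ) • phi`, where `incl π = id - [δ, η]`. -/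
structure IsTransferOutput (GA : ℕ → Submodule ℝ A) (lam : Operations B B) (δ η : B →ₗ[ℝ] B)
    (incl : A →ₗ[ℝ] B) (mu : Operations A A) (phi : Operations A B) : Prop where
  recursion : ∀ (n : ℕ) (d : Fin n → ℕ) (x : Fin n → A), (∀ j, x j ∈ GA (d j)) →
    phi n x = ofLinear incl n x - η (bullet (fun k => lam k - ofLinear δ k) phi d x)
  structure_eq : ∀ (n : ℕ) (d : Fin n → ℕ) (x : Fin n → A), (∀ j, x j ∈ GA (d j)) →
    incl (mu n x) = ofLinear (δ ∘ₗ incl) n x +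
      (LinearMap.id - (δ ∘ₗ η + η ∘ₗ δ) : B →ₗ[ℝ] B) (bullet (fun k => lam k - ofLinear δ k) phi d x)

/-- Let `g` be a map of complexes, in a fixed degree, `Z` and `Bd` the cocycles and coboundaries of
the source, `Z'` and `Bd'` those of the target.  The induced map `Z / Bd → Z' / Bd'` on cohomology
is injective and surjective. -/
def IsCohomologyBijective (Z Bd : Submodule ℝ A) (Z' Bd' : Submodule ℝ B) (g : A →ₗ[ℝ] B) : Prop :=
  (∀ z ∈ Z, g z ∈ Bd' → z ∈ Bd) ∧ (∀ z' ∈ Z', ∃ z ∈ Z, z' - g z ∈ Bd')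

end Algebra

/-! ### Submanifolds, subbundles and bundle maps -/

section Bundles

variable {EM : Type*} [NormedAddCommGroup EM] [NormedSpace ℝ EM]
  {M : Type*} [TopologicalSpace M] [ChartedSpace EM M]
  {FM : Type*} [NormedAddCommGroup FM] [NormedSpace ℝ FM]
  {V : M → Type*} [∀ p, AddCommGroup (V p)] [∀ p, Module ℝ (V p)]
  [TopologicalSpace (TotalSpace FM V)] [∀ p, TopologicalSpace (V p)] [FiberBundle FM V]
  {EN : Type*} [NormedAddCommGroup EN] [NormedSpace ℝ EN]
  {N : Type*} [TopologicalSpace N] [ChartedSpace EN N]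
  {FN : Type*} [NormedAddCommGroup FN] [NormedSpace ℝ FN]
  {W : N → Type*} [∀ q, AddCommGroup (W q)] [∀ q, Module ℝ (W q)]
  [TopologicalSpace (TotalSpace FN W)] [∀ q, TopologicalSpace (W q)] [FiberBundle FN W]

variable (EM) in
/-- `Y` is a (smoothly embedded) submanifold of `M`: near each of its points it is a linear slice
in some smooth chart of `M`.  Open subsets are submanifolds. -/
def IsSubmanifold (Y : Set M) : Prop :=
  ∀ p ∈ Y, ∃ e ∈ IsManifold.maximalAtlas 𝓘(ℝ, EM) ∞ M, p ∈ e.source ∧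
    ∃ S : Submodule ℝ EM, ∀ q ∈ e.source, q ∈ Y ↔ e q ∈ S

variable (EM FM) in
/-- The restriction of the section `s` of `V` to the set `Y` is smooth.  (On a submanifold this is
smoothness in the intrinsic sense, as smooth functions on it extend locally.) -/
def IsSmoothSection (Y : Set M) (s : ∀ p, V p) : Prop :=
  ContMDiffOn 𝓘(ℝ, EM) (𝓘(ℝ, EM).prod 𝓘(ℝ, FM)) ∞ (fun p => TotalSpace.mk' FM p (s p)) Y

variable (EM FM) in
/-- The subspaces `S p`, `p ∈ Y`, form a smooth subbundle of `V|_Y`: they have smooth frames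
locally on `Y`. -/
def IsSmoothSubbundle (Y : Set M) (S : ∀ p, Submodule ℝ (V p)) : Prop :=
  ∀ p ∈ Y, ∃ u : Set M, IsOpen u ∧ p ∈ u ∧ ∃ (r : ℕ) (s : Fin r → ∀ q, V q),
    (∀ j, IsSmoothSection EM FM (Y ∩ u) (s j)) ∧
    ∀ q ∈ Y ∩ u, LinearIndependent ℝ (fun j => s j q) ∧
      Submodule.span ℝ (range fun j => s j q) = S q

variable (EM FM EN FN) in
/-- A fibrewise multilinear map from the subbundle `S` of `V|_Y` to the family `T` of subspaces of
`W`, over `f : Y → N`, is smooth: it maps local smooth sections to smooth sections along `f`. -/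
def IsSmoothMultilinear (Y : Set M) (S : ∀ p, Submodule ℝ (V p)) (f : M → N)
    (T : ∀ q, Submodule ℝ (W q)) {k : ℕ}
    (phi : ∀ p, MultilinearMap ℝ (fun _ : Fin k => S p) (T (f p))) : Prop :=
  ∀ u : Set M, IsOpen u → ∀ s : Fin k → ∀ p, S p,
    (∀ j, IsSmoothSection EM FM (Y ∩ u) (fun p => (s j p : V p))) →
    ContMDiffOn 𝓘(ℝ, EM) (𝓘(ℝ, EN).prod 𝓘(ℝ, FN)) ∞
      (fun p => TotalSpace.mk' FN (f p) (phi p (fun j => s j p) : W (f p))) (Y ∩ u)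

end Bundles

/-! ### `L∞`-bundles -/

/-- An `L∞`-bundle `(Y, L, λ)` whose base `Y = base` is a submanifold of `M` (for instance `M`
itself, or an open subset) and whose graded vector bundle `L = L¹ ⊕ ⋯ ⊕ Lⁿ`, `Lⁱ = grade i`, is a
smooth graded subbundle of the vector bundle `V|_Y` (for instance `V` itself).  The fibre of `L` at
`p` is `⨆ i, grade i p`.  The values of the fields at points outside of `base` are irrelevant. -/
structure LInftyBundle (EM FM : Type*) [NormedAddCommGroup EM] [NormedSpace ℝ EM]
    [NormedAddCommGroup FM] [NormedSpace ℝ FM] {M : Type*} [TopologicalSpace M] [ChartedSpace EM M]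
    (V : M → Type*) [∀ p, AddCommGroup (V p)] [∀ p, Module ℝ (V p)]
    [TopologicalSpace (TotalSpace FM V)] [∀ p, TopologicalSpace (V p)] [FiberBundle FM V] where
  base : Set M
  submanifold : IsSubmanifold EM base
  grade : ℕ → ∀ p, Submodule ℝ (V p)
  subbundle : ∀ i, IsSmoothSubbundle EM FM base (grade i)
  independent : ∀ p ∈ base, iSupIndep (fun i => grade i p)
  grade_zero : ∀ p ∈ base, grade 0 p = ⊥
  bounded : ∃ n, ∀ i, n < i → ∀ p ∈ base, grade i p = ⊥
  op : ∀ p, Operations ↥(⨆ i, grade i p) ↥(⨆ i, grade i p)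
  curvedLInfty : ∀ p ∈ base,
    IsCurvedLInfty (fun i => (grade i p).submoduleOf (⨆ i, grade i p)) (op p)
  smooth : ∀ k, IsSmoothMultilinear EM FM EM FM base (fun p => ⨆ i, grade i p) id
    (fun p => ⨆ i, grade i p) (fun p => op p k)

namespace LInftyBundle

variable {EM : Type*} [NormedAddCommGroup EM] [NormedSpace ℝ EM]
  {M : Type*} [TopologicalSpace M] [ChartedSpace EM M]
  {FM : Type*} [NormedAddCommGroup FM] [NormedSpace ℝ FM]
  {V : M → Type*} [∀ p, AddCommGroup (V p)] [∀ p, Module ℝ (V p)]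
  [TopologicalSpace (TotalSpace FM V)] [∀ p, TopologicalSpace (V p)] [FiberBundle FM V]
  {EN : Type*} [NormedAddCommGroup EN] [NormedSpace ℝ EN]
  {N : Type*} [TopologicalSpace N] [ChartedSpace EN N]
  {FN : Type*} [NormedAddCommGroup FN] [NormedSpace ℝ FN]
  {W : N → Type*} [∀ q, AddCommGroup (W q)] [∀ q, Module ℝ (W q)]
  [TopologicalSpace (TotalSpace FN W)] [∀ q, TopologicalSpace (W q)] [FiberBundle FN W]
  {EP : Type*} [NormedAddCommGroup EP] [NormedSpace ℝ EP]
  {P : Type*} [TopologicalSpace P] [ChartedSpace EP P]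
  {FP : Type*} [NormedAddCommGroup FP] [NormedSpace ℝ FP]
  {X : P → Type*} [∀ q, AddCommGroup (X q)] [∀ q, Module ℝ (X q)]
  [TopologicalSpace (TotalSpace FP X)] [∀ q, TopologicalSpace (X q)] [FiberBundle FP X]

/-- The fibre `L|_p`, as a subspace of `V p`. -/
abbrev fib (𝓛 : LInftyBundle EM FM V) (p : M) : Submodule ℝ (V p) := ⨆ i, 𝓛.grade i p

/-- The homogeneous part `Lⁱ|_p`, as a subspace of the fibre `L|_p`. -/
abbrev gr (𝓛 : LInftyBundle EM FM V) (p : M) (i : ℕ) : Submodule ℝ (𝓛.fib p) :=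
  (𝓛.grade i p).submoduleOf (𝓛.fib p)

/-- The curvature `λ₀`. -/
def curvature (𝓛 : LInftyBundle EM FM V) (p : M) : 𝓛.fib p := 𝓛.op p 0 (fun j => j.elim0)

/-- The classical, or Maurer-Cartan, locus: the zero locus of the curvature. -/
def classicalLocus (𝓛 : LInftyBundle EM FM V) : Set M := {p | p ∈ 𝓛.base ∧ 𝓛.curvature p = 0}

/-- The restriction of an `L∞`-bundle to an open set. -/
def restrict [IsManifold 𝓘(ℝ, EM) ∞ M] (𝓛 : LInftyBundle EM FM V)
    (u : TopologicalSpace.Opens M) : LInftyBundle EM FM V where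
  base := 𝓛.base ∩ u
  submanifold := by
    rintro p ⟨hp, hu⟩
    obtain ⟨e, he, hpe, S, hS⟩ := 𝓛.submanifold p hp
    refine ⟨e.restr u, restr_mem_maximalAtlas _ he u.isOpen, ?_, S, ?_⟩
    · simpa [u.isOpen.interior_eq] using ⟨hpe, hu⟩
    · intro q hq
      simp only [OpenPartialHomeomorph.restr_source, u.isOpen.interior_eq] at hq
      simpa [hq.2] using hS q hq.1
  grade := 𝓛.grade
  subbundle := by
    rintro i p ⟨hp, _⟩
    obtain ⟨v, hv, hpv, r, s, hs, hs'⟩ := 𝓛.subbundle i p hp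
    exact ⟨v, hv, hpv, r, s,
      fun j => (hs j).mono (inter_subset_inter_left _ inter_subset_left),
      fun q hq => hs' q ⟨hq.1.1, hq.2⟩⟩
  independent := fun p hp => 𝓛.independent p hp.1
  grade_zero := fun p hp => 𝓛.grade_zero p hp.1
  bounded := 𝓛.bounded.imp fun _ h i hi p hp => h i hi p hp.1
  op := 𝓛.op
  curvedLInfty := fun p hp => 𝓛.curvedLInfty p hp.1
  smooth := by
    intro k v hv s hs
    rw [inter_assoc]
    refine 𝓛.smooth k (u ∩ v) (u.isOpen.inter hv) s fun j => ?_
    rw [← inter_assoc]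
    exact hs j

/-- A morphism of `L∞`-bundles over the map `f` of base manifolds: smooth fibrewise multilinear
maps `φ_k : Sym^k L → L'` over `f` which, at each point `p` of the base, form a morphism of curved
`L∞[1]`-algebras from `L|_p` to `L'|_{f p}`.  The values of `f` and `φ_k` at points outside of the
base are irrelevant. -/
structure Hom (𝓛 : LInftyBundle EM FM V) (𝓛' : LInftyBundle EN FN W) (f : M → N) where
  mapsTo : MapsTo f 𝓛.base 𝓛'.base
  contMDiffOn : ContMDiffOn 𝓘(ℝ, EM) 𝓘(ℝ, EN) ∞ f 𝓛.base
  op : ∀ p, Operations (𝓛.fib p) (𝓛'.fib (f p))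
  morphism : ∀ p ∈ 𝓛.base,
    IsLInftyMorphism (𝓛.gr p) (𝓛.op p) (𝓛'.gr (f p)) (𝓛'.op (f p)) (op p)
  smooth : ∀ k, IsSmoothMultilinear EM FM EN FN 𝓛.base 𝓛.fib f 𝓛'.fib (fun p => op p k)

/-- The linear part `φ₁` at a point. -/
def Hom.lin {𝓛 : LInftyBundle EM FM V} {𝓛' : LInftyBundle EN FN W} {f : M → N}
    (φ : Hom 𝓛 𝓛' f) (p : M) : 𝓛.fib p →ₗ[ℝ] 𝓛'.fib (f p) := unary (φ.op p)

/-- A morphism is linear if `φ_k = 0` for all `k > 1` (for `k = 0` this always holds). -/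
def Hom.IsLinear {𝓛 : LInftyBundle EM FM V} {𝓛' : LInftyBundle EN FN W} {f : M → N}
    (φ : Hom 𝓛 𝓛' f) : Prop :=
  ∀ p ∈ 𝓛.base, ∀ k, 1 < k → φ.op p k = 0

/-- A morphism, from an `L∞`-bundle whose base is open in `M` to one whose base is open in `N`, is
a fibration if `f` is a submersion and `φ₁ : L → f^* L'` is surjective in each degree. -/
def Hom.IsFibration {𝓛 : LInftyBundle EM FM V} {𝓛' : LInftyBundle EN FN W} {f : M → N}
    (φ : Hom 𝓛 𝓛' f) : Prop :=
  ∀ p ∈ 𝓛.base, Function.Surjective (mfderiv 𝓘(ℝ, EM) 𝓘(ℝ, EN) f p) ∧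
    ∀ i, SurjOn (φ.lin p) (𝓛.gr p i) (𝓛'.gr (f p) i)

/-- The map `L^i → f^* L'^i` induced by `φ₁` is an isomorphism of vector bundles. -/
def Hom.IsIsoInDegree {𝓛 : LInftyBundle EM FM V} {𝓛' : LInftyBundle EN FN W} {f : M → N}
    (φ : Hom 𝓛 𝓛' f) (i : ℕ) : Prop :=
  ∀ p ∈ 𝓛.base, BijOn (φ.lin p) (𝓛.gr p i) (𝓛'.gr (f p) i)

/-- `χ` is the composition of `φ` followed by `ψ`. -/
def IsComposition {𝓛 : LInftyBundle EM FM V} {𝓛' : LInftyBundle EN FN W}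
    {𝓛'' : LInftyBundle EP FP X} {f : M → N} {g : N → P}
    (φ : Hom 𝓛 𝓛' f) (ψ : Hom 𝓛' 𝓛'' g) (χ : Hom 𝓛 𝓛'' (g ∘ f)) : Prop :=
  ∀ p ∈ 𝓛.base, ∀ (n : ℕ) (d : Fin n → ℕ) (x : Fin n → 𝓛.fib p), (∀ j, x j ∈ 𝓛.gr p (d j)) →
    χ.op p n x = bullet (ψ.op (f p)) (φ.op p) d x

/-- The composition of `φ : 𝓛 → 𝓛'`, over `f`, with `ψ : 𝓛' → 𝓛`, over `g`, is the identity of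
`𝓛`.  As `g (f p) = p` is part of the claim, it is stated as an equality of points of the total
space of `V`. -/
def IsLeftInverse {𝓛 : LInftyBundle EM FM V} {𝓛' : LInftyBundle EN FN W} {f : M → N} {g : N → M}
    (ψ : Hom 𝓛' 𝓛 g) (φ : Hom 𝓛 𝓛' f) : Prop :=
  ∀ p ∈ 𝓛.base, ∀ (n : ℕ) (d : Fin n → ℕ) (x : Fin n → 𝓛.fib p), (∀ j, x j ∈ 𝓛.gr p (d j)) →
    TotalSpace.mk' FM (g (f p)) ((bullet (ψ.op (f p)) (φ.op p) d x : 𝓛.fib (g (f p))) : V (g (f p))) =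
      TotalSpace.mk' FM p ((ofLinear LinearMap.id n x : 𝓛.fib p) : V p)

/-- An isomorphism of `L∞`-bundles: a morphism with a two-sided inverse.  (The base map of a
morphism is given as a function on all of the ambient manifold, so that the isomorphism between
two empty `L∞`-bundles has to be admitted separately.) -/
def Hom.IsIso {𝓛 : LInftyBundle EM FM V} {𝓛' : LInftyBundle EN FN W} {f : M → N}
    (φ : Hom 𝓛 𝓛' f) : Prop :=
  (𝓛.base = ∅ ∧ 𝓛'.base = ∅) ∨
    ∃ (g : N → M) (ψ : Hom 𝓛' 𝓛 g), IsLeftInverse ψ φ ∧ IsLeftInverse φ ψ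

/-- The morphism `φ` restricts to an isomorphism from `𝓛|_u` to `𝓛'|_v`. -/
def Hom.RestrictsToIso [IsManifold 𝓘(ℝ, EM) ∞ M] [IsManifold 𝓘(ℝ, EN) ∞ N]
    {𝓛 : LInftyBundle EM FM V} {𝓛' : LInftyBundle EN FN W} {f : M → N} (φ : Hom 𝓛 𝓛' f)
    (u : TopologicalSpace.Opens M) (v : TopologicalSpace.Opens N) : Prop :=
  ∃ φ' : Hom (𝓛.restrict u) (𝓛'.restrict v) f,
    (∀ p ∈ (𝓛.restrict u).base, φ'.op p = φ.op p) ∧ φ'.IsIso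

/-- A local isomorphism: a morphism that, near each point of its source, restricts to an
isomorphism onto the restriction of the target to an open subset. -/
def Hom.IsLocalIso [IsManifold 𝓘(ℝ, EM) ∞ M] [IsManifold 𝓘(ℝ, EN) ∞ N]
    {𝓛 : LInftyBundle EM FM V} {𝓛' : LInftyBundle EN FN W} {f : M → N} (φ : Hom 𝓛 𝓛' f) : Prop :=
  ∀ p ∈ 𝓛.base, ∃ (u : TopologicalSpace.Opens M) (v : TopologicalSpace.Opens N),
    p ∈ u ∧ φ.RestrictsToIso u v

/-! ### Étale morphisms

The tangent complex `TM|_p → L¹|_p → L²|_p → ⋯` at a classical point `p`, for an `L∞`-bundle whose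
base is open in `M`.  Its first map is the derivative of the curvature at its zero `p`, the others
are `λ₁`. -/

/-- The derivative `D_p λ₀ : TM|_p → V p` of the curvature at a zero `p`, computed in a local
trivialization of `V` (the result does not depend on it). -/
def curvatureDeriv [VectorBundle ℝ FM V] (𝓛 : LInftyBundle EM FM V) (p : M) :
    TangentSpace 𝓘(ℝ, EM) p →L[ℝ] V p :=
  ((trivializationAt FM V p).symmL ℝ p).comp
    (mfderiv 𝓘(ℝ, EM) 𝓘(ℝ, FM)
      (fun q => (trivializationAt FM V p (TotalSpace.mk' FM q (𝓛.curvature q : V q))).2) p)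

/-- The cocycles of the tangent complex at `p`, in degree `i ≥ 1`. -/
def cocycles (𝓛 : LInftyBundle EM FM V) (p : M) (i : ℕ) : Submodule ℝ (𝓛.fib p) :=
  𝓛.gr p i ⊓ (unary (𝓛.op p)).ker

/-- The coboundaries of the tangent complex at `p`, in degree `i ≥ 1`. -/
def coboundaries [VectorBundle ℝ FM V] (𝓛 : LInftyBundle EM FM V) (p : M) (i : ℕ) :
    Submodule ℝ (𝓛.fib p) :=
  if i = 1 then (𝓛.curvatureDeriv p).toLinearMap.range.submoduleOf (𝓛.fib p)
  else (𝓛.gr p (i - 1)).map (unary (𝓛.op p))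

/-- A morphism is étale at the classical point `p` if it induces a quasi-isomorphism of the tangent
complexes at `p` and `f p`. -/
def Hom.IsEtaleAt [VectorBundle ℝ FM V] [VectorBundle ℝ FN W] {𝓛 : LInftyBundle EM FM V}
    {𝓛' : LInftyBundle EN FN W} {f : M → N} (φ : Hom 𝓛 𝓛' f) (p : M) : Prop :=
  p ∈ 𝓛.classicalLocus ∧
  IsCohomologyBijective (𝓛.curvatureDeriv p).toLinearMap.ker ⊥
    (𝓛'.curvatureDeriv (f p)).toLinearMap.ker ⊥
    (mfderiv 𝓘(ℝ, EM) 𝓘(ℝ, EN) f p).toLinearMap ∧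
  ∀ i, 1 ≤ i → IsCohomologyBijective (𝓛.cocycles p i) (𝓛.coboundaries p i)
    (𝓛'.cocycles (f p) i) (𝓛'.coboundaries (f p) i) (φ.lin p)

/-- A weak equivalence: étale at all classical points, and a bijection on classical loci. -/
def Hom.IsWeakEquivalence [VectorBundle ℝ FM V] [VectorBundle ℝ FN W] {𝓛 : LInftyBundle EM FM V}
    {𝓛' : LInftyBundle EN FN W} {f : M → N} (φ : Hom 𝓛 𝓛' f) : Prop :=
  (∀ p ∈ 𝓛.classicalLocus, φ.IsEtaleAt p) ∧ BijOn f 𝓛.classicalLocus 𝓛'.classicalLocus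

/-! ### Transfer embeddings and simple subbundles -/

/-- A transfer embedding `(U, H, μ) → (M, L, λ)` relative to a set `Z`: the base `U ⊇ Z` is open in
the base of `𝓛`, and the morphism is the inclusion morphism obtained by applying the homotopy
transfer theorem to `𝓛|_U`, followed by the inclusion of `𝓛|_U` in `𝓛`.  The data of the theorem
are smooth bundle maps `δ`, `η` and a filtration `F_k L = ⨁ i, Fil k i` by graded subbundles. -/
def Hom.IsTransferEmbedding {𝓗 𝓛 : LInftyBundle EM FM V} (ι : Hom 𝓗 𝓛 id) (Z : Set M) : Prop :=
  (∃ u : Set M, IsOpen u ∧ 𝓗.base = 𝓛.base ∩ u) ∧ Z ⊆ 𝓗.base ∧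
  ∃ (δ η : ∀ p, 𝓛.fib p →ₗ[ℝ] 𝓛.fib p) (Fil : ℕ → ℕ → ∀ p, Submodule ℝ (V p)),
    IsSmoothMultilinear EM FM EM FM 𝓗.base 𝓛.fib id 𝓛.fib (fun p => ofLinear (δ p) 1) ∧
    IsSmoothMultilinear EM FM EM FM 𝓗.base 𝓛.fib id 𝓛.fib (fun p => ofLinear (η p) 1) ∧
    (∀ k i, IsSmoothSubbundle EM FM 𝓗.base (Fil k i)) ∧
    (∃ m, ∀ i, ∀ p ∈ 𝓗.base, Fil m i p = ⊥) ∧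
    ∀ p ∈ 𝓗.base,
      (∀ k i, Fil k i p ≤ 𝓛.grade i p) ∧
      IsTransferInput (𝓛.gr p) (𝓛.op p) (δ p) (η p)
        (fun k i => (Fil k i p).submoduleOf (𝓛.fib p)) ∧
      (∀ i, 𝓗.grade i p =
        (𝓛.gr p i ⊓ (δ p ∘ₗ η p + η p ∘ₗ δ p).ker).map (𝓛.fib p).subtype) ∧
      ∃ h : 𝓗.fib p ≤ 𝓛.fib p,
        IsTransferOutput (𝓗.gr p) (𝓛.op p) (δ p) (η p) (Submodule.inclusion h) (𝓗.op p) (ι.op p)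

/-- `ι : 𝓗 → 𝓛` is the composition of a finite (nonempty) sequence `𝓗 → ⋯ → 𝓛` of transfer
embeddings relative to `Z`.  (A sequence of length zero needs no separate case: the identity is a
transfer embedding, with `δ = η = 0`.) -/
inductive TransferSequence (Z : Set M) (𝓛 : LInftyBundle EM FM V) :
    ∀ 𝓗 : LInftyBundle EM FM V, Hom 𝓗 𝓛 id → Prop
  | single {𝓗 : LInftyBundle EM FM V} (ι : Hom 𝓗 𝓛 id) :
      ι.IsTransferEmbedding Z → TransferSequence Z 𝓛 𝓗 ι
  | step {𝓗 𝓚 : LInftyBundle EM FM V} (ι : Hom 𝓗 𝓛 id) (κ : Hom 𝓚 𝓗 id) (χ : Hom 𝓚 𝓛 id) :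
      TransferSequence Z 𝓛 𝓗 ι → κ.IsTransferEmbedding Z → IsComposition κ ι χ →
      TransferSequence Z 𝓛 𝓚 χ

/-- `j` is the inclusion of a simple subbundle: `Y` is a submanifold contained in the base of `𝓗`,
`E¹` is a subbundle of `H¹|_Y` that contains the curvature of `𝓗` along `Y`, `Eⁱ = Hⁱ|_Y` for
`i ≥ 2`, and the operations of `𝓨 = (Y, E, ν)` are the restrictions of those of `𝓗`.  (That `Y` is
a submanifold and `E¹` a smooth subbundle is part of `𝓨` being an `L∞`-bundle.) -/
structure Hom.IsSimpleSubbundle {𝓨 𝓗 : LInftyBundle EM FM V} (j : Hom 𝓨 𝓗 id) : Prop where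
  base_subset : 𝓨.base ⊆ 𝓗.base
  grade_one_le : ∀ p ∈ 𝓨.base, 𝓨.grade 1 p ≤ 𝓗.grade 1 p
  curvature_mem : ∀ p ∈ 𝓨.base, (𝓗.curvature p : V p) ∈ 𝓨.grade 1 p
  grade_eq : ∀ p ∈ 𝓨.base, ∀ i, 2 ≤ i → 𝓨.grade i p = 𝓗.grade i p
  op_eq : ∀ p ∈ 𝓨.base, ∀ h : 𝓨.fib p ≤ 𝓗.fib p, ∀ (k : ℕ) (x : Fin k → 𝓨.fib p),
    (𝓨.op p k x : V p) = 𝓗.op p k (fun a => Submodule.inclusion h (x a))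
  inclusion : ∀ p ∈ 𝓨.base, ∀ h : 𝓨.fib p ≤ 𝓗.fib p,
    j.op p = ofLinear (Submodule.inclusion h)

end LInftyBundle

end
open LInftyBundle

/-!
Let `K` be the kernel of a linear fibration of `L∞`-bundles, a graded vector bundle on the source.
A quasi-isomorphism of tangent complexes that is surjective has an exact kernel, so at the points of
`Z` the complex `ker df → K¹ → K² → ⋯` is exact (`LInftyBundle.Hom.IsEtaleAt.exactAt`).  The proof
makes `K` smaller until nothing is left of it.

**Degrees at least two.**  Assume that `K` vanishes above degree `m + 1`, where `m ≥ 1`.  By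
exactness `λ₁ : K^m → K^{m+1}` is surjective over `Z`, hence over a neighbourhood of `Z`
(`isOpen_surjLocus`), and there it has a smooth right inverse `η`, the fibrewise pseudoinverse for a
fibre metric (`exists_pseudoinverse`, `exists_kernelHomotopy`).  The part of `λ₁` from degree `m` to
degree `m + 1` and `η` are the data of a transfer, for the filtration by `weight`.  A nonlinear
operation with an argument in `K^m` has its value in `K` in degree at least `m + 2`, so it vanishes
(`LInftyBundle.Hom.IsLinear.op_eq_zero`).  Therefore the recursive formulas of the homotopy transfer
theorem break off (`IdealTransfer`): the transferred operations are `π ∘ λ`, the inclusion morphism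
is `ι - η ∘ λ`, and its composition with the fibration is linear, since `η` has values in `K`.  The
transfer removes `K^{m+1}`, together with a complement of the kernel of `λ₁` in `K^m`, and the
tangent complexes of what remains of `K` are exact in degrees at most `m`
(`exists_transferEmbedding`).  By downward induction on `m`, a sequence of transfers leaves a
linear fibration whose kernel is concentrated in degree one (`exists_transferSequence`).  That the
successive inclusion morphisms can be composed is `IsLInftyMorphism.bullet`: over a Grassmann
algebra, where operations of degree zero become functions and `L∞`-structures become vector fields,
it is the chain rule for Taylor coefficients (`envOp_bullet`, `envOp_insertOp`).

**Degree one.**  Let `E¹` be the orthogonal complement of `K¹` in degree one and let `Y` be the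
locus where the curvature `λ₀` belongs to `E¹` (`orthKer`, `orthLocus`).  At the points of `Z` the
derivative of the component of `λ₀` in `K¹` is an isomorphism from `ker df` to `K¹`.  By the inverse
function theorem `Y` is a submanifold near `Z` on which `f` is a local diffeomorphism
(`exists_isLocalSection_orthLocus`), and the linear part of the fibration is an isomorphism from
`E¹ ⊕ H^{≥2}` to the target in each degree.  A linear morphism that is fibrewise an isomorphism, over
a diffeomorphism, is an isomorphism of `L∞`-bundles (`restrictsToIso`).

**Trivial fibrations.**  If `f` maps the classical locus bijectively to that of the target, the
classical locus is a union of fibres of `f|_Y`: over a classical point the curvature is both in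
`K¹` and orthogonal to `K¹`.  A local diffeomorphism that is injective on such a union is injective
on a neighbourhood of it (`exists_isOpen_injOn`), and after shrinking `Y` the local isomorphisms are
restrictions of a global one.
-/

noncomputable section

set_option linter.unusedSectionVars false

/-! ### Koszul signs of families of finite sets -/

section Signs

variable {I : Type*} [LinearOrder I]

/-- The sign `θ_b θ_a ↦ ± θ_a θ_b` relating products of two square-zero generators. -/
def crossSign (d : I → ℕ) (a b : I) : ℝ :=
  if a < b then 1 else if b < a then (-1) ^ (d a * d b) else 0

/-- The structure constant of the product `θ_S θ_T = setSign d S T • θ_{S ∪ T}`. -/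
def setSign (d : I → ℕ) (S T : Finset I) : ℝ := ∏ a ∈ S, ∏ b ∈ T, crossSign d a b

/-- The structure constant of the product `θ_{S 0} ⋯ θ_{S (k-1)}`. -/
def familySign (d : I → ℕ) {k : ℕ} (S : Fin k → Finset I) : ℝ :=
  ∏ a : Fin k, ∏ b : Fin k, if a < b then setSign d (S a) (S b) else 1

/-- The structure constant of the product `θ_E θ_{S 0} ⋯ θ_{S (k-1)}`. -/
def leadingSign (d : I → ℕ) (E : Finset I) {k : ℕ} (S : Fin k → Finset I) : ℝ :=
  (∏ a : Fin k, setSign d E (S a)) * familySign d S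

/-- The degree of `θ_S`, up to the sign. -/
abbrev setDegree (d : I → ℕ) (S : Finset I) : ℕ := ∑ i ∈ S, d i

lemma crossSign_comm (d : I → ℕ) (a b : I) :
    crossSign d b a = crossSign d a b * (-1) ^ (d a * d b) := by
  unfold crossSign
  rcases lt_trichotomy a b with h | rfl | h
  · simp [h, h.not_gt, mul_comm]
  · simp
  · simp only [h, if_true, h.not_gt, if_false, ← pow_add, ← two_mul]
    simp

lemma setSign_comm (d : I → ℕ) (S T : Finset I) :
    setSign d T S = setSign d S T * (-1) ^ (setDegree d S * setDegree d T) := by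
  unfold setSign setDegree
  rw [Finset.prod_comm, Finset.sum_mul_sum, ← Finset.prod_pow_eq_pow_sum, ← Finset.prod_mul_distrib]
  refine Finset.prod_congr rfl fun a _ => ?_
  rw [← Finset.prod_pow_eq_pow_sum, ← Finset.prod_mul_distrib]
  exact Finset.prod_congr rfl fun b _ => crossSign_comm d a b

lemma setSign_eq_zero (d : I → ℕ) {S T : Finset I} (h : ¬ Disjoint S T) : setSign d S T = 0 := by
  obtain ⟨a, ha, hb⟩ := Finset.not_disjoint_iff.1 h
  exact Finset.prod_eq_zero ha (Finset.prod_eq_zero hb (by simp [crossSign]))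

@[simp] lemma setSign_empty_left (d : I → ℕ) (T : Finset I) : setSign d ∅ T = 1 := by
  simp [setSign]

@[simp] lemma leadingSign_empty (d : I → ℕ) {k : ℕ} (S : Fin k → Finset I) :
    leadingSign d ∅ S = familySign d S := by
  simp [leadingSign]

lemma setSign_biUnion_right (d : I → ℕ) (E : Finset I) {k : ℕ} (S : Fin k → Finset I)
    (hS : ∀ a b, a ≠ b → Disjoint (S a) (S b)) :
    setSign d E (Finset.univ.biUnion S) = ∏ a, setSign d E (S a) := by
  unfold setSign
  symm
  rw [Finset.prod_comm]
  refine Finset.prod_congr rfl fun e _ => ?_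
  rw [Finset.prod_biUnion]
  exact fun a _ b _ h => hS a b h

lemma setSign_biUnion_left (d : I → ℕ) (E : Finset I) {k : ℕ} (S : Fin k → Finset I)
    (hS : ∀ a b, a ≠ b → Disjoint (S a) (S b)) :
    setSign d (Finset.univ.biUnion S) E = ∏ a, setSign d (S a) E := by
  unfold setSign
  rw [Finset.prod_biUnion]
  exact fun a _ b _ h => hS a b h

lemma setSign_union_left (d : I → ℕ) {S T : Finset I} (E : Finset I) (h : Disjoint S T) :
    setSign d (S ∪ T) E = setSign d S E * setSign d T E := by
  unfold setSign
  rw [Finset.prod_union h]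

lemma familySign_ne_zero {d : I → ℕ} {k : ℕ} {S : Fin k → Finset I} (h : familySign d S ≠ 0)
    (a b : Fin k) (hab : a ≠ b) : Disjoint (S a) (S b) := by
  wlog hlt : a < b generalizing a b
  · exact (this b a hab.symm (lt_of_le_of_ne (not_lt.1 hlt) hab.symm)).symm
  by_contra hd
  refine h (Finset.prod_eq_zero (Finset.mem_univ a) (Finset.prod_eq_zero (Finset.mem_univ b) ?_))
  rw [if_pos hlt, setSign_eq_zero d hd]

lemma leadingSign_ne_zero {d : I → ℕ} {E : Finset I} {k : ℕ} {S : Fin k → Finset I}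
    (h : leadingSign d E S ≠ 0) :
    (∀ a, Disjoint E (S a)) ∧ ∀ a b, a ≠ b → Disjoint (S a) (S b) := by
  refine ⟨fun a => ?_, familySign_ne_zero (right_ne_zero_of_mul h)⟩
  by_contra hd
  exact left_ne_zero_of_mul h (Finset.prod_eq_zero (Finset.mem_univ a) (setSign_eq_zero d hd))

lemma setDegree_of_leadingSign_ne_zero {d : I → ℕ} {E : Finset I} {k : ℕ} {S : Fin k → Finset I}
    (h : leadingSign d E S ≠ 0) :
    setDegree d (E ∪ Finset.univ.biUnion S) = (∑ a, setDegree d (S a)) + setDegree d E := by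
  obtain ⟨h1, h2⟩ := leadingSign_ne_zero h
  unfold setDegree
  rw [Finset.sum_union, Finset.sum_biUnion, add_comm]
  · exact fun a _ b _ h => h2 a b h
  · exact (Finset.disjoint_biUnion_right _ _ _).2 fun a _ => h1 a

lemma prod_pairs {n : ℕ} (F : Fin n → Fin n → ℝ) (hF : ∀ a, F a a = 1) :
    ∏ a, ∏ b, F a b = ∏ a, ∏ b, if a < b then F a b * F b a else 1 := by
  have h1 : ∏ a, ∏ b, F a b =
      (∏ a, ∏ b, if a < b then F a b else 1) * ∏ a, ∏ b, if b < a then F a b else 1 := by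
    rw [← Finset.prod_mul_distrib]
    refine Finset.prod_congr rfl fun a _ => ?_
    rw [← Finset.prod_mul_distrib]
    refine Finset.prod_congr rfl fun b _ => ?_
    rcases lt_trichotomy a b with h | rfl | h
    · simp [h, h.not_gt]
    · simp [hF]
    · simp [h, h.not_gt]
  rw [h1, Finset.prod_comm (f := fun a b => if b < a then F a b else 1), ← Finset.prod_mul_distrib]
  refine Finset.prod_congr rfl fun a _ => ?_
  rw [← Finset.prod_mul_distrib]
  refine Finset.prod_congr rfl fun b _ => ?_
  split_ifs <;> simp

/-- Sorting a product of the `θ_{S a}` by `pos` costs the Koszul sign. -/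
lemma prod_sorted {n : ℕ} {α : Type*} [LinearOrder α] (d : I → ℕ) (S : Fin n → Finset I)
    (pos : Fin n → α) :
    (∏ a, ∏ b, if pos a < pos b ∨ (pos a = pos b ∧ a < b) then setSign d (S a) (S b) else 1) =
      familySign d S * koszulSign (fun a => setDegree d (S a)) pos := by
  rw [prod_pairs _ (by simp)]
  unfold familySign koszulSign
  rw [← Finset.prod_mul_distrib]
  refine Finset.prod_congr rfl fun a _ => ?_
  rw [← Finset.prod_mul_distrib]
  refine Finset.prod_congr rfl fun b _ => ?_
  by_cases hab : a < b
  · rcases lt_trichotomy (pos a) (pos b) with h | h | h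
    · simp [hab, h, h.not_gt, hab.not_gt, h.ne']
    · simp [hab, h, hab.not_gt]
    · simp only [hab, if_true, h, h.not_gt, h.ne', false_or, and_true, true_or, one_mul,
        false_and, if_false, h.ne]
      exact setSign_comm d _ _
  · simp [hab]

lemma koszulSign_mul_self {n : ℕ} {α : Type*} [LinearOrder α] (d : Fin n → ℕ) (pos : Fin n → α) :
    koszulSign d pos * koszulSign d pos = 1 := by
  unfold koszulSign
  rw [← Finset.prod_mul_distrib]
  refine Finset.prod_eq_one fun a _ => ?_
  rw [← Finset.prod_mul_distrib]
  refine Finset.prod_eq_one fun b _ => ?_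
  split_ifs
  · rw [← pow_add, ← two_mul]; simp
  · simp

lemma koszulSign_of_forall_le {n : ℕ} {α : Type*} [LinearOrder α] (d : Fin n → ℕ) (pos : Fin n → α)
    (h : ∀ a b, a < b → pos a ≤ pos b) : koszulSign d pos = 1 := by
  unfold koszulSign
  refine Finset.prod_eq_one fun a _ => Finset.prod_eq_one fun b _ => ?_
  rw [if_neg]
  rintro ⟨h1, h2⟩
  exact absurd (h a b h1) h2.not_ge

lemma familySign_comp_perm {n : ℕ} (d : I → ℕ) (S : Fin n → Finset I) (σ : Equiv.Perm (Fin n)) :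
    familySign d (fun a => S (σ a)) =
      familySign d S * koszulSign (fun a => setDegree d (S a)) (fun a => σ.symm a) := by
  rw [← prod_sorted]
  unfold familySign
  refine Fintype.prod_equiv σ _ _ fun a => Fintype.prod_equiv σ _ _ fun b => ?_
  simp only [Equiv.symm_apply_apply]
  congr 1
  simp only [eq_iff_iff]
  constructor
  · exact fun h => Or.inl h
  · rintro (h | ⟨rfl, h⟩)
    · exact h
    · exact absurd h (lt_irrefl _)

lemma leadingSign_comp_perm {n : ℕ} (d : I → ℕ) (E : Finset I) (S : Fin n → Finset I)
    (σ : Equiv.Perm (Fin n)) :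
    leadingSign d E (fun a => S (σ a)) =
      leadingSign d E S * koszulSign (fun a => setDegree d (S a)) (fun a => σ.symm a) := by
  unfold leadingSign
  rw [familySign_comp_perm, mul_assoc]
  congr 1
  exact Equiv.prod_comp σ fun a => setSign d E (S a)

/-- The `j`-th element of the block `m` belongs to the block `m`. -/
lemma index_emb {n : ℕ} (c : OrderedFinpartition n) (m : Fin c.length) (j : Fin (c.partSize m)) :
    c.index (c.emb m j) = m := by
  by_contra h
  exact c.emb_ne_emb_of_ne h (c.emb_invEmbedding (c.emb m j))

/-- The structure constants are compatible with bracketing a product along a partition. -/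
lemma leadingSign_partition {n : ℕ} (d : I → ℕ) (E : Finset I) (S : Fin n → Finset I)
    (c : OrderedFinpartition n) :
    leadingSign d E S * koszulSign (fun a => setDegree d (S a)) c.index =
      leadingSign d E (fun m => Finset.univ.biUnion fun j => S (c.emb m j)) *
        ∏ m, familySign d (fun j => S (c.emb m j)) := by
  by_cases hS : ∀ a b, a ≠ b → Disjoint (S a) (S b)
  · have hS' : ∀ m, ∀ a b, a ≠ b → Disjoint (S (c.emb m a)) (S (c.emb m b)) := fun m a b h =>
      hS _ _ fun h' => h ((c.emb_strictMono m).injective h')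
    unfold leadingSign
    rw [mul_assoc, mul_assoc, ← prod_sorted]
    congr 1
    · rw [← c.prod_sigma_eq_prod]
      exact Finset.prod_congr rfl fun m _ => (setSign_biUnion_right d E _ (hS' m)).symm
    rw [← c.prod_sigma_eq_prod]
    unfold familySign
    rw [← Finset.prod_mul_distrib]
    refine Finset.prod_congr rfl fun m _ => ?_
    have key : ∀ j : Fin (c.partSize m),
        (∏ b, if c.index (c.emb m j) < c.index b ∨ c.index (c.emb m j) = c.index b ∧ c.emb m j < b
          then setSign d (S (c.emb m j)) (S b) else 1) =
        (∏ m', if m < m' then ∏ j', setSign d (S (c.emb m j)) (S (c.emb m' j')) else 1) *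
          ∏ j', if j < j' then setSign d (S (c.emb m j)) (S (c.emb m j')) else 1 := by
      intro j
      rw [← c.prod_sigma_eq_prod]
      have : (∏ j', if j < j' then setSign d (S (c.emb m j)) (S (c.emb m j')) else 1) =
          ∏ m', ∏ j' : Fin (c.partSize m'), if m = m' ∧ c.emb m j < c.emb m' j' then
            setSign d (S (c.emb m j)) (S (c.emb m' j')) else 1 := by
        rw [Finset.prod_eq_single m]
        · refine Finset.prod_congr rfl fun j' _ => ?_
          simp [(c.emb_strictMono m).lt_iff_lt]
        · intro m' _ hm'
          simp [hm'.symm]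
        · simp
      rw [this, ← Finset.prod_mul_distrib]
      refine Finset.prod_congr rfl fun m' _ => ?_
      simp only [index_emb]
      by_cases h : m < m'
      · simp [h, h.ne]
      · simp [h]
    rw [Finset.prod_congr rfl fun j _ => key j, Finset.prod_mul_distrib, Finset.prod_comm]
    congr 1
    refine Finset.prod_congr rfl fun m' _ => ?_
    split_ifs with h
    · rw [setSign_biUnion_left d _ _ (hS' m)]
      exact Finset.prod_congr rfl fun j _ => (setSign_biUnion_right d _ _ (hS' m')).symm
    · simp
  · have h0 : leadingSign d E S = 0 := by
      by_contra h
      exact hS (leadingSign_ne_zero h).2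
    rw [h0, zero_mul, eq_comm]
    by_contra h
    have h1 := (leadingSign_ne_zero (left_ne_zero_of_mul h)).2
    have h2 := Finset.prod_ne_zero_iff.1 (right_ne_zero_of_mul h)
    refine hS fun a b hab => ?_
    obtain ⟨⟨m, j⟩, rfl⟩ := c.exists_inverse a
    obtain ⟨⟨m', j'⟩, rfl⟩ := c.exists_inverse b
    by_cases hm : m = m'
    · subst hm
      exact familySign_ne_zero (h2 m (Finset.mem_univ _)) j j' fun h => hab (by rw [h])
    · exact (h1 m m' hm).mono (Finset.subset_biUnion_of_mem (fun j => S (c.emb m j)) (Finset.mem_univ j))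
        (Finset.subset_biUnion_of_mem (fun j => S (c.emb m' j)) (Finset.mem_univ j'))

/-- A bijection of `Fin n` with the disjoint union of a subset and its complement, each of them
enumerated increasingly. -/
def sumComplEquiv {n : ℕ} (S : Finset (Fin n)) : Fin S.card ⊕ Fin Sᶜ.card ≃ Fin n :=
  (Equiv.sumCongr (S.orderIsoOfFin rfl).toEquiv
    ((Sᶜ.orderIsoOfFin rfl).toEquiv.trans (Equiv.subtypeEquivRight (by simp)))).trans
    (Equiv.sumCompl (· ∈ S))

lemma prod_subset_compl {n : ℕ} (S : Finset (Fin n)) (F : Fin n → ℝ) :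
    ∏ a, F a = (∏ j, F (S.orderEmbOfFin rfl j)) * ∏ j, F (Sᶜ.orderEmbOfFin rfl j) := by
  rw [← (sumComplEquiv S).prod_comp, Fintype.prod_sum_type]
  rfl

lemma familySign_cons (d : I → ℕ) {k : ℕ} (Q : Finset I) (S : Fin k → Finset I) :
    familySign d (Fin.cons Q S : Fin (k + 1) → Finset I) = leadingSign d Q S := by
  unfold familySign leadingSign
  rw [Fin.prod_univ_succ]
  congr 1
  · rw [Fin.prod_univ_succ]
    simp [Fin.succ_pos]
  · refine Finset.prod_congr rfl fun a _ => ?_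
    rw [Fin.prod_univ_succ]
    simp

/-- The structure constants are compatible with bracketing together a subset of the factors. -/
lemma leadingSign_subset {n : ℕ} (d : I → ℕ) (E : Finset I) (R : Fin n → Finset I)
    (S : Finset (Fin n)) :
    leadingSign d E R *
      koszulSign (fun a => setDegree d (R a)) (fun a => if a ∈ S then (0 : ℕ) else 1) =
      leadingSign d E (fun j => R (S.orderEmbOfFin rfl j)) *
        leadingSign d (E ∪ Finset.univ.biUnion fun j => R (S.orderEmbOfFin rfl j))
          (fun j => R (Sᶜ.orderEmbOfFin rfl j)) := by
  by_cases h0 : leadingSign d E (fun j => R (S.orderEmbOfFin rfl j)) = 0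
  · rw [h0, zero_mul, mul_eq_zero]
    left
    by_contra h
    obtain ⟨h1, h2⟩ := leadingSign_ne_zero h
    unfold leadingSign familySign at h0
    rw [mul_eq_zero, Finset.prod_eq_zero_iff, Finset.prod_eq_zero_iff] at h0
    have hz : ∀ A B : Finset I, Disjoint A B → setSign d A B ≠ 0 := fun A B hAB => by
      unfold setSign
      refine Finset.prod_ne_zero_iff.2 fun a ha => Finset.prod_ne_zero_iff.2 fun b hb => ?_
      have hne : a ≠ b := fun h => Finset.disjoint_left.1 hAB ha (h ▸ hb)
      unfold crossSign
      rcases lt_or_gt_of_ne hne with h | h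
      · simp [h]
      · simp [h, h.not_gt]
    rcases h0 with ⟨a, -, ha⟩ | ⟨a, -, ha⟩
    · exact hz _ _ (h1 _) ha
    · rw [Finset.prod_eq_zero_iff] at ha
      obtain ⟨b, -, hb⟩ := ha
      split_ifs at hb with hab
      · exact hz _ _ (h2 _ _ fun h' => hab.ne ((S.orderEmbOfFin rfl).injective h')) hb
      · exact one_ne_zero hb
  obtain ⟨h1, h2⟩ := leadingSign_ne_zero h0
  have hE : Disjoint E (Finset.univ.biUnion fun j => R (S.orderEmbOfFin rfl j)) :=
    (Finset.disjoint_biUnion_right _ _ _).2 fun a _ => h1 a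
  have hS : ∀ j : Fin S.card, S.orderEmbOfFin rfl j ∈ S := fun j => Finset.orderEmbOfFin_mem _ _ _
  have hSc : ∀ j : Fin Sᶜ.card, Sᶜ.orderEmbOfFin rfl j ∉ S := fun j =>
    Finset.mem_compl.1 (Finset.orderEmbOfFin_mem _ _ _)
  unfold leadingSign
  simp only [setSign_union_left d _ hE, setSign_biUnion_left d _ _ h2]
  rw [mul_assoc, ← prod_sorted, prod_subset_compl S (fun a => setSign d E (R a)),
    prod_subset_compl S (fun a => ∏ b, _)]
  simp only [prod_subset_compl S (fun b => ite _ _ _)]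
  simp only [hS, hSc, if_true, if_false, Finset.prod_mul_distrib]
  have e1 : ∀ j j' : Fin S.card, (S.orderEmbOfFin rfl j < S.orderEmbOfFin rfl j') = (j < j') :=
    fun j j' => propext (OrderEmbedding.lt_iff_lt _)
  have e2 : ∀ j j' : Fin Sᶜ.card, (Sᶜ.orderEmbOfFin rfl j < Sᶜ.orderEmbOfFin rfl j') = (j < j') :=
    fun j j' => propext (OrderEmbedding.lt_iff_lt _)
  simp only [e1, e2]
  unfold familySign
  simp only [lt_self_iff_false, true_and, false_or, zero_lt_one, true_or, if_true,
    Nat.not_lt_zero, one_ne_zero, false_and, or_self, if_false, Finset.prod_const_one, one_mul]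
  rw [Finset.prod_comm (s := (Finset.univ : Finset (Fin S.card)))
    (t := (Finset.univ : Finset (Fin Sᶜ.card)))]
  ring

end Signs

/-! ### The Grassmann envelope of graded operations -/

section Envelope

variable {I : Type*} [LinearOrder I]
variable {A B C : Type*} [AddCommGroup A] [Module ℝ A] [AddCommGroup B] [Module ℝ B]
  [AddCommGroup C] [Module ℝ C]

lemma biUnion_partition {n : ℕ} (c : OrderedFinpartition n) (R : Fin n → Finset I) :
    (Finset.univ.biUnion fun m => Finset.univ.biUnion fun j => R (c.emb m j)) =
      Finset.univ.biUnion R := by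
  ext i
  simp only [Finset.mem_biUnion, Finset.mem_univ, true_and]
  constructor
  · rintro ⟨m, j, h⟩
    exact ⟨_, h⟩
  · rintro ⟨a, h⟩
    exact ⟨c.index a, c.invEmbedding a, by simpa using h⟩

lemma biUnion_subset_compl {n : ℕ} (R : Fin n → Finset I) (S : Finset (Fin n)) :
    (Finset.univ.biUnion fun j => R (S.orderEmbOfFin rfl j)) ∪
      (Finset.univ.biUnion fun j => R (Sᶜ.orderEmbOfFin rfl j)) = Finset.univ.biUnion R := by
  ext i
  simp only [Finset.mem_union, Finset.mem_biUnion, Finset.mem_univ, true_and]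
  constructor
  · rintro (⟨j, h⟩ | ⟨j, h⟩) <;> exact ⟨_, h⟩
  · rintro ⟨a, h⟩
    obtain ⟨j | j, rfl⟩ := (sumComplEquiv S).surjective a
    · exact Or.inl ⟨j, h⟩
    · exact Or.inr ⟨j, h⟩

lemma biUnion_cons {k : ℕ} (Q : Finset I) (P : Fin k → Finset I) :
    Finset.univ.biUnion (Fin.cons Q P : Fin (k + 1) → Finset I) = Q ∪ Finset.univ.biUnion P := by
  ext i
  simp [Fin.exists_fin_succ]

variable [Fintype I]

/-- A family `X : Finset I → A` stands for the element `∑ S, θ_S ⊗ X S` with Grassmann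
coefficients.  This is the coefficient of `θ_U` in the value at `X 0, …, X (n-1)` of `θ_E` times
the operation `F`, extended linearly over the Grassmann coefficients. -/
def envOp (d : I → ℕ) (E : Finset I) {n : ℕ} (F : (Fin n → ℕ) → (Fin n → A) → B)
    (X : Fin n → Finset I → A) (U : Finset I) : B :=
  ∑ R : Fin n → Finset I, (if E ∪ Finset.univ.biUnion R = U then leadingSign d E R else 0) •
    F (fun a => setDegree d (R a)) (fun a => X a (R a))

/-- The envelope of `ψ • φ` is given by the Faà di Bruno formula. -/
lemma envOp_bullet (d : I → ℕ) (E : Finset I) (psi : Operations B C) (phi : Operations A B)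
    {n : ℕ} (X : Fin n → Finset I → A) (U : Finset I) :
    envOp d E (fun d x => bullet psi phi d x) X U =
      ∑ c : OrderedFinpartition n, envOp d E (fun _ => psi c.length)
        (fun m => envOp d ∅ (fun _ => phi (c.partSize m)) (fun j => X (c.emb m j))) U := by
  unfold envOp bullet
  simp only [Finset.smul_sum]
  rw [Finset.sum_comm]
  refine Finset.sum_congr rfl fun c _ => ?_
  simp only [MultilinearMap.map_sum, MultilinearMap.map_smul_univ, Finset.smul_sum, smul_smul,
    leadingSign_empty, Finset.empty_union]
  rw [Finset.sum_comm]
  have hsum : ∀ P : (m : Fin c.length) → Fin (c.partSize m) → Finset I,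
      (∑ Q : Fin c.length → Finset I,
        ((if E ∪ Finset.univ.biUnion Q = U then leadingSign d E Q else 0) *
          ∏ m, if Finset.univ.biUnion (P m) = Q m then familySign d (P m) else 0) •
          psi c.length fun m => phi (c.partSize m) fun j => X (c.emb m j) (P m j)) =
      ((if E ∪ Finset.univ.biUnion (fun m => Finset.univ.biUnion (P m)) = U then
        leadingSign d E (fun m => Finset.univ.biUnion (P m)) else 0) *
          ∏ m, familySign d (P m)) •
          psi c.length fun m => phi (c.partSize m) fun j => X (c.emb m j) (P m j) := by
    intro P
    rw [Finset.sum_eq_single (fun m => Finset.univ.biUnion (P m))]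
    · simp
    · intro Q _ hQ
      obtain ⟨m, hm⟩ := Function.ne_iff.1 hQ
      rw [Finset.prod_eq_zero (Finset.mem_univ m) (if_neg (Ne.symm hm)), mul_zero, zero_smul]
    · simp
  rw [Finset.sum_congr rfl fun P _ => hsum P]
  refine Fintype.sum_equiv ((c.equivSigma.arrowCongr (Equiv.refl _)).symm.trans
    (Equiv.piCurry fun _ _ => Finset I)) _ _ fun R => ?_
  have hR : ((c.equivSigma.arrowCongr (Equiv.refl _)).symm.trans
    (Equiv.piCurry fun _ _ => Finset I)) R = fun m j => R (c.emb m j) := rfl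
  rw [hR, biUnion_partition]
  congr 1
  split_ifs
  · exact leadingSign_partition d E R c
  · simp

/-- The envelope of `φ ∘ λ` is given by the Leibniz formula for the derivative of the function `φ`
along the vector field `λ`. -/
lemma envOp_insertOp (d : I → ℕ) (E : Finset I) (phi : Operations A B) (lam : Operations A A)
    {n : ℕ} (X : Fin n → Finset I → A) (U : Finset I) :
    envOp d E (fun d x => insertOp phi lam d x) X U =
      ∑ S : Finset (Fin n), envOp d ∅ (fun _ => phi (Sᶜ.card + 1))
        (Fin.cons (envOp d E (fun _ => lam S.card) (fun j => X (S.orderEmbOfFin rfl j)))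
          (fun j => X (Sᶜ.orderEmbOfFin rfl j))) U := by
  unfold envOp insertOp
  simp only [Finset.smul_sum]
  rw [Finset.sum_comm]
  refine Finset.sum_congr rfl fun S _ => ?_
  simp only [leadingSign_empty, Finset.empty_union]
  symm
  rw [← (Fin.consEquiv fun _ => Finset I).sum_comp, Fintype.sum_prod_type]
  have hc : ∀ (Q : Finset I) (P : Fin Sᶜ.card → Finset I),
      (Fin.consEquiv fun _ => Finset I) (Q, P) = Fin.cons Q P := fun _ _ => rfl
  simp only [hc, familySign_cons, biUnion_cons]
  have e : ∀ (Q : Finset I) (P : Fin Sᶜ.card → Finset I),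
      (fun a => (Fin.cons (fun U => ∑ R : Fin S.card → Finset I,
          (if E ∪ Finset.univ.biUnion R = U then leadingSign d E R else 0) •
            lam S.card fun a => X (S.orderEmbOfFin rfl a) (R a))
          (fun j => X (Sᶜ.orderEmbOfFin rfl j)) : Fin (Sᶜ.card + 1) → Finset I → A) a
          ((Fin.cons Q P : Fin (Sᶜ.card + 1) → Finset I) a)) =
      Fin.cons (∑ R : Fin S.card → Finset I,
          (if E ∪ Finset.univ.biUnion R = Q then leadingSign d E R else 0) •
            lam S.card fun a => X (S.orderEmbOfFin rfl a) (R a))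
        fun j => X (Sᶜ.orderEmbOfFin rfl j) (P j) := by
    intro Q P
    funext a
    refine Fin.cases ?_ (fun a => ?_) a <;> simp
  simp only [e]
  have hlin : ∀ (P : Fin Sᶜ.card → A) (w : (Fin S.card → Finset I) → ℝ)
      (v : (Fin S.card → Finset I) → A),
      phi (Sᶜ.card + 1) (Fin.cons (∑ R, w R • v R) P) =
        ∑ R, w R • phi (Sᶜ.card + 1) (Fin.cons (v R) P) := by
    intro P w v
    let L := (phi (Sᶜ.card + 1)).toLinearMap (Fin.cons 0 P) 0
    have hL : ∀ z, phi (Sᶜ.card + 1) (Fin.cons z P) = L z := fun z => by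
      simp [L, Fin.update_cons_zero]
    simp only [hL, map_sum, map_smul]
  simp only [hlin, Finset.smul_sum, smul_smul]
  rw [Finset.sum_comm]
  have hQ : ∀ (P : Fin Sᶜ.card → Finset I),
      (∑ Q : Finset I, ∑ R : Fin S.card → Finset I,
        ((if Q ∪ Finset.univ.biUnion P = U then leadingSign d Q P else 0) *
          if E ∪ Finset.univ.biUnion R = Q then leadingSign d E R else 0) •
          phi (Sᶜ.card + 1) (Fin.cons (lam S.card fun a => X (S.orderEmbOfFin rfl a) (R a))
            fun j => X (Sᶜ.orderEmbOfFin rfl j) (P j))) =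
      ∑ R : Fin S.card → Finset I,
        ((if E ∪ Finset.univ.biUnion R ∪ Finset.univ.biUnion P = U then
          leadingSign d (E ∪ Finset.univ.biUnion R) P else 0) * leadingSign d E R) •
          phi (Sᶜ.card + 1) (Fin.cons (lam S.card fun a => X (S.orderEmbOfFin rfl a) (R a))
            fun j => X (Sᶜ.orderEmbOfFin rfl j) (P j)) := by
    intro P
    rw [Finset.sum_comm]
    refine Finset.sum_congr rfl fun R _ => ?_
    rw [Finset.sum_eq_single (E ∪ Finset.univ.biUnion R)]
    · simp
    · intro Q _ hQ
      rw [if_neg (Ne.symm hQ), mul_zero, zero_smul]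
    · simp
  rw [Finset.sum_congr rfl fun P _ => hQ P, Finset.sum_comm, ← Fintype.sum_prod_type']
  refine Fintype.sum_equiv ((Equiv.sumArrowEquivProdArrow _ _ _).symm.trans
    ((sumComplEquiv S).arrowCongr (Equiv.refl _))) _ _ fun RP => ?_
  obtain ⟨R', rfl⟩ : ∃ R', RP = ((Equiv.sumArrowEquivProdArrow _ _ _).symm.trans
    ((sumComplEquiv S).arrowCongr (Equiv.refl _))).symm R' := ⟨_, (Equiv.symm_apply_apply _ _).symm⟩
  rw [Equiv.apply_symm_apply]
  have h1 : (((Equiv.sumArrowEquivProdArrow _ _ _).symm.trans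
    ((sumComplEquiv S).arrowCongr (Equiv.refl _))).symm R').1 =
    fun j => R' (S.orderEmbOfFin rfl j) := rfl
  have h2 : (((Equiv.sumArrowEquivProdArrow _ _ _).symm.trans
    ((sumComplEquiv S).arrowCongr (Equiv.refl _))).symm R').2 =
    fun j => R' (Sᶜ.orderEmbOfFin rfl j) := rfl
  rw [h1, h2, Finset.union_assoc, biUnion_subset_compl]
  congr 1
  split_ifs
  · rw [leadingSign_subset, mul_comm]
  · simp

end Envelope

/-- Operations in the weak sense of families of functions that depend on the degrees of their
arguments can be recovered from their envelopes. -/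
lemma envOp_single {A B : Type*} [AddCommGroup A] [Module ℝ A] [AddCommGroup B] [Module ℝ B]
    {n : ℕ} (d : Fin n → ℕ) (F : (Fin n → ℕ) → (Fin n → A) → B)
    (hF : ∀ d x j, x j = 0 → F d x = 0) (x : Fin n → A) :
    envOp (Fin.cons 1 d : Fin (n + 1) → ℕ) {0} F
      (fun j => Pi.single {j.succ} (x j)) Finset.univ = F d x := by
  unfold envOp
  rw [Finset.sum_eq_single (fun j => {j.succ})]
  · have hU : ({0} : Finset (Fin (n + 1))) ∪ Finset.univ.biUnion (fun j : Fin n => {j.succ}) =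
        Finset.univ := by
      ext i
      refine Fin.cases ?_ (fun i => ?_) i <;> simp
    have hs : leadingSign (Fin.cons 1 d : Fin (n + 1) → ℕ) {0} (fun j : Fin n => {j.succ}) = 1 := by
      unfold leadingSign familySign setSign crossSign
      simp only [Finset.prod_singleton, Fin.succ_pos, if_true, Finset.prod_const_one, one_mul]
      refine Finset.prod_eq_one fun a _ => Finset.prod_eq_one fun b _ => ?_
      split_ifs with h h' <;> first | rfl | (simp at h'; omega)
    rw [if_pos hU, hs, one_smul]
    simp [setDegree]
  · intro R _ hR
    obtain ⟨j, hj⟩ := Function.ne_iff.1 hR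
    rw [hF _ _ j (Pi.single_eq_of_ne hj _), smul_zero]
  · simp

/-! ### Taylor coefficients of polynomial maps -/

section Jets

variable {E F G : Type*} [NormedAddCommGroup E] [NormedSpace ℝ E] [NormedAddCommGroup F]
  [NormedSpace ℝ F] [NormedAddCommGroup G] [NormedSpace ℝ G]

/-- The iterated directional derivative along a list of vectors. -/
def listDeriv : List E → (E → F) → E → F
  | [], u => u
  | a :: l, u => fun x => fderiv ℝ (listDeriv l u) x a

lemma contDiff_listDeriv (l : List E) {u : E → F} (hu : ContDiff ℝ ∞ u) :
    ContDiff ℝ ∞ (listDeriv l u) := by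
  induction l with
  | nil => exact hu
  | cons a l ih => exact (ih.fderiv_right (m := ∞) (by simp)).clm_apply contDiff_const

lemma iteratedFDeriv_eq_listDeriv {u : E → F} (hu : ContDiff ℝ ∞ u) (n : ℕ) (h : Fin n → E)
    (x : E) : iteratedFDeriv ℝ n u x h = listDeriv (List.ofFn h) u x := by
  induction n generalizing x with
  | zero => simp [listDeriv]
  | succ n ih =>
    rw [iteratedFDeriv_succ_apply_left, List.ofFn_succ]
    have hd : DifferentiableAt ℝ (iteratedFDeriv ℝ n u) x :=
      (hu.differentiable_iteratedFDeriv (m := n) (by exact_mod_cast WithTop.coe_lt_top _)) x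
    have : listDeriv (List.ofFn fun i : Fin n => h i.succ) u =
        fun x => iteratedFDeriv ℝ n u x (fun i => h i.succ) := by
      funext y
      exact (ih _ y).symm
    simp only [listDeriv]
    rw [this, fderiv_continuousMultilinear_apply_const_apply hd]
    rfl

/-- The Leibniz rule for the pairing of two functions. -/
lemma listDeriv_clm_apply {ι : Type*} [LinearOrder ι] {u : E → F →L[ℝ] G} {v : E → F}
    (hu : ContDiff ℝ ∞ u) (hv : ContDiff ℝ ∞ v) (h : ι → E) (T : Finset ι) :
    listDeriv ((T.sort (· ≤ ·)).map h) (fun x => u x (v x)) = fun x =>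
      ∑ S ∈ T.powerset, listDeriv (((T \ S).sort (· ≤ ·)).map h) u x
        (listDeriv ((S.sort (· ≤ ·)).map h) v x) := by
  induction T using Finset.induction_on_min with
  | empty => simp [listDeriv]
  | insert a s ha ih =>
    have has : a ∉ s := fun h => lt_irrefl _ (ha a h)
    have hsort : ∀ t : Finset ι, t ⊆ s → (insert a t).sort (· ≤ ·) = a :: t.sort (· ≤ ·) := fun t ht =>
      Finset.sort_insert _ (fun b hb => (ha b (Finset.mem_of_subset ht hb)).le)
        (fun h => has (Finset.mem_of_subset ht h))
    funext x
    rw [hsort s subset_rfl, Finset.sum_powerset_insert has, List.map_cons]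
    simp only [listDeriv]
    rw [ih, fderiv_fun_sum]
    · rw [sum_apply, ← Finset.sum_add_distrib]
      refine Finset.sum_congr rfl fun t ht => ?_
      have ht' := Finset.mem_powerset.1 ht
      have h1 : insert a s \ t = insert a (s \ t) :=
        Finset.insert_sdiff_of_notMem _ fun h => has (ht' h)
      have h2 : insert a s \ insert a t = s \ t := by
        rw [Finset.insert_sdiff_insert, Finset.sdiff_insert_of_notMem has]
      rw [h1, h2, hsort t ht', hsort (s \ t) Finset.sdiff_subset, List.map_cons, List.map_cons,
        fderiv_clm_apply ((contDiff_listDeriv _ hu).differentiable (by simp) x)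
          ((contDiff_listDeriv _ hv).differentiable (by simp) x)]
      simp [listDeriv, add_comm]
    · exact fun t _ => ((contDiff_listDeriv _ hu).differentiable (by simp) x).clm_apply
        ((contDiff_listDeriv _ hv).differentiable (by simp) x)

/-- Listing `h` along the increasing enumeration of `S`. -/
lemma ofFn_orderEmbOfFin {ι α : Type*} [LinearOrder ι] (S : Finset ι) (h : ι → α) :
    List.ofFn (fun j => h (S.orderEmbOfFin rfl j)) = (S.sort (· ≤ ·)).map h := by
  apply List.ext_getElem
  · simp
  · intro i h1 h2
    simp [Finset.orderEmbOfFin_apply]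

/-- The Leibniz rule for `x ↦ u x (v x)`: the directions are distributed over the two factors in all
possible ways. -/
lemma iteratedFDeriv_pairing {u : E → F →L[ℝ] G} {v : E → F}
    (hu : ContDiff ℝ ∞ u) (hv : ContDiff ℝ ∞ v) (n : ℕ) (h : Fin n → E) (x : E) :
    iteratedFDeriv ℝ n (fun x => u x (v x)) x h = ∑ S : Finset (Fin n),
      iteratedFDeriv ℝ Sᶜ.card u x (fun j => h (Sᶜ.orderEmbOfFin rfl j))
        (iteratedFDeriv ℝ S.card v x (fun j => h (S.orderEmbOfFin rfl j))) := by
  have huv : ContDiff ℝ ∞ fun x => u x (v x) := hu.clm_apply hv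
  have h0 : List.ofFn h = ((Finset.univ : Finset (Fin n)).sort (· ≤ ·)).map h := by
    rw [Fin.sort_univ, List.ofFn_eq_map]
  rw [iteratedFDeriv_eq_listDeriv huv, h0, listDeriv_clm_apply hu hv]
  simp only [Finset.powerset_univ]
  refine Finset.sum_congr rfl fun S _ => ?_
  rw [iteratedFDeriv_eq_listDeriv hu, iteratedFDeriv_eq_listDeriv hv, ofFn_orderEmbOfFin,
    ofFn_orderEmbOfFin, Finset.compl_eq_univ_sdiff]

/-- Two functions have the same Taylor coefficients at the origin. -/
def JetEq (f g : E → F) : Prop := ∀ n, iteratedFDeriv ℝ n f 0 = iteratedFDeriv ℝ n g 0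

/-- The Taylor coefficients of a composition depend only on those of the factors, by the Faà di
Bruno formula. -/
lemma JetEq.comp {f f' : E → F} {g g' : F → G} (h : JetEq f f') (h' : JetEq g g') (h0 : f 0 = 0)
    (hf : ContDiff ℝ ∞ f) (hf' : ContDiff ℝ ∞ f') (hg : ContDiff ℝ ∞ g) (hg' : ContDiff ℝ ∞ g') :
    JetEq (g ∘ f) (g' ∘ f') := by
  intro n
  have h0' : f' 0 = 0 := by
    have := congrArg (fun m => m fun j => j.elim0) (h 0)
    simpa [h0] using this.symm
  rw [iteratedFDeriv_comp (n := ∞) hg.contDiffAt hf.contDiffAt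
      (by exact_mod_cast (WithTop.coe_lt_top _).le),
    iteratedFDeriv_comp (n := ∞) hg'.contDiffAt hf'.contDiffAt
      (by exact_mod_cast (WithTop.coe_lt_top _).le)]
  have e1 : ftaylorSeries ℝ f 0 = ftaylorSeries ℝ f' 0 := funext h
  have e2 : ftaylorSeries ℝ g 0 = ftaylorSeries ℝ g' 0 := funext h'
  rw [h0, h0', e1, e2]

lemma JetEq.pairing {u u' : E → F →L[ℝ] G} {v v' : E → F} (h : JetEq u u') (h' : JetEq v v')
    (hu : ContDiff ℝ ∞ u) (hu' : ContDiff ℝ ∞ u') (hv : ContDiff ℝ ∞ v) (hv' : ContDiff ℝ ∞ v') :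
    JetEq (fun x => u x (v x)) (fun x => u' x (v' x)) := by
  intro n
  ext m
  simp only [iteratedFDeriv_pairing hu hv, iteratedFDeriv_pairing hu' hv', h _, h' _]

lemma JetEq.fderiv {f f' : E → F} (h : JetEq f f') : JetEq (fderiv ℝ f) (fderiv ℝ f') := by
  intro n
  ext m y
  have h1 := iteratedFDeriv_succ_apply_right (𝕜 := ℝ) (f := f) (x := 0)
    (Fin.snoc m y : Fin (n + 1) → E)
  have h2 := iteratedFDeriv_succ_apply_right (𝕜 := ℝ) (f := f') (x := 0)
    (Fin.snoc m y : Fin (n + 1) → E)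
  rw [h (n + 1), h2] at h1
  simpa using h1.symm

/-- In finite dimension multilinear maps are continuous. -/
lemma MultilinearMap.continuous_of_finiteDimensional [FiniteDimensional ℝ E] {n : ℕ}
    (f : MultilinearMap ℝ (fun _ : Fin n => E) F) : Continuous f := by
  let b := Module.finBasis ℝ E
  have : ⇑f = fun x => ∑ r : Fin n → Fin (Module.finrank ℝ E),
      (∏ i, b.repr (x i) (r i)) • f fun i => b (r i) := by
    funext x
    conv_lhs => rw [show x = fun i => ∑ j, b.repr (x i) j • b j from
      funext fun i => (b.sum_repr (x i)).symm]
    rw [MultilinearMap.map_sum]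
    exact Finset.sum_congr rfl fun r _ => f.map_smul_univ _ _
  rw [this]
  refine continuous_finsetSum _ fun r _ => Continuous.smul ?_ continuous_const
  refine continuous_finsetProd _ fun i _ => ?_
  exact (LinearMap.continuous_of_finiteDimensional (b.coord (r i))).comp (continuous_apply i)

variable [FiniteDimensional ℝ E]

/-- The power series `∑ T_k (x, …, x) / k!`. -/
def taylorSeries (T : ∀ k : ℕ, MultilinearMap ℝ (fun _ : Fin k => E) F) :
    FormalMultilinearSeries ℝ E F :=
  fun k => ((k.factorial : ℝ)⁻¹) • ⟨T k, MultilinearMap.continuous_of_finiteDimensional (T k)⟩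

/-- The function `∑ T_k (x, …, x) / k!`. -/
def polyMap (T : ∀ k : ℕ, MultilinearMap ℝ (fun _ : Fin k => E) F) : E → F := (taylorSeries T).sum

/-- If `T k` vanishes for `k ≥ N`, the series is a polynomial and converges everywhere. -/
lemma hasPowerSeries_polyMap {T : ∀ k : ℕ, MultilinearMap ℝ (fun _ : Fin k => E) F} {N : ℕ}
    (hN : ∀ k, N ≤ k → T k = 0) :
    HasFiniteFPowerSeriesOnBall (polyMap T) (taylorSeries T) 0 N ⊤ := by
  refine (taylorSeries T).hasFiniteFPowerSeriesOnBall_of_finite fun k hk => ?_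
  ext x
  simp only [taylorSeries, hN k hk]
  exact smul_zero _

lemma contDiff_polyMap {T : ∀ k : ℕ, MultilinearMap ℝ (fun _ : Fin k => E) F} {N : ℕ}
    (hN : ∀ k, N ≤ k → T k = 0) : ContDiff ℝ ω (polyMap T) := by
  have := (hasPowerSeries_polyMap hN).cpolynomialOn
  exact contDiff_iff_contDiffAt.2 fun x => CPolynomialAt.contDiffAt (this x (by simp))

lemma iteratedFDeriv_polyMap {T : ∀ k : ℕ, MultilinearMap ℝ (fun _ : Fin k => E) F} {N : ℕ}
    (hN : ∀ k, N ≤ k → T k = 0)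
    (hsymm : ∀ k (x : Fin k → E) (σ : Equiv.Perm (Fin k)), T k (fun j => x (σ j)) = T k x)
    (k : ℕ) (x : Fin k → E) : iteratedFDeriv ℝ k (polyMap T) 0 x = T k x := by
  have h1 := (hasPowerSeries_polyMap hN).toHasFPowerSeriesOnBall
  have h2 : AnalyticOn ℝ (polyMap T) univ := (contDiff_polyMap hN).contDiffOn.analyticOn
  rw [h1.iteratedFDeriv_eq_sum h2]
  have : ∀ σ : Equiv.Perm (Fin k), taylorSeries T k (fun i => x (σ i)) =
      ((k.factorial : ℝ)⁻¹) • T k x := fun σ => by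
    rw [← hsymm k x σ]; rfl
  simp only [this, Finset.sum_const, Finset.card_univ, Fintype.card_perm, Fintype.card_fin]
  rw [← Nat.cast_smul_eq_nsmul ℝ, smul_smul, mul_inv_cancel₀ (by positivity), one_smul]

end Jets

/-! ### Composition of morphisms of curved `L∞[1]`-algebras -/

section BulletBasics

variable {A B C : Type*} [AddCommGroup A] [Module ℝ A] [AddCommGroup B] [Module ℝ B]
  [AddCommGroup C] [Module ℝ C]

lemma bullet_eq_zero (psi : Operations B C) (phi : Operations A B) {n : ℕ} (d : Fin n → ℕ)
    (x : Fin n → A) (j : Fin n) (hj : x j = 0) : bullet psi phi d x = 0 := by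
  unfold bullet
  refine Finset.sum_eq_zero fun c _ => ?_
  rw [(psi c.length).map_coord_zero (c.index j), smul_zero]
  exact (phi _).map_coord_zero (c.invEmbedding j) (by simpa using hj)

lemma insertOp_eq_zero (phi : Operations A B) (lam : Operations A A) {n : ℕ} (d : Fin n → ℕ)
    (x : Fin n → A) (j : Fin n) (hj : x j = 0) : insertOp phi lam d x = 0 := by
  unfold insertOp
  refine Finset.sum_eq_zero fun S _ => ?_
  obtain ⟨i | i, rfl⟩ := (sumComplEquiv S).surjective j
  · rw [(phi _).map_coord_zero 0, smul_zero]
    rw [Fin.cons_zero]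
    exact (lam _).map_coord_zero i hj
  · rw [(phi _).map_coord_zero i.succ, smul_zero]
    rw [Fin.cons_succ]
    exact hj

lemma bullet_zero (psi : Operations B C) (phi : Operations A B) (d : Fin 0 → ℕ) (x : Fin 0 → A) :
    bullet psi phi d x = psi 0 (fun j => j.elim0) := by
  unfold bullet
  rw [Fintype.sum_unique]
  have : koszulSign d (default : OrderedFinpartition 0).index = 1 := by simp [koszulSign]
  rw [this, one_smul, OrderedFinpartition.default_eq]
  change psi 0 _ = _
  congr 1
  funext j
  exact j.elim0

lemma bullet_degree {G' : ℕ → Submodule ℝ B} {G'' : ℕ → Submodule ℝ C} {G : ℕ → Submodule ℝ A}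
    {psi : Operations B C} {phi : Operations A B} (e : ℕ)
    (hpsi : ∀ (k : ℕ) (d : Fin k → ℕ) (x : Fin k → B), (∀ j, x j ∈ G' (d j)) →
      psi k x ∈ G'' ((∑ j, d j) + e))
    (hphi : ∀ (k : ℕ) (d : Fin k → ℕ) (x : Fin k → A), (∀ j, x j ∈ G (d j)) →
      phi k x ∈ G' (∑ j, d j)) {n : ℕ} (d : Fin n → ℕ) (x : Fin n → A)
    (hx : ∀ j, x j ∈ G (d j)) : bullet psi phi d x ∈ G'' ((∑ j, d j) + e) := by
  unfold bullet
  refine Submodule.sum_mem _ fun c _ => Submodule.smul_mem _ _ ?_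
  rw [← c.sum_sigma_eq_sum]
  exact hpsi _ _ _ fun m => hphi _ _ _ fun j => hx _

end BulletBasics

section Env

variable {A B C : Type*} [NormedAddCommGroup A] [NormedSpace ℝ A] [NormedAddCommGroup B]
  [NormedSpace ℝ B] [NormedAddCommGroup C] [NormedSpace ℝ C]
  {I : Type*} [LinearOrder I] [Fintype I]

/-- The elements `∑ S, θ_S ⊗ X S` of total degree zero, where `θ_S` has degree `-d_S`. -/
abbrev Env (G : ℕ → Submodule ℝ A) (d : I → ℕ) := ∀ S : Finset I, ↥(G (setDegree d S))

/-- Operations of degree `e` map `(G, …, G)` to `G'`. -/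
def HasDegree (G : ℕ → Submodule ℝ A) (G' : ℕ → Submodule ℝ B) (e : ℕ) (phi : Operations A B) :
    Prop :=
  ∀ (k : ℕ) (d : Fin k → ℕ) (x : Fin k → A), (∀ j, x j ∈ G (d j)) → phi k x ∈ G' ((∑ j, d j) + e)

variable {G : ℕ → Submodule ℝ A} {G' : ℕ → Submodule ℝ B} {G'' : ℕ → Submodule ℝ C}

lemma envOp_mem {F : ∀ n, (Fin n → ℕ) → (Fin n → A) → B} {d : I → ℕ} {E : Finset I}
    (hF : ∀ (k : ℕ) (d' : Fin k → ℕ) (x : Fin k → A), (∀ j, x j ∈ G (d' j)) →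
      F k d' x ∈ G' ((∑ j, d' j) + setDegree d E))
    {k : ℕ} (X : Fin k → Env G d) (U : Finset I) :
    envOp d E (F k) (fun m S => (X m S : A)) U ∈ G' (setDegree d U) := by
  refine Submodule.sum_mem _ fun R _ => ?_
  split_ifs with hU
  · by_cases h : leadingSign d E R = 0
    · simp [h]
    · rw [← hU, setDegree_of_leadingSign_ne_zero h]
      exact Submodule.smul_mem _ _ (hF _ _ _ fun j => (X j (R j)).2)
  · simp

/-- The multilinear map that operations of degree `d_E` induce, after multiplication by `θ_E`, on
elements with Grassmann coefficients. -/
def envMap (d : I → ℕ) (E : Finset I) (phi : Operations A B)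
    (h : HasDegree G G' (setDegree d E) phi) (k : ℕ) :
    MultilinearMap ℝ (fun _ : Fin k => Env G d) (Env G' d) :=
  MultilinearMap.pi fun U => MultilinearMap.codRestrict
    (∑ R : Fin k → Finset I, (if E ∪ Finset.univ.biUnion R = U then leadingSign d E R else 0) •
      (phi k).compLinearMap fun m => (G (setDegree d (R m))).subtype ∘ₗ LinearMap.proj (R m))
    (G' (setDegree d U)) fun X => by
      have := envOp_mem (F := fun n _ => phi n) (G' := G') h X U
      convert this using 1
      simp only [envOp, sum_apply, smul_apply, MultilinearMap.compLinearMap_apply]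
      rfl

lemma envMap_apply {d : I → ℕ} {E : Finset I} {phi : Operations A B}
    (h : HasDegree G G' (setDegree d E) phi) {k : ℕ} (X : Fin k → Env G d) (U : Finset I) :
    (envMap d E phi h k X U : B) = envOp d E (fun _ => phi k) (fun m S => (X m S : A)) U := by
  change (∑ R : Fin k → Finset I, _ • (phi k).compLinearMap _ :
    MultilinearMap ℝ (fun _ : Fin k => Env G d) B) X = _
  simp only [envOp, sum_apply, smul_apply, MultilinearMap.compLinearMap_apply]
  rfl

/-- With Grassmann coefficients graded symmetry becomes symmetry. -/
lemma envMap_symm {d : I → ℕ} {E : Finset I} {phi : Operations A B}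
    (h : HasDegree G G' (setDegree d E) phi) (hs : IsGradedSymmetric G phi) (k : ℕ)
    (X : Fin k → Env G d) (σ : Equiv.Perm (Fin k)) :
    envMap d E phi h k (fun j => X (σ j)) = envMap d E phi h k X := by
  funext U
  apply Subtype.ext
  rw [envMap_apply, envMap_apply]
  unfold envOp
  refine (Fintype.sum_equiv (σ.arrowCongr (Equiv.refl _)).symm _ _ fun R => ?_).symm
  have hR : (σ.arrowCongr (Equiv.refl (Finset I))).symm R = fun a => R (σ a) := rfl
  have hb : Finset.univ.biUnion (fun a => R (σ a)) = Finset.univ.biUnion R := by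
    ext i
    simp only [Finset.mem_biUnion, Finset.mem_univ, true_and]
    exact σ.exists_congr_left.trans (by simp)
  beta_reduce
  rw [hR, hb, leadingSign_comp_perm,
    hs k (fun a => setDegree d (R a)) (fun a => (X a (R a) : A)) (fun j => (X j (R j)).2) σ, smul_smul]
  congr 1
  split_ifs
  · rw [mul_assoc, koszulSign_mul_self, mul_one]
  · simp

/-- All vectors have positive degree, so every argument contributes a nonempty product of the `θ_i`,
and the product of more such factors than there are generators is zero. -/
lemma envMap_eq_zero {d : I → ℕ} {E : Finset I} {phi : Operations A B}
    (h : HasDegree G G' (setDegree d E) phi) (h0 : G 0 = ⊥) (k : ℕ)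
    (hk : Fintype.card I + 1 ≤ k) : envMap d E phi h k = 0 := by
  refine MultilinearMap.ext fun X => funext fun U => Subtype.ext ?_
  rw [envMap_apply]
  refine Finset.sum_eq_zero fun R _ => ?_
  beta_reduce
  by_cases hR : leadingSign d E R = 0
  · simp [hR]
  · obtain ⟨a, ha⟩ : ∃ a, R a = ∅ := by
      by_contra hne
      push Not at hne
      choose r hr using fun a => hne a
      have hinj : Function.Injective r := fun a b hab => by
        by_contra hne
        exact Finset.disjoint_left.1 ((leadingSign_ne_zero hR).2 a b hne) (hr a) (hab ▸ hr b)
      have := Fintype.card_le_of_injective r hinj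
      simp only [Fintype.card_fin] at this
      omega
    rw [(phi k).map_coord_zero a, smul_zero]
    have h1 := (X a (R a)).2
    have h2 : setDegree d (R a) = 0 := by simp [ha]
    have h3 : G (setDegree d (R a)) = ⊥ := by rw [h2, h0]
    exact (Submodule.mem_bot ℝ).1 (h3.le h1)

variable [FiniteDimensional ℝ A]

lemma iteratedFDeriv_envMap {d : I → ℕ} {E : Finset I} {phi : Operations A B}
    (h : HasDegree G G' (setDegree d E) phi) (hs : IsGradedSymmetric G phi) (h0 : G 0 = ⊥) (k : ℕ)
    (X : Fin k → Env G d) :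
    iteratedFDeriv ℝ k (polyMap (envMap d E phi h)) 0 X = envMap d E phi h k X :=
  iteratedFDeriv_polyMap (envMap_eq_zero h h0) (envMap_symm h hs) k X

lemma contDiff_envMap {d : I → ℕ} {E : Finset I} {phi : Operations A B}
    (h : HasDegree G G' (setDegree d E) phi) (h0 : G 0 = ⊥) :
    ContDiff ℝ ω (polyMap (envMap d E phi h)) :=
  contDiff_polyMap (envMap_eq_zero h h0)

lemma polyMap_envMap_zero {d : I → ℕ} {phi : Operations A B} {E : Finset I}
    (h : HasDegree G G' (setDegree d E) phi) (h0 : G 0 = ⊥) (hphi : phi 0 = 0)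
    (hs : IsGradedSymmetric G phi) :
    polyMap (envMap d E phi h) 0 = 0 := by
  have := iteratedFDeriv_envMap h hs h0 0 (fun j => j.elim0)
  rw [iteratedFDeriv_zero_apply] at this
  rw [this]
  funext U
  apply Subtype.ext
  rw [envMap_apply]
  simp [envOp, hphi]

/-- The Taylor coefficients of a composition are given by `ψ • φ`. -/
lemma iteratedFDeriv_envMap_comp [FiniteDimensional ℝ B] {d : I → ℕ} {E : Finset I}
    {phi : Operations A B} {psi : Operations B C}
    (h : HasDegree G G' (setDegree d ∅) phi) (hs : IsGradedSymmetric G phi) (h0 : G 0 = ⊥)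
    (hphi : phi 0 = 0)
    (h' : HasDegree G' G'' (setDegree d E) psi) (hs' : IsGradedSymmetric G' psi) (h0' : G' 0 = ⊥)
    (n : ℕ) (X : Fin n → Env G d) (U : Finset I) :
    (iteratedFDeriv ℝ n (polyMap (envMap d E psi h') ∘ polyMap (envMap d ∅ phi h)) 0 X U : C) =
      envOp d E (fun d x => bullet psi phi d x) (fun m S => (X m S : A)) U := by
  rw [iteratedFDeriv_comp (n := ω) (contDiff_envMap h' h0').contDiffAt
    (contDiff_envMap h h0).contDiffAt le_top, envOp_bullet,
    polyMap_envMap_zero h h0 hphi hs]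
  simp only [FormalMultilinearSeries.taylorComp, sum_apply,
    FormalMultilinearSeries.compAlongOrderedFinpartition_apply, Finset.sum_apply,
    AddSubmonoidClass.coe_finsetSum]
  refine Finset.sum_congr rfl fun c _ => ?_
  simp only [ftaylorSeries]
  rw [iteratedFDeriv_envMap h' hs' h0', envMap_apply]
  congr 1
  funext m S
  rw [OrderedFinpartition.applyOrderedFinpartition_apply]
  beta_reduce
  rw [iteratedFDeriv_envMap h hs h0, envMap_apply]
  rfl

/-- The Taylor coefficients of the derivative of `φ` along the vector field `λ` are given by
`φ ∘ λ`. -/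
lemma iteratedFDeriv_envMap_insertOp {d : I → ℕ} {E : Finset I} {phi : Operations A B}
    {lam : Operations A A}
    (h : HasDegree G G' (setDegree d ∅) phi) (hs : IsGradedSymmetric G phi) (h0 : G 0 = ⊥)
    (h' : HasDegree G G (setDegree d E) lam) (hs' : IsGradedSymmetric G lam)
    (n : ℕ) (X : Fin n → Env G d) (U : Finset I) :
    (iteratedFDeriv ℝ n (fun Y => fderiv ℝ (polyMap (envMap d ∅ phi h)) Y
      (polyMap (envMap d E lam h') Y)) 0 X U : B) =
      envOp d E (fun d x => insertOp phi lam d x) (fun m S => (X m S : A)) U := by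
  have hc : ContDiff ℝ ∞ (fderiv ℝ (polyMap (envMap d ∅ phi h))) :=
    (contDiff_envMap h h0).fderiv_right le_top
  rw [iteratedFDeriv_pairing hc ((contDiff_envMap h' h0).of_le le_top), envOp_insertOp]
  simp only [Finset.sum_apply, AddSubmonoidClass.coe_finsetSum]
  refine Finset.sum_congr rfl fun S _ => ?_
  have key : ∀ (m : ℕ) (Y : Fin m → Env G d) (y : Env G d),
      iteratedFDeriv ℝ m (fderiv ℝ (polyMap (envMap d ∅ phi h))) 0 Y y =
        envMap d ∅ phi h (m + 1) (Fin.cons y Y) := by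
    intro m Y y
    have := iteratedFDeriv_succ_apply_right (𝕜 := ℝ) (f := polyMap (envMap d ∅ phi h)) (x := 0)
      (Fin.snoc Y y : Fin (m + 1) → Env G d)
    simp only [Fin.init_snoc, Fin.snoc_last] at this
    rw [← this, iteratedFDeriv_envMap h hs h0, Fin.snoc_eq_cons_rotate]
    exact envMap_symm h hs _ _ _
  rw [key, envMap_apply, iteratedFDeriv_envMap h' hs' h0]
  congr 1
  funext m T
  refine Fin.cases ?_ (fun m => ?_) m
  · simp only [Fin.cons_zero]
    rw [envMap_apply]
  · simp only [Fin.cons_succ]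

end Env

section Composition

lemma envOp_congr {A B : Type*} [AddCommGroup A] [Module ℝ A] [AddCommGroup B] [Module ℝ B]
    {I : Type*} [LinearOrder I] [Fintype I] {G : ℕ → Submodule ℝ A} {d : I → ℕ} {E : Finset I}
    {n : ℕ} {F F' : (Fin n → ℕ) → (Fin n → A) → B}
    (hF : ∀ d x, (∀ j, x j ∈ G (d j)) → F d x = F' d x) (X : Fin n → Finset I → A)
    (hX : ∀ j S, X j S ∈ G (setDegree d S)) (U : Finset I) :
    envOp d E F X U = envOp d E F' X U :=
  Finset.sum_congr rfl fun R _ => by rw [hF _ _ fun j => hX j (R j)]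

section Normed

variable {A B C : Type*} [NormedAddCommGroup A] [NormedSpace ℝ A] [NormedAddCommGroup B]
  [NormedSpace ℝ B] [NormedAddCommGroup C] [NormedSpace ℝ C]
  {G : ℕ → Submodule ℝ A} {G' : ℕ → Submodule ℝ B} {G'' : ℕ → Submodule ℝ C}

/-- The vector with Grassmann coefficients `θ_j ⊗ x j`. -/
def envSingle {n : ℕ} {d : Fin n → ℕ} {x : Fin n → A} (hx : ∀ j, x j ∈ G (d j)) (j : Fin n) :
    Env G (Fin.cons 1 d : Fin (n + 1) → ℕ) :=
  Pi.single {j.succ} ⟨x j, by simpa [setDegree] using hx j⟩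

lemma envSingle_coe {n : ℕ} {d : Fin n → ℕ} {x : Fin n → A} (hx : ∀ j, x j ∈ G (d j)) :
    (fun (j : Fin n) (S : Finset (Fin (n + 1))) => (envSingle (G := G) hx j S : A)) =
      fun j => Pi.single {j.succ} (x j) := by
  funext j S
  unfold envSingle
  by_cases h : S = {j.succ}
  · subst h; simp
  · simp [Pi.single_eq_of_ne h]

variable [FiniteDimensional ℝ A] [FiniteDimensional ℝ B]

/-- `ψ • φ` is graded symmetric, because the iterated derivatives of the composition of the
functions `φ` and `ψ` are symmetric. -/
lemma IsGradedSymmetric.bullet_normed {phi : Operations A B} {psi : Operations B C}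
    {omega : Operations A C} (h0 : G 0 = ⊥) (h0' : G' 0 = ⊥)
    (hd : HasDegree G G' 0 phi) (hs : IsGradedSymmetric G phi) (hz : phi 0 = 0)
    (hd' : HasDegree G' G'' 0 psi) (hs' : IsGradedSymmetric G' psi)
    (homega : ∀ (n : ℕ) (d : Fin n → ℕ) (x : Fin n → A), (∀ j, x j ∈ G (d j)) →
      omega n x = bullet psi phi d x) : IsGradedSymmetric G omega := by
  intro n d x hx σ
  -- no direction `θ_E` is needed here, so that the variables are the `θ_j` alone
  have hd1 : HasDegree G G' (setDegree d ∅) phi := hd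
  have hd1' : HasDegree G' G'' (setDegree d ∅) psi := hd'
  let X : Fin n → Env G d := fun j => Pi.single {j} ⟨x j, by simpa [setDegree] using hx j⟩
  have hX : ∀ j S, (X j S : A) = (Pi.single {j} (x j) : Finset (Fin n) → A) S := fun j S => by
    by_cases h : S = {j}
    · subst h; simp [X]
    · simp [X, Pi.single_eq_of_ne h]
  have hval : ∀ τ : Equiv.Perm (Fin n),
      (iteratedFDeriv ℝ n (polyMap (envMap d ∅ psi hd1') ∘ polyMap (envMap d ∅ phi hd1)) 0
        (X ∘ τ) Finset.univ : C) =
      koszulSign d (fun a => τ.symm a) • omega n (fun j => x (τ j)) := by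
    intro τ
    have hmem : ∀ d' x', (∀ j, x' j ∈ G (d' j)) → bullet psi phi d' x' = omega n x' :=
      fun d' x' hx' => (homega n d' x' hx').symm
    rw [iteratedFDeriv_envMap_comp hd1 hs h0 hz hd1' hs' h0',
      envOp_congr hmem _ (fun j S => ((X ∘ τ) j S).2)]
    unfold envOp
    rw [Finset.sum_eq_single (fun j => {τ j})]
    · have hU : (∅ : Finset (Fin n)) ∪ Finset.univ.biUnion (fun j : Fin n => {τ j}) =
          Finset.univ := by
        ext i
        simp only [Finset.empty_union, Finset.mem_biUnion, Finset.mem_univ, Finset.mem_singleton,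
          true_and, iff_true]
        exact ⟨τ.symm i, by simp⟩
      have hfam : familySign d (fun j : Fin n => {j}) = 1 := by
        unfold familySign setSign crossSign
        simp only [Finset.prod_singleton]
        refine Finset.prod_eq_one fun a _ => Finset.prod_eq_one fun b _ => ?_
        split_ifs <;> rfl
      rw [if_pos hU, leadingSign_empty, familySign_comp_perm d (fun j => {j}) τ, hfam, one_mul]
      simp [setDegree, hX]
    · intro R _ hR
      obtain ⟨j, hj⟩ := Function.ne_iff.1 hR
      beta_reduce
      rw [(omega n).map_coord_zero j, smul_zero]
      simp only [Function.comp, hX]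
      exact Pi.single_eq_of_ne hj _
    · simp
  have hsm : ContDiffAt ℝ ω (polyMap (envMap d ∅ psi hd1') ∘ polyMap (envMap d ∅ phi hd1)) 0 :=
    ((contDiff_envMap hd1' h0').comp (contDiff_envMap hd1 h0)).contDiffAt
  have h1 := hval σ
  rw [hsm.iteratedFDeriv_comp_perm] at h1
  have h2 := hval (Equiv.refl _)
  simp only [Equiv.coe_refl, Function.comp_id, Equiv.refl_symm, id] at h2
  rw [h1, koszulSign_of_forall_le d (fun a => a) (fun a b h => h.le), one_smul] at h2
  rw [← h2, smul_smul, koszulSign_mul_self, one_smul]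

/-- After extension of scalars to a Grassmann algebra, operations of degree zero are functions `Φ`
and `Ψ`, and the curved `L∞[1]`-structures are vector fields `Λ`, `Λ'` and `Λ''`, up to equality of
Taylor coefficients at the origin. To be a morphism means `dΦ (Λ) = Λ' ∘ Φ`, and the chain rule
shows that this property is inherited by compositions. -/
lemma comp_normed [FiniteDimensional ℝ C] {lam : Operations A A} {lam' : Operations B B}
    {lam'' : Operations C C}
    {phi : Operations A B} {psi : Operations B C} {omega : Operations A C}
    (h0 : G 0 = ⊥) (h0' : G' 0 = ⊥) (h0'' : G'' 0 = ⊥)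
    (hlam : IsCurvedLInfty G lam) (hlam' : IsCurvedLInfty G' lam')
    (hlam'' : IsCurvedLInfty G'' lam'')
    (hphi : IsLInftyMorphism G lam G' lam' phi) (hpsi : IsLInftyMorphism G' lam' G'' lam'' psi)
    (homega : ∀ (n : ℕ) (d : Fin n → ℕ) (x : Fin n → A), (∀ j, x j ∈ G (d j)) →
      omega n x = bullet psi phi d x) : IsLInftyMorphism G lam G'' lam'' omega := by
  have hz : omega 0 = 0 := by
    ext x
    rw [homega 0 (fun j => j.elim0) x fun j => j.elim0, bullet_zero, hpsi.zero]
    rfl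
  have hsy : IsGradedSymmetric G omega := IsGradedSymmetric.bullet_normed h0 h0'
    hphi.degree hphi.symmetric hphi.zero hpsi.degree hpsi.symmetric homega
  have hdeg : HasDegree G G'' 0 omega := fun k d x hx => by
    rw [homega k d x hx]
    exact bullet_degree 0 hpsi.degree hphi.degree d x hx
  refine ⟨hz, hsy, hdeg, fun n d x hx => ?_⟩
  -- the exterior variable `θ_0` of degree one accounts for the degree of `λ`
  let D : Fin (n + 1) → ℕ := Fin.cons 1 d
  have e0 : setDegree D ∅ = 0 := by simp [setDegree]
  have e1 : setDegree D {0} = 1 := by simp [setDegree, D]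
  have dphi : HasDegree G G' (setDegree D ∅) phi := by rw [e0]; exact hphi.degree
  have dpsi : HasDegree G' G'' (setDegree D ∅) psi := by rw [e0]; exact hpsi.degree
  have dom : HasDegree G G'' (setDegree D ∅) omega := by rw [e0]; exact hdeg
  have dlam : HasDegree G G (setDegree D {0}) lam := by rw [e1]; exact hlam.degree
  have dlam' : HasDegree G' G' (setDegree D {0}) lam' := by rw [e1]; exact hlam'.degree
  have dlam'' : HasDegree G'' G'' (setDegree D {0}) lam'' := by rw [e1]; exact hlam''.degree
  let Φ := polyMap (envMap D ∅ phi dphi)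
  let Ψ := polyMap (envMap D ∅ psi dpsi)
  let Ω := polyMap (envMap D ∅ omega dom)
  let Λ := polyMap (envMap D {0} lam dlam)
  let Λ' := polyMap (envMap D {0} lam' dlam')
  let Λ'' := polyMap (envMap D {0} lam'' dlam'')
  have cΦ : ContDiff ℝ ω Φ := contDiff_envMap dphi h0
  have cΨ : ContDiff ℝ ω Ψ := contDiff_envMap dpsi h0'
  have cΩ : ContDiff ℝ ω Ω := contDiff_envMap dom h0
  have cΛ : ContDiff ℝ ω Λ := contDiff_envMap dlam h0
  have cΛ' : ContDiff ℝ ω Λ' := contDiff_envMap dlam' h0'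
  have cΛ'' : ContDiff ℝ ω Λ'' := contDiff_envMap dlam'' h0''
  have zΦ : Φ 0 = 0 := polyMap_envMap_zero dphi h0 hphi.zero hphi.symmetric
  have zΩ : Ω 0 = 0 := polyMap_envMap_zero dom h0 hz hsy
  have jΩ : JetEq Ω (Ψ ∘ Φ) := by
    intro m
    ext X U
    rw [iteratedFDeriv_envMap_comp dphi hphi.symmetric h0 hphi.zero dpsi hpsi.symmetric h0',
      iteratedFDeriv_envMap dom hsy h0, envMap_apply]
    exact envOp_congr (homega m) _ (fun j S => (X j S).2) U
  have jφ : JetEq (fun X => fderiv ℝ Φ X (Λ X)) (Λ' ∘ Φ) := by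
    intro m
    ext X U
    rw [iteratedFDeriv_envMap_comp dphi hphi.symmetric h0 hphi.zero dlam' hlam'.symmetric h0',
      iteratedFDeriv_envMap_insertOp dphi hphi.symmetric h0 dlam hlam.symmetric]
    exact envOp_congr (hphi.comm m) _ (fun j S => (X j S).2) U
  have jψ : JetEq (fun X => fderiv ℝ Ψ X (Λ' X)) (Λ'' ∘ Ψ) := by
    intro m
    ext X U
    rw [iteratedFDeriv_envMap_comp dpsi hpsi.symmetric h0' hpsi.zero dlam'' hlam''.symmetric h0'',
      iteratedFDeriv_envMap_insertOp dpsi hpsi.symmetric h0' dlam' hlam'.symmetric]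
    exact envOp_congr (hpsi.comm m) _ (fun j S => (X j S).2) U
  have cdΨ : ContDiff ℝ ∞ (fderiv ℝ Ψ) := cΨ.fderiv_right le_top
  have cdΦ : ContDiff ℝ ∞ (fderiv ℝ Φ) := cΦ.fderiv_right le_top
  have cdΩ : ContDiff ℝ ∞ (fderiv ℝ Ω) := cΩ.fderiv_right le_top
  have sΦ : ContDiff ℝ ∞ Φ := cΦ.of_le le_top
  have sΨ : ContDiff ℝ ∞ Ψ := cΨ.of_le le_top
  have sΩ : ContDiff ℝ ∞ Ω := cΩ.of_le le_top
  have sΛ : ContDiff ℝ ∞ Λ := cΛ.of_le le_top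
  have sΛ' : ContDiff ℝ ∞ Λ' := cΛ'.of_le le_top
  have sΛ'' : ContDiff ℝ ∞ Λ'' := cΛ''.of_le le_top
  -- `dΩ (Λ) = d(Ψ ∘ Φ) (Λ) = dΨ (dΦ (Λ)) = dΨ (Λ' ∘ Φ) = Λ'' ∘ Ψ ∘ Φ = Λ'' ∘ Ω`
  have step1 : JetEq (fun X => fderiv ℝ Ω X (Λ X)) (fun X => fderiv ℝ (Ψ ∘ Φ) X (Λ X)) :=
    jΩ.fderiv.pairing (fun _ => rfl) cdΩ ((cΨ.comp cΦ).fderiv_right le_top) sΛ sΛ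
  have step2 : (fun X => fderiv ℝ (Ψ ∘ Φ) X (Λ X)) =
      fun X => (fderiv ℝ Ψ (Φ X)) (fderiv ℝ Φ X (Λ X)) := by
    funext X
    rw [fderiv_comp X (cΨ.differentiable (by simp) _) (cΦ.differentiable (by simp) _)]
    rfl
  have step3 : JetEq (fun X => (fderiv ℝ Ψ (Φ X)) (fderiv ℝ Φ X (Λ X)))
      (fun X => (fderiv ℝ Ψ (Φ X)) (Λ' (Φ X))) :=
    JetEq.pairing (u := fun X => fderiv ℝ Ψ (Φ X)) (fun _ => rfl) jφ (cdΨ.comp sΦ)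
      (cdΨ.comp sΦ) (cdΦ.clm_apply sΛ) (sΛ'.comp sΦ)
  have step4 : JetEq ((fun Y => fderiv ℝ Ψ Y (Λ' Y)) ∘ Φ) ((Λ'' ∘ Ψ) ∘ Φ) :=
    JetEq.comp (fun _ => rfl) jψ zΦ sΦ sΦ (cdΨ.clm_apply sΛ') (sΛ''.comp sΨ)
  have step5 : JetEq (Λ'' ∘ Ω) (Λ'' ∘ (Ψ ∘ Φ)) :=
    JetEq.comp jΩ (fun _ => rfl) zΩ sΩ (sΨ.comp sΦ) sΛ'' sΛ''
  have fin : JetEq (fun X => fderiv ℝ Ω X (Λ X)) (Λ'' ∘ Ω) := by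
    intro m
    rw [step1 m, step2, step3 m, step5 m]
    exact step4 m
  -- the coefficient of `θ_0 θ_1 ⋯ θ_n` in the identity at `θ_j ⊗ x j` is the required relation
  have hval := congrArg (fun T => (T (envSingle (G := G) hx) Finset.univ : C)) (fin n)
  rw [iteratedFDeriv_envMap_insertOp dom hsy h0 dlam hlam.symmetric,
    iteratedFDeriv_envMap_comp dom hsy h0 hz dlam'' hlam''.symmetric h0'', envSingle_coe,
    envOp_single d _ (fun d x j => insertOp_eq_zero _ _ d x j),
    envOp_single d _ (fun d x j => bullet_eq_zero _ _ d x j)] at hval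
  exact hval

end Normed

/-- Operations `ω` that are given by `ψ • φ` for morphisms `φ` and `ψ` form a morphism. -/
theorem IsLInftyMorphism.bullet {A B C : Type*} [AddCommGroup A] [Module ℝ A] [AddCommGroup B]
    [Module ℝ B] [AddCommGroup C] [Module ℝ C]
    [FiniteDimensional ℝ A] [FiniteDimensional ℝ B] [FiniteDimensional ℝ C]
    {G : ℕ → Submodule ℝ A} {G' : ℕ → Submodule ℝ B} {G'' : ℕ → Submodule ℝ C}
    {lam : Operations A A} {lam' : Operations B B} {lam'' : Operations C C}
    {phi : Operations A B} {psi : Operations B C} {omega : Operations A C}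
    (h0 : G 0 = ⊥) (h0' : G' 0 = ⊥) (h0'' : G'' 0 = ⊥)
    (hlam : IsCurvedLInfty G lam) (hlam' : IsCurvedLInfty G' lam')
    (hlam'' : IsCurvedLInfty G'' lam'')
    (hphi : IsLInftyMorphism G lam G' lam' phi) (hpsi : IsLInftyMorphism G' lam' G'' lam'' psi)
    (homega : ∀ (n : ℕ) (d : Fin n → ℕ) (x : Fin n → A), (∀ j, x j ∈ G (d j)) →
      omega n x = bullet psi phi d x) : IsLInftyMorphism G lam G'' lam'' omega := by
  -- any norms will do
  let eA := (Module.finBasis ℝ A).equivFun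
  let eB := (Module.finBasis ℝ B).equivFun
  let eC := (Module.finBasis ℝ C).equivFun
  let iA : NormedAddCommGroup A := NormedAddCommGroup.induced A _ eA.toLinearMap eA.injective
  let iB : NormedAddCommGroup B := NormedAddCommGroup.induced B _ eB.toLinearMap eB.injective
  let iC : NormedAddCommGroup C := NormedAddCommGroup.induced C _ eC.toLinearMap eC.injective
  let jA : NormedSpace ℝ A := NormedSpace.induced ℝ A _ eA.toLinearMap
  let jB : NormedSpace ℝ B := NormedSpace.induced ℝ B _ eB.toLinearMap
  let jC : NormedSpace ℝ C := NormedSpace.induced ℝ C _ eC.toLinearMap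
  exact comp_normed h0 h0' h0'' hlam hlam' hlam'' hphi hpsi homega

end Composition

/-! ### Linear operations -/

section OfLinear

variable {A B C : Type*} [AddCommGroup A] [Module ℝ A] [AddCommGroup B] [Module ℝ B]
  [AddCommGroup C] [Module ℝ C]

@[simp] lemma ofLinear_zero (g : A →ₗ[ℝ] B) : ofLinear g 0 = 0 := rfl

@[simp] lemma ofLinear_one (g : A →ₗ[ℝ] B) (x : Fin 1 → A) : ofLinear g 1 x = g (x 0) := rfl

lemma ofLinear_eq_zero (g : A →ₗ[ℝ] B) {n : ℕ} (hn : n ≠ 1) : ofLinear g n = 0 := by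
  match n, hn with
  | 0, _ => rfl
  | n + 2, _ => rfl

@[simp] lemma unary_apply (phi : Operations A B) (x : A) : unary phi x = phi 1 (fun _ => x) := rfl

lemma ofLinear_unary (phi : Operations A B) (h0 : phi 0 = 0) (h : ∀ k, 1 < k → phi k = 0) :
    ofLinear (unary phi) = phi := by
  funext n
  match n with
  | 0 => exact h0.symm
  | 1 =>
    ext x
    simp only [ofLinear_one, unary_apply]
    congr 1
    funext i
    rw [Subsingleton.elim i 0]
  | n + 2 => exact (h _ (by omega)).symm

@[simp] lemma unary_ofLinear (g : A →ₗ[ℝ] B) : unary (ofLinear g) = g := rfl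

lemma comp_ofLinear (g : A →ₗ[ℝ] B) (h : B →ₗ[ℝ] C) (n : ℕ) (x : Fin n → A) :
    h (ofLinear g n x) = ofLinear (h ∘ₗ g) n x := by
  match n with
  | 0 => simp
  | 1 => simp
  | n + 2 => simp [ofLinear_eq_zero]

/-- The partition of `Fin n`, `n > 0`, with a single block. -/
def singleBlock (n : ℕ) (hn : 0 < n) : OrderedFinpartition n where
  length := 1
  partSize _ := n
  partSize_pos _ := hn
  emb _ := id
  emb_strictMono _ := strictMono_id
  parts_strictMono := Subsingleton.strictMono _
  disjoint _ _ _ _ h := absurd (Subsingleton.elim _ _) h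
  cover x := ⟨0, x, rfl⟩

lemma eq_singleBlock {n : ℕ} (hn : 0 < n) (c : OrderedFinpartition n) (hc : c.length = 1) :
    c = singleBlock n hn := by
  have h1 : ∀ m, c.partSize m = n := fun m => by
    have h := Fintype.card_congr c.equivSigma
    have hs : Subsingleton (Fin c.length) := by rw [hc]; infer_instance
    have : Unique (Fin c.length) := ⟨⟨m⟩, fun a => Subsingleton.elim _ _⟩
    simp only [Fintype.card_sigma, Fintype.card_fin, Finset.univ_unique,
      Finset.sum_singleton] at h
    exact (congrArg c.partSize (Subsingleton.elim m default)).trans h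
  rcases c with ⟨length, partSize, hp, emb, hemb, h3, h4, h5⟩
  dsimp only at hc h1
  subst hc
  obtain rfl : partSize = fun _ => n := funext h1
  have : emb = fun _ => id := by
    funext m
    have e := OrderEmbedding.ofStrictMono (emb m) (hemb m)
    funext j
    have := Subsingleton.elim
      (RelIso.ofSurjective (OrderEmbedding.ofStrictMono (emb m) (hemb m))
        (Finite.surjective_of_injective (hemb m).injective))
      (OrderIso.refl (Fin n))
    exact congrArg (fun e : Fin n ≃o Fin n => e j) this
  subst this
  rfl

lemma eq_atomic {n : ℕ} (c : OrderedFinpartition n) (hc : ∀ m, c.partSize m = 1) :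
    c = OrderedFinpartition.atomic n := by
  have h1 : c.length = n := by
    have h := Fintype.card_congr c.equivSigma
    simpa [hc] using h
  rcases c with ⟨length, partSize, hp, emb, hemb, h3, h4, h5⟩
  dsimp only at hc h1
  subst h1
  obtain rfl : partSize = fun _ => 1 := funext hc
  have : emb = fun m _ => m := by
    funext m j
    have := Subsingleton.elim
      (RelIso.ofSurjective (OrderEmbedding.ofStrictMono _ h3)
        (Finite.surjective_of_injective h3.injective))
      (OrderIso.refl (Fin length))
    have := congrArg (fun e : Fin length ≃o Fin length => e m) this
    have hj : j = (⟨1 - 1, by omega⟩ : Fin 1) := Subsingleton.elim _ _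
    rw [hj]
    exact this
  subst this
  rfl

lemma koszulSign_atomic {n : ℕ} (d : Fin n → ℕ) :
    koszulSign d (OrderedFinpartition.atomic n).index = 1 := by
  refine koszulSign_of_forall_le d _ fun a b h => ?_
  have : ∀ a : Fin n, (OrderedFinpartition.atomic n).index a = a := fun a => by
    conv_rhs => rw [← (OrderedFinpartition.atomic n).emb_invEmbedding a]
    rfl
  rw [this, this]
  exact h.le

lemma koszulSign_singleBlock {n : ℕ} (hn : 0 < n) (d : Fin n → ℕ) :
    koszulSign d (singleBlock n hn).index = 1 :=
  koszulSign_of_forall_le d _ fun a b _ => by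
    have h1 := ((singleBlock n hn).index a).2
    have h2 := ((singleBlock n hn).index b).2
    have h3 : (singleBlock n hn).length = 1 := rfl
    rw [Fin.le_def]
    omega

/-- Only the partition with a single block contributes. -/
lemma bullet_ofLinear_left (g : B →ₗ[ℝ] C) (phi : Operations A B) (h0 : phi 0 = 0) {n : ℕ}
    (d : Fin n → ℕ) (x : Fin n → A) : bullet (ofLinear g) phi d x = g (phi n x) := by
  rcases Nat.eq_zero_or_pos n with rfl | hn
  · rw [bullet_zero]
    simp [h0]
  · unfold bullet
    rw [Finset.sum_eq_single (singleBlock n hn)]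
    · rw [koszulSign_singleBlock, one_smul]
      rfl
    · intro c _ hc
      rw [ofLinear_eq_zero g fun h => hc (eq_singleBlock hn c h)]
      simp
    · simp

/-- The contribution of the partition into singletons to `λ • φ`. -/
lemma bullet_atomic (lam : Operations B C) (phi : Operations A B) {n : ℕ}
    (d : Fin n → ℕ) (x : Fin n → A) :
    koszulSign d (OrderedFinpartition.atomic n).index •
      lam (OrderedFinpartition.atomic n).length (fun m =>
        phi ((OrderedFinpartition.atomic n).partSize m)
          (fun j => x ((OrderedFinpartition.atomic n).emb m j))) =
      lam n (fun j => unary phi (x j)) := by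
  rw [koszulSign_atomic, one_smul]
  rfl

lemma bullet_ofLinear_right (lam : Operations B C) (g : A →ₗ[ℝ] B) {n : ℕ}
    (d : Fin n → ℕ) (x : Fin n → A) :
    bullet lam (ofLinear g) d x = lam n (fun j => g (x j)) := by
  unfold bullet
  rw [Finset.sum_eq_single (OrderedFinpartition.atomic n)]
  · exact bullet_atomic lam (ofLinear g) d x
  · intro c _ hc
    obtain ⟨m, hm⟩ : ∃ m, c.partSize m ≠ 1 := by
      by_contra h
      push Not at h
      exact hc (eq_atomic c h)
    rw [(lam _).map_coord_zero m, smul_zero]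
    rw [ofLinear_eq_zero g hm]
    rfl
  · simp

lemma bullet_sub_left (lam lam' : Operations B C) (phi : Operations A B) {n : ℕ}
    (d : Fin n → ℕ) (x : Fin n → A) :
    bullet (fun k => lam k - lam' k) phi d x = bullet lam phi d x - bullet lam' phi d x := by
  unfold bullet
  rw [← Finset.sum_sub_distrib]
  exact Finset.sum_congr rfl fun c _ => by rw [← smul_sub]; rfl

/-- The summand of `φ ∘ λ` in which `λ` is applied to all the arguments. -/
lemma insertOp_univ (phi : Operations A B) (lam : Operations A A) {n : ℕ} (d : Fin n → ℕ)
    (x : Fin n → A) :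
    koszulSign d (fun a => if a ∈ (Finset.univ : Finset (Fin n)) then (0 : ℕ) else 1) •
      phi ((Finset.univ : Finset (Fin n))ᶜ.card + 1)
        (Fin.cons (lam (Finset.univ : Finset (Fin n)).card
            (fun j => x ((Finset.univ : Finset (Fin n)).orderEmbOfFin rfl j)))
          (fun j => x ((Finset.univ : Finset (Fin n))ᶜ.orderEmbOfFin rfl j))) =
      unary phi (lam n x) := by
  rw [koszulSign_of_forall_le _ _ (by simp), one_smul]
  have h1 : lam (Finset.univ : Finset (Fin n)).card
      (fun j => x ((Finset.univ : Finset (Fin n)).orderEmbOfFin rfl j)) = lam n x := by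
    have : ∀ (m : ℕ) (h : (Finset.univ : Finset (Fin n)).card = m) (hm : m = n),
        lam m (fun j => x ((Finset.univ : Finset (Fin n)).orderEmbOfFin h j)) = lam n x := by
      rintro m h rfl
      congr 1
      funext j
      congr 1
      have := Finset.orderEmbOfFin_unique h (f := id) (by simp) strictMono_id
      exact (congrFun this j).symm
    exact this _ rfl (by simp)
  rw [h1]
  have : ∀ (m : ℕ) (hm : m = 0) (v : Fin m → A), phi (m + 1) (Fin.cons (lam n x) v) =
      unary phi (lam n x) := by
    rintro m rfl v
    rw [unary_apply]
    congr 1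
    funext j
    exact Fin.cases rfl (fun i => i.elim0) j
  exact this _ (by simp) _

lemma insertOp_ofLinear (g : A →ₗ[ℝ] B) (lam : Operations A A) {n : ℕ} (d : Fin n → ℕ)
    (x : Fin n → A) : insertOp (ofLinear g) lam d x = g (lam n x) := by
  unfold insertOp
  rw [Finset.sum_eq_single Finset.univ]
  · exact insertOp_univ (ofLinear g) lam d x
  · intro S _ hS
    rw [ofLinear_eq_zero g, zero_apply, smul_zero]
    intro h
    exact hS (by simpa using h)
  · simp

lemma isGradedSymmetric_ofLinear (G : ℕ → Submodule ℝ A) (g : A →ₗ[ℝ] B) :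
    IsGradedSymmetric G (ofLinear g) := by
  intro k d x _ σ
  match k with
  | 0 => simp
  | 1 =>
    rw [koszulSign_of_forall_le _ _ fun a b h => absurd h (by simp [Subsingleton.elim a b]), one_smul]
    congr 1
    funext j
    rw [Subsingleton.elim (σ j) j]
  | k + 2 => simp [ofLinear_eq_zero]

/-- A linear morphism of curved `L∞[1]`-algebras is a map that commutes with the operations. -/
lemma isLInftyMorphism_ofLinear {G : ℕ → Submodule ℝ A} {lam : Operations A A}
    {G' : ℕ → Submodule ℝ B} {lam' : Operations B B} {g : A →ₗ[ℝ] B}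
    (hg : ∀ i, ∀ x ∈ G i, g x ∈ G' i)
    (h : ∀ (n : ℕ) (d : Fin n → ℕ) (x : Fin n → A), (∀ j, x j ∈ G (d j)) →
      g (lam n x) = lam' n (fun j => g (x j))) :
    IsLInftyMorphism G lam G' lam' (ofLinear g) where
  zero := rfl
  symmetric := isGradedSymmetric_ofLinear G g
  degree k d x hx := by
    match k with
    | 0 => simp
    | 1 => simpa using hg _ _ (hx 0)
    | k + 2 => simp [ofLinear_eq_zero]
  comm n d x hx := by rw [insertOp_ofLinear, bullet_ofLinear_right, h n d x hx]

lemma IsLInftyMorphism.map_op {G : ℕ → Submodule ℝ A} {lam : Operations A A}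
    {G' : ℕ → Submodule ℝ B} {lam' : Operations B B} {g : A →ₗ[ℝ] B}
    (hg : IsLInftyMorphism G lam G' lam' (ofLinear g)) (n : ℕ) (d : Fin n → ℕ) (x : Fin n → A)
    (hx : ∀ j, x j ∈ G (d j)) : g (lam n x) = lam' n (fun j => g (x j)) := by
  have := hg.comm n d x hx
  rwa [insertOp_ofLinear, bullet_ofLinear_right] at this

end OfLinear

/-! ### Multilinear maps on spanning families -/

section Span

variable {A B : Type*} [AddCommGroup A] [Module ℝ A] [AddCommGroup B] [Module ℝ B]

lemma MultilinearMap.mem_of_span {k : ℕ} (f : MultilinearMap ℝ (fun _ : Fin k => A) B)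
    (s : Fin k → Set A) (P : Submodule ℝ B) (h : ∀ x : Fin k → A, (∀ j, x j ∈ s j) → f x ∈ P)
    (x : Fin k → A) (hx : ∀ j, x j ∈ Submodule.span ℝ (s j)) : f x ∈ P := by
  have key : ∀ (t : Finset (Fin k)) (x : Fin k → A), (∀ j ∈ t, x j ∈ Submodule.span ℝ (s j)) →
      (∀ j, j ∉ t → x j ∈ s j) → f x ∈ P := by
    intro t
    induction t using Finset.induction_on with
    | empty => exact fun x _ hx => h x fun j => hx j (by simp)
    | insert i t hi ih =>
      intro x h1 h2
      have h3 : ∀ z ∈ Submodule.span ℝ (s i), f (Function.update x i z) ∈ P := by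
        intro z hz
        induction hz using Submodule.span_induction with
        | mem z hz =>
          refine ih _ (fun j hj => ?_) fun j hj => ?_
          · rw [Function.update_of_ne (ne_of_mem_of_not_mem hj hi)]
            exact h1 j (Finset.mem_insert_of_mem hj)
          · by_cases hji : j = i
            · subst hji; simpa using hz
            · rw [Function.update_of_ne hji]
              exact h2 j (by simp [hji, hj])
        | zero => simp
        | add z z' _ _ hz hz' =>
          rw [f.map_update_add]
          exact P.add_mem hz hz'
        | smul c z _ hz =>
          rw [f.map_update_smul]
          exact P.smul_mem c hz
      have := h3 (x i) (h1 i (Finset.mem_insert_self _ _))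
      rwa [Function.update_eq_self] at this
  exact key Finset.univ x (fun j _ => hx j) (by simp)

lemma iSup_eq_span_biUnion (G : ℕ → Submodule ℝ A) :
    (⨆ i, G i) = Submodule.span ℝ {x | ∃ i, x ∈ G i} := by
  rw [Submodule.iSup_eq_span]
  congr 1
  ext x
  simp

/-- To check where a multilinear map sends sums of homogeneous elements, it suffices to consider
homogeneous elements. -/
lemma MultilinearMap.mem_of_homogeneous {k : ℕ} (f : MultilinearMap ℝ (fun _ : Fin k => A) B)
    (G : Fin k → ℕ → Submodule ℝ A) (P : Submodule ℝ B)
    (h : ∀ (d : Fin k → ℕ) (x : Fin k → A), (∀ j, x j ∈ G j (d j)) → f x ∈ P)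
    (x : Fin k → A) (hx : ∀ j, x j ∈ ⨆ i, G j i) : f x ∈ P := by
  refine f.mem_of_span (fun j => {x | ∃ i, x ∈ G j i}) P (fun x hx => ?_) x fun j => ?_
  · choose d hd using hx
    exact h d x hd
  · rw [← iSup_eq_span_biUnion]
    exact hx j

end Span

/-! ### Homotopy transfer along a homotopy with values in an ideal -/

section Transfer

variable {A B : Type*} [AddCommGroup A] [Module ℝ A] [AddCommGroup B] [Module ℝ B]

/-- The data of a transfer along `η` from `B` to a complement `A` of the image of `[δ, η]`, with
inclusion `incl` and projection `pr`, in which the operations `λ` vanish on the values of `δ η`, and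
those of arity at least two also on the values of `η`.  The recursive formulas of the homotopy
transfer theorem then break off: the transferred operations are `pr ∘ λ` and the inclusion morphism
is `incl - η ∘ λ`. -/
structure IdealTransfer (GA : ℕ → Submodule ℝ A) (GB : ℕ → Submodule ℝ B) (lam : Operations B B)
    (δ η : B →ₗ[ℝ] B) (incl : A →ₗ[ℝ] B) (pr : B →ₗ[ℝ] A) : Prop where
  lam_curved : IsCurvedLInfty GB lam
  incl_injective : Function.Injective incl
  incl_mem : ∀ i x, x ∈ GA i ↔ incl x ∈ GB i
  δ_degree : ∀ i, ∀ x ∈ GB i, δ x ∈ GB (i + 1)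
  η_degree : ∀ i, ∀ x ∈ GB (i + 1), η x ∈ GB i
  contraction : ∀ x, η (δ (η x)) = η x
  incl_pr : ∀ x, incl (pr x) = x - (δ (η x) + η (δ x))
  δ_sq : ∀ x, δ (δ x) = 0
  ηδ_incl : ∀ x, η (δ (incl x)) = 0
  η_lam_one : ∀ x, η (unary lam (incl x)) = 0
  η_curv : ∀ x, η (lam 0 x) = 0
  lam_η : ∀ k, 2 ≤ k → ∀ (x : Fin k → B) (i : Fin k) (y : B), x i = η y → lam k x = 0
  lam_δη : ∀ k, ∀ (x : Fin k → B) (i : Fin k) (y : B), x i = δ (η y) → lam k x = 0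
  lam_one_η : ∀ y, unary lam (η y) = δ (η y)

namespace IdealTransfer

variable {GA : ℕ → Submodule ℝ A} {GB : ℕ → Submodule ℝ B} {lam : Operations B B}
    {δ η : B →ₗ[ℝ] B} {incl : A →ₗ[ℝ] B} {pr : B →ₗ[ℝ] A}

/-- The transferred operations. -/
def mu (lam : Operations B B) (incl : A →ₗ[ℝ] B) (pr : B →ₗ[ℝ] A) : Operations A A := fun k =>
  pr.compMultilinearMap ((lam k).compLinearMap fun _ => incl)

/-- The inclusion morphism. -/
def phi (lam : Operations B B) (η : B →ₗ[ℝ] B) (incl : A →ₗ[ℝ] B) : Operations A B := fun k =>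
  ofLinear incl k - η.compMultilinearMap ((lam k).compLinearMap fun _ => incl)

lemma mu_apply (k : ℕ) (x : Fin k → A) :
    mu lam incl pr k x = pr (lam k fun j => incl (x j)) := rfl

lemma phi_apply (k : ℕ) (x : Fin k → A) :
    phi lam η incl k x = ofLinear incl k x - η (lam k fun j => incl (x j)) := rfl

lemma phi_of_ne_one {k : ℕ} (hk : k ≠ 1) (x : Fin k → A) :
    phi lam η incl k x = η (-(lam k fun j => incl (x j))) := by
  rw [phi_apply, ofLinear_eq_zero _ hk]
  simp

variable (T : IdealTransfer GA GB lam δ η incl pr)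
include T

lemma phi_zero : phi lam η incl 0 = 0 := by
  ext x
  rw [phi_apply, T.η_curv]
  simp

lemma unary_phi : unary (phi lam η incl) = incl := by
  ext x
  have := T.η_lam_one x
  rw [unary_apply] at this
  rw [unary_apply, phi_apply, this]
  simp

lemma mu_degree (k : ℕ) (d : Fin k → ℕ) (x : Fin k → A) (hx : ∀ j, x j ∈ GA (d j)) :
    mu lam incl pr k x ∈ GA ((∑ j, d j) + 1) := by
  have h := T.lam_curved.degree k d (fun j => incl (x j)) fun j => (T.incl_mem _ _).1 (hx j)
  rw [mu_apply, T.incl_mem, T.incl_pr]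
  exact Submodule.sub_mem _ h (Submodule.add_mem _ (T.δ_degree _ _ (T.η_degree _ _ h))
    (T.η_degree _ _ (T.δ_degree _ _ h)))

lemma phi_degree (k : ℕ) (d : Fin k → ℕ) (x : Fin k → A) (hx : ∀ j, x j ∈ GA (d j)) :
    phi lam η incl k x ∈ GB (∑ j, d j) := by
  have h := T.lam_curved.degree k d (fun j => incl (x j)) fun j => (T.incl_mem _ _).1 (hx j)
  rw [phi_apply]
  refine Submodule.sub_mem _ ?_ (T.η_degree _ _ h)
  match k with
  | 0 => simp
  | 1 => simpa using (T.incl_mem _ _).1 (hx 0)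
  | k + 2 => simp [ofLinear_eq_zero]

lemma isGradedSymmetric_comp {C : Type*} [AddCommGroup C] [Module ℝ C] (g : B →ₗ[ℝ] C) :
    IsGradedSymmetric GA (fun k => g.compMultilinearMap ((lam k).compLinearMap fun _ => incl)) := by
  intro k d x hx σ
  have := T.lam_curved.symmetric k d (fun j => incl (x j)) (fun j => (T.incl_mem _ _).1 (hx j)) σ
  change g (lam k fun j => incl (x (σ j))) = _ • g (lam k fun j => incl (x j))
  rw [this, map_smul]

/-- `λ • φ = λ - δ η λ` on `A`. -/
lemma bullet_phi {n : ℕ} (d : Fin n → ℕ) (x : Fin n → A) :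
    bullet lam (phi lam η incl) d x =
      lam n (fun j => incl (x j)) - δ (η (lam n fun j => incl (x j))) := by
  have hat : ∀ n (d : Fin n → ℕ) (x : Fin n → A), _ :=
    fun n d x => bullet_atomic lam (phi lam η incl) (n := n) d x
  simp only [T.unary_phi] at hat
  rcases Nat.lt_or_ge n 2 with hn | hn
  · have hz : η (lam n fun j => incl (x j)) = 0 := by
      obtain rfl | rfl : n = 0 ∨ n = 1 := by omega
      · exact T.η_curv _
      · have := T.η_lam_one (x 0)
        rw [unary_apply] at this
        convert this using 4 with j
        rw [Subsingleton.elim j 0]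
    rw [hz, map_zero, sub_zero, ← hat n d x]
    unfold bullet
    obtain rfl | rfl : n = 0 ∨ n = 1 := by omega
    · rw [Fintype.sum_unique]; rfl
    · rw [Fintype.sum_unique]
      rw [Subsingleton.elim (default : OrderedFinpartition 1) (OrderedFinpartition.atomic 1)]
  -- the nonlinear part of `φ` has values in the image of `η`, on which only the unary operation of
  -- `λ` does not vanish; so only the partitions into singletons and with a single block contribute
  · have hne : OrderedFinpartition.atomic n ≠ singleBlock n (by omega) := fun h => by
      have : n = 1 := congrArg OrderedFinpartition.length h
      omega
    unfold bullet
    rw [Finset.sum_eq_add _ _ hne]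
    · rw [hat, koszulSign_singleBlock, one_smul, sub_eq_add_neg]
      congr 1
      change unary lam (phi lam η incl n x) = _
      rw [phi_of_ne_one (by omega), map_neg, map_neg, T.lam_one_η]
    · rintro c - ⟨h1, h2⟩
      obtain ⟨m, hm⟩ : ∃ m, c.partSize m ≠ 1 := by
        by_contra h
        push Not at h
        exact h1 (eq_atomic c h)
      have hl : c.length ≠ 1 := fun h => h2 (eq_singleBlock _ c h)
      have hl' := c.length_pos (by omega)
      rw [T.lam_η _ (by omega) _ m _ (phi_of_ne_one hm _), smul_zero]
    · simp
    · simp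

/-- Inserting the transferred operations `(1 - δ η - η δ) λ` in `λ`: the Jacobi identity of `λ`
cancels the first summand, the second does not contribute, and the third does so only in the linear
part of the outer `λ`. -/
lemma insert_mu {n : ℕ} (d : Fin n → ℕ) (x : Fin n → A) (hx : ∀ j, x j ∈ GA (d j)) :
    (∑ S : Finset (Fin n), koszulSign d (fun a => if a ∈ S then (0 : ℕ) else 1) •
      lam (Sᶜ.card + 1) (fun m => incl ((Fin.cons
        (mu lam incl pr S.card (fun j => x (S.orderEmbOfFin rfl j)))
        (fun j => x (Sᶜ.orderEmbOfFin rfl j)) : Fin (Sᶜ.card + 1) → A) m))) =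
      -(δ (η (δ (lam n fun j => incl (x j))))) := by
  have hcons : ∀ (k : ℕ) (a : A) (v : Fin k → A),
      (fun m => incl ((Fin.cons a v : Fin (k + 1) → A) m)) =
        Fin.cons (incl a) (fun m => incl (v m)) := fun k a v => by
    funext m
    refine Fin.cases ?_ (fun m => ?_) m <;> simp
  have hsub : ∀ (k : ℕ) (a b : B) (v : Fin k → B), lam (k + 1) (Fin.cons (a - b) v) =
      lam (k + 1) (Fin.cons a v) - lam (k + 1) (Fin.cons b v) := fun k a b v => by
    have := (lam (k + 1)).map_update_sub (Fin.cons 0 v) 0 a b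
    simpa [Fin.update_cons_zero] using this
  have hadd : ∀ (k : ℕ) (a b : B) (v : Fin k → B), lam (k + 1) (Fin.cons (a + b) v) =
      lam (k + 1) (Fin.cons a v) + lam (k + 1) (Fin.cons b v) := fun k a b v => by
    have := (lam (k + 1)).map_update_add (Fin.cons 0 v) 0 a b
    simpa [Fin.update_cons_zero] using this
  have hj := T.lam_curved.jacobi n d (fun j => incl (x j)) fun j => (T.incl_mem _ _).1 (hx j)
  have hdiff : (∑ S : Finset (Fin n), koszulSign d (fun a => if a ∈ S then (0 : ℕ) else 1) •
      lam (Sᶜ.card + 1) (Fin.cons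
        (η (δ (lam S.card (fun j => incl (x (S.orderEmbOfFin rfl j))))))
        (fun j => incl (x (Sᶜ.orderEmbOfFin rfl j))))) =
      δ (η (δ (lam n fun j => incl (x j)))) := by
    rw [Finset.sum_eq_single Finset.univ]
    · have := insertOp_univ lam (fun k => (η ∘ₗ δ).compMultilinearMap (lam k)) d
        (fun j => incl (x j))
      exact this.trans (T.lam_one_η _)
    · intro S _ hS
      rw [T.lam_η _ _ _ 0 (δ (lam S.card (fun j => incl (x (S.orderEmbOfFin rfl j))))) rfl,
        smul_zero]
      have : 0 < Sᶜ.card := Finset.card_pos.2 (Finset.nonempty_iff_ne_empty.2 (by simpa using hS))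
      omega
    · simp
  unfold insertOp at hj
  rw [← hdiff, ← sub_eq_zero, sub_neg_eq_add, ← Finset.sum_add_distrib, ← hj]
  refine Finset.sum_congr rfl fun S _ => ?_
  rw [← smul_add, hcons, mu_apply, T.incl_pr, hsub, hadd,
    T.lam_δη _ (Fin.cons (δ (η (lam S.card fun j => incl (x (S.orderEmbOfFin rfl j)))))
      (fun j => incl (x (Sᶜ.orderEmbOfFin rfl j)))) 0 _ rfl, zero_add, sub_add_cancel]

/-- The transferred structure is a curved `L∞[1]`-structure. -/
lemma isCurvedLInfty_mu : IsCurvedLInfty GA (mu lam incl pr) where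
  symmetric := T.isGradedSymmetric_comp pr
  degree := T.mu_degree
  jacobi n d x hx := by
    have h := congrArg pr (T.insert_mu d x hx)
    rw [map_sum] at h
    simp only [map_smul, map_neg] at h
    refine h.trans ?_
    rw [neg_eq_zero]
    apply T.incl_injective
    rw [T.incl_pr, T.contraction, T.δ_sq]
    simp

/-- The inclusion is a morphism. -/
lemma isLInftyMorphism_phi :
    IsLInftyMorphism GA (mu lam incl pr) GB lam (phi lam η incl) where
  zero := T.phi_zero
  symmetric k d x hx σ := by
    have h1 := isGradedSymmetric_ofLinear GA incl k d x hx σ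
    have h2 := T.isGradedSymmetric_comp η k d x hx σ
    rw [phi_apply, phi_apply, smul_sub, ← h1]
    exact congrArg _ h2
  degree := T.phi_degree
  comm n d x hx := by
    have h1 := insertOp_ofLinear incl (mu lam incl pr) d x
    have h2 := congrArg η (T.insert_mu d x hx)
    rw [map_sum] at h2
    simp only [map_smul] at h2
    have h3 : insertOp (phi lam η incl) (mu lam incl pr) d x =
        insertOp (ofLinear incl) (mu lam incl pr) d x -
          insertOp (fun k => η.compMultilinearMap ((lam k).compLinearMap fun _ => incl))
            (mu lam incl pr) d x := by
      unfold insertOp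
      rw [← Finset.sum_sub_distrib]
      exact Finset.sum_congr rfl fun S _ => by rw [← smul_sub]; rfl
    rw [h3, h1, T.bullet_phi, mu_apply, T.incl_pr]
    have h4 : insertOp (fun k => η.compMultilinearMap ((lam k).compLinearMap fun _ => incl))
        (mu lam incl pr) d x = η (-(δ (η (δ (lam n fun j => incl (x j)))))) := h2
    rw [h4, map_neg, T.contraction]
    abel

/-- The structures `mu` and `phi` are those of the homotopy transfer theorem. -/
lemma isTransferOutput : IsTransferOutput GA lam δ η incl (mu lam incl pr) (phi lam η incl) := by
  have hb : ∀ (n : ℕ) (d : Fin n → ℕ) (x : Fin n → A),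
      bullet (fun k => lam k - ofLinear δ k) (phi lam η incl) d x =
        lam n (fun j => incl (x j)) - ofLinear (δ ∘ₗ incl) n x := by
    intro n d x
    rw [bullet_sub_left, T.bullet_phi]
    have := bullet_ofLinear_left δ (phi lam η incl) T.phi_zero d x
    refine (congrArg _ this).trans ?_
    rw [phi_apply, map_sub, comp_ofLinear]
    abel
  constructor
  · intro n d x _
    rw [hb, map_sub, comp_ofLinear, phi_apply]
    have : η ∘ₗ δ ∘ₗ incl = 0 := LinearMap.ext fun x => T.ηδ_incl x
    rw [this]
    have : ofLinear (0 : A →ₗ[ℝ] B) n x = 0 := by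
      match n with
      | 0 => rfl
      | 1 => rfl
      | n + 2 => rfl
    rw [this, sub_zero]
  · intro n d x _
    rw [hb, mu_apply, T.incl_pr, map_sub]
    have h : (LinearMap.id - (δ ∘ₗ η + η ∘ₗ δ) : B →ₗ[ℝ] B) ∘ₗ δ ∘ₗ incl = δ ∘ₗ incl := by
      ext x
      simp [T.ηδ_incl, T.δ_sq]
    rw [comp_ofLinear, h]
    simp

end IdealTransfer

end Transfer

/-! ### Smooth sections along maps -/

section Along

open Filter Topology

/-- If smooth vectors `a j p` are linearly independent at `p₀`, the coefficients of a smooth linear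
combination of them are smooth at `p₀`. -/
lemma contMDiffWithinAt_coeff
    {EP : Type*} [NormedAddCommGroup EP] [NormedSpace ℝ EP]
    {P : Type*} [TopologicalSpace P] [ChartedSpace EP P]
    {F : Type*} [NormedAddCommGroup F] [NormedSpace ℝ F] [FiniteDimensional ℝ F]
    {ι : Type*} [Fintype ι] {A : Set P} {p₀ : P} (hp₀ : p₀ ∈ A) {a : ι → P → F} {c : ι → P → ℝ}
    {s : P → F} (ha : ∀ j, ContMDiffWithinAt 𝓘(ℝ, EP) 𝓘(ℝ, F) ∞ (a j) A p₀)
    (hs : ContMDiffWithinAt 𝓘(ℝ, EP) 𝓘(ℝ, F) ∞ s A p₀)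
    (hli : LinearIndependent ℝ fun j => a j p₀)
    (h : ∀ᶠ p in 𝓝[A] p₀, ∑ j, c j p • a j p = s p) (j : ι) :
    ContMDiffWithinAt 𝓘(ℝ, EP) 𝓘(ℝ, ℝ) ∞ (c j) A p₀ := by
  classical
  obtain ⟨l, hl⟩ : ∃ l : F →ₗ[ℝ] (ι → ℝ), ∀ j, l (a j p₀) = Pi.single j 1 := by
    have hk := LinearMap.exists_leftInverse_of_injective
      (Fintype.linearCombination ℝ fun j => a j p₀)
      (LinearMap.ker_eq_bot.2 (linearIndependent_iff_injective_fintypeLinearCombination.1 hli))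
    obtain ⟨l, hl⟩ := hk
    refine ⟨l, fun j => ?_⟩
    have := LinearMap.congr_fun hl (Pi.single j 1)
    simpa [Fintype.linearCombination_apply, Pi.single_apply] using this
  let L : F →L[ℝ] (ι → ℝ) := LinearMap.toContinuousLinearMap l
  have hL : ∀ x, L x = l x := fun x => rfl
  -- the matrix of the vectors `a j p` in the coordinates `l`
  let m : P → (ι → ℝ) →L[ℝ] (ι → ℝ) := fun p =>
    ∑ j, ContinuousLinearMap.smulRightL ℝ (ι → ℝ) (ι → ℝ)
      (ContinuousLinearMap.proj (R := ℝ) (φ := fun _ : ι => ℝ) j) (L (a j p))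
  have hm_apply : ∀ p (x : ι → ℝ), m p x = ∑ j, x j • L (a j p) := fun p x => by
    simp [m]
  have hm : ContMDiffWithinAt 𝓘(ℝ, EP) 𝓘(ℝ, (ι → ℝ) →L[ℝ] (ι → ℝ)) ∞ m A p₀ := by
    refine ContMDiffWithinAt.sum fun j _ => ?_
    exact ((ContinuousLinearMap.contMDiff (L := (ContinuousLinearMap.smulRightL ℝ (ι → ℝ) (ι → ℝ)
      (ContinuousLinearMap.proj (R := ℝ) (φ := fun _ : ι => ℝ) j)).comp L)).contMDiffAt).comp_contMDiffWithinAt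
      p₀ (ha j)
  have hm0 : m p₀ = (ContinuousLinearEquiv.refl ℝ (ι → ℝ) : (ι → ℝ) →L[ℝ] (ι → ℝ)) := by
    ext x i
    rw [hm_apply]
    simp [hL, hl, Pi.single_apply]
  have hinv : ContMDiffWithinAt 𝓘(ℝ, EP) 𝓘(ℝ, (ι → ℝ) →L[ℝ] (ι → ℝ)) ∞
      (fun p => ContinuousLinearMap.inverse (m p)) A p₀ := by
    refine ContMDiffAt.comp_contMDiffWithinAt (g := ContinuousLinearMap.inverse) p₀ ?_ hm
    rw [hm0]
    exact (contDiffAt_map_inverse _).contMDiffAt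
  have hLs : ContMDiffWithinAt 𝓘(ℝ, EP) 𝓘(ℝ, ι → ℝ) ∞ (fun p => L (s p)) A p₀ :=
    (L.contMDiff.contMDiffAt).comp_contMDiffWithinAt p₀ hs
  have hc : ContMDiffWithinAt 𝓘(ℝ, EP) 𝓘(ℝ, ℝ) ∞
      (fun p => ContinuousLinearMap.inverse (m p) (L (s p)) j) A p₀ :=
    ((ContinuousLinearMap.proj (R := ℝ) (φ := fun _ : ι => ℝ) j).contMDiff.contMDiffAt).comp_contMDiffWithinAt
      p₀ (hinv.clm_apply hLs)
  have hev : ∀ᶠ p in 𝓝[A] p₀, ∃ e : (ι → ℝ) ≃L[ℝ] (ι → ℝ), (e : (ι → ℝ) →L[ℝ] (ι → ℝ)) = m p := by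
    have h1 := ContinuousLinearEquiv.nhds (ContinuousLinearEquiv.refl ℝ (ι → ℝ))
    rw [← hm0] at h1
    exact hm.continuousWithinAt h1
  have key : ∀ᶠ p in 𝓝[A] p₀, c j p = ContinuousLinearMap.inverse (m p) (L (s p)) j := by
    filter_upwards [hev, h] with p ⟨e, he⟩ hp
    have h2 : L (s p) = m p (fun j => c j p) := by
      rw [hm_apply, ← hp, map_sum]
      simp
    rw [h2, ← he, ContinuousLinearMap.inverse_equiv]
    simp
  exact hc.congr_of_eventuallyEq key (key.self_of_nhdsWithin hp₀)

variable {EP : Type*} [NormedAddCommGroup EP] [NormedSpace ℝ EP]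
  {P : Type*} [TopologicalSpace P] [ChartedSpace EP P]
  {EQ : Type*} [NormedAddCommGroup EQ] [NormedSpace ℝ EQ]
  {Q : Type*} [TopologicalSpace Q] [ChartedSpace EQ Q]
  {EM : Type*} [NormedAddCommGroup EM] [NormedSpace ℝ EM]
  {M : Type*} [TopologicalSpace M] [ChartedSpace EM M]
  {FM : Type*} [NormedAddCommGroup FM] [NormedSpace ℝ FM]
  {V : M → Type*} [∀ p, AddCommGroup (V p)] [∀ p, Module ℝ (V p)]
  [TopologicalSpace (TotalSpace FM V)] [∀ p, TopologicalSpace (V p)] [FiberBundle FM V]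

variable (EP EM FM) in
/-- The section `s` of `V` along the map `b` is smooth at `p₀` within `A`. -/
def SmoothAlong (b : P → M) (A : Set P) (p₀ : P) (s : ∀ p, V (b p)) : Prop :=
  ContMDiffWithinAt 𝓘(ℝ, EP) (𝓘(ℝ, EM).prod 𝓘(ℝ, FM)) ∞
    (fun p => TotalSpace.mk' FM (b p) (s p)) A p₀

variable {b : P → M} {A : Set P} {p₀ : P} {s t : ∀ p, V (b p)}

namespace SmoothAlong

lemma mono {A' : Set P} (hs : SmoothAlong EP EM FM b A p₀ s) (h : A' ⊆ A) :
    SmoothAlong EP EM FM b A' p₀ s := ContMDiffWithinAt.mono hs h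

lemma mono_of_mem {A' : Set P} (hs : SmoothAlong EP EM FM b A p₀ s) (h : A ∈ 𝓝[A'] p₀) :
    SmoothAlong EP EM FM b A' p₀ s := ContMDiffWithinAt.mono_of_mem_nhdsWithin hs h

lemma congr (hs : SmoothAlong EP EM FM b A p₀ s) (hp : p₀ ∈ A) (h : ∀ᶠ p in 𝓝[A] p₀, t p = s p) :
    SmoothAlong EP EM FM b A p₀ t := by
  refine ContMDiffWithinAt.congr_of_eventuallyEq hs ?_ ?_
  · filter_upwards [h] with p hp
    rw [hp]
  · rw [h.self_of_nhdsWithin hp]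

lemma comp {A' : Set Q} {q₀ : Q} {g : Q → P} {s : ∀ p, V (b p)}
    (hs : SmoothAlong EP EM FM b A (g q₀) s)
    (hg : ContMDiffWithinAt 𝓘(ℝ, EQ) 𝓘(ℝ, EP) ∞ g A' q₀) (h : MapsTo g A' A) :
    SmoothAlong EQ EM FM (b ∘ g) A' q₀ (fun q => s (g q)) :=
  ContMDiffWithinAt.comp q₀ (g := fun p => TotalSpace.mk' FM (b p) (s p)) hs hg h

section

variable [VectorBundle ℝ FM V]

lemma base (hs : SmoothAlong EP EM FM b A p₀ s) :
    ContMDiffWithinAt 𝓘(ℝ, EP) 𝓘(ℝ, EM) ∞ b A p₀ := (contMDiffWithinAt_totalSpace.1 hs).1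

lemma eventually_mem_baseSet (hb : ContMDiffWithinAt 𝓘(ℝ, EP) 𝓘(ℝ, EM) ∞ b A p₀) :
    ∀ᶠ p in 𝓝[A] p₀, b p ∈ (trivializationAt FM V (b p₀)).baseSet :=
  hb.continuousWithinAt ((trivializationAt FM V (b p₀)).open_baseSet.mem_nhds
    (mem_baseSet_trivializationAt FM V (b p₀)))

/-- Smoothness of a section along a map, in a local trivialization. -/
lemma iff_linearMapAt (hb : ContMDiffWithinAt 𝓘(ℝ, EP) 𝓘(ℝ, EM) ∞ b A p₀) :
    SmoothAlong EP EM FM b A p₀ s ↔ ContMDiffWithinAt 𝓘(ℝ, EP) 𝓘(ℝ, FM) ∞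
      (fun p => (trivializationAt FM V (b p₀)).linearMapAt ℝ (b p) (s p)) A p₀ := by
  unfold SmoothAlong
  rw [contMDiffWithinAt_totalSpace, and_iff_right hb]
  refine Filter.EventuallyEq.contMDiffWithinAt_iff ?_ ?_
  · filter_upwards [eventually_mem_baseSet (FM := FM) (V := V) hb] with p hp
    rw [Trivialization.coe_linearMapAt_of_mem _ hp]
  · rw [Trivialization.coe_linearMapAt_of_mem _ (mem_baseSet_trivializationAt FM V (b p₀))]

lemma linearMapAt (hs : SmoothAlong EP EM FM b A p₀ s) : ContMDiffWithinAt 𝓘(ℝ, EP) 𝓘(ℝ, FM) ∞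
      (fun p => (trivializationAt FM V (b p₀)).linearMapAt ℝ (b p) (s p)) A p₀ :=
  (iff_linearMapAt hs.base).1 hs

lemma zero (hb : ContMDiffWithinAt 𝓘(ℝ, EP) 𝓘(ℝ, EM) ∞ b A p₀) :
    SmoothAlong EP EM FM b A p₀ (fun p => (0 : V (b p))) := by
  rw [iff_linearMapAt hb]
  simpa using contMDiffWithinAt_const

lemma add (hs : SmoothAlong EP EM FM b A p₀ s) (ht : SmoothAlong EP EM FM b A p₀ t) :
    SmoothAlong EP EM FM b A p₀ (fun p => s p + t p) := by
  rw [iff_linearMapAt hs.base]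
  simp only [map_add]
  exact hs.linearMapAt.add ht.linearMapAt

lemma smul {c : P → ℝ} (hc : ContMDiffWithinAt 𝓘(ℝ, EP) 𝓘(ℝ, ℝ) ∞ c A p₀)
    (hs : SmoothAlong EP EM FM b A p₀ s) :
    SmoothAlong EP EM FM b A p₀ (fun p => c p • s p) := by
  rw [iff_linearMapAt hs.base]
  simp only [map_smul]
  exact hc.smul hs.linearMapAt

lemma neg (hs : SmoothAlong EP EM FM b A p₀ s) : SmoothAlong EP EM FM b A p₀ (fun p => -s p) := by
  simpa using hs.smul (contMDiffWithinAt_const (c := (-1 : ℝ)))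

lemma sub (hs : SmoothAlong EP EM FM b A p₀ s) (ht : SmoothAlong EP EM FM b A p₀ t) :
    SmoothAlong EP EM FM b A p₀ (fun p => s p - t p) := by
  simpa [sub_eq_add_neg] using hs.add ht.neg

lemma sum {ι : Type*} (I : Finset ι) {s : ι → ∀ p, V (b p)}
    (hb : ContMDiffWithinAt 𝓘(ℝ, EP) 𝓘(ℝ, EM) ∞ b A p₀)
    (hs : ∀ i ∈ I, SmoothAlong EP EM FM b A p₀ (s i)) :
    SmoothAlong EP EM FM b A p₀ (fun p => ∑ i ∈ I, s i p) := by
  rw [iff_linearMapAt hb]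
  simpa using ContMDiffWithinAt.sum fun i hi => (hs i hi).linearMapAt

lemma linearIndependent_linearMapAt {ι : Type*} {q q₀ : M} {v : ι → V q}
    (hq : q ∈ (trivializationAt FM V q₀).baseSet) :
    LinearIndependent ℝ (fun j => (trivializationAt FM V q₀).linearMapAt ℝ q (v j)) ↔
      LinearIndependent ℝ v := by
  have h : LinearMap.ker ((trivializationAt FM V q₀).linearMapAt ℝ q) = ⊥ :=
    LinearMap.ker_eq_bot.2 (Function.LeftInverse.injective
      (Trivialization.symmₗ_linearMapAt _ hq))
  exact LinearMap.linearIndependent_iff ((trivializationAt FM V q₀).linearMapAt ℝ q) h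

variable [FiniteDimensional ℝ FM]

lemma coeff {ι : Type*} [Fintype ι] (hp : p₀ ∈ A) {a : ι → ∀ p, V (b p)} {c : ι → P → ℝ}
    (ha : ∀ j, SmoothAlong EP EM FM b A p₀ (a j)) (hs : SmoothAlong EP EM FM b A p₀ s)
    (hli : LinearIndependent ℝ fun j => a j p₀)
    (h : ∀ᶠ p in 𝓝[A] p₀, ∑ j, c j p • a j p = s p) (j : ι) :
    ContMDiffWithinAt 𝓘(ℝ, EP) 𝓘(ℝ, ℝ) ∞ (c j) A p₀ := by
  refine contMDiffWithinAt_coeff hp (fun j => (ha j).linearMapAt) hs.linearMapAt ?_ ?_ j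
  · exact (linearIndependent_linearMapAt (mem_baseSet_trivializationAt FM V (b p₀))).2 hli
  · filter_upwards [h] with p hp
    rw [← hp]
    simp

lemma eventually_linearIndependent {ι : Type*} [Finite ι] {a : ι → ∀ p, V (b p)}
    (hb : ContMDiffWithinAt 𝓘(ℝ, EP) 𝓘(ℝ, EM) ∞ b A p₀)
    (ha : ∀ j, SmoothAlong EP EM FM b A p₀ (a j))
    (hli : LinearIndependent ℝ fun j => a j p₀) :
    ∀ᶠ p in 𝓝[A] p₀, LinearIndependent ℝ fun j => a j p := by
  have h1 : ∀ᶠ p in 𝓝[A] p₀, LinearIndependent ℝ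
      (fun j => (trivializationAt FM V (b p₀)).linearMapAt ℝ (b p) (a j p)) := by
    have h2 : Tendsto (fun p j => (trivializationAt FM V (b p₀)).linearMapAt ℝ (b p) (a j p))
        (𝓝[A] p₀) (𝓝 (fun j => (trivializationAt FM V (b p₀)).linearMapAt ℝ (b p₀) (a j p₀))) :=
      tendsto_pi_nhds.2 fun j => (ha j).linearMapAt.continuousWithinAt
    exact h2 (isOpen_setOfPred_linearIndependent.mem_nhds
      ((linearIndependent_linearMapAt (mem_baseSet_trivializationAt FM V (b p₀))).2 hli))
  filter_upwards [h1, eventually_mem_baseSet (FM := FM) (V := V) hb] with p hp hp'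
  exact (linearIndependent_linearMapAt hp').1 hp

end

end SmoothAlong

end Along

/-! ### Local frames of subbundles -/

section Frames

open Filter Topology

/-- The element `x` of `S`, and `0` if `x` does not belong to `S`. -/
def Submodule.clip {E : Type*} [AddCommGroup E] [Module ℝ E] (S : Submodule ℝ E) (x : E) : S := by
  classical
  exact if h : x ∈ S then ⟨x, h⟩ else 0

lemma Submodule.coe_clip {E : Type*} [AddCommGroup E] [Module ℝ E] {S : Submodule ℝ E} {x : E}
    (h : x ∈ S) : (S.clip x : E) = x := by
  simp [Submodule.clip, h]

/-- Every finite family of vectors has a linearly independent subfamily with the same span. -/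
lemma exists_subfamily_linearIndependent {E ι : Type*} [AddCommGroup E] [Module ℝ E] (v : ι → E) :
    ∃ J : Set ι, LinearIndependent ℝ (fun j : J => v j) ∧
      Submodule.span ℝ (range fun j : J => v j) = Submodule.span ℝ (range v) := by
  obtain ⟨κ, a, ha, hs, hl⟩ := exists_linearIndependent' ℝ v
  refine ⟨range a, ?_, ?_⟩
  · rw [← linearIndependent_equiv (Equiv.ofInjective a ha)]
    exact hl
  · rw [← hs]
    congr 1
    ext x
    simp

section LinearAlgebra

variable {E F ι : Type*} [AddCommGroup E] [Module ℝ E] [AddCommGroup F] [Module ℝ F] [Fintype ι]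

/-- If the images under `B` of the members `e j`, `j ∈ J`, of a basis are a basis of the range of
`B`, then the vectors `e i - ∑ b i j • e j`, `i ∉ J`, that belong to the kernel are a basis of the
kernel. -/
lemma linearIndependent_span_ker {e : ι → E} (hl : LinearIndependent ℝ e)
    (hs : Submodule.span ℝ (range e) = ⊤) (B : E →ₗ[ℝ] F) (J : Set ι) [Fintype J]
    (hJ : LinearIndependent ℝ fun j : J => B (e j)) (b : ι → J → ℝ)
    (hb : ∀ i, ∑ j, b i j • B (e j) = B (e i)) :
    LinearIndependent ℝ (fun i : ↥Jᶜ => e i - ∑ j, b i j • e j) ∧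
      Submodule.span ℝ (range fun i : ↥Jᶜ => e i - ∑ j, b i j • e j) = LinearMap.ker B := by
  classical
  let bas : Module.Basis ι ℝ E := Module.Basis.mk hl hs.ge
  have hbas : ∀ i, bas i = e i := fun i => Module.Basis.mk_apply hl hs.ge i
  have hc : ∀ i j, bas.coord i (e j) = if j = i then 1 else 0 := fun i j => by
    rw [← hbas, Module.Basis.coord_apply, Module.Basis.repr_self_apply]
  have hk : ∀ i i' : ↥Jᶜ, bas.coord i (e i' - ∑ j, b i' j • e j) = if i' = i then 1 else 0 := by
    intro i i'
    rw [map_sub, map_sum, hc]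
    have : ∀ j : J, bas.coord i (b i' j • e j) = 0 := fun j => by
      rw [map_smul, hc, if_neg, smul_zero]
      intro h
      exact i.2 (h ▸ j.2)
    simp [this, Subtype.ext_iff]
  constructor
  · rw [Fintype.linearIndependent_iff]
    intro c h0 i
    have := congrArg (bas.coord i) h0
    rw [map_sum] at this
    simpa [-map_sub, map_smul, hk] using this
  · apply le_antisymm
    · rw [Submodule.span_le]
      rintro _ ⟨i, rfl⟩
      simp [map_sum, hb i]
    · intro x hx
      set y := x - ∑ i : ↥Jᶜ, bas.coord i x • (e i - ∑ j, b i j • e j) with hy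
      have hyk : B y = 0 := by
        rw [hy, map_sub, map_sum, LinearMap.mem_ker.1 hx]
        simp [map_sum, hb]
      have hyc : ∀ i : ↥Jᶜ, bas.coord i y = 0 := fun i => by
        rw [hy, map_sub, map_sum]
        simp [-map_sub, map_smul, hk]
      have hys : y = ∑ j : J, bas.coord j y • e j := by
        conv_lhs => rw [← bas.sum_repr y]
        rw [← Fintype.sum_subtype_add_sum_subtype (fun i => i ∈ J)]
        have : ∑ i : {x // x ∉ J}, bas.repr y i • bas i = 0 :=
          Finset.sum_eq_zero fun i _ => by
            have := hyc ⟨i.1, i.2⟩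
            rw [Module.Basis.coord_apply] at this
            rw [this, zero_smul]
        rw [this, add_zero]
        exact Finset.sum_congr (by ext; simp) fun j _ => by rw [hbas, Module.Basis.coord_apply]
      have hy0 : y = 0 := by
        rw [hys, map_sum] at hyk
        simp only [map_smul] at hyk
        have := Fintype.linearIndependent_iff.1 hJ _ hyk
        rw [hys]
        exact Finset.sum_eq_zero fun j _ => by rw [this j, zero_smul]
      have : x = ∑ i : ↥Jᶜ, bas.coord i x • (e i - ∑ j, b i j • e j) := by
        rw [← sub_eq_zero, ← hy, hy0]
      rw [this]
      exact Submodule.sum_mem _ fun i _ => Submodule.smul_mem _ _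
        (Submodule.subset_span (mem_range_self i))

end LinearAlgebra

variable {EP : Type*} [NormedAddCommGroup EP] [NormedSpace ℝ EP]
  {P : Type*} [TopologicalSpace P] [ChartedSpace EP P]
  {EM : Type*} [NormedAddCommGroup EM] [NormedSpace ℝ EM]
  {M : Type*} [TopologicalSpace M] [ChartedSpace EM M]
  {FM : Type*} [NormedAddCommGroup FM] [NormedSpace ℝ FM]
  {V : M → Type*} [∀ p, AddCommGroup (V p)] [∀ p, Module ℝ (V p)]
  [TopologicalSpace (TotalSpace FM V)] [∀ p, TopologicalSpace (V p)] [FiberBundle FM V]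
  {EN : Type*} [NormedAddCommGroup EN] [NormedSpace ℝ EN]
  {N : Type*} [TopologicalSpace N] [ChartedSpace EN N]
  {FN : Type*} [NormedAddCommGroup FN] [NormedSpace ℝ FN]
  {W : N → Type*} [∀ q, AddCommGroup (W q)] [∀ q, Module ℝ (W q)]
  [TopologicalSpace (TotalSpace FN W)] [∀ q, TopologicalSpace (W q)] [FiberBundle FN W]

variable (EM FM) in
/-- The sections `e j` of `S` are smooth near `p₀` within `A`, and a basis at each point. -/
structure IsFrameAt (A : Set M) (S : ∀ p, Submodule ℝ (V p)) (p₀ : M) {ι : Type*}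
    (e : ι → ∀ p, S p) : Prop where
  smooth : ∀ᶠ q in 𝓝[A] p₀, ∀ j, SmoothAlong EM EM FM id A q (fun p => (e j p : V p))
  indep : ∀ᶠ q in 𝓝[A] p₀, LinearIndependent ℝ fun j => e j q
  span : ∀ᶠ q in 𝓝[A] p₀, Submodule.span ℝ (range fun j => e j q) = ⊤

/-- A frame of `S`, from sections of `V` that take their values in `S` near `p₀`. -/
lemma isFrameAt_clip {A : Set M} {S : ∀ p, Submodule ℝ (V p)} {p₀ : M} {ι : Type*}
    {v : ι → ∀ p, V p} (hv : ∀ᶠ q in 𝓝[A] p₀, ∀ j, SmoothAlong EM EM FM id A q (v j))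
    (hl : ∀ᶠ q in 𝓝[A] p₀, LinearIndependent ℝ fun j => v j q)
    (hs : ∀ᶠ q in 𝓝[A] p₀, Submodule.span ℝ (range fun j => v j q) = S q) :
    IsFrameAt EM FM A S p₀ (fun j q => (S q).clip (v j q)) := by
  have hcoe : ∀ᶠ q in 𝓝[A] p₀, ∀ j, ((S q).clip (v j q) : V q) = v j q := by
    filter_upwards [hs] with q hq j
    refine Submodule.coe_clip ?_
    rw [← hq]
    exact Submodule.subset_span (mem_range_self j)
  refine ⟨?_, ?_, ?_⟩
  · filter_upwards [hv, eventually_eventually_nhdsWithin.2 hcoe, eventually_mem_nhdsWithin]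
      with q h1 h2 h3 j
    exact (h1 j).congr h3 (h2.mono fun p hp => hp j)
  · filter_upwards [hl, hcoe] with q h1 h2
    refine LinearIndependent.of_comp (S q).subtype ?_
    convert! h1 using 2 with j
    exact h2 j
  · filter_upwards [hs, hcoe] with q h1 h2
    apply Submodule.map_injective_of_injective (S q).injective_subtype
    rw [Submodule.map_span, ← range_comp, Submodule.map_top, Submodule.range_subtype]
    refine Eq.trans ?_ h1
    congr 2
    funext j
    exact h2 j

lemma isSmoothSubbundle_iff {A : Set M} {S : ∀ p, Submodule ℝ (V p)} :
    IsSmoothSubbundle EM FM A S ↔ ∀ p ∈ A, ∃ (ι : Type) (_ : Fintype ι) (e : ι → ∀ p, S p),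
      IsFrameAt EM FM A S p e := by
  constructor
  · intro h p hp
    obtain ⟨u, hu, hpu, r, s, hs, hs'⟩ := h p hp
    have hev : ∀ᶠ q in 𝓝[A] p, q ∈ A ∩ u :=
      eventually_mem_nhdsWithin.and (mem_nhdsWithin_of_mem_nhds (hu.mem_nhds hpu))
    refine ⟨Fin r, inferInstance, fun j q => (S q).clip (s j q), isFrameAt_clip ?_ ?_ ?_⟩
    · filter_upwards [hev] with q hq j
      have h1 : SmoothAlong EM EM FM id (A ∩ u) q (s j) := hs j q hq
      exact h1.mono_of_mem
        (inter_mem self_mem_nhdsWithin (mem_nhdsWithin_of_mem_nhds (hu.mem_nhds hq.2)))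
    · filter_upwards [hev] with q hq using (hs' q hq).1
    · filter_upwards [hev] with q hq using (hs' q hq).2
  · intro h p hp
    obtain ⟨ι, _, e, he⟩ := h p hp
    obtain ⟨u, h1, hu, hpu⟩ := eventually_nhds_iff.1
      (eventually_nhdsWithin_iff.1 (he.smooth.and (he.indep.and he.span)))
    refine ⟨u, hu, hpu, Fintype.card ι, fun j q => e ((Fintype.equivFin ι).symm j) q, ?_, ?_⟩
    · intro j q hq
      exact ((h1 q hq.2 hq.1).1 _).mono inter_subset_left
    · intro q hq
      obtain ⟨-, h2, h3⟩ := h1 q hq.2 hq.1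
      constructor
      · exact (h2.map' (S q).subtype (S q).ker_subtype).comp _ (Equiv.injective _)
      · have h4 := congrArg (Submodule.map (S q).subtype) h3
        rw [Submodule.map_span, ← range_comp, Submodule.map_top, Submodule.range_subtype] at h4
        rw [← h4]
        congr 1
        exact (Fintype.equivFin ι).symm.surjective.range_comp (fun j => (e j q : V q))

/-- A section of `S` along a map has smooth coefficients in a frame of `S`. -/
lemma IsFrameAt.exists_coeff [VectorBundle ℝ FM V] [FiniteDimensional ℝ FM] {Y : Set M}
    {S : ∀ p, Submodule ℝ (V p)} {ι : Type*} [Fintype ι] {b : P → M} {A : Set P} {p₀ : P}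
    (hp : p₀ ∈ A) {e : ι → ∀ p, S p} (he : IsFrameAt EM FM Y S (b p₀) e) (hbA : MapsTo b A Y)
    {s : ∀ p, S (b p)} (hs : SmoothAlong EP EM FM b A p₀ (fun p => (s p : V (b p)))) :
    ∃ c : ι → P → ℝ, (∀ j, ContMDiffWithinAt 𝓘(ℝ, EP) 𝓘(ℝ, ℝ) ∞ (c j) A p₀) ∧
      ∀ᶠ p in 𝓝[A] p₀, s p = ∑ j, c j p • e j (b p) := by
  classical
  have hb := hs.base
  have ht : Tendsto b (𝓝[A] p₀) (𝓝[Y] (b p₀)) := hb.continuousWithinAt.tendsto_nhdsWithin hbA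
  have h1 : ∀ᶠ p in 𝓝[A] p₀, ∃ c : ι → ℝ, ∑ j, c j • e j (b p) = s p := by
    filter_upwards [ht he.span] with p hp
    have h2 : s p ∈ Submodule.span ℝ (range fun j => e j (b p)) := by rw [hp]; trivial
    exact (Submodule.mem_span_range_iff_exists_fun ℝ).1 h2
  let c : ι → P → ℝ := fun j p =>
    if h : ∃ c : ι → ℝ, ∑ j, c j • e j (b p) = s p then h.choose j else 0
  have hc : ∀ᶠ p in 𝓝[A] p₀, s p = ∑ j, c j p • e j (b p) := by
    filter_upwards [h1] with p hp
    have := hp.choose_spec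
    simp only [c, dif_pos hp, this]
  refine ⟨c, fun j => ?_, hc⟩
  have h0 := he.smooth.self_of_nhdsWithin (hbA hp)
  refine SmoothAlong.coeff (a := fun j p => (e j (b p) : V (b p))) hp
    (fun j => (h0 j).comp hb hbA) hs ?_ ?_ j
  · exact (he.indep.self_of_nhdsWithin (hbA hp)).map' (S (b p₀)).subtype (S (b p₀)).ker_subtype
  · filter_upwards [hc] with p hp
    rw [hp]
    simp

/-- Smooth multilinear bundle maps send sections along a map to sections along a map. -/
lemma IsSmoothMultilinear.along [VectorBundle ℝ FM V] [FiniteDimensional ℝ FM] [VectorBundle ℝ FN W]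
    {Y : Set M} {S : ∀ p, Submodule ℝ (V p)} {f : M → N} {T : ∀ q, Submodule ℝ (W q)} {k : ℕ}
    {phi : ∀ p, MultilinearMap ℝ (fun _ : Fin k => S p) (T (f p))}
    (hphi : IsSmoothMultilinear EM FM EN FN Y S f T phi) (hS : IsSmoothSubbundle EM FM Y S)
    {b : P → M} {A : Set P} {p₀ : P} (hp : p₀ ∈ A)
    (hb : ContMDiffWithinAt 𝓘(ℝ, EP) 𝓘(ℝ, EM) ∞ b A p₀) (hbA : MapsTo b A Y)
    {s : Fin k → ∀ p, S (b p)}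
    (hs : ∀ j, SmoothAlong EP EM FM b A p₀ (fun p => (s j p : V (b p)))) :
    SmoothAlong EP EN FN (f ∘ b) A p₀ (fun p => (phi (b p) (fun j => s j p) : W (f (b p)))) := by
  classical
  obtain ⟨ι, _, e, he⟩ := isSmoothSubbundle_iff.1 hS (b p₀) (hbA hp)
  choose c hc hcs using fun j => he.exists_coeff hp hbA (hs j)
  obtain ⟨u, hsm, hu, hpu⟩ := eventually_nhds_iff.1 (eventually_nhdsWithin_iff.1 he.smooth)
  have h1 : ∀ J : Fin k → ι, SmoothAlong EM EN FN f Y (b p₀)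
      (fun q => (phi q (fun j => e (J j) q) : W (f q))) := fun J => by
    have h2 : SmoothAlong EM EN FN f (Y ∩ u) (b p₀)
      (fun q => (phi q (fun j => e (J j) q) : W (f q))) :=
      hphi u hu (fun j q => e (J j) q)
        (fun j q hq => (hsm q hq.2 hq.1 (J j)).mono inter_subset_left) (b p₀) ⟨hbA hp, hpu⟩
    exact h2.mono_of_mem (inter_mem self_mem_nhdsWithin (mem_nhdsWithin_of_mem_nhds (hu.mem_nhds hpu)))
  have h2 : ∀ J : Fin k → ι, SmoothAlong EP EN FN (f ∘ b) A p₀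
      (fun p => (phi (b p) (fun j => e (J j) (b p)) : W (f (b p)))) := fun J =>
    (h1 J).comp hb hbA
  have hbase : ContMDiffWithinAt 𝓘(ℝ, EP) 𝓘(ℝ, EN) ∞ (f ∘ b) A p₀ := by
    have h3 : SmoothAlong EM EN FN f (Y ∩ u) (b p₀) _ :=
      hphi u hu (fun j q => 0) (fun j q hq => SmoothAlong.zero contMDiffWithinAt_id) (b p₀) ⟨hbA hp, hpu⟩
    have h4 := h3.mono_of_mem
      (inter_mem self_mem_nhdsWithin (mem_nhdsWithin_of_mem_nhds (hu.mem_nhds hpu)) : Y ∩ u ∈ 𝓝[Y] (b p₀))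
    exact h4.base.comp p₀ hb hbA
  have h5 : SmoothAlong EP EN FN (f ∘ b) A p₀ (fun p => ∑ J : Fin k → ι,
      (∏ j, c j (J j) p) • (phi (b p) (fun j => e (J j) (b p)) : W (f (b p)))) := by
    refine SmoothAlong.sum _ hbase fun J _ => (h2 J).smul ?_
    exact contMDiffWithinAt_finsetProd fun j _ => hc j (J j)
  refine h5.congr hp ?_
  filter_upwards [eventually_all.2 hcs] with p hp
  have : (fun j => s j p) = fun j => ∑ i, c j i p • e i (b p) := funext hp
  rw [this, MultilinearMap.map_sum]
  simp only [MultilinearMap.map_smul_univ, Submodule.coe_sum, Submodule.coe_smul]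

/-- The kernel of a smooth family of linear maps of constant rank is a smooth subbundle. -/
lemma IsFrameAt.exists_frame_ker [VectorBundle ℝ FM V] {F : Type*}
    [NormedAddCommGroup F] [NormedSpace ℝ F] [FiniteDimensional ℝ F] {A : Set M}
    {S : ∀ p, Submodule ℝ (V p)} {p₀ : M} (hp : p₀ ∈ A) {ι : Type} [Fintype ι] {e : ι → ∀ p, S p}
    (he : IsFrameAt EM FM A S p₀ e) (B : ∀ p, S p →ₗ[ℝ] F)
    (hB : ∀ᶠ q in 𝓝[A] p₀, ∀ j,
      ContMDiffWithinAt 𝓘(ℝ, EM) 𝓘(ℝ, F) ∞ (fun p => B p (e j p)) A q) (r : ℕ)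
    (hr : ∀ᶠ q in 𝓝[A] p₀, Module.finrank ℝ (LinearMap.range (B q)) = r) :
    ∃ (κ : Type) (_ : Fintype κ) (k : κ → ∀ p, (LinearMap.ker (B p)).map (S p).subtype),
      IsFrameAt EM FM A (fun p => (LinearMap.ker (B p)).map (S p).subtype) p₀ k := by
  classical
  obtain ⟨J, hJ, hJs⟩ := exists_subfamily_linearIndependent (fun j => B p₀ (e j p₀))
  have hrange : ∀ᶠ q in 𝓝[A] p₀, LinearMap.range (B q) =
      Submodule.span ℝ (range fun j => B q (e j q)) := by
    filter_upwards [he.span] with q hq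
    rw [LinearMap.range_eq_map, ← hq, Submodule.map_span, ← range_comp]
    rfl
  have hcard : Fintype.card J = r := by
    rw [← finrank_span_eq_card hJ, hJs, ← hrange.self_of_nhdsWithin hp, hr.self_of_nhdsWithin hp]
  have hli : ∀ᶠ q in 𝓝[A] p₀, LinearIndependent ℝ (fun j : J => B q (e j q)) := by
    have h2 : Tendsto (fun q (j : J) => B q (e j q)) (𝓝[A] p₀) (𝓝 (fun j : J => B p₀ (e j p₀))) :=
      tendsto_pi_nhds.2 fun j => ((hB.self_of_nhdsWithin hp) j).continuousWithinAt
    exact h2 (isOpen_setOfPred_linearIndependent.mem_nhds hJ)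
  have hex : ∀ᶠ q in 𝓝[A] p₀, ∀ i, ∃ b : J → ℝ, ∑ j, b j • B q (e j q) = B q (e i q) := by
    filter_upwards [hli, hrange, hr] with q h1 h2 h3 i
    rw [← Submodule.mem_span_range_iff_exists_fun]
    have h4 : Submodule.span ℝ (range fun j : J => B q (e j q)) = LinearMap.range (B q) := by
      refine Submodule.eq_of_le_of_finrank_eq ?_ ?_
      · rw [Submodule.span_le]
        rintro _ ⟨j, rfl⟩
        exact LinearMap.mem_range_self _ _
      · rw [finrank_span_eq_card h1, hcard, h3]
    rw [h4]
    exact LinearMap.mem_range_self _ _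
  let b : ι → J → M → ℝ := fun i j q =>
    if h : ∃ b : J → ℝ, ∑ j, b j • B q (e j q) = B q (e i q) then h.choose j else 0
  have hb : ∀ᶠ q in 𝓝[A] p₀, ∀ i, ∑ j, b i j q • B q (e j q) = B q (e i q) := by
    filter_upwards [hex] with q hq i
    have := (hq i).choose_spec
    simp only [b, dif_pos (hq i), this]
  have hbs : ∀ᶠ q in 𝓝[A] p₀, ∀ i j, ContMDiffWithinAt 𝓘(ℝ, EM) 𝓘(ℝ, ℝ) ∞ (b i j) A q := by
    filter_upwards [hB, hli, eventually_eventually_nhdsWithin.2 hb, eventually_mem_nhdsWithin]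
      with q h1 h2 h3 h4 i j
    exact contMDiffWithinAt_coeff (a := fun (j : J) p => B p (e j p)) h4 (fun j => h1 j) (h1 i) h2
      (h3.mono fun p hp => hp i) j
  let w : ↥Jᶜ → ∀ q, S q := fun i q => e i q - ∑ j, b i j q • e j q
  have hw : ∀ᶠ q in 𝓝[A] p₀, LinearIndependent ℝ (fun i => w i q) ∧
      Submodule.span ℝ (range fun i => w i q) = LinearMap.ker (B q) := by
    filter_upwards [he.indep, he.span, hli, hb] with q h1 h2 h3 h4
    exact linearIndependent_span_ker h1 h2 (B q) J h3 (fun i j => b i j q) h4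
  refine ⟨↥Jᶜ, inferInstance, fun i q => ((LinearMap.ker (B q)).map (S q).subtype).clip (w i q),
    isFrameAt_clip (v := fun i q => (w i q : V q)) ?_ ?_ ?_⟩
  · filter_upwards [hbs, he.smooth] with q h1 h2 i
    have : (fun q => (w i q : V q)) = fun q => (e i q : V q) - ∑ j : J, b i j q • (e j q : V q) := by
      funext q
      simp [w]
    rw [this]
    exact (h2 i).sub (SmoothAlong.sum _ contMDiffWithinAt_id fun j _ => (h2 j).smul (h1 i j))
  · filter_upwards [hw] with q h1 using h1.1.map' (S q).subtype (S q).ker_subtype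
  · filter_upwards [hw] with q h1
    rw [← h1.2, Submodule.map_span, ← range_comp]
    rfl

/-- A smooth section along a map is smooth in every local trivialization at a point. -/
lemma SmoothAlong.linearMapAt_of_mem [VectorBundle ℝ FM V] [IsManifold 𝓘(ℝ, EM) ∞ M]
    [ContMDiffVectorBundle ∞ FM V 𝓘(ℝ, EM)] {b : P → M} {A : Set P} {p₀ : P} {s : ∀ p, V (b p)}
    (hs : SmoothAlong EP EM FM b A p₀ s) {q : M} (hq : b p₀ ∈ (trivializationAt FM V q).baseSet) :
    ContMDiffWithinAt 𝓘(ℝ, EP) 𝓘(ℝ, FM) ∞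
      (fun p => (trivializationAt FM V q).linearMapAt ℝ (b p) (s p)) A p₀ := by
  have h := (((trivializationAt FM V q).contMDiffWithinAt_iff (f := fun p => TotalSpace.mk' FM (b p) (s p))
    (by rwa [Trivialization.mem_source])).1 hs).2
  refine h.congr_of_eventuallyEq ?_ ?_
  · filter_upwards [hs.base.continuousWithinAt
      ((trivializationAt FM V q).open_baseSet.mem_nhds hq)] with p hp
    rw [Trivialization.coe_linearMapAt_of_mem _ hp]
  · rw [Trivialization.coe_linearMapAt_of_mem _ hq]

lemma IsFrameAt.of_eventuallyEq {A : Set M} {S S' : ∀ p, Submodule ℝ (V p)} {p₀ : M} {ι : Type*}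
    {e : ι → ∀ p, S p} (he : IsFrameAt EM FM A S p₀ e) (h : ∀ᶠ q in 𝓝[A] p₀, S' q = S q) :
    IsFrameAt EM FM A S' p₀ (fun j q => (S' q).clip (e j q)) := by
  refine isFrameAt_clip (v := fun j q => (e j q : V q)) he.smooth ?_ ?_
  · filter_upwards [he.indep] with q hq using hq.map' (S q).subtype (S q).ker_subtype
  · filter_upwards [he.span, h] with q h1 h2
    rw [h2]
    have h4 := congrArg (Submodule.map (S q).subtype) h1
    rwa [Submodule.map_span, ← range_comp, Submodule.map_top, Submodule.range_subtype] at h4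

/-- The kernel of a smooth bundle map of constant rank is a smooth subbundle. -/
lemma IsFrameAt.exists_frame_ker_bundle [VectorBundle ℝ FM V] [VectorBundle ℝ FN W]
    [FiniteDimensional ℝ FN] [IsManifold 𝓘(ℝ, EN) ∞ N] [ContMDiffVectorBundle ∞ FN W 𝓘(ℝ, EN)] {A : Set M}
    {S : ∀ p, Submodule ℝ (V p)} {p₀ : M} (hp : p₀ ∈ A) {ι : Type} [Fintype ι] {e : ι → ∀ p, S p}
    (he : IsFrameAt EM FM A S p₀ e) {f : M → N} (hf : ContMDiffWithinAt 𝓘(ℝ, EM) 𝓘(ℝ, EN) ∞ f A p₀)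
    (B : ∀ p, S p →ₗ[ℝ] W (f p))
    (hB : ∀ᶠ q in 𝓝[A] p₀, ∀ j, SmoothAlong EM EN FN f A q (fun p => B p (e j p))) (r : ℕ)
    (hr : ∀ᶠ q in 𝓝[A] p₀, Module.finrank ℝ (LinearMap.range (B q)) = r) :
    ∃ (κ : Type) (_ : Fintype κ) (k : κ → ∀ p, (LinearMap.ker (B p)).map (S p).subtype),
      IsFrameAt EM FM A (fun p => (LinearMap.ker (B p)).map (S p).subtype) p₀ k := by
  have hmem := SmoothAlong.eventually_mem_baseSet (FM := FN) (V := W) hf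
  have hinj : ∀ᶠ q in 𝓝[A] p₀, LinearMap.ker
      ((trivializationAt FN W (f p₀)).linearMapAt ℝ (f q)) = ⊥ := by
    filter_upwards [hmem] with q hq
    exact LinearMap.ker_eq_bot.2 (Function.LeftInverse.injective
      (Trivialization.symmₗ_linearMapAt _ hq))
  have h1 : ∀ᶠ q in 𝓝[A] p₀, ∀ j, ContMDiffWithinAt 𝓘(ℝ, EM) 𝓘(ℝ, FN) ∞
      (fun p => (((trivializationAt FN W (f p₀)).linearMapAt ℝ (f p)) ∘ₗ B p) (e j p)) A q := by
    filter_upwards [hB, hmem] with q h1 h2 j using (h1 j).linearMapAt_of_mem h2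
  have h2 : ∀ᶠ q in 𝓝[A] p₀, Module.finrank ℝ (LinearMap.range
      (((trivializationAt FN W (f p₀)).linearMapAt ℝ (f q)) ∘ₗ B q)) = r := by
    filter_upwards [hinj, hr] with q h1 h2
    rw [LinearMap.range_comp, ← h2]
    exact LinearEquiv.finrank_eq (Submodule.equivMapOfInjective _ (LinearMap.ker_eq_bot.1 h1) _).symm
  obtain ⟨κ, hκ, k, hk⟩ := he.exists_frame_ker hp _ h1 r h2
  refine ⟨κ, hκ, _, hk.of_eventuallyEq ?_⟩
  filter_upwards [hinj] with q hq
  rw [LinearMap.ker_comp_of_ker_eq_bot _ hq]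

/-- The rank of a smooth bundle map is lower semicontinuous. -/
lemma IsFrameAt.eventually_le_finrank_range [VectorBundle ℝ FM V] [VectorBundle ℝ FN W]
    [FiniteDimensional ℝ FN] {A : Set M}
    {S : ∀ p, Submodule ℝ (V p)} {p₀ : M} (hp : p₀ ∈ A) {ι : Type} [Fintype ι] {e : ι → ∀ p, S p}
    (he : IsFrameAt EM FM A S p₀ e) {f : M → N} (hf : ContMDiffWithinAt 𝓘(ℝ, EM) 𝓘(ℝ, EN) ∞ f A p₀)
    (B : ∀ p, S p →ₗ[ℝ] W (f p))
    (hB : ∀ j, SmoothAlong EM EN FN f A p₀ (fun p => B p (e j p))) :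
    ∀ᶠ q in 𝓝[A] p₀, Module.finrank ℝ (LinearMap.range (B p₀)) ≤
      Module.finrank ℝ (LinearMap.range (B q)) := by
  classical
  obtain ⟨J, hJ, hJs⟩ := exists_subfamily_linearIndependent (fun j => B p₀ (e j p₀))
  have hcard : Fintype.card J = Module.finrank ℝ (LinearMap.range (B p₀)) := by
    rw [← finrank_span_eq_card hJ, hJs, LinearMap.range_eq_map, ← he.span.self_of_nhdsWithin hp,
      Submodule.map_span, ← range_comp]
    rfl
  filter_upwards [SmoothAlong.eventually_linearIndependent hf (fun j : J => hB j) hJ, he.span]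
    with q hq h1
  have : Module.Finite ℝ (S q) :=
    Module.Finite.of_fg_top ((Submodule.fg_def).2 ⟨_, finite_range _, h1⟩)
  rw [← hcard, ← finrank_span_eq_card hq]
  refine Submodule.finrank_mono ?_
  rw [Submodule.span_le]
  rintro _ ⟨j, rfl⟩
  exact LinearMap.mem_range_self _ _

/-- The kernel of a smooth fibrewise idempotent is a smooth subbundle. -/
lemma IsSmoothSubbundle.ker_of_isIdempotent [VectorBundle ℝ FM V] [FiniteDimensional ℝ FM]
    [IsManifold 𝓘(ℝ, EM) ∞ M] [ContMDiffVectorBundle ∞ FM V 𝓘(ℝ, EM)] {A : Set M}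
    {S : ∀ p, Submodule ℝ (V p)} (hS : IsSmoothSubbundle EM FM A S) (R : ∀ p, S p →ₗ[ℝ] S p)
    (hR : ∀ p ∈ A, ∀ s : ∀ q, S q, SmoothAlong EM EM FM id A p (fun q => (s q : V q)) →
      SmoothAlong EM EM FM id A p (fun q => (R q (s q) : V q)))
    (hidem : ∀ p ∈ A, ∀ x, R p (R p x) = R p x) :
    IsSmoothSubbundle EM FM A (fun p => (LinearMap.ker (R p)).map (S p).subtype) := by
  rw [isSmoothSubbundle_iff] at hS ⊢
  intro p₀ hp
  obtain ⟨ι, _, e, he⟩ := hS p₀ hp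
  have hsm := he.smooth.self_of_nhdsWithin hp
  have hid : ContMDiffWithinAt 𝓘(ℝ, EM) 𝓘(ℝ, EM) ∞ (id : M → M) A p₀ := contMDiffWithinAt_id
  have hrange : ∀ q, ∀ B : S q →ₗ[ℝ] S q, Module.finrank ℝ (LinearMap.range ((S q).subtype ∘ₗ B)) =
      Module.finrank ℝ (LinearMap.range B) := fun q B => by
    rw [LinearMap.range_comp]
    exact LinearEquiv.finrank_eq
      (Submodule.equivMapOfInjective _ (S q).injective_subtype _).symm
  have h1 := he.eventually_le_finrank_range hp hid (fun q => (S q).subtype ∘ₗ R q)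
    (fun j => hR p₀ hp (e j) (hsm j))
  have h2 := he.eventually_le_finrank_range hp hid
    (fun q => (S q).subtype ∘ₗ (LinearMap.id - R q))
    (fun j => (hsm j).sub (hR p₀ hp (e j) (hsm j)))
  have hfin : ∀ᶠ q in 𝓝[A] p₀, Module.Finite ℝ (S q) := by
    filter_upwards [he.span] with q hq
    exact Module.Finite.of_fg_top ((Submodule.fg_def).2 ⟨_, finite_range _, hq⟩)
  have hdim : ∀ᶠ q in 𝓝[A] p₀, Module.finrank ℝ (S q) = Fintype.card ι := by
    filter_upwards [he.span, he.indep] with q h3 h4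
    rw [← finrank_top ℝ (S q), ← h3, finrank_span_eq_card h4]
  have hker : ∀ q ∈ A, LinearMap.range (LinearMap.id - R q) = LinearMap.ker (R q) := by
    intro q hq
    ext x
    constructor
    · rintro ⟨y, rfl⟩
      simp [hidem q hq]
    · intro hx
      exact ⟨x, by simp [LinearMap.mem_ker.1 hx]⟩
  have hsum : ∀ᶠ q in 𝓝[A] p₀, Module.finrank ℝ (LinearMap.range (R q)) +
      Module.finrank ℝ (LinearMap.range (LinearMap.id - R q)) = Fintype.card ι := by
    filter_upwards [hfin, hdim, eventually_mem_nhdsWithin] with q h3 h4 h5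
    rw [hker q h5, ← h4]
    exact LinearMap.finrank_range_add_finrank_ker (R q)
  have h0 := hsum.self_of_nhdsWithin hp
  obtain ⟨κ, hκ, k, hk⟩ := he.exists_frame_ker_bundle hp hid (fun q => (S q).subtype ∘ₗ R q)
    (by
      filter_upwards [he.smooth, eventually_mem_nhdsWithin] with q h3 h4 j
      exact hR q h4 (e j) (h3 j)) (Module.finrank ℝ (LinearMap.range (R p₀)))
    (by
      filter_upwards [h1, h2, hsum] with q h3 h4 h5
      have a1 := hrange q (R q)
      have a2 := hrange p₀ (R p₀)
      have a3 := hrange q (LinearMap.id - R q)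
      have a4 := hrange p₀ (LinearMap.id - R p₀)
      have h3' := a2.symm.le.trans (h3.trans a1.le)
      have h4' := a4.symm.le.trans (h4.trans a3.le)
      refine a1.trans ?_
      omega)
  refine ⟨κ, hκ, _, hk.of_eventuallyEq (Eventually.of_forall fun q => ?_)⟩
  rw [LinearMap.ker_comp_of_ker_eq_bot _ (S q).ker_subtype]

end Frames

/-! ### Smooth fibre metrics -/

section Metric

open Filter Topology

variable {EM : Type*} [NormedAddCommGroup EM] [NormedSpace ℝ EM]
  {M : Type*} [TopologicalSpace M] [ChartedSpace EM M]
  {FM : Type*} [NormedAddCommGroup FM] [NormedSpace ℝ FM]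
  {V : M → Type*} [∀ p, AddCommGroup (V p)] [∀ p, Module ℝ (V p)]
  [TopologicalSpace (TotalSpace FM V)] [∀ p, TopologicalSpace (V p)] [FiberBundle FM V]

variable (EM FM V) in
/-- A smooth family of scalar products on the fibres of `V`. -/
structure FibreMetric where
  form : ∀ p, V p →ₗ[ℝ] V p →ₗ[ℝ] ℝ
  symm : ∀ p x y, form p x y = form p y x
  pos : ∀ p x, x ≠ 0 → 0 < form p x x
  smooth : ∀ (A : Set M) (p : M) (s t : ∀ q, V q), SmoothAlong EM EM FM id A p s →
    SmoothAlong EM EM FM id A p t →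
    ContMDiffWithinAt 𝓘(ℝ, EM) 𝓘(ℝ, ℝ) ∞ (fun q => form q (s q) (t q)) A p

/-- Scalar products in local trivializations are glued by a partition of unity. -/
lemma exists_fibreMetric [FiniteDimensional ℝ EM] [IsManifold 𝓘(ℝ, EM) ∞ M] [T2Space M]
    [SecondCountableTopology M] [FiniteDimensional ℝ FM] [VectorBundle ℝ FM V]
    [ContMDiffVectorBundle ∞ FM V 𝓘(ℝ, EM)] : Nonempty (FibreMetric EM FM V) := by
  have : LocallyCompactSpace M := ChartedSpace.locallyCompactSpace EM M
  obtain ⟨ρ, hρ⟩ := SmoothPartitionOfUnity.exists_isSubordinate 𝓘(ℝ, EM) (s := (univ : Set M))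
    isClosed_univ (fun q : M => (trivializationAt FM V q).baseSet)
    (fun q => (trivializationAt FM V q).open_baseSet)
    (fun p _ => mem_iUnion.2 ⟨p, mem_baseSet_trivializationAt FM V p⟩)
  let L : FM →L[ℝ] EuclideanSpace ℝ (Fin (Module.finrank ℝ FM)) :=
    (toEuclidean : FM ≃L[ℝ] EuclideanSpace ℝ (Fin (Module.finrank ℝ FM)))
  have hL : ∀ x, L x = 0 → x = 0 := fun x hx =>
    (toEuclidean : FM ≃L[ℝ] EuclideanSpace ℝ (Fin (Module.finrank ℝ FM))).map_eq_zero_iff.1 hx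
  let B : M → ∀ p, V p →ₗ[ℝ] V p →ₗ[ℝ] ℝ := fun q p =>
    (innerₗ (EuclideanSpace ℝ (Fin (Module.finrank ℝ FM)))).compl₁₂
      (L.toLinearMap ∘ₗ (trivializationAt FM V q).linearMapAt ℝ p)
      (L.toLinearMap ∘ₗ (trivializationAt FM V q).linearMapAt ℝ p)
  have hB : ∀ q p x y, B q p x y = inner ℝ (L ((trivializationAt FM V q).linearMapAt ℝ p x))
      (L ((trivializationAt FM V q).linearMapAt ℝ p y)) := fun q p x y => rfl
  have hsum : ∀ p x y, (∑ q ∈ ρ.finsupport p, ρ q p • B q p) x y =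
      ∑ q ∈ ρ.finsupport p, ρ q p * B q p x y := fun p x y => by
    simp [LinearMap.sum_apply]
  refine ⟨⟨fun p => ∑ q ∈ ρ.finsupport p, ρ q p • B q p, fun p x y => ?_, fun p x hx => ?_,
    fun A p s t hs ht => ?_⟩⟩
  · rw [hsum, hsum]
    exact Finset.sum_congr rfl fun q _ => by rw [hB, hB, real_inner_comm]
  · rw [hsum]
    have hnn : ∀ q, 0 ≤ B q p x x := fun q => by
      rw [hB]
      exact real_inner_self_nonneg
    obtain ⟨q, hq⟩ := ρ.exists_pos_of_mem (mem_univ p)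
    refine Finset.sum_pos' (fun q _ => mul_nonneg (ρ.nonneg q p) (hnn q)) ⟨q, ?_, ?_⟩
    · rw [ρ.mem_finsupport]
      exact hq.ne'
    · refine mul_pos hq (lt_of_le_of_ne (hnn q) fun h => hx ?_)
      rw [hB, eq_comm, inner_self_eq_zero] at h
      have hmem : p ∈ (trivializationAt FM V q).baseSet :=
        hρ q (subset_tsupport _ hq.ne')
      have := hL _ h
      have h2 := Trivialization.symmₗ_linearMapAt (R := ℝ) (trivializationAt FM V q) hmem x
      rw [this, map_zero] at h2
      exact h2.symm
  · have hev : ∀ᶠ y in 𝓝[A] p, (∑ q ∈ ρ.finsupport y, ρ q y • B q y) (s y) (t y) =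
        ∑ q ∈ ρ.fintsupport p, ρ q y * B q y (s y) (t y) := by
      filter_upwards [mem_nhdsWithin_of_mem_nhds (ρ.eventually_finsupport_subset p)] with y hy
      rw [hsum]
      refine Finset.sum_subset hy fun q _ hq => ?_
      rw [ρ.mem_finsupport, Function.mem_support, not_not] at hq
      rw [hq, zero_mul]
    have hp : (∑ q ∈ ρ.finsupport p, ρ q p • B q p) (s p) (t p) =
        ∑ q ∈ ρ.fintsupport p, ρ q p * B q p (s p) (t p) := by
      rw [hsum]
      refine Finset.sum_subset (ρ.finsupport_subset_fintsupport p) fun q _ hq => ?_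
      rw [ρ.mem_finsupport, Function.mem_support, not_not] at hq
      rw [hq, zero_mul]
    refine ContMDiffWithinAt.congr_of_eventuallyEq ?_ hev hp
    refine contMDiffWithinAt_finsetSum fun q hq => ?_
    rw [ρ.mem_fintsupport_iff] at hq
    have hmem : id p ∈ (trivializationAt FM V q).baseSet := hρ q hq
    have h1 := hs.linearMapAt_of_mem hmem
    have h2 := ht.linearMapAt_of_mem hmem
    have h3 : ContMDiffWithinAt 𝓘(ℝ, EM) 𝓘(ℝ, ℝ) ∞ (fun y => ρ q y) A p :=
      (ρ q).contMDiff.contMDiffAt.contMDiffWithinAt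
    refine h3.mul ?_
    have h4 : ContDiff ℝ ∞ (fun z : FM × FM => (inner ℝ (L z.1) (L z.2) : ℝ)) :=
      (L.contDiff.comp contDiff_fst).inner ℝ (L.contDiff.comp contDiff_snd)
    exact (h4.contMDiff.contMDiffAt).comp_contMDiffWithinAt p (h1.prodMk_space h2)

end Metric

/-! ### Homogeneous components and graded frames -/

section BulletHom

variable {A B C : Type*} [AddCommGroup A] [Module ℝ A] [AddCommGroup B] [Module ℝ B]
  [AddCommGroup C] [Module ℝ C]

/-- For fixed degrees `d`, the map `x ↦ bullet psi phi d x` is multilinear. -/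
def bulletHom (psi : Operations B C) (phi : Operations A B) {n : ℕ} (d : Fin n → ℕ) :
    MultilinearMap ℝ (fun _ : Fin n => A) C :=
  have key : ∀ (c : OrderedFinpartition n) (x : Fin n → A) (i : Fin n) (z : A),
      (fun m => phi (c.partSize m) (fun j => Function.update x i z (c.emb m j))) =
        Function.update (fun m => phi (c.partSize m) (fun j => x (c.emb m j))) (c.index i)
          (phi (c.partSize (c.index i))
            (Function.update (fun j => x (c.emb (c.index i) j)) (c.invEmbedding i) z)) := by
    intro c x i z
    funext m
    by_cases hm : m = c.index i
    · subst hm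
      rw [Function.update_self]
      congr 1
      funext j
      by_cases hj : j = c.invEmbedding i
      · subst hj
        simp
      · rw [Function.update_of_ne hj, Function.update_of_ne]
        intro h
        exact hj ((c.emb_strictMono _).injective (by simpa using h))
    · rw [Function.update_of_ne hm]
      congr 1
      funext j
      rw [Function.update_of_ne]
      rintro rfl
      exact hm (index_emb c m j).symm
  MultilinearMap.mk' (bullet psi phi d)
    (fun x i y z => by
      unfold bullet
      rw [← Finset.sum_add_distrib]
      refine Finset.sum_congr rfl fun c _ => ?_
      rw [key, key, key, (phi _).map_update_add, (psi _).map_update_add, smul_add])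
    (fun x i a z => by
      unfold bullet
      rw [Finset.smul_sum]
      refine Finset.sum_congr rfl fun c _ => ?_
      rw [key, key, (phi _).map_update_smul, (psi _).map_update_smul, smul_comm])

@[simp] lemma bulletHom_apply (psi : Operations B C) (phi : Operations A B) {n : ℕ}
    (d : Fin n → ℕ) (x : Fin n → A) : bulletHom psi phi d x = bullet psi phi d x := rfl

end BulletHom

namespace LInftyBundle

open Filter Topology

variable {EM : Type*} [NormedAddCommGroup EM] [NormedSpace ℝ EM]
  {M : Type*} [TopologicalSpace M] [ChartedSpace EM M]
  {FM : Type*} [NormedAddCommGroup FM] [NormedSpace ℝ FM]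
  {V : M → Type*} [∀ p, AddCommGroup (V p)] [∀ p, Module ℝ (V p)]
  [TopologicalSpace (TotalSpace FM V)] [∀ p, TopologicalSpace (V p)] [FiberBundle FM V]
  {EN : Type*} [NormedAddCommGroup EN] [NormedSpace ℝ EN]
  {N : Type*} [TopologicalSpace N] [ChartedSpace EN N]
  {FN : Type*} [NormedAddCommGroup FN] [NormedSpace ℝ FN]
  {W : N → Type*} [∀ q, AddCommGroup (W q)] [∀ q, Module ℝ (W q)]
  [TopologicalSpace (TotalSpace FN W)] [∀ q, TopologicalSpace (W q)] [FiberBundle FN W]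
  {EP : Type*} [NormedAddCommGroup EP] [NormedSpace ℝ EP]
  {P : Type*} [TopologicalSpace P] [ChartedSpace EP P]
  {FP : Type*} [NormedAddCommGroup FP] [NormedSpace ℝ FP]
  {X : P → Type*} [∀ q, AddCommGroup (X q)] [∀ q, Module ℝ (X q)]
  [TopologicalSpace (TotalSpace FP X)] [∀ q, TopologicalSpace (X q)] [FiberBundle FP X]

variable (𝓛 : LInftyBundle EM FM V)

lemma grade_le_fib (p : M) (i : ℕ) : 𝓛.grade i p ≤ 𝓛.fib p := le_iSup (fun i => 𝓛.grade i p) i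

lemma map_gr (p : M) (i : ℕ) : (𝓛.gr p i).map (𝓛.fib p).subtype = 𝓛.grade i p := by
  refine (Submodule.map_comap_subtype _ _).trans (inf_eq_right.2 ?_)
  exact 𝓛.grade_le_fib p i

lemma mem_gr {p : M} {i : ℕ} {x : 𝓛.fib p} : x ∈ 𝓛.gr p i ↔ (x : V p) ∈ 𝓛.grade i p := Iff.rfl

lemma iSup_gr (p : M) : ⨆ i, 𝓛.gr p i = ⊤ := by
  apply Submodule.map_injective_of_injective (𝓛.fib p).injective_subtype
  rw [Submodule.map_iSup, Submodule.map_top, Submodule.range_subtype]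
  simp_rw [map_gr]

lemma gr_zero {p : M} (hp : p ∈ 𝓛.base) : 𝓛.gr p 0 = ⊥ := by
  rw [eq_bot_iff]
  intro x hx
  rw [mem_gr, 𝓛.grade_zero p hp, Submodule.mem_bot] at hx
  exact Subtype.ext hx

/-- A bound for the degrees of the graded bundle. -/
def bound : ℕ := 𝓛.bounded.choose

lemma gr_eq_bot {p : M} (hp : p ∈ 𝓛.base) {i : ℕ} (hi : 𝓛.bound < i) : 𝓛.gr p i = ⊥ := by
  rw [eq_bot_iff]
  intro x hx
  rw [mem_gr, 𝓛.bounded.choose_spec i hi p hp, Submodule.mem_bot] at hx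
  exact Subtype.ext hx

lemma isCompl_gr {p : M} (hp : p ∈ 𝓛.base) (i : ℕ) :
    IsCompl (𝓛.gr p i) (⨆ j, ⨆ (_ : j ≠ i), 𝓛.gr p j) := by
  constructor
  · rw [Submodule.disjoint_def]
    intro x hx hx'
    have h1 := Submodule.mem_map_of_mem (f := (𝓛.fib p).subtype) hx'
    simp_rw [Submodule.map_iSup, map_gr] at h1
    have h2 := Submodule.disjoint_def.1 (𝓛.independent p hp i) (x : V p) hx h1
    exact Subtype.ext h2
  · rw [codisjoint_iff, eq_top_iff, ← 𝓛.iSup_gr p]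
    refine iSup_le fun j => ?_
    by_cases hj : j = i
    · subst hj
      exact le_sup_left
    · exact le_sup_of_le_right (le_iSup₂_of_le j hj le_rfl)

/-- The projection of the fibre to its part of degree `i`. -/
def proj (p : M) (i : ℕ) : 𝓛.fib p →ₗ[ℝ] 𝓛.fib p := by
  classical
  exact if h : IsCompl (𝓛.gr p i) (⨆ j, ⨆ (_ : j ≠ i), 𝓛.gr p j) then Submodule.projection _ _ h
    else 0

section Proj

variable {𝓛} {p : M} (hp : p ∈ 𝓛.base)
include hp

lemma proj_of_mem {i : ℕ} {x : 𝓛.fib p} (hx : x ∈ 𝓛.gr p i) : 𝓛.proj p i x = x := by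
  rw [proj, dif_pos (𝓛.isCompl_gr hp i)]
  exact Submodule.projection_apply_of_mem_left _ hx

lemma proj_of_mem_ne {i j : ℕ} (hij : j ≠ i) {x : 𝓛.fib p} (hx : x ∈ 𝓛.gr p j) :
    𝓛.proj p i x = 0 := by
  rw [proj, dif_pos (𝓛.isCompl_gr hp i)]
  exact Submodule.projection_apply_of_mem_right _ (Submodule.mem_iSup_of_mem j
    (Submodule.mem_iSup_of_mem hij hx))

lemma proj_mem (i : ℕ) (x : 𝓛.fib p) : 𝓛.proj p i x ∈ 𝓛.gr p i := by
  rw [proj, dif_pos (𝓛.isCompl_gr hp i)]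
  exact Submodule.projection_apply_mem _ x

end Proj

/-- Induction on the fibre: a property of homogeneous elements that is stable under sums holds
everywhere. -/
lemma fib_induction {p : M} {C : 𝓛.fib p → Prop} (h : ∀ i, ∀ x ∈ 𝓛.gr p i, C x)
    (h0 : C 0) (hadd : ∀ x y, C x → C y → C (x + y)) (x : 𝓛.fib p) : C x := by
  have hx : x ∈ ⨆ i, 𝓛.gr p i := by rw [𝓛.iSup_gr p]; trivial
  exact Submodule.iSup_induction _ (motive := C) hx h h0 hadd

lemma linearMap_ext {B : Type*} [AddCommGroup B] [Module ℝ B] {p : M} {g g' : 𝓛.fib p →ₗ[ℝ] B}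
    (h : ∀ i, ∀ x ∈ 𝓛.gr p i, g x = g' x) : g = g' :=
  LinearMap.ext fun x => 𝓛.fib_induction (C := fun x => g x = g' x) h (by simp)
    (fun x y hx hy => by rw [map_add, map_add, hx, hy]) x

lemma mem_iSup_gr {p : M} (x : 𝓛.fib p) : x ∈ ⨆ i, 𝓛.gr p i := by rw [𝓛.iSup_gr p]; trivial

lemma sum_proj {p : M} (hp : p ∈ 𝓛.base) (x : 𝓛.fib p) :
    ∑ i ∈ Finset.range (𝓛.bound + 1), 𝓛.proj p i x = x := by
  refine 𝓛.fib_induction (C := fun x => ∑ i ∈ Finset.range (𝓛.bound + 1), 𝓛.proj p i x = x)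
    (fun i x hx => ?_) (by simp) (fun x y hx hy => ?_) x
  · by_cases hi : i < 𝓛.bound + 1
    · rw [Finset.sum_eq_single i, proj_of_mem hp hx]
      · intro j _ hj
        exact proj_of_mem_ne hp hj.symm hx
      · intro h
        exact absurd (Finset.mem_range.2 hi) h
    · rw [𝓛.gr_eq_bot hp (by omega), Submodule.mem_bot] at hx
      simp [hx]
  · simp only [map_add, Finset.sum_add_distrib]
    rw [hx, hy]

/-- Two multilinear maps that agree on homogeneous elements agree. -/
lemma multilinearMap_ext {B : Type*} [AddCommGroup B] [Module ℝ B] {p : M} {k : ℕ}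
    {g g' : MultilinearMap ℝ (fun _ : Fin k => 𝓛.fib p) B}
    (h : ∀ (d : Fin k → ℕ) (x : Fin k → 𝓛.fib p), (∀ j, x j ∈ 𝓛.gr p (d j)) → g x = g' x) :
    g = g' := by
  ext x
  rw [← sub_eq_zero, ← Submodule.mem_bot ℝ]
  refine (g - g').mem_of_homogeneous (fun _ => 𝓛.gr p) ⊥ (fun d x hx => ?_) x
    (fun j => 𝓛.mem_iSup_gr (x j))
  rw [Submodule.mem_bot, sub_apply, h d x hx, sub_self]

section Smooth

variable [VectorBundle ℝ FM V] [FiniteDimensional ℝ FM]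

/-- Near each point of the base there is a smooth frame of homogeneous sections. -/
lemma exists_graded_frame {p : M} (hp : p ∈ 𝓛.base) : ∃ (ι : Type) (_ : Fintype ι) (deg : ι → ℕ)
    (e : ι → ∀ q, 𝓛.fib q), IsFrameAt EM FM 𝓛.base 𝓛.fib p e ∧
      ∀ᶠ q in 𝓝[𝓛.base] p, ∀ j, e j q ∈ 𝓛.gr q (deg j) := by
  choose κ hκ e he using fun i => isSmoothSubbundle_iff.1 (𝓛.subbundle i) p hp
  let ι := Σ i : Fin (𝓛.bound + 1), κ i
  let v : ι → ∀ q, V q := fun a q => (e a.1 a.2 q : V q)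
  have hmem : ∀ q a, v a q ∈ 𝓛.fib q := fun q a => 𝓛.grade_le_fib q a.1 (e a.1 a.2 q).2
  refine ⟨ι, inferInstance, fun a => a.1, fun a q => (𝓛.fib q).clip (v a q),
    isFrameAt_clip ?_ ?_ ?_, ?_⟩
  · filter_upwards [eventually_all.2 fun i : Fin (𝓛.bound + 1) => (he i).smooth] with q hq a
    exact hq a.1 a.2
  · filter_upwards [eventually_all.2 fun i : Fin (𝓛.bound + 1) => (he i).indep,
      eventually_mem_nhdsWithin] with q hq hqb
    let w : ι → 𝓛.fib q := fun a => ⟨v a q, hmem q a⟩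
    suffices LinearIndependent ℝ w from this.map' (𝓛.fib q).subtype (𝓛.fib q).ker_subtype
    rw [Fintype.linearIndependent_iff]
    rintro c hc ⟨i, j⟩
    have h1 := congrArg (𝓛.proj q i) hc
    rw [map_sum, map_zero, Fintype.sum_sigma, Finset.sum_eq_single i] at h1
    · have h2 : ∑ j, c ⟨i, j⟩ • e i j q = 0 := by
        apply Subtype.ext
        have h3 := congrArg Subtype.val h1
        rw [AddSubmonoidClass.coe_finsetSum] at h3 ⊢
        refine Eq.trans (Finset.sum_congr rfl fun j _ => ?_) h3
        rw [map_smul, proj_of_mem hqb (show w ⟨i, j⟩ ∈ 𝓛.gr q i from (e i j q).2)]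
        rfl
      exact Fintype.linearIndependent_iff.1 (hq i) _ h2 j
    · intro i' _ hi'
      refine Finset.sum_eq_zero fun j _ => ?_
      rw [map_smul, proj_of_mem_ne hqb (fun h => hi' (Fin.ext h))
        (show w ⟨i', j⟩ ∈ 𝓛.gr q i' from (e i' j q).2), smul_zero]
    · simp
  · filter_upwards [eventually_all.2 fun i : Fin (𝓛.bound + 1) => (he i).span,
      eventually_mem_nhdsWithin] with q hq hqb
    apply le_antisymm
    · rw [Submodule.span_le]
      rintro _ ⟨a, rfl⟩
      exact hmem q a
    · refine iSup_le fun i => ?_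
      by_cases hi : i < 𝓛.bound + 1
      · have h4 := congrArg (Submodule.map (𝓛.grade i q).subtype) (hq ⟨i, hi⟩)
        rw [Submodule.map_span, ← range_comp, Submodule.map_top, Submodule.range_subtype] at h4
        refine h4.symm.le.trans ?_
        refine Submodule.span_mono ?_
        rintro _ ⟨j, rfl⟩
        exact ⟨⟨⟨i, hi⟩, j⟩, rfl⟩
      · rw [𝓛.bounded.choose_spec i (by unfold bound at hi; omega) q hqb]
        exact bot_le
  · refine Eventually.of_forall fun q a => ?_
    rw [mem_gr, Submodule.coe_clip (hmem q a)]
    exact (e a.1 a.2 q).2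

lemma isSmoothSubbundle_fib : IsSmoothSubbundle EM FM 𝓛.base 𝓛.fib := by
  rw [isSmoothSubbundle_iff]
  intro p hp
  obtain ⟨ι, h, deg, e, he, -⟩ := 𝓛.exists_graded_frame hp
  exact ⟨ι, h, e, he⟩

variable {b : P → M} {A : Set P} {p₀ : P}

lemma smoothAlong_proj (hp : p₀ ∈ A) (hbA : MapsTo b A 𝓛.base) (i : ℕ) {s : ∀ p, 𝓛.fib (b p)}
    (hs : SmoothAlong EP EM FM b A p₀ (fun p => (s p : V (b p)))) :
    SmoothAlong EP EM FM b A p₀ (fun p => (𝓛.proj (b p) i (s p) : V (b p))) := by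
  classical
  obtain ⟨ι, h, deg, e, he, hdeg⟩ := 𝓛.exists_graded_frame (hbA hp)
  obtain ⟨c, hc, hcs⟩ := he.exists_coeff hp hbA hs
  have ht : Tendsto b (𝓝[A] p₀) (𝓝[𝓛.base] (b p₀)) :=
    hs.base.continuousWithinAt.tendsto_nhdsWithin hbA
  have h0 := he.smooth.self_of_nhdsWithin (hbA hp)
  refine SmoothAlong.congr (s := fun p => ∑ j with deg j = i, c j p • (e j (b p) : V (b p)))
    (SmoothAlong.sum _ hs.base fun j _ => ((h0 j).comp hs.base hbA).smul (hc j)) hp ?_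
  filter_upwards [hcs, ht hdeg, eventually_mem_nhdsWithin] with p h1 h2 h3
  rw [h1, map_sum, AddSubmonoidClass.coe_finsetSum, Finset.sum_filter]
  refine Finset.sum_congr rfl fun j _ => ?_
  rw [map_smul]
  split_ifs with hj
  · rw [proj_of_mem (hbA h3) (hj ▸ h2 j)]
    rfl
  · rw [proj_of_mem_ne (hbA h3) hj (h2 j), smul_zero]
    rfl

lemma smoothAlong_op (hp : p₀ ∈ A) (hb : ContMDiffWithinAt 𝓘(ℝ, EP) 𝓘(ℝ, EM) ∞ b A p₀)
    (hbA : MapsTo b A 𝓛.base) {k : ℕ} {s : Fin k → ∀ p, 𝓛.fib (b p)}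
    (hs : ∀ j, SmoothAlong EP EM FM b A p₀ (fun p => (s j p : V (b p)))) :
    SmoothAlong EP EM FM b A p₀ (fun p => (𝓛.op (b p) k (fun j => s j p) : V (b p))) :=
  (𝓛.smooth k).along 𝓛.isSmoothSubbundle_fib hp hb hbA hs

variable {𝓛}

lemma Hom.smoothAlong [VectorBundle ℝ FN W] {𝓛' : LInftyBundle EN FN W} {f : M → N}
    (φ : Hom 𝓛 𝓛' f) (hp : p₀ ∈ A) (hb : ContMDiffWithinAt 𝓘(ℝ, EP) 𝓘(ℝ, EM) ∞ b A p₀)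
    (hbA : MapsTo b A 𝓛.base) {k : ℕ} {s : Fin k → ∀ p, 𝓛.fib (b p)}
    (hs : ∀ j, SmoothAlong EP EM FM b A p₀ (fun p => (s j p : V (b p)))) :
    SmoothAlong EP EN FN (f ∘ b) A p₀
      (fun p => (φ.op (b p) k (fun j => s j p) : W (f (b p)))) :=
  (φ.smooth k).along 𝓛.isSmoothSubbundle_fib hp hb hbA hs

lemma Hom.smoothAlong_lin [VectorBundle ℝ FN W] {𝓛' : LInftyBundle EN FN W} {f : M → N}
    (φ : Hom 𝓛 𝓛' f) (hp : p₀ ∈ A) (hbA : MapsTo b A 𝓛.base) {s : ∀ p, 𝓛.fib (b p)}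
    (hs : SmoothAlong EP EM FM b A p₀ (fun p => (s p : V (b p)))) :
    SmoothAlong EP EN FN (f ∘ b) A p₀ (fun p => (φ.lin (b p) (s p) : W (f (b p)))) :=
  φ.smoothAlong (k := 1) (s := fun _ => s) hp hs.base hbA fun _ => hs

end Smooth

/-! ### Composition of morphisms, and linear morphisms -/

section Comp

variable {𝓛} {𝓛' : LInftyBundle EN FN W} {𝓛'' : LInftyBundle EP FP X} {f : M → N} {g : N → P}

lemma finiteDimensional_fib [VectorBundle ℝ FM V] [FiniteDimensional ℝ FM] (p : M) :
    FiniteDimensional ℝ (𝓛.fib p) := by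
  have : FiniteDimensional ℝ (V p) :=
    LinearEquiv.finiteDimensional ((trivializationAt FM V p).continuousLinearEquivAt ℝ p
      (mem_baseSet_trivializationAt FM V p)).symm.toLinearEquiv
  infer_instance

/-- The operations of the composition of two morphisms: the sum of the compositions with the
projections to the homogeneous parts. -/
def compOp (φ : Hom 𝓛 𝓛' f) (ψ : Hom 𝓛' 𝓛'' g) (p : M) :
    Operations (𝓛.fib p) (𝓛''.fib (g (f p))) := by
  classical
  exact fun n => if p ∈ 𝓛.base then ∑ d : Fin n → Fin (𝓛.bound + 1),
    (bulletHom (ψ.op (f p)) (φ.op p) (fun j => (d j : ℕ))).compLinearMap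
      (fun j => 𝓛.proj p (d j)) else 0

lemma compOp_apply (φ : Hom 𝓛 𝓛' f) (ψ : Hom 𝓛' 𝓛'' g) {p : M} (hp : p ∈ 𝓛.base) {n : ℕ}
    (x : Fin n → 𝓛.fib p) : compOp φ ψ p n x = ∑ d : Fin n → Fin (𝓛.bound + 1),
      bullet (ψ.op (f p)) (φ.op p) (fun j => (d j : ℕ)) (fun j => 𝓛.proj p (d j) (x j)) := by
  rw [compOp, if_pos hp, sum_apply]
  rfl

lemma compOp_eq_bullet (φ : Hom 𝓛 𝓛' f) (ψ : Hom 𝓛' 𝓛'' g) {p : M} (hp : p ∈ 𝓛.base) {n : ℕ}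
    (d : Fin n → ℕ) (x : Fin n → 𝓛.fib p) (hx : ∀ j, x j ∈ 𝓛.gr p (d j)) :
    compOp φ ψ p n x = bullet (ψ.op (f p)) (φ.op p) d x := by
  rw [compOp_apply φ ψ hp]
  by_cases hd : ∀ j, d j < 𝓛.bound + 1
  · rw [Finset.sum_eq_single (fun j => (⟨d j, hd j⟩ : Fin (𝓛.bound + 1)))]
    · congr 1
      funext j
      exact proj_of_mem hp (hx j)
    · intro d' _ hd'
      obtain ⟨j, hj⟩ := Function.ne_iff.1 hd'
      refine bullet_eq_zero _ _ _ _ j (proj_of_mem_ne hp (fun h => hj (Fin.ext ?_)) (hx j))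
      exact h.symm
    · simp
  · push Not at hd
    obtain ⟨j, hj⟩ := hd
    have h0 : x j = 0 := by
      have := hx j
      rwa [𝓛.gr_eq_bot hp (by omega), Submodule.mem_bot] at this
    rw [bullet_eq_zero _ _ _ _ j h0]
    exact Finset.sum_eq_zero fun d' _ => bullet_eq_zero _ _ _ _ j (by rw [h0, map_zero])

variable [VectorBundle ℝ FM V] [FiniteDimensional ℝ FM] [VectorBundle ℝ FN W]
  [FiniteDimensional ℝ FN] [VectorBundle ℝ FP X] [FiniteDimensional ℝ FP]

lemma isLInftyMorphism_compOp (φ : Hom 𝓛 𝓛' f) (ψ : Hom 𝓛' 𝓛'' g) {p : M} (hp : p ∈ 𝓛.base) :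
    IsLInftyMorphism (𝓛.gr p) (𝓛.op p) (𝓛''.gr (g (f p))) (𝓛''.op (g (f p))) (compOp φ ψ p) := by
  have i1 := finiteDimensional_fib (𝓛 := 𝓛) p
  have i2 := finiteDimensional_fib (𝓛 := 𝓛') (f p)
  have i3 := finiteDimensional_fib (𝓛 := 𝓛'') (g (f p))
  have h1 := 𝓛.curvedLInfty p hp
  have h2 := 𝓛'.curvedLInfty _ (φ.mapsTo hp)
  have h3 := 𝓛''.curvedLInfty _ (ψ.mapsTo (φ.mapsTo hp))
  have h4 := φ.morphism p hp
  have h5 := ψ.morphism _ (φ.mapsTo hp)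
  have h6 := fun n d x hx => compOp_eq_bullet φ ψ hp (n := n) d x hx
  exact IsLInftyMorphism.bullet (𝓛.gr_zero hp) (𝓛'.gr_zero (φ.mapsTo hp))
    (𝓛''.gr_zero (ψ.mapsTo (φ.mapsTo hp))) h1 h2 h3 h4 h5 h6

/-- The composition of two morphisms. -/
def Hom.comp (φ : Hom 𝓛 𝓛' f) (ψ : Hom 𝓛' 𝓛'' g) : Hom 𝓛 𝓛'' (g ∘ f) where
  mapsTo := ψ.mapsTo.comp φ.mapsTo
  contMDiffOn := ψ.contMDiffOn.comp φ.contMDiffOn φ.mapsTo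
  op p := (compOp (f := f) (g := g) φ ψ p :)
  morphism _ hp := isLInftyMorphism_compOp φ ψ hp
  smooth := by
    intro k u hu s hs p₀ hp
    have hid : ContMDiffWithinAt 𝓘(ℝ, EM) 𝓘(ℝ, EM) ∞ (id : M → M) (𝓛.base ∩ u) p₀ :=
      contMDiffWithinAt_id
    have hf : ContMDiffWithinAt 𝓘(ℝ, EM) 𝓘(ℝ, EN) ∞ f (𝓛.base ∩ u) p₀ :=
      (φ.contMDiffOn p₀ hp.1).mono inter_subset_left
    have hgf : ContMDiffWithinAt 𝓘(ℝ, EM) 𝓘(ℝ, EP) ∞ (g ∘ f) (𝓛.base ∩ u) p₀ :=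
      ((ψ.contMDiffOn.comp φ.contMDiffOn φ.mapsTo) p₀ hp.1).mono inter_subset_left
    have hm : MapsTo (id : M → M) (𝓛.base ∩ u) 𝓛.base := fun _ h => h.1
    have hm' : MapsTo f (𝓛.base ∩ u) 𝓛'.base := fun _ h => φ.mapsTo h.1
    refine SmoothAlong.congr (s := fun p => ∑ d : Fin k → Fin (𝓛.bound + 1),
      ∑ c : OrderedFinpartition k, koszulSign (fun j => (d j : ℕ)) c.index •
      (ψ.op (f p) c.length (fun m => φ.op p (c.partSize m) (fun j =>
        𝓛.proj p (d (c.emb m j)) (s (c.emb m j) p))) : X (g (f p)))) ?_ hp ?_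
    · refine SmoothAlong.sum _ hgf fun d _ => SmoothAlong.sum _ hgf fun c _ => ?_
      refine SmoothAlong.smul contMDiffWithinAt_const ?_
      refine ψ.smoothAlong hp hf hm' fun m => ?_
      refine φ.smoothAlong hp hid hm fun j => ?_
      exact 𝓛.smoothAlong_proj hp hm _ (hs _ p₀ hp)
    · filter_upwards [eventually_mem_nhdsWithin] with p h
      rw [compOp_apply φ ψ h.1]
      simp [bullet]

lemma Hom.isComposition_comp (φ : Hom 𝓛 𝓛' f) (ψ : Hom 𝓛' 𝓛'' g) :
    IsComposition φ ψ (φ.comp ψ) := fun _ hp _ d x hx => compOp_eq_bullet φ ψ hp d x hx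

/-- The linear morphism given by a smooth bundle map that commutes with the operations. -/
def Hom.ofLinear {f : M → N} (hf : MapsTo f 𝓛.base 𝓛'.base)
    (hf' : ContMDiffOn 𝓘(ℝ, EM) 𝓘(ℝ, EN) ∞ f 𝓛.base) (g : ∀ p, 𝓛.fib p →ₗ[ℝ] 𝓛'.fib (f p))
    (hg : ∀ p ∈ 𝓛.base, ∀ i, ∀ x ∈ 𝓛.gr p i, g p x ∈ 𝓛'.gr (f p) i)
    (hop : ∀ p ∈ 𝓛.base, ∀ (n : ℕ) (d : Fin n → ℕ) (x : Fin n → 𝓛.fib p),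
      (∀ j, x j ∈ 𝓛.gr p (d j)) → g p (𝓛.op p n x) = 𝓛'.op (f p) n (fun j => g p (x j)))
    (hsm : ∀ (A : Set M) (p : M), A ⊆ 𝓛.base → p ∈ A → ∀ s : ∀ q, 𝓛.fib q,
      SmoothAlong EM EM FM id A p (fun q => (s q : V q)) →
      SmoothAlong EM EN FN f A p (fun q => (g q (s q) : W (f q)))) : Hom 𝓛 𝓛' f where
  mapsTo := hf
  contMDiffOn := hf'
  op p := _root_.ofLinear (g p)
  morphism p hp := isLInftyMorphism_ofLinear (hg p hp) (hop p hp)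
  smooth := by
    intro k u hu s hs p₀ hp
    match k with
    | 1 => exact hsm _ p₀ inter_subset_left hp (s 0) (hs 0 p₀ hp)
    | 0 => exact SmoothAlong.zero ((hf' p₀ hp.1).mono inter_subset_left)
    | k + 2 => exact SmoothAlong.zero ((hf' p₀ hp.1).mono inter_subset_left)

end Comp

end LInftyBundle

/-! ### Derivatives of sections at their zeros -/

section SectionDeriv

open Filter Topology

variable {EM : Type*} [NormedAddCommGroup EM] [NormedSpace ℝ EM]
  {M : Type*} [TopologicalSpace M] [ChartedSpace EM M]

variable (EM) in
/-- The derivative of a real function at a point, as a linear form on the model space. -/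
def realDeriv (c : M → ℝ) (p : M) : EM →L[ℝ] ℝ := mfderiv 𝓘(ℝ, EM) 𝓘(ℝ, ℝ) c p

/-- At a common zero of the coefficients the derivative of a linear combination involves only the
derivatives of the coefficients. -/
lemma mfderiv_sum_smul {F : Type*} [NormedAddCommGroup F] [NormedSpace ℝ F] {ι : Type} [Fintype ι]
    {p : M} {c : ι → M → ℝ} {a : ι → M → F}
    (hc : ∀ j, ContMDiffAt 𝓘(ℝ, EM) 𝓘(ℝ, ℝ) ∞ (c j) p)
    (ha : ∀ j, ContMDiffAt 𝓘(ℝ, EM) 𝓘(ℝ, F) ∞ (a j) p) (h0 : ∀ j, c j p = 0)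
    (v : TangentSpace 𝓘(ℝ, EM) p) :
    (mfderiv 𝓘(ℝ, EM) 𝓘(ℝ, F) (fun q => ∑ j, c j q • a j q) p v : F) =
      ∑ j, realDeriv EM (c j) p v • a j p := by
  have hsmul : ∀ j, HasMFDerivAt 𝓘(ℝ, EM) 𝓘(ℝ, F) (fun q => c j q • a j q) p
      ((realDeriv EM (c j) p).smulRight (a j p) : EM →L[ℝ] F) := by
    intro j
    have h1 := ((hc j).mdifferentiableAt (by simp)).hasMFDerivAt
    have h2 := ((ha j).mdifferentiableAt (by simp)).hasMFDerivAt
    refine ⟨h1.1.smul h2.1, ?_⟩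
    have h3 := HasFDerivWithinAt.smul h1.2 h2.2
    refine h3.congr_fderiv ?_
    ext w
    simp only [writtenInExtChartAt, mfld_simps, h0]
    exact (congrArg (· + realDeriv EM (c j) p w • a j p) (zero_smul ℝ _)).trans (zero_add _)
  have hs : HasMFDerivAt 𝓘(ℝ, EM) 𝓘(ℝ, F) (∑ j, fun q => c j q • a j q) p
      (∑ j, (realDeriv EM (c j) p).smulRight (a j p) : EM →L[ℝ] F) :=
    HasMFDerivAt.sum (t := Finset.univ) (f := fun j q => c j q • a j q)
      (f' := fun j => ((realDeriv EM (c j) p).smulRight (a j p) : EM →L[ℝ] F)) (fun j _ => hsmul j)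
  have he : (fun q => ∑ j, c j q • a j q) = ∑ j, fun q => c j q • a j q := by
    funext q
    simp
  rw [he, hs.mfderiv]
  have happ : ∀ w : EM, (∑ j, (realDeriv EM (c j) p).smulRight (a j p) : EM →L[ℝ] F) w =
      ∑ j, realDeriv EM (c j) p w • a j p := fun w => by
    rw [_root_.sum_apply]
    rfl
  exact happ v

variable {FM : Type*} [NormedAddCommGroup FM] [NormedSpace ℝ FM]
  {V : M → Type*} [∀ p, AddCommGroup (V p)] [∀ p, Module ℝ (V p)]
  [TopologicalSpace (TotalSpace FM V)] [∀ p, TopologicalSpace (V p)] [FiberBundle FM V]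
  {EP : Type*} [NormedAddCommGroup EP] [NormedSpace ℝ EP]
  {P : Type*} [TopologicalSpace P] [ChartedSpace EP P]
  [VectorBundle ℝ FM V]

/-- If a section along `b` is a smooth linear combination with coefficients that vanish at `p`, the
derivatives of the coefficients compute its derivative in a local trivialization. -/
lemma symmL_mfderiv_linearMapAt {ι : Type} [Fintype ι] {b : P → M} {p : P} {c : ι → P → ℝ}
    {a : ι → ∀ q, V (b q)} {s : ∀ q, V (b q)}
    (hc : ∀ j, ContMDiffAt 𝓘(ℝ, EP) 𝓘(ℝ, ℝ) ∞ (c j) p)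
    (ha : ∀ j, SmoothAlong EP EM FM b univ p (a j)) (h0 : ∀ j, c j p = 0)
    (hs : ∀ᶠ q in 𝓝 p, s q = ∑ j, c j q • a j q) (v : TangentSpace 𝓘(ℝ, EP) p) :
    (trivializationAt FM V (b p)).symmL ℝ (b p) (mfderiv 𝓘(ℝ, EP) 𝓘(ℝ, FM)
      (fun q => (trivializationAt FM V (b p)).linearMapAt ℝ (b q) (s q)) p v : FM) =
      ∑ j, realDeriv EP (c j) p v • a j p := by
  have h1 : (fun q => (trivializationAt FM V (b p)).linearMapAt ℝ (b q) (s q)) =ᶠ[𝓝 p]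
      fun q => ∑ j, c j q • (trivializationAt FM V (b p)).linearMapAt ℝ (b q) (a j q) := by
    filter_upwards [hs] with q hq
    rw [hq, map_sum]
    simp only [map_smul]
  rw [h1.mfderiv_eq]
  refine (congrArg (fun w : FM => (trivializationAt FM V (b p)).symmL ℝ (b p) w)
    (mfderiv_sum_smul hc (fun j => contMDiffWithinAt_univ.1 (ha j).linearMapAt) h0 v)).trans ?_
  rw [map_sum]
  refine Finset.sum_congr rfl fun j _ => ?_
  rw [map_smul]
  congr 1
  exact Trivialization.symmₗ_linearMapAt (R := ℝ) _ (mem_baseSet_trivializationAt FM V (b p)) _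

/-- Two smooth linear combinations that agree near a common zero of their coefficients have the same
derivative there. -/
lemma sum_mfderiv_smul_eq {ι κ : Type} [Fintype ι] [Fintype κ] {b : P → M} {p : P} {c : ι → P → ℝ}
    {a : ι → ∀ q, V (b q)} {c' : κ → P → ℝ} {a' : κ → ∀ q, V (b q)}
    (hc : ∀ j, ContMDiffAt 𝓘(ℝ, EP) 𝓘(ℝ, ℝ) ∞ (c j) p)
    (ha : ∀ j, SmoothAlong EP EM FM b univ p (a j)) (h0 : ∀ j, c j p = 0)
    (hc' : ∀ j, ContMDiffAt 𝓘(ℝ, EP) 𝓘(ℝ, ℝ) ∞ (c' j) p)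
    (ha' : ∀ j, SmoothAlong EP EM FM b univ p (a' j)) (h0' : ∀ j, c' j p = 0)
    (hs : ∀ᶠ q in 𝓝 p, ∑ j, c j q • a j q = ∑ j, c' j q • a' j q) (v : TangentSpace 𝓘(ℝ, EP) p) :
    ∑ j, realDeriv EP (c j) p v • a j p =
      ∑ j, realDeriv EP (c' j) p v • a' j p := by
  exact (symmL_mfderiv_linearMapAt hc ha h0 (Eventually.of_forall fun _ => rfl) v).symm.trans
    (symmL_mfderiv_linearMapAt hc' ha' h0' hs v)

end SectionDeriv

namespace LInftyBundle

open Filter Topology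

variable {EM : Type*} [NormedAddCommGroup EM] [NormedSpace ℝ EM]
  {M : Type*} [TopologicalSpace M] [ChartedSpace EM M]
  {FM : Type*} [NormedAddCommGroup FM] [NormedSpace ℝ FM]
  {V : M → Type*} [∀ p, AddCommGroup (V p)] [∀ p, Module ℝ (V p)]
  [TopologicalSpace (TotalSpace FM V)] [∀ p, TopologicalSpace (V p)] [FiberBundle FM V]
  {EN : Type*} [NormedAddCommGroup EN] [NormedSpace ℝ EN]
  {N : Type*} [TopologicalSpace N] [ChartedSpace EN N]
  {FN : Type*} [NormedAddCommGroup FN] [NormedSpace ℝ FN]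
  {W : N → Type*} [∀ q, AddCommGroup (W q)] [∀ q, Module ℝ (W q)]
  [TopologicalSpace (TotalSpace FN W)] [∀ q, TopologicalSpace (W q)] [FiberBundle FN W]
  [VectorBundle ℝ FM V] [FiniteDimensional ℝ FM] [VectorBundle ℝ FN W] [FiniteDimensional ℝ FN]

variable {𝓛 : LInftyBundle EM FM V} {𝓛' : LInftyBundle EN FN W} {f : M → N}

lemma lam_degree {p : M} (hp : p ∈ 𝓛.base) {i : ℕ} {x : 𝓛.fib p} (hx : x ∈ 𝓛.gr p i) :
    unary (𝓛.op p) x ∈ 𝓛.gr p (i + 1) := by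
  have := (𝓛.curvedLInfty p hp).degree 1 (fun _ => i) (fun _ => x) (fun _ => hx)
  simpa using this

lemma curvature_mem {p : M} (hp : p ∈ 𝓛.base) : 𝓛.curvature p ∈ 𝓛.gr p 1 := by
  have := (𝓛.curvedLInfty p hp).degree 0 (fun j => j.elim0) (fun j => j.elim0) (fun j => j.elim0)
  rw [Finset.univ_eq_empty, Finset.sum_empty, zero_add] at this
  exact this

lemma op_zero (p : M) (x : Fin 0 → 𝓛.fib p) : 𝓛.op p 0 x = 𝓛.curvature p := by
  unfold curvature
  congr 1
  funext j
  exact j.elim0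

/-- The Jacobi identity in arity zero: `λ₁ λ₀ = 0`. -/
lemma lam_curvature {p : M} (hp : p ∈ 𝓛.base) : unary (𝓛.op p) (𝓛.curvature p) = 0 := by
  have := (𝓛.curvedLInfty p hp).jacobi 0 (fun j => j.elim0) (fun j => j.elim0) (fun j => j.elim0)
  unfold insertOp at this
  rw [Fintype.sum_unique] at this
  have h := insertOp_univ (𝓛.op p) (𝓛.op p) (n := 0) (fun j => j.elim0) (fun j => j.elim0)
  rw [op_zero] at h
  rw [← h]
  exact this

/-- The Jacobi identity in arity one, at a classical point: `λ₁ λ₁ = 0`. -/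
lemma lam_lam {p : M} (hp : p ∈ 𝓛.classicalLocus) {i : ℕ} {x : 𝓛.fib p} (hx : x ∈ 𝓛.gr p i) :
    unary (𝓛.op p) (unary (𝓛.op p) x) = 0 := by
  have h := (𝓛.curvedLInfty p hp.1).jacobi 1 (fun _ => i) (fun _ => x) (fun _ => hx)
  have h1 := insertOp_univ (𝓛.op p) (𝓛.op p) (n := 1) (fun _ => i) (fun _ => x)
  unfold insertOp at h
  rw [Finset.sum_eq_single Finset.univ] at h
  · rw [h] at h1
    exact h1.symm
  · intro S _ hS
    have : S = ∅ := by
      by_contra hne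
      obtain ⟨a, ha⟩ := Finset.nonempty_iff_ne_empty.2 hne
      exact hS (Finset.eq_univ_of_forall fun b => by rwa [Subsingleton.elim b a])
    subst this
    rw [MultilinearMap.map_coord_zero _ 0, smul_zero]
    rw [Fin.cons_zero]
    exact (op_zero p _).trans hp.2
  · simp

section Linear

variable {χ : Hom 𝓛 𝓛' f} (hχ : χ.IsLinear) {p : M} (hp : p ∈ 𝓛.base)
include hχ hp

lemma Hom.IsLinear.op_eq : χ.op p = _root_.ofLinear (χ.lin p) :=
  (ofLinear_unary _ (χ.morphism p hp).zero (hχ p hp)).symm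

lemma Hom.IsLinear.map_op (n : ℕ) (d : Fin n → ℕ) (x : Fin n → 𝓛.fib p)
    (hx : ∀ j, x j ∈ 𝓛.gr p (d j)) :
    χ.lin p (𝓛.op p n x) = 𝓛'.op (f p) n (fun j => χ.lin p (x j)) := by
  have h := χ.morphism p hp
  rw [hχ.op_eq hp] at h
  exact h.map_op n d x hx

lemma Hom.IsLinear.lin_lam {i : ℕ} {x : 𝓛.fib p} (hx : x ∈ 𝓛.gr p i) :
    χ.lin p (unary (𝓛.op p) x) = unary (𝓛'.op (f p)) (χ.lin p x) :=
  hχ.map_op hp 1 (fun _ => i) (fun _ => x) (fun _ => hx)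

lemma Hom.IsLinear.lin_curvature : χ.lin p (𝓛.curvature p) = 𝓛'.curvature (f p) := by
  have h := hχ.map_op hp 0 (fun j => j.elim0) (fun j => j.elim0) (fun j => j.elim0)
  rwa [op_zero, op_zero] at h

end Linear

lemma Hom.lin_mem (χ : Hom 𝓛 𝓛' f) {p : M} (hp : p ∈ 𝓛.base) {i : ℕ} {x : 𝓛.fib p}
    (hx : x ∈ 𝓛.gr p i) : χ.lin p x ∈ 𝓛'.gr (f p) i := by
  have := (χ.morphism p hp).degree 1 (fun _ => i) (fun _ => x) (fun _ => hx)
  rw [Fin.sum_univ_one] at this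
  exact this

/-- The kernel of the linear part of a morphism in degree `i`. -/
def Hom.kerGr (χ : Hom 𝓛 𝓛' f) (p : M) (i : ℕ) : Submodule ℝ (𝓛.fib p) :=
  𝓛.gr p i ⊓ LinearMap.ker (χ.lin p)

lemma Hom.mem_kerGr {χ : Hom 𝓛 𝓛' f} {p : M} {i : ℕ} {x : 𝓛.fib p} :
    x ∈ χ.kerGr p i ↔ x ∈ 𝓛.gr p i ∧ χ.lin p x = 0 := Iff.rfl

lemma Hom.IsLinear.lam_mem_kerGr {χ : Hom 𝓛 𝓛' f} (hχ : χ.IsLinear) {p : M} (hp : p ∈ 𝓛.base)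
    {i : ℕ} {x : 𝓛.fib p} (hx : x ∈ χ.kerGr p i) : unary (𝓛.op p) x ∈ χ.kerGr p (i + 1) := by
  rw [Hom.mem_kerGr] at hx ⊢
  exact ⟨lam_degree hp hx.1, by rw [hχ.lin_lam hp hx.1, hx.2, map_zero]⟩

variable (𝓛) in
/-- A smooth representation of the curvature near a classical point computes its derivative. -/
lemma exists_curvature_repr (hopen : IsOpen 𝓛.base) {p : M} (hp : p ∈ 𝓛.classicalLocus) :
    ∃ (ι : Type) (_ : Fintype ι) (c : ι → M → ℝ) (e : ι → ∀ q, 𝓛.fib q),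
      (∀ j, ContMDiffAt 𝓘(ℝ, EM) 𝓘(ℝ, ℝ) ∞ (c j) p) ∧
      (∀ j, SmoothAlong EM EM FM id univ p (fun q => (e j q : V q))) ∧
      (∀ j, c j p = 0) ∧ (∀ᶠ q in 𝓝 p, 𝓛.curvature q = ∑ j, c j q • e j q) ∧
      (∀ j, ∀ᶠ q in 𝓝 p, e j q ∈ 𝓛.gr q 1) ∧
      ∀ v : TangentSpace 𝓘(ℝ, EM) p, 𝓛.curvatureDeriv p v =
        ∑ j, realDeriv EM (c j) p v • (e j p : V p) := by
  classical
  have hnh : 𝓝[𝓛.base] p = 𝓝 p := hopen.nhdsWithin_eq hp.1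
  have hbase : ∀ᶠ q in 𝓝 p, q ∈ 𝓛.base := hopen.mem_nhds hp.1
  obtain ⟨ι, _, e₁, he⟩ := isSmoothSubbundle_iff.1 (𝓛.subbundle 1) p hp.1
  have hcurv : SmoothAlong EM EM FM id 𝓛.base p (fun q => (𝓛.curvature q : V q)) :=
    by
      have h := 𝓛.smoothAlong_op (k := 0) (b := id) hp.1 contMDiffWithinAt_id (fun _ h => h)
        (s := fun j => j.elim0) (fun j => j.elim0)
      simp only [op_zero] at h
      exact h
  let s : ∀ q, 𝓛.grade 1 q := fun q => (𝓛.grade 1 q).clip (𝓛.curvature q)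
  have hs : ∀ q ∈ 𝓛.base, (s q : V q) = 𝓛.curvature q := fun q hq =>
    Submodule.coe_clip (curvature_mem hq)
  have hss : SmoothAlong EM EM FM id 𝓛.base p (fun q => (s q : V q)) := by
    refine hcurv.congr hp.1 ?_
    filter_upwards [eventually_mem_nhdsWithin] with q hq using hs q hq
  obtain ⟨c, hc, hcs⟩ := he.exists_coeff hp.1 (fun _ h => h) hss
  rw [hnh] at hcs
  let e : ι → ∀ q, 𝓛.fib q := fun j q => Submodule.inclusion (𝓛.grade_le_fib q 1) (e₁ j q)
  have hrep : ∀ᶠ q in 𝓝 p, 𝓛.curvature q = ∑ j, c j q • e j q := by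
    filter_upwards [hcs, hbase] with q h1 h2
    apply Subtype.ext
    rw [← hs q h2, h1]
    simp [e]
  have hes : ∀ j, SmoothAlong EM EM FM id univ p (fun q => (e j q : V q)) := fun j =>
    (he.smooth.self_of_nhdsWithin hp.1 j).mono_of_mem (by simpa using hbase)
  have hcc : ∀ j, ContMDiffAt 𝓘(ℝ, EM) 𝓘(ℝ, ℝ) ∞ (c j) p := fun j => (hc j).contMDiffAt hbase
  have hc0 : ∀ j, c j p = 0 := by
    have h1 := hrep.self_of_nhds
    rw [hp.2] at h1
    have h2 : ∑ j, c j p • e₁ j p = 0 := by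
      apply Subtype.ext
      have h3 := congrArg Subtype.val h1
      simpa [e] using h3.symm
    exact Fintype.linearIndependent_iff.1 (he.indep.self_of_nhdsWithin hp.1) _ h2
  refine ⟨ι, inferInstance, c, e, hcc, hes, hc0, hrep,
    fun j => Eventually.of_forall fun q => (e₁ j q).2, fun v => ?_⟩
  have h1 := symmL_mfderiv_linearMapAt (b := id) (s := fun q => (𝓛.curvature q : V q))
    (a := fun j q => (e j q : V q)) hcc hes hc0
    (by filter_upwards [hrep] with q hq; rw [hq]; simp) v
  rw [← h1]
  have h2 : (fun q => (trivializationAt FM V p (TotalSpace.mk' FM q (𝓛.curvature q : V q))).2) =ᶠ[𝓝 p]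
      fun q => (trivializationAt FM V p).linearMapAt ℝ q (𝓛.curvature q : V q) := by
    filter_upwards [(trivializationAt FM V p).open_baseSet.mem_nhds
      (mem_baseSet_trivializationAt FM V p)] with q hq
    rw [Trivialization.coe_linearMapAt_of_mem _ hq]
  unfold curvatureDeriv
  rw [h2.mfderiv_eq]
  rfl

lemma curvatureDeriv_mem (hopen : IsOpen 𝓛.base) {p : M} (hp : p ∈ 𝓛.classicalLocus)
    (v : TangentSpace 𝓘(ℝ, EM) p) : 𝓛.curvatureDeriv p v ∈ 𝓛.grade 1 p := by
  obtain ⟨ι, _, c, e, -, -, -, -, he, hD⟩ := 𝓛.exists_curvature_repr hopen hp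
  rw [hD]
  exact Submodule.sum_mem _ fun j _ => Submodule.smul_mem _ _ (he j).self_of_nhds

/-- The derivative of the curvature, as a map to the fibre. -/
lemma exists_curvatureDeriv (hopen : IsOpen 𝓛.base) {p : M} (hp : p ∈ 𝓛.classicalLocus)
    (v : TangentSpace 𝓘(ℝ, EM) p) :
    ∃ y : 𝓛.fib p, (y : V p) = 𝓛.curvatureDeriv p v ∧ y ∈ 𝓛.gr p 1 :=
  ⟨⟨_, 𝓛.grade_le_fib p 1 (curvatureDeriv_mem hopen hp v)⟩, rfl, curvatureDeriv_mem hopen hp v⟩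

/-- At a classical point the composition `λ₁ ∘ D λ₀` vanishes. -/
lemma lam_curvatureDeriv (hopen : IsOpen 𝓛.base) {p : M} (hp : p ∈ 𝓛.classicalLocus)
    (v : TangentSpace 𝓘(ℝ, EM) p) {y : 𝓛.fib p} (hy : (y : V p) = 𝓛.curvatureDeriv p v) :
    unary (𝓛.op p) y = 0 := by
  obtain ⟨ι, _, c, e, hc, he, h0, hrep, -, hD⟩ := 𝓛.exists_curvature_repr hopen hp
  have hbase : ∀ᶠ q in 𝓝 p, q ∈ 𝓛.base := hopen.mem_nhds hp.1
  have hy' : y = ∑ j, realDeriv EM (c j) p v • e j p := by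
    apply Subtype.ext
    rw [hy, hD]
    simp
  have hle : ∀ j, SmoothAlong EM EM FM id univ p (fun q => (unary (𝓛.op q) (e j q) : V q)) :=
    fun j => by
      have h1 : SmoothAlong EM EM FM id 𝓛.base p (fun q => (unary (𝓛.op q) (e j q) : V q)) :=
        𝓛.smoothAlong_op (k := 1) hp.1 contMDiffWithinAt_id (fun _ h => h) (s := fun _ => e j)
          (fun _ => (he j).mono (subset_univ _))
      exact h1.mono_of_mem (by simpa using hbase)
  have key := sum_mfderiv_smul_eq (b := id) (κ := Empty) (c' := fun j => j.elim)
    (a' := fun j => j.elim) hc hle h0 (fun j => j.elim) (fun j => j.elim) (fun j => j.elim) (by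
      filter_upwards [hrep, hbase] with q h1 h2
      have h3 := lam_curvature h2
      rw [h1, map_sum] at h3
      simp only [map_smul] at h3
      have h4 := congrArg Subtype.val h3
      simpa [-unary_apply] using h4) v
  rw [hy', map_sum]
  simp only [map_smul]
  apply Subtype.ext
  simpa [-unary_apply] using key

/-- The derivative of the curvature is natural with respect to linear morphisms. -/
lemma Hom.IsLinear.lin_curvatureDeriv {χ : Hom 𝓛 𝓛' f} (hχ : χ.IsLinear) (hopen : IsOpen 𝓛.base)
    (hopen' : IsOpen 𝓛'.base) {p : M} (hp : p ∈ 𝓛.classicalLocus)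
    (v : TangentSpace 𝓘(ℝ, EM) p) {y : 𝓛.fib p} (hy : (y : V p) = 𝓛.curvatureDeriv p v) :
    (χ.lin p y : W (f p)) = 𝓛'.curvatureDeriv (f p) (mfderiv 𝓘(ℝ, EM) 𝓘(ℝ, EN) f p v) := by
  obtain ⟨ι, _, c, e, hc, he, h0, hrep, -, hD⟩ := 𝓛.exists_curvature_repr hopen hp
  have hp' : f p ∈ 𝓛'.classicalLocus :=
    ⟨χ.mapsTo hp.1, by rw [← hχ.lin_curvature hp.1, hp.2, map_zero]⟩
  obtain ⟨κ, _, c', e', hc', he', h0', hrep', -, hD'⟩ := 𝓛'.exists_curvature_repr hopen' hp'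
  have hbase : ∀ᶠ q in 𝓝 p, q ∈ 𝓛.base := hopen.mem_nhds hp.1
  have hf : ContMDiffAt 𝓘(ℝ, EM) 𝓘(ℝ, EN) ∞ f p := (χ.contMDiffOn p hp.1).contMDiffAt hbase
  have hy' : y = ∑ j, realDeriv EM (c j) p v • e j p := by
    apply Subtype.ext
    rw [hy, hD]
    simp
  have hle : ∀ j, SmoothAlong EM EN FN f univ p (fun q => (χ.lin q (e j q) : W (f q))) :=
    fun j => by
      have h1 : SmoothAlong EM EN FN f 𝓛.base p (fun q => (χ.lin q (e j q) : W (f q))) :=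
        χ.smoothAlong_lin (b := id) hp.1 (fun _ h => h) ((he j).mono (subset_univ _))
      exact h1.mono_of_mem (by simpa using hbase)
  have key := sum_mfderiv_smul_eq (b := f) (c := c) (a := fun j q => (χ.lin q (e j q) : W (f q)))
    (c' := fun j q => c' j (f q)) (a' := fun j q => (e' j (f q) : W (f q))) hc hle h0
    (fun j => (hc' j).comp p hf) (fun j => (he' j).comp hf.contMDiffWithinAt (fun _ _ => trivial))
    h0' (by
      filter_upwards [hrep, hbase, hf.continuousAt hrep'] with q h1 h2 h3
      have h4 := hχ.lin_curvature h2
      have h3' : 𝓛'.curvature (f q) = ∑ j, c' j (f q) • e' j (f q) := h3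
      rw [h1, h3', map_sum] at h4
      simp only [map_smul] at h4
      have h5 := congrArg Subtype.val h4
      simpa using h5) v
  rw [hD', hy', map_sum]
  simp only [map_smul]
  rw [AddSubmonoidClass.coe_finsetSum]
  refine Eq.trans key (Finset.sum_congr rfl fun j _ => ?_)
  congr 1
  exact mfderiv_comp_apply p ((hc' j).mdifferentiableAt (by simp)) (hf.mdifferentiableAt (by simp)) v

/-- The vertical part of the tangent complex of the linear fibration `χ` at the classical point `p`
is exact in degrees at most `n`, where tangent vectors have degree zero. -/
structure Hom.ExactAt (χ : Hom 𝓛 𝓛' f) (n : ℕ) (p : M) : Prop where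
  classical : p ∈ 𝓛.classicalLocus
  exact : ∀ i, 1 ≤ i → i + 1 ≤ n → ∀ y ∈ χ.kerGr p (i + 1), unary (𝓛.op p) y = 0 →
    ∃ z ∈ χ.kerGr p i, unary (𝓛.op p) z = y
  exact_one : ∀ y ∈ χ.kerGr p 1, unary (𝓛.op p) y = 0 →
    ∃ v : TangentSpace 𝓘(ℝ, EM) p, mfderiv 𝓘(ℝ, EM) 𝓘(ℝ, EN) f p v = 0 ∧
      𝓛.curvatureDeriv p v = (y : V p)
  exact_zero : ∀ v : TangentSpace 𝓘(ℝ, EM) p, mfderiv 𝓘(ℝ, EM) 𝓘(ℝ, EN) f p v = 0 →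
    𝓛.curvatureDeriv p v = 0 → v = 0

/-- The kernel of a surjective quasi-isomorphism is exact. -/
lemma Hom.IsEtaleAt.exactAt {χ : Hom 𝓛 𝓛' f} {p : M} (h : χ.IsEtaleAt p) (hχ : χ.IsLinear)
    (hfib : χ.IsFibration) (hopen : IsOpen 𝓛.base) (hopen' : IsOpen 𝓛'.base) (n : ℕ) :
    χ.ExactAt n p := by
  obtain ⟨hp, ⟨h0i, h0s⟩, hi⟩ := h
  have hp' : f p ∈ 𝓛'.classicalLocus :=
    ⟨χ.mapsTo hp.1, by rw [← hχ.lin_curvature hp.1, hp.2, map_zero]⟩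
  have hcob : ∀ i, 1 ≤ i → 𝓛.coboundaries p (i + 1) = (𝓛.gr p i).map (unary (𝓛.op p)) :=
    fun i hi => by rw [coboundaries, if_neg (by omega)]; rfl
  have hcob' : ∀ i, 1 ≤ i → 𝓛'.coboundaries (f p) (i + 1) =
      (𝓛'.gr (f p) i).map (unary (𝓛'.op (f p))) :=
    fun i hi => by rw [coboundaries, if_neg (by omega)]; rfl
  -- the image of a tangent vector under the derivative of the curvature lifts
  have hlift : ∀ w ∈ 𝓛'.coboundaries (f p) 1, ∃ (v : TangentSpace 𝓘(ℝ, EM) p) (y : 𝓛.fib p),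
      (y : V p) = 𝓛.curvatureDeriv p v ∧ y ∈ 𝓛.gr p 1 ∧ χ.lin p y = w := by
    intro w hw
    rw [coboundaries, if_pos rfl] at hw
    obtain ⟨v', hv'⟩ := hw
    obtain ⟨v, rfl⟩ := (hfib p hp.1).1 v'
    obtain ⟨y, hy, hy1⟩ := exists_curvatureDeriv hopen hp v
    refine ⟨v, y, hy, hy1, Subtype.ext ?_⟩
    rw [hχ.lin_curvatureDeriv hopen hopen' hp v hy]
    exact hv'
  refine ⟨hp, fun i h1 _ y hy hly => ?_, fun y hy hly => ?_, fun v hv hv' => ?_⟩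
  · obtain ⟨hinj, -⟩ := hi (i + 1) (by omega)
    have hy1 := hinj y ⟨hy.1, hly⟩ (by rw [hy.2]; exact Submodule.zero_mem _)
    rw [hcob i h1] at hy1
    obtain ⟨x, hx, rfl⟩ := hy1
    have hχx : χ.lin p x ∈ 𝓛'.cocycles (f p) i := by
      refine ⟨χ.lin_mem hp.1 hx, ?_⟩
      change unary (𝓛'.op (f p)) (χ.lin p x) = 0
      rw [← hχ.lin_lam hp.1 hx]
      exact hy.2
    obtain ⟨z, hz, hxz⟩ := (hi i h1).2 _ hχx
    rcases Nat.lt_or_ge 1 i with h2 | h2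
    · obtain ⟨i, rfl⟩ : ∃ k, i = k + 1 := ⟨i - 1, by omega⟩
      rw [hcob' i (by omega)] at hxz
      obtain ⟨w', hw', hw⟩ := hxz
      obtain ⟨w, hw1, rfl⟩ := (hfib p hp.1).2 i hw'
      refine ⟨x - z - unary (𝓛.op p) w, ⟨?_, ?_⟩, ?_⟩
      · exact Submodule.sub_mem _ (Submodule.sub_mem _ hx hz.1) (lam_degree hp.1 hw1)
      · change χ.lin p _ = 0
        rw [map_sub, map_sub, hχ.lin_lam hp.1 hw1]
        exact sub_eq_zero.2 hw.symm
      · have h5 : unary (𝓛.op p) z = 0 := hz.2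
        rw [map_sub, map_sub, h5, lam_lam hp hw1, sub_zero, sub_zero]
    · obtain rfl : i = 1 := by omega
      obtain ⟨v, u, hu, hu1, hw⟩ := hlift _ hxz
      refine ⟨x - z - u, ⟨?_, ?_⟩, ?_⟩
      · exact Submodule.sub_mem _ (Submodule.sub_mem _ hx hz.1) hu1
      · change χ.lin p _ = 0
        rw [map_sub, map_sub, hw]
        exact sub_self _
      · have h5 : unary (𝓛.op p) z = 0 := hz.2
        rw [map_sub, map_sub, h5, lam_curvatureDeriv hopen hp v hu, sub_zero, sub_zero]
  · obtain ⟨hinj, -⟩ := hi 1 le_rfl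
    have hy1 := hinj y ⟨hy.1, hly⟩ (by rw [hy.2]; exact Submodule.zero_mem _)
    rw [coboundaries, if_pos rfl] at hy1
    obtain ⟨v, hv⟩ := hy1
    have hv : 𝓛.curvatureDeriv p v = (y : V p) := hv
    have h2 := hχ.lin_curvatureDeriv hopen hopen' hp v hv.symm
    rw [hy.2] at h2
    obtain ⟨z, hz, hvz⟩ := h0s (mfderiv 𝓘(ℝ, EM) 𝓘(ℝ, EN) f p v) h2.symm
    refine ⟨v - z, ?_, ?_⟩
    · rw [map_sub]
      exact hvz
    · rw [map_sub, hv, show 𝓛.curvatureDeriv p z = 0 from hz, sub_zero]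
  · exact h0i v hv' hv

end LInftyBundle

/-! ### Pseudoinverses -/

section Pseudoinverse

variable {B : Type*} [AddCommGroup B] [Module ℝ B]

/-- `s` is the value at `x` of the pseudoinverse of `T : K₁ → K₂`, extended by zero to the
orthogonal complement of `K₂`: the image `T s` is the orthogonal projection of `x` to `K₂`, and `s`
is the image of some `y ∈ K₂` under the adjoint of `T`. -/
def IsPseudoinverseAt (g : B →ₗ[ℝ] B →ₗ[ℝ] ℝ) (K₁ K₂ : Submodule ℝ B) (T : B →ₗ[ℝ] B)
    (x s y : B) : Prop :=
  (∀ k ∈ K₂, g (T s) k = g x k) ∧ ∀ a ∈ K₁, g s a = g y (T a)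

variable {g : B →ₗ[ℝ] B →ₗ[ℝ] ℝ} (hpos : ∀ x, x ≠ 0 → 0 < g x x) {K₁ K₂ : Submodule ℝ B}
  {T : B →ₗ[ℝ] B} (hT : K₁.map T = K₂)
include hpos hT

/-- Uniqueness: the linear conditions that define the pseudoinverse are nonsingular. -/
lemma IsPseudoinverseAt.eq_zero {s y : B} (hs : s ∈ K₁) (hy : y ∈ K₂)
    (h : IsPseudoinverseAt g K₁ K₂ T 0 s y) : s = 0 ∧ y = 0 := by
  have hz : ∀ x, g x x = 0 → x = 0 := fun x hx => by
    by_contra h0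
    exact (hpos x h0).ne' hx
  have h1 : T s = 0 := by
    refine hz _ ?_
    rw [h.1 _ (hT ▸ Submodule.mem_map_of_mem hs)]
    simp
  have h2 : s = 0 := by
    refine hz _ ?_
    rw [h.2 s hs, h1, map_zero]
  refine ⟨h2, ?_⟩
  rw [← hT] at hy
  obtain ⟨a, ha, rfl⟩ := hy
  refine hz _ ?_
  rw [← h.2 a ha, h2]
  simp

/-- A linear system with as many equations as unknowns and with unique solutions is solvable. -/
lemma exists_pseudoinverse [FiniteDimensional ℝ B] : ∃ σ : B →ₗ[ℝ] B, (∀ x, σ x ∈ K₁) ∧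
    ∀ x, ∃ y ∈ K₂, IsPseudoinverseAt g K₁ K₂ T x (σ x) y := by
  let Φ : (K₁ × K₂) →ₗ[ℝ] Module.Dual ℝ K₁ × Module.Dual ℝ K₂ :=
    (((g.compl₁₂ K₁.subtype K₁.subtype) ∘ₗ LinearMap.fst ℝ K₁ K₂) -
      ((g.compl₁₂ K₂.subtype (T ∘ₗ K₁.subtype)) ∘ₗ LinearMap.snd ℝ K₁ K₂)).prod
    ((g.compl₁₂ (T ∘ₗ K₁.subtype) K₂.subtype) ∘ₗ LinearMap.fst ℝ K₁ K₂)
  have hΦ1 : ∀ z a, (Φ z).1 a = g z.1 a - g z.2 (T a) := fun z a => rfl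
  have hΦ2 : ∀ z k, (Φ z).2 k = g (T z.1) k := fun z k => rfl
  have hinj : Function.Injective Φ := by
    rw [← LinearMap.ker_eq_bot, LinearMap.ker_eq_bot']
    rintro ⟨s, y⟩ h
    have := IsPseudoinverseAt.eq_zero hpos hT s.2 y.2 ⟨fun k hk => by
      have h1 := hΦ2 ⟨s, y⟩ ⟨k, hk⟩
      rw [h] at h1
      simpa using h1.symm, fun a ha => by
      have h1 := hΦ1 ⟨s, y⟩ ⟨a, ha⟩
      rw [h] at h1
      exact sub_eq_zero.1 h1.symm⟩
    exact Prod.ext (Subtype.ext this.1) (Subtype.ext this.2)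
  have hsurj : Function.Surjective Φ := by
    refine (LinearMap.injective_iff_surjective_of_finrank_eq_finrank ?_).1 hinj
    rw [Module.finrank_prod, Module.finrank_prod, Subspace.dual_finrank_eq,
      Subspace.dual_finrank_eq]
  let e := LinearEquiv.ofBijective Φ ⟨hinj, hsurj⟩
  let r : B →ₗ[ℝ] Module.Dual ℝ K₁ × Module.Dual ℝ K₂ :=
    LinearMap.prod 0 (g.compl₁₂ LinearMap.id K₂.subtype)
  have he : ∀ x, Φ (e.symm (r x)) = r x := fun x => e.apply_symm_apply (r x)
  refine ⟨K₁.subtype ∘ₗ LinearMap.fst ℝ K₁ K₂ ∘ₗ e.symm.toLinearMap ∘ₗ r,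
    fun x => (e.symm (r x)).1.2, fun x => ⟨(e.symm (r x)).2, (e.symm (r x)).2.2, ?_, ?_⟩⟩
  · intro k hk
    have := hΦ2 (e.symm (r x)) ⟨k, hk⟩
    rw [he] at this
    exact this.symm
  · intro a ha
    have := hΦ1 (e.symm (r x)) ⟨a, ha⟩
    rw [he] at this
    exact sub_eq_zero.1 this.symm

end Pseudoinverse

namespace LInftyBundle

open Filter Topology

variable {EM : Type*} [NormedAddCommGroup EM] [NormedSpace ℝ EM]
  {M : Type*} [TopologicalSpace M] [ChartedSpace EM M]
  {FM : Type*} [NormedAddCommGroup FM] [NormedSpace ℝ FM]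
  {V : M → Type*} [∀ p, AddCommGroup (V p)] [∀ p, Module ℝ (V p)]
  [TopologicalSpace (TotalSpace FM V)] [∀ p, TopologicalSpace (V p)] [FiberBundle FM V]
  {EN : Type*} [NormedAddCommGroup EN] [NormedSpace ℝ EN]
  {N : Type*} [TopologicalSpace N] [ChartedSpace EN N]
  {FN : Type*} [NormedAddCommGroup FN] [NormedSpace ℝ FN]
  {W : N → Type*} [∀ q, AddCommGroup (W q)] [∀ q, Module ℝ (W q)]
  [TopologicalSpace (TotalSpace FN W)] [∀ q, TopologicalSpace (W q)] [FiberBundle FN W]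
  [VectorBundle ℝ FM V] [FiniteDimensional ℝ FM] [VectorBundle ℝ FN W] [FiniteDimensional ℝ FN]

variable {𝓛 : LInftyBundle EM FM V} {𝓛' : LInftyBundle EN FN W} {f : M → N}

/-! ### The kernel of a fibration -/

/-- The kernel of the linear part of a morphism in degree `i`, as a subspace of the ambient
bundle. -/
def Hom.kerGrade (χ : Hom 𝓛 𝓛' f) (i : ℕ) (p : M) : Submodule ℝ (V p) :=
  (χ.kerGr p i).map (𝓛.fib p).subtype

lemma Hom.kerGrade_le_fib (χ : Hom 𝓛 𝓛' f) (i : ℕ) (p : M) : χ.kerGrade i p ≤ 𝓛.fib p := by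
  rintro _ ⟨x, -, rfl⟩
  exact x.2

lemma Hom.inclusion_mem_kerGr (χ : Hom 𝓛 𝓛' f) {i : ℕ} {p : M} (x : χ.kerGrade i p) :
    Submodule.inclusion (χ.kerGrade_le_fib i p) x ∈ χ.kerGr p i := by
  obtain ⟨_, ⟨y, hy, rfl⟩⟩ := x
  exact hy

/-- The kernel of a fibration is a subbundle in each degree. -/
lemma Hom.IsFibration.isSmoothSubbundle_kerGrade [IsManifold 𝓘(ℝ, EN) ∞ N]
    [ContMDiffVectorBundle ∞ FN W 𝓘(ℝ, EN)] {χ : Hom 𝓛 𝓛' f} (hfib : χ.IsFibration) (i : ℕ) :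
    IsSmoothSubbundle EM FM 𝓛.base (χ.kerGrade i) := by
  rw [isSmoothSubbundle_iff]
  intro p₀ hp
  obtain ⟨ι, _, e, he⟩ := isSmoothSubbundle_iff.1 (𝓛.subbundle i) p₀ hp
  obtain ⟨ι', _, e', he'⟩ := isSmoothSubbundle_iff.1 (𝓛'.subbundle i) (f p₀) (χ.mapsTo hp)
  have hf := χ.contMDiffOn p₀ hp
  have ht : Tendsto f (𝓝[𝓛.base] p₀) (𝓝[𝓛'.base] (f p₀)) :=
    hf.continuousWithinAt.tendsto_nhdsWithin χ.mapsTo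
  let B : ∀ p, 𝓛.grade i p →ₗ[ℝ] W (f p) := fun p =>
    (𝓛'.fib (f p)).subtype ∘ₗ χ.lin p ∘ₗ Submodule.inclusion (𝓛.grade_le_fib p i)
  have hrange : ∀ p ∈ 𝓛.base, LinearMap.range (B p) = 𝓛'.grade i (f p) := by
    intro p hp
    apply le_antisymm
    · rintro _ ⟨x, rfl⟩
      exact χ.lin_mem hp (i := i) (x := Submodule.inclusion (𝓛.grade_le_fib p i) x) x.2
    · intro y hy
      obtain ⟨x, hx, hxy⟩ := (hfib p hp).2 i
        (show (⟨y, 𝓛'.grade_le_fib _ i hy⟩ : 𝓛'.fib (f p)) ∈ 𝓛'.gr (f p) i from hy)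
      exact ⟨⟨x, hx⟩, congrArg Subtype.val hxy⟩
  obtain ⟨κ, hκ, k, hk⟩ := he.exists_frame_ker_bundle hp hf B (by
      filter_upwards [he.smooth, eventually_mem_nhdsWithin] with q h1 h2 j
      exact χ.smoothAlong_lin (b := id) h2 (fun _ h => h)
        (s := fun p => Submodule.inclusion (𝓛.grade_le_fib p i) (e j p)) (h1 j))
    (Fintype.card ι') (by
      filter_upwards [ht he'.span, ht he'.indep, eventually_mem_nhdsWithin] with q h1 h2 h3
      rw [hrange q h3]
      have h4 := finrank_span_eq_card h2
      rw [h1, finrank_top] at h4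
      exact h4)
  refine ⟨κ, hκ, _, hk.of_eventuallyEq (Eventually.of_forall fun q => ?_)⟩
  ext x
  constructor
  · rintro ⟨y, hy, rfl⟩
    exact ⟨⟨y, hy.1⟩, congrArg Subtype.val hy.2, rfl⟩
  · rintro ⟨y, hy, rfl⟩
    exact ⟨Submodule.inclusion (𝓛.grade_le_fib q i) y, ⟨y.2, Subtype.ext hy⟩, rfl⟩

/-- The set of points where `λ₁` maps the kernel of `χ` in degree `m` onto that in degree
`m + 1`. -/
def Hom.surjLocus (χ : Hom 𝓛 𝓛' f) (m : ℕ) : Set M :=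
  {p | p ∈ 𝓛.base ∧ χ.kerGr p (m + 1) ≤ (χ.kerGr p m).map (unary (𝓛.op p))}

lemma Hom.IsLinear.map_kerGr {χ : Hom 𝓛 𝓛' f} (hχ : χ.IsLinear) {m : ℕ} {p : M}
    (hp : p ∈ χ.surjLocus m) : (χ.kerGr p m).map (unary (𝓛.op p)) = χ.kerGr p (m + 1) := by
  refine le_antisymm ?_ hp.2
  rintro _ ⟨x, hx, rfl⟩
  exact hχ.lam_mem_kerGr hp.1 hx

/-- Surjectivity is an open condition, as the rank of a smooth bundle map is lower semicontinuous
and the kernels of a fibration have locally constant rank. -/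
lemma Hom.IsLinear.isOpen_surjLocus [IsManifold 𝓘(ℝ, EN) ∞ N]
    [ContMDiffVectorBundle ∞ FN W 𝓘(ℝ, EN)] {χ : Hom 𝓛 𝓛' f} (hχ : χ.IsLinear)
    (hfib : χ.IsFibration) (hopen : IsOpen 𝓛.base) (m : ℕ) : IsOpen (χ.surjLocus m) := by
  rw [isOpen_iff_eventually]
  rintro p₀ ⟨hp, hp'⟩
  rw [← hopen.nhdsWithin_eq hp]
  obtain ⟨ι, _, a, ha⟩ := isSmoothSubbundle_iff.1 (hfib.isSmoothSubbundle_kerGrade m) p₀ hp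
  obtain ⟨κ, _, k, hk⟩ := isSmoothSubbundle_iff.1 (hfib.isSmoothSubbundle_kerGrade (m + 1)) p₀ hp
  let B : ∀ p, χ.kerGrade m p →ₗ[ℝ] V p := fun p =>
    (𝓛.fib p).subtype ∘ₗ unary (𝓛.op p) ∘ₗ Submodule.inclusion (χ.kerGrade_le_fib m p)
  have hrange : ∀ p, LinearMap.range (B p) =
      ((χ.kerGr p m).map (unary (𝓛.op p))).map (𝓛.fib p).subtype := by
    intro p
    ext x
    constructor
    · rintro ⟨y, rfl⟩
      exact ⟨_, ⟨_, χ.inclusion_mem_kerGr y, rfl⟩, rfl⟩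
    · rintro ⟨_, ⟨y, hy, rfl⟩, rfl⟩
      exact ⟨⟨y, ⟨y, hy, rfl⟩⟩, rfl⟩
  have hle : ∀ p ∈ 𝓛.base, LinearMap.range (B p) ≤ χ.kerGrade (m + 1) p := by
    intro p hp
    rw [hrange]
    refine Submodule.map_mono ?_
    rintro _ ⟨x, hx, rfl⟩
    exact hχ.lam_mem_kerGr hp hx
  have hdim : ∀ᶠ q in 𝓝[𝓛.base] p₀, Module.finrank ℝ (χ.kerGrade (m + 1) q) = Fintype.card κ := by
    filter_upwards [hk.span, hk.indep] with q h3 h4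
    rw [← finrank_top ℝ (χ.kerGrade (m + 1) q), ← h3, finrank_span_eq_card h4]
  have h0 : LinearMap.range (B p₀) = χ.kerGrade (m + 1) p₀ :=
    le_antisymm (hle p₀ hp) (by rw [hrange]; exact Submodule.map_mono hp')
  have hid : ContMDiffWithinAt 𝓘(ℝ, EM) 𝓘(ℝ, EM) ∞ (id : M → M) 𝓛.base p₀ := contMDiffWithinAt_id
  have hrank := ha.eventually_le_finrank_range hp (f := id) hid B fun j =>
    𝓛.smoothAlong_op (k := 1) (b := id) hp hid (fun _ h => h)
      (s := fun _ p => Submodule.inclusion (χ.kerGrade_le_fib m p) (a j p))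
      fun _ => ha.smooth.self_of_nhdsWithin hp j
  filter_upwards [hrank, hdim, eventually_mem_nhdsWithin] with q h1 h2 h3
  refine ⟨h3, ?_⟩
  have hfd : Module.Finite ℝ (V q) :=
    LinearEquiv.finiteDimensional ((trivializationAt FM V q).continuousLinearEquivAt ℝ q
      (mem_baseSet_trivializationAt FM V q)).symm.toLinearEquiv
  have h4 : LinearMap.range (B q) = χ.kerGrade (m + 1) q := by
    refine Submodule.eq_of_le_of_finrank_le (hle q h3) ?_
    rw [h2, ← hdim.self_of_nhdsWithin hp, ← h0]
    exact h1
  rw [hrange] at h4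
  exact (Submodule.map_injective_of_injective (𝓛.fib q).injective_subtype h4).ge

/-! ### The homotopy on the kernel of a fibration -/

/-- A smooth family of maps `η` of degree `-1`, defined over `U`, with values in the kernel of `χ`
in degree `m`, that vanishes outside of degree `m + 1`, and inverts `λ₁` between the kernels of `χ`
in these degrees, up to a choice of complements. -/
structure KernelHomotopy (χ : Hom 𝓛 𝓛' f) (m : ℕ) (U : Set M) where
  η : ∀ p, 𝓛.fib p →ₗ[ℝ] 𝓛.fib p
  eq_zero : ∀ p ∉ U, η p = 0
  mem : ∀ p ∈ U, ∀ x, η p x ∈ χ.kerGr p m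
  apply_of_ne : ∀ p ∈ U, ∀ i, i ≠ m + 1 → ∀ x ∈ 𝓛.gr p i, η p x = 0
  contraction : ∀ p ∈ U, ∀ x, η p (unary (𝓛.op p) (η p x)) = η p x
  injective : ∀ p ∈ U, ∀ x ∈ χ.kerGr p (m + 1), η p x = 0 → x = 0
  smooth : ∀ (A : Set M) (p : M), A ⊆ U → p ∈ A → ∀ s : ∀ q, 𝓛.fib q,
    SmoothAlong EM EM FM id A p (fun q => (s q : V q)) →
    SmoothAlong EM EM FM id A p (fun q => (η q (s q) : V q))

/-- The homotopy is the fibrewise pseudoinverse of `λ₁` between the kernels with respect to a fibre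
metric, preceded by the projection to degree `m + 1`. -/
lemma Hom.IsLinear.exists_kernelHomotopy [IsManifold 𝓘(ℝ, EN) ∞ N]
    [ContMDiffVectorBundle ∞ FN W 𝓘(ℝ, EN)] {χ : Hom 𝓛 𝓛' f} (hχ : χ.IsLinear)
    (hfib : χ.IsFibration) (m : ℕ) (G : FibreMetric EM FM V) :
    Nonempty (KernelHomotopy χ m (χ.surjLocus m)) := by
  classical
  let g : ∀ p, 𝓛.fib p →ₗ[ℝ] 𝓛.fib p →ₗ[ℝ] ℝ := fun p =>
    (G.form p).compl₁₂ (𝓛.fib p).subtype (𝓛.fib p).subtype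
  have hpos : ∀ p x, x ≠ 0 → 0 < g p x x := fun p x hx => G.pos p x (by simpa using hx)
  have hex : ∀ p, ∃ σ : 𝓛.fib p →ₗ[ℝ] 𝓛.fib p, p ∈ χ.surjLocus m → (∀ x, σ x ∈ χ.kerGr p m) ∧
      ∀ x, ∃ y ∈ χ.kerGr p (m + 1),
        IsPseudoinverseAt (g p) (χ.kerGr p m) (χ.kerGr p (m + 1)) (unary (𝓛.op p)) x (σ x) y := by
    intro p
    by_cases hp : p ∈ χ.surjLocus m
    · have := finiteDimensional_fib (𝓛 := 𝓛) p
      obtain ⟨σ, hσ⟩ := exists_pseudoinverse (hpos p) (hχ.map_kerGr hp)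
      exact ⟨σ, fun _ => hσ⟩
    · exact ⟨0, fun h => absurd h hp⟩
  choose σ hσ using hex
  let η : ∀ p, 𝓛.fib p →ₗ[ℝ] 𝓛.fib p := fun p =>
    if p ∈ χ.surjLocus m then σ p ∘ₗ 𝓛.proj p (m + 1) else 0
  have hη : ∀ p ∈ χ.surjLocus m, ∀ x, η p x = σ p (𝓛.proj p (m + 1) x) := fun p hp x => by
    simp only [η, if_pos hp, LinearMap.comp_apply]
  have huniq : ∀ p ∈ χ.surjLocus m, ∀ x, (∀ k ∈ χ.kerGr p (m + 1), g p x k = 0) → σ p x = 0 := by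
    intro p hp x hx
    obtain ⟨hmem, hps⟩ := hσ p hp
    obtain ⟨y, hy, h⟩ := hps x
    refine (IsPseudoinverseAt.eq_zero (hpos p) (hχ.map_kerGr hp) (hmem x) hy ⟨fun k hk => ?_, h.2⟩).1
    rw [h.1 k hk, hx k hk]
    simp
  refine ⟨⟨η, fun p hp => if_neg hp, fun p hp x => ?_, fun p hp i hi x hx => ?_,
    fun p hp x => ?_, fun p hp x hx h0 => ?_, fun A p hA hp s hs => ?_⟩⟩
  · rw [hη p hp]
    exact (hσ p hp).1 _
  · rw [hη p hp, proj_of_mem_ne hp.1 hi hx, map_zero]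
  · rw [hη p hp, hη p hp, proj_of_mem hp.1 (lam_degree hp.1 ((hσ p hp).1 _).1), ← sub_eq_zero,
      ← map_sub]
    refine huniq p hp _ fun k hk => ?_
    obtain ⟨y, hy, h⟩ := (hσ p hp).2 (𝓛.proj p (m + 1) x)
    rw [map_sub, LinearMap.sub_apply, h.1 k hk, sub_self]
  · rw [hη p hp, proj_of_mem hp.1 hx.1] at h0
    obtain ⟨y, hy, h⟩ := (hσ p hp).2 x
    by_contra hx0
    have h1 := h.1 x hx
    rw [h0] at h1
    simp only [map_zero, LinearMap.zero_apply] at h1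
    exact (hpos p x hx0).ne h1
  · obtain ⟨ι, _, a, ha⟩ :=
      isSmoothSubbundle_iff.1 (hfib.isSmoothSubbundle_kerGrade m) p (hA hp).1
    obtain ⟨κ, _, k, hk⟩ :=
      isSmoothSubbundle_iff.1 (hfib.isSmoothSubbundle_kerGrade (m + 1)) p (hA hp).1
    have hAb : A ⊆ 𝓛.base := fun q hq => (hA hq).1
    have hmono : 𝓝[A] p ≤ 𝓝[𝓛.base] p := nhdsWithin_mono p hAb
    have hid : ContMDiffWithinAt 𝓘(ℝ, EM) 𝓘(ℝ, EM) ∞ (id : M → M) A p := contMDiffWithinAt_id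
    let a' : ι → ∀ q, 𝓛.fib q := fun j q => Submodule.inclusion (χ.kerGrade_le_fib m q) (a j q)
    let k' : κ → ∀ q, 𝓛.fib q := fun j q =>
      Submodule.inclusion (χ.kerGrade_le_fib (m + 1) q) (k j q)
    have has : ∀ j, SmoothAlong EM EM FM id A p (fun q => (a' j q : V q)) := fun j =>
      (ha.smooth.self_of_nhdsWithin (hA hp).1 j).mono hAb
    have hks : ∀ j, SmoothAlong EM EM FM id A p (fun q => (k' j q : V q)) := fun j =>
      (hk.smooth.self_of_nhdsWithin (hA hp).1 j).mono hAb
    have hTa : ∀ j, SmoothAlong EM EM FM id A p (fun q => (unary (𝓛.op q) (a' j q) : V q)) :=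
      fun j => 𝓛.smoothAlong_op (k := 1) (b := id) hp hid hAb (s := fun _ => a' j) fun _ => has j
    have hps := 𝓛.smoothAlong_proj (b := id) hp hAb (m + 1) hs
    let x : ∀ q, 𝓛.fib q := fun q => 𝓛.proj q (m + 1) (s q)
    -- the coefficients of the pseudoinverse solve a system of linear equations
    let vec : ι ⊕ κ → M → (ι ⊕ κ → ℝ) := fun j q => Sum.elim
      (fun i => Sum.elim (fun i' => g q (a' i q) (a' i' q))
        (fun j' => g q (unary (𝓛.op q) (a' i q)) (k' j' q)))
      (fun j => Sum.elim (fun i' => -g q (k' j q) (unary (𝓛.op q) (a' i' q))) (fun _ => 0)) j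
    let rhs : M → (ι ⊕ κ → ℝ) := fun q => Sum.elim (fun _ => 0) (fun j' => g q (x q) (k' j' q))
    have hspanA : ∀ q ∈ A, Submodule.span ℝ (range fun j => a j q) = ⊤ →
        ∀ z ∈ χ.kerGr q m, ∃ c : ι → ℝ, z = ∑ j, c j • a' j q := by
      intro q _ h1 z hz
      have h2 : (⟨z, ⟨z, hz, rfl⟩⟩ : χ.kerGrade m q) ∈ Submodule.span ℝ (range fun j => a j q) := by
        rw [h1]; trivial
      obtain ⟨c, hc⟩ := (Submodule.mem_span_range_iff_exists_fun ℝ).1 h2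
      refine ⟨c, Subtype.ext ?_⟩
      have h3 := congrArg Subtype.val hc
      simpa [a'] using h3.symm
    have hspanK : ∀ q ∈ A, Submodule.span ℝ (range fun j => k j q) = ⊤ →
        ∀ z ∈ χ.kerGr q (m + 1), ∃ c : κ → ℝ, z = ∑ j, c j • k' j q := by
      intro q _ h1 z hz
      have h2 : (⟨z, ⟨z, hz, rfl⟩⟩ : χ.kerGrade (m + 1) q) ∈
          Submodule.span ℝ (range fun j => k j q) := by
        rw [h1]; trivial
      obtain ⟨c, hc⟩ := (Submodule.mem_span_range_iff_exists_fun ℝ).1 h2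
      refine ⟨c, Subtype.ext ?_⟩
      have h3 := congrArg Subtype.val hc
      simpa [a', k'] using h3.symm
    -- the equations, in terms of the vectors
    have hsys : ∀ q (c : ι ⊕ κ → ℝ) (z : 𝓛.fib q),
        ((∀ i', g q (∑ i, c (.inl i) • a' i q) (a' i' q) =
            g q (∑ j, c (.inr j) • k' j q) (unary (𝓛.op q) (a' i' q))) ∧
          ∀ j', g q (unary (𝓛.op q) (∑ i, c (.inl i) • a' i q)) (k' j' q) = g q z (k' j' q)) ↔
        ∑ j, c j • vec j q = Sum.elim (fun _ => 0) (fun j' => g q z (k' j' q)) := by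
      intro q c z
      rw [funext_iff, Sum.forall]
      refine and_congr (forall_congr' fun i' => ?_) (forall_congr' fun j' => ?_)
      · rw [← sub_eq_zero]
        simp only [map_sum, map_smul, LinearMap.sum_apply, LinearMap.smul_apply, Finset.sum_apply,
          Pi.smul_apply, Fintype.sum_sum_type, Sum.elim_inl, vec, smul_neg,
          Finset.sum_neg_distrib, Sum.elim_inr, sub_eq_add_neg]
      · simp only [map_sum, map_smul, LinearMap.sum_apply, LinearMap.smul_apply, Finset.sum_apply,
          Pi.smul_apply, Fintype.sum_sum_type, Sum.elim_inl, vec, Sum.elim_inr, smul_zero,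
          Finset.sum_const_zero, add_zero]
    have hcoef : ∀ q, ∃ c : ι ⊕ κ → ℝ, (q ∈ A → Submodule.span ℝ (range fun j => a j q) = ⊤ →
        Submodule.span ℝ (range fun j => k j q) = ⊤ →
        σ q (x q) = ∑ i, c (.inl i) • a' i q ∧ ∑ j, c j • vec j q = rhs q) := by
      intro q
      by_cases h : q ∈ A ∧ Submodule.span ℝ (range fun j => a j q) = ⊤ ∧
        Submodule.span ℝ (range fun j => k j q) = ⊤
      · obtain ⟨h1, h2, h3⟩ := h
        obtain ⟨y, hy, h4, h5⟩ := (hσ q (hA h1)).2 (x q)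
        obtain ⟨c, hc⟩ := hspanA q h1 h2 _ ((hσ q (hA h1)).1 (x q))
        obtain ⟨d, hd⟩ := hspanK q h1 h3 _ hy
        refine ⟨Sum.elim c d, fun _ _ _ => ⟨by simpa using hc, ?_⟩⟩
        rw [← hsys q (Sum.elim c d) (x q)]
        simp only [Sum.elim_inl, Sum.elim_inr]
        rw [← hc, ← hd]
        exact ⟨fun i' => h5 _ (χ.inclusion_mem_kerGr _), fun j' => h4 _ (χ.inclusion_mem_kerGr _)⟩
      · exact ⟨0, fun h1 h2 h3 => absurd ⟨h1, h2, h3⟩ h⟩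
    choose c hc using hcoef
    have hev : ∀ᶠ q in 𝓝[A] p, σ q (x q) = ∑ i, c q (.inl i) • a' i q ∧
        ∑ j, c q j • vec j q = rhs q := by
      filter_upwards [hmono ha.span, hmono hk.span, eventually_mem_nhdsWithin] with q h1 h2 h3
      exact hc q h3 h1 h2
    -- the system is nonsingular, so its solutions depend smoothly on the coefficients
    have hli : LinearIndependent ℝ fun j => vec j p := by
      rw [Fintype.linearIndependent_iff]
      intro d hd
      have h1 : ∑ j, d j • vec j p =
          Sum.elim (fun _ => 0) (fun j' => g p 0 (k' j' p)) := by
        rw [hd]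
        funext j
        rcases j with j | j <;> simp
      obtain ⟨h2, h3⟩ := (hsys p d 0).2 h1
      have hlin : ∀ {ι : Type} [Fintype ι] (v : ι → 𝓛.fib p) (e : ι → ℝ) (l l' : 𝓛.fib p →ₗ[ℝ] ℝ),
          (∀ j, l (v j) = l' (v j)) → l (∑ j, e j • v j) = l' (∑ j, e j • v j) := by
        intro ι _ v e l l' h
        rw [map_sum, map_sum]
        refine Finset.sum_congr rfl fun j _ => ?_
        rw [map_smul, map_smul, h j]
      have hspa := ha.span.self_of_nhdsWithin (hA hp).1
      have hspk := hk.span.self_of_nhdsWithin (hA hp).1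
      obtain ⟨h4, h5⟩ := IsPseudoinverseAt.eq_zero (hpos p) (hχ.map_kerGr (hA hp))
        (s := ∑ i, d (.inl i) • a' i p) (y := ∑ j, d (.inr j) • k' j p)
        (Submodule.sum_mem _ fun i _ => Submodule.smul_mem _ _ (χ.inclusion_mem_kerGr _))
        (Submodule.sum_mem _ fun i _ => Submodule.smul_mem _ _ (χ.inclusion_mem_kerGr _))
        ⟨fun z hz => by
          obtain ⟨e, rfl⟩ := hspanK p hp hspk z hz
          exact hlin (k' · p) e _ _ h3,
        fun z hz => by
          obtain ⟨e, rfl⟩ := hspanA p hp hspa z hz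
          exact hlin (a' · p) e _ (g p _ ∘ₗ unary (𝓛.op p)) h2⟩
      have h6 : ∑ i, d (.inl i) • a i p = 0 := by
        apply Subtype.ext
        have := congrArg Subtype.val h4
        simpa [a'] using this
      have h7 : ∑ i, d (.inr i) • k i p = 0 := by
        apply Subtype.ext
        have := congrArg Subtype.val h5
        simpa [k'] using this
      rintro (i | j)
      · exact Fintype.linearIndependent_iff.1 (ha.indep.self_of_nhdsWithin (hA hp).1) _ h6 i
      · exact Fintype.linearIndependent_iff.1 (hk.indep.self_of_nhdsWithin (hA hp).1) _ h7 j
    have hgs : ∀ {s t : ∀ q, 𝓛.fib q}, SmoothAlong EM EM FM id A p (fun q => (s q : V q)) →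
        SmoothAlong EM EM FM id A p (fun q => (t q : V q)) →
        ContMDiffWithinAt 𝓘(ℝ, EM) 𝓘(ℝ, ℝ) ∞ (fun q => g q (s q) (t q)) A p :=
      fun hs ht => G.smooth A p _ _ hs ht
    have hvec : ∀ j, ContMDiffWithinAt 𝓘(ℝ, EM) 𝓘(ℝ, ι ⊕ κ → ℝ) ∞ (vec j) A p := by
      intro j
      rw [contMDiffWithinAt_pi_space]
      rcases j with i | j <;> rintro (i' | j')
      · exact hgs (has i) (has i')
      · exact hgs (hTa i) (hks j')
      · exact (hgs (hks j) (hTa i')).neg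
      · exact contMDiffWithinAt_const
    have hrhs : ContMDiffWithinAt 𝓘(ℝ, EM) 𝓘(ℝ, ι ⊕ κ → ℝ) ∞ rhs A p := by
      rw [contMDiffWithinAt_pi_space]
      rintro (i' | j')
      · exact contMDiffWithinAt_const
      · exact hgs hps (hks j')
    have hcs := contMDiffWithinAt_coeff (c := fun j q => c q j) hp hvec hrhs hli
      (hev.mono fun q hq => hq.2)
    refine SmoothAlong.congr (s := fun q => ∑ i, c q (.inl i) • (a' i q : V q))
      (SmoothAlong.sum _ hid fun i _ => (has i).smul (hcs (.inl i))) hp ?_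
    filter_upwards [hev, eventually_mem_nhdsWithin] with q h1 h2
    rw [hη q (hA h2), h1.1]
    simp

end LInftyBundle

namespace LInftyBundle

open Filter Topology

variable {EM : Type*} [NormedAddCommGroup EM] [NormedSpace ℝ EM]
  {M : Type*} [TopologicalSpace M] [ChartedSpace EM M]
  {FM : Type*} [NormedAddCommGroup FM] [NormedSpace ℝ FM]
  {V : M → Type*} [∀ p, AddCommGroup (V p)] [∀ p, Module ℝ (V p)]
  [TopologicalSpace (TotalSpace FM V)] [∀ p, TopologicalSpace (V p)] [FiberBundle FM V]
  {EN : Type*} [NormedAddCommGroup EN] [NormedSpace ℝ EN]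
  {N : Type*} [TopologicalSpace N] [ChartedSpace EN N]
  {FN : Type*} [NormedAddCommGroup FN] [NormedSpace ℝ FN]
  {W : N → Type*} [∀ q, AddCommGroup (W q)] [∀ q, Module ℝ (W q)]
  [TopologicalSpace (TotalSpace FN W)] [∀ q, TopologicalSpace (W q)] [FiberBundle FN W]
  [VectorBundle ℝ FM V] [FiniteDimensional ℝ FM] [VectorBundle ℝ FN W] [FiniteDimensional ℝ FN]

variable {𝓛 : LInftyBundle EM FM V} {𝓛' : LInftyBundle EN FN W} {f : M → N}

/-! ### Transfer along a homotopy on the kernel of a fibration -/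

variable (𝓛) in
/-- The part of `λ₁` that raises the degree from `m` to `m + 1`. -/
def degDiff (m : ℕ) (p : M) : 𝓛.fib p →ₗ[ℝ] 𝓛.fib p := unary (𝓛.op p) ∘ₗ 𝓛.proj p m

lemma degDiff_of_mem {m : ℕ} {p : M} (hp : p ∈ 𝓛.base) {x : 𝓛.fib p} (hx : x ∈ 𝓛.gr p m) :
    𝓛.degDiff m p x = unary (𝓛.op p) x := by
  rw [degDiff, LinearMap.comp_apply, proj_of_mem hp hx]

lemma degDiff_of_mem_ne {m i : ℕ} (hi : i ≠ m) {p : M} (hp : p ∈ 𝓛.base) {x : 𝓛.fib p}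
    (hx : x ∈ 𝓛.gr p i) : 𝓛.degDiff m p x = 0 := by
  rw [degDiff, LinearMap.comp_apply, proj_of_mem_ne hp hi hx, map_zero]

lemma degDiff_mem (m : ℕ) {p : M} (hp : p ∈ 𝓛.base) (x : 𝓛.fib p) :
    𝓛.degDiff m p x ∈ 𝓛.gr p (m + 1) := lam_degree hp (proj_mem hp m x)

lemma degDiff_mem_gr (m : ℕ) {p : M} (hp : p ∈ 𝓛.base) {i : ℕ} {x : 𝓛.fib p} (hx : x ∈ 𝓛.gr p i) :
    𝓛.degDiff m p x ∈ 𝓛.gr p (i + 1) := by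
  by_cases hi : i = m
  · subst hi
    exact degDiff_mem _ hp x
  · rw [degDiff_of_mem_ne hi hp hx]
    exact Submodule.zero_mem _

lemma degDiff_sq (m : ℕ) {p : M} (hp : p ∈ 𝓛.base) (x : 𝓛.fib p) :
    𝓛.degDiff m p (𝓛.degDiff m p x) = 0 :=
  degDiff_of_mem_ne (by omega) hp (degDiff_mem m hp x)

lemma smoothAlong_degDiff (m : ℕ) {A : Set M} {p : M} (hA : A ⊆ 𝓛.base) (hp : p ∈ A)
    {s : ∀ q, 𝓛.fib q} (hs : SmoothAlong EM EM FM id A p (fun q => (s q : V q))) :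
    SmoothAlong EM EM FM id A p (fun q => (𝓛.degDiff m q (s q) : V q)) :=
  𝓛.smoothAlong_op (k := 1) (b := id) hp contMDiffWithinAt_id hA
    (s := fun _ q => 𝓛.proj q m (s q)) fun _ => 𝓛.smoothAlong_proj (b := id) hp hA m hs

/-- A smooth family of linear maps, as a smooth family of unary operations. -/
lemma isSmoothMultilinear_ofLinear {A : Set M} {g : ∀ p, 𝓛.fib p →ₗ[ℝ] 𝓛.fib p}
    (hg : ∀ (B : Set M) (p : M), B ⊆ A → p ∈ B → ∀ s : ∀ q, 𝓛.fib q,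
      SmoothAlong EM EM FM id B p (fun q => (s q : V q)) →
      SmoothAlong EM EM FM id B p (fun q => (g q (s q) : V q))) :
    IsSmoothMultilinear EM FM EM FM A 𝓛.fib id 𝓛.fib (fun p => _root_.ofLinear (g p) 1) :=
  fun _ _ s hs p hp => hg _ p inter_subset_left hp (s 0) (hs 0 p hp)

/-- The kernel of a morphism that is an isomorphism in degree `i` vanishes. -/
lemma Hom.IsIsoInDegree.kerGr_eq_bot {χ : Hom 𝓛 𝓛' f} {i : ℕ} (h : χ.IsIsoInDegree i) {p : M}
    (hp : p ∈ 𝓛.base) : χ.kerGr p i = ⊥ := by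
  rw [eq_bot_iff]
  rintro x ⟨hx, hx'⟩
  exact (h p hp).2.1 hx (Submodule.zero_mem _) (by rw [map_zero]; exact hx')

/-- The operations of the source of `χ` vanish if one argument belongs to the kernel of `χ`, in a
degree so large that the kernel vanishes in the degree of the result: the result belongs to the
kernel, and all arguments have positive degree. -/
lemma Hom.IsLinear.op_eq_zero {χ : Hom 𝓛 𝓛' f} (hχ : χ.IsLinear) {p : M} (hp : p ∈ 𝓛.base) {m : ℕ}
    (hvan : ∀ i, m + 1 < i → χ.kerGr p i = ⊥) {k e : ℕ} (x : Fin k → 𝓛.fib p) (i : Fin k)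
    (hx : x i ∈ χ.kerGr p e) (he : m + 1 ≤ e ∨ m ≤ e ∧ 2 ≤ k) : 𝓛.op p k x = 0 := by
  classical
  rw [← Submodule.mem_bot ℝ]
  refine (𝓛.op p k).mem_of_homogeneous
    (fun j n => if j = i then (if n = e then χ.kerGr p e else ⊥) else 𝓛.gr p n) ⊥
    (fun d y hy => ?_) x fun j => ?_
  · rw [Submodule.mem_bot]
    by_cases hzero : ∃ j, y j = 0
    · obtain ⟨j, hj⟩ := hzero
      exact MultilinearMap.map_coord_zero _ j hj
    push Not at hzero
    have hi := hy i
    rw [if_pos rfl] at hi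
    have hde : d i = e := by
      by_contra hne
      rw [if_neg hne] at hi
      exact hzero i hi
    rw [if_pos hde] at hi
    have hyg : ∀ j, y j ∈ 𝓛.gr p (d j) := fun j => by
      by_cases hj : j = i
      · subst hj
        rw [hde]
        exact hi.1
      · have := hy j
        rwa [if_neg hj] at this
    have hd1 : ∀ j, 1 ≤ d j := fun j => by
      by_contra h0
      have h1 := hyg j
      rw [show d j = 0 by omega, 𝓛.gr_zero hp, Submodule.mem_bot] at h1
      exact hzero j h1
    have hdeg : m + 1 < (∑ j, d j) + 1 := by
      rw [← Finset.add_sum_erase _ _ (Finset.mem_univ i), hde]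
      rcases he with he | ⟨he, hk⟩
      · omega
      · have : ∃ j, j ∈ Finset.univ.erase i := by
          have : 0 < (Finset.univ.erase i).card := by
            rw [Finset.card_erase_of_mem (Finset.mem_univ i), Finset.card_univ, Fintype.card_fin]
            omega
          exact Finset.card_pos.1 this
        obtain ⟨j, hj⟩ := this
        have h2 := Finset.single_le_sum (f := d) (fun _ _ => Nat.zero_le _) hj
        have h3 := hd1 j
        omega
    have hmem : 𝓛.op p k y ∈ χ.kerGr p ((∑ j, d j) + 1) := by
      refine ⟨(𝓛.curvedLInfty p hp).degree k d y hyg, ?_⟩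
      change χ.lin p _ = 0
      rw [hχ.map_op hp k d y hyg]
      exact MultilinearMap.map_coord_zero _ i hi.2
    rw [hvan _ hdeg, Submodule.mem_bot] at hmem
    exact hmem
  · by_cases hj : j = i
    · subst hj
      refine Submodule.mem_iSup_of_mem e ?_
      simpa using hx
    · simp only [if_neg hj]
      exact 𝓛.mem_iSup_gr (x j)

namespace KernelHomotopy

variable {χ : Hom 𝓛 𝓛' f} {m : ℕ} {U : Set M} (h : KernelHomotopy χ m U)

/-- The projection `[δ, η]` whose kernel is the subspace to which the structure is transferred. -/
def comm (p : M) : 𝓛.fib p →ₗ[ℝ] 𝓛.fib p :=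
  𝓛.degDiff m p ∘ₗ h.η p + h.η p ∘ₗ 𝓛.degDiff m p

/-- The homogeneous parts of the kernel of `[δ, η]`. -/
def hGrade (i : ℕ) (p : M) : Submodule ℝ (V p) :=
  (𝓛.gr p i ⊓ (h.comm p).ker).map (𝓛.fib p).subtype

lemma comm_apply (p : M) (x : 𝓛.fib p) :
    h.comm p x = 𝓛.degDiff m p (h.η p x) + h.η p (𝓛.degDiff m p x) := rfl

lemma comm_off {p : M} (hp : p ∉ U) (x : 𝓛.fib p) : h.comm p x = 0 := by
  rw [comm_apply, h.eq_zero p hp]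
  simp

lemma hGrade_le (i : ℕ) (p : M) : h.hGrade i p ≤ 𝓛.grade i p := by
  rintro _ ⟨x, hx, rfl⟩
  exact hx.1

lemma iSup_hGrade_le (p : M) : ⨆ i, h.hGrade i p ≤ 𝓛.fib p :=
  iSup_mono fun i => h.hGrade_le i p

section

variable (hU : U ⊆ 𝓛.base)
include hU

lemma η_sq (p : M) (x : 𝓛.fib p) : h.η p (h.η p x) = 0 := by
  by_cases hp : p ∈ U
  · exact h.apply_of_ne p hp m (by omega) _ (h.mem p hp x).1
  · rw [h.eq_zero p hp]
    rfl

lemma η_degDiff {p : M} (hp : p ∈ U) (x : 𝓛.fib p) :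
    h.η p (𝓛.degDiff m p x) = h.η p (unary (𝓛.op p) x) := by
  refine LinearMap.congr_fun (𝓛.linearMap_ext (g := h.η p ∘ₗ 𝓛.degDiff m p)
    (g' := h.η p ∘ₗ unary (𝓛.op p)) fun i x hx => ?_) x
  rw [LinearMap.comp_apply, LinearMap.comp_apply]
  by_cases hi : i = m
  · subst hi
    rw [degDiff_of_mem (hU hp) hx]
  · rw [degDiff_of_mem_ne hi (hU hp) hx, map_zero,
      h.apply_of_ne p hp (i + 1) (by omega) _ (lam_degree (hU hp) hx)]

lemma degDiff_η {p : M} (hp : p ∈ U) (x : 𝓛.fib p) :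
    𝓛.degDiff m p (h.η p x) = unary (𝓛.op p) (h.η p x) :=
  degDiff_of_mem (hU hp) (h.mem p hp x).1

lemma η_degDiff_η (p : M) (x : 𝓛.fib p) : h.η p (𝓛.degDiff m p (h.η p x)) = h.η p x := by
  by_cases hp : p ∈ U
  · rw [h.degDiff_η hU hp, h.contraction p hp]
  · rw [h.eq_zero p hp]
    rfl

lemma η_degree {p : M} (hp : p ∈ U) {i : ℕ} {x : 𝓛.fib p} (hx : x ∈ 𝓛.gr p (i + 1)) :
    h.η p x ∈ 𝓛.gr p i := by
  by_cases hi : i = m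
  · subst hi
    exact (h.mem p hp x).1
  · rw [h.apply_of_ne p hp (i + 1) (by omega) x hx]
    exact Submodule.zero_mem _

lemma comm_degree (p : M) {i : ℕ} {x : 𝓛.fib p} (hx : x ∈ 𝓛.gr p i) : h.comm p x ∈ 𝓛.gr p i := by
  by_cases hp : p ∈ U
  · rw [comm_apply]
    refine Submodule.add_mem _ ?_ (h.η_degree hU hp (degDiff_mem_gr m (hU hp) hx))
    by_cases hi : i = m + 1
    · subst hi
      exact degDiff_mem m (hU hp) _
    · rw [h.apply_of_ne p hp i hi x hx, map_zero]
      exact Submodule.zero_mem _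
  · rw [h.comm_off hp]
    exact Submodule.zero_mem _

lemma comm_comm (p : M) (x : 𝓛.fib p) : h.comm p (h.comm p x) = h.comm p x := by
  by_cases hp : p ∈ U
  · simp only [comm_apply, map_add, h.η_sq hU, h.η_degDiff_η hU, degDiff_sq m (hU hp), map_zero,
      add_zero, zero_add]
  · simp only [h.comm_off hp]

lemma comm_of_ne {p : M} (hp : p ∈ U) {i : ℕ} (h1 : i ≠ m) (h2 : i ≠ m + 1) {x : 𝓛.fib p}
    (hx : x ∈ 𝓛.gr p i) : h.comm p x = 0 := by
  rw [comm_apply, h.apply_of_ne p hp i h2 x hx, degDiff_of_mem_ne h1 (hU hp) hx]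
  simp

lemma sub_comm_mem (p : M) (x : 𝓛.fib p) :
    ((x - h.comm p x : 𝓛.fib p) : V p) ∈ ⨆ i, h.hGrade i p := by
  refine 𝓛.fib_induction
    (C := fun x => ((x - h.comm p x : 𝓛.fib p) : V p) ∈ ⨆ i, h.hGrade i p) (fun i x hx => ?_)
    (by simp) (fun x y hx hy => ?_) x
  · refine Submodule.mem_iSup_of_mem i ⟨x - h.comm p x,
      ⟨Submodule.sub_mem _ hx (h.comm_degree hU p hx), ?_⟩, rfl⟩
    change h.comm p _ = 0
    rw [map_sub, h.comm_comm hU, sub_self]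
  · have : x + y - h.comm p (x + y) = (x - h.comm p x) + (y - h.comm p y) := by
      rw [map_add]
      abel
    rw [this]
    exact Submodule.add_mem _ hx hy

lemma comm_incl (p : M) (x : ↥(⨆ i, h.hGrade i p)) :
    h.comm p (Submodule.inclusion (h.iSup_hGrade_le p) x) = 0 := by
  have : ⨆ i, h.hGrade i p ≤ ((h.comm p).ker).map (𝓛.fib p).subtype :=
    iSup_le fun i => Submodule.map_mono inf_le_right
  obtain ⟨y, hy, hyx⟩ := this x.2
  have h1 : Submodule.inclusion (h.iSup_hGrade_le p) x = y := Subtype.ext hyx.symm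
  rw [h1]
  exact hy

end

/-- The projection `id - [δ, η]`. -/
def pr (hU : U ⊆ 𝓛.base) (p : M) : 𝓛.fib p →ₗ[ℝ] ↥(⨆ i, h.hGrade i p) :=
  ((𝓛.fib p).subtype ∘ₗ (LinearMap.id - h.comm p)).codRestrict _ (h.sub_comm_mem hU p)

lemma incl_pr (hU : U ⊆ 𝓛.base) (p : M) (x : 𝓛.fib p) :
    Submodule.inclusion (h.iSup_hGrade_le p) (h.pr hU p x) = x - h.comm p x := rfl

section

variable (hU : U ⊆ 𝓛.base) (hχ : χ.IsLinear)
include hU hχ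

lemma degDiff_η_mem {p : M} (hp : p ∈ U) (x : 𝓛.fib p) :
    𝓛.degDiff m p (h.η p x) ∈ χ.kerGr p (m + 1) := by
  rw [h.degDiff_η hU hp]
  exact hχ.lam_mem_kerGr (hU hp) (h.mem p hp x)

lemma lin_comm {p : M} (hp : p ∈ U) (x : 𝓛.fib p) : χ.lin p (h.comm p x) = 0 := by
  rw [comm_apply, map_add, (h.mem p hp _).2, add_zero]
  exact (h.degDiff_η_mem hU hχ hp x).2

variable (hm : 1 ≤ m) (hvan : ∀ p ∈ U, ∀ i, m + 1 < i → χ.kerGr p i = ⊥)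
include hm hvan

lemma η_curvature {p : M} (hp : p ∈ U) : h.η p (𝓛.curvature p) = 0 :=
  h.apply_of_ne p hp 1 (by omega) _ (curvature_mem (hU hp))

/-- The kernel of `χ` is an ideal on which, by degree reasons, the operations vanish as required for
the transfer along `η`. -/
lemma idealTransfer {p : M} (hp : p ∈ U) :
    IdealTransfer (fun i => (h.hGrade i p).submoduleOf (⨆ i, h.hGrade i p)) (𝓛.gr p) (𝓛.op p)
      (𝓛.degDiff m p) (h.η p) (Submodule.inclusion (h.iSup_hGrade_le p)) (h.pr hU p) := by
  have hη : ∀ x, h.η p (Submodule.inclusion (h.iSup_hGrade_le p) x) +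
      h.η p (h.comm p (Submodule.inclusion (h.iSup_hGrade_le p) x)) =
      h.η p (Submodule.inclusion (h.iSup_hGrade_le p) x) := fun x => by
    rw [h.comm_incl hU, map_zero, add_zero]
  have hη0 : ∀ x, h.η p (Submodule.inclusion (h.iSup_hGrade_le p) x) = 0 := fun x => by
    have h1 := congrArg (h.η p) (h.comm_incl hU p x)
    rwa [comm_apply, map_add, h.η_degDiff_η hU, h.η_sq hU, add_zero, map_zero] at h1
  have hηδ : ∀ x, h.η p (𝓛.degDiff m p (Submodule.inclusion (h.iSup_hGrade_le p) x)) = 0 :=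
    fun x => by
      have h1 := h.comm_incl hU p x
      rwa [comm_apply, hη0, map_zero, zero_add] at h1
  exact
  { lam_curved := 𝓛.curvedLInfty p (hU hp)
    incl_injective := Submodule.inclusion_injective _
    incl_mem := fun i x => ⟨fun hx => h.hGrade_le i p hx, fun hx =>
      ⟨Submodule.inclusion (h.iSup_hGrade_le p) x, ⟨hx, h.comm_incl hU p x⟩, rfl⟩⟩
    δ_degree := fun i x hx => degDiff_mem_gr m (hU hp) hx
    η_degree := fun i x hx => h.η_degree hU hp hx
    contraction := h.η_degDiff_η hU p
    incl_pr := h.incl_pr hU p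
    δ_sq := degDiff_sq m (hU hp)
    ηδ_incl := hηδ
    η_lam_one := fun x => by rw [← h.η_degDiff hU hp, hηδ]
    η_curv := fun x => by rw [op_zero]; exact h.η_curvature hU hχ hm hvan hp
    lam_η := fun k hk x i y hx => hχ.op_eq_zero (hU hp) (hvan p hp) x i
      (by rw [hx]; exact h.mem p hp y) (Or.inr ⟨le_rfl, hk⟩)
    lam_δη := fun k x i y hx => hχ.op_eq_zero (hU hp) (hvan p hp) x i
      (by rw [hx]; exact h.degDiff_η_mem hU hχ hp y) (Or.inl le_rfl)
    lam_one_η := fun y => (h.degDiff_η hU hp y).symm }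

omit hχ hm hvan in
lemma smoothAlong_comm {A : Set M} {p : M} (hA : A ⊆ U) (hp : p ∈ A)
    {s : ∀ q, 𝓛.fib q} (hs : SmoothAlong EM EM FM id A p (fun q => (s q : V q))) :
    SmoothAlong EM EM FM id A p (fun q => (h.comm q (s q) : V q)) :=
  (smoothAlong_degDiff m (hA.trans hU) hp (h.smooth A p hA hp s hs)).add
    (h.smooth A p hA hp _ (smoothAlong_degDiff m (hA.trans hU) hp hs))

omit hχ hm hvan in
lemma isSmoothSubbundle_hGrade [IsManifold 𝓘(ℝ, EM) ∞ M] [ContMDiffVectorBundle ∞ FM V 𝓘(ℝ, EM)]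
    (i : ℕ) : IsSmoothSubbundle EM FM U (h.hGrade i) := by
  let R : ∀ p, 𝓛.grade i p →ₗ[ℝ] 𝓛.grade i p := fun p =>
    ((𝓛.fib p).subtype ∘ₗ h.comm p ∘ₗ Submodule.inclusion (𝓛.grade_le_fib p i)).codRestrict _
      fun x => h.comm_degree hU p (i := i) (x := Submodule.inclusion (𝓛.grade_le_fib p i) x) x.2
  have hR : ∀ p x, Submodule.inclusion (𝓛.grade_le_fib p i) (R p x) =
      h.comm p (Submodule.inclusion (𝓛.grade_le_fib p i) x) := fun p x => rfl
  have hS : IsSmoothSubbundle EM FM U (𝓛.grade i) := by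
    rw [isSmoothSubbundle_iff]
    intro p hp
    obtain ⟨ι, hι, e, he⟩ := isSmoothSubbundle_iff.1 (𝓛.subbundle i) p (hU hp)
    have hle : 𝓝[U] p ≤ 𝓝[𝓛.base] p := nhdsWithin_mono p hU
    refine ⟨ι, hι, e, ?_, hle he.indep, hle he.span⟩
    filter_upwards [hle he.smooth] with q hq j using (hq j).mono hU
  have hker := hS.ker_of_isIdempotent R (fun p hp s hs => h.smoothAlong_comm hU subset_rfl hp
    (s := fun q => Submodule.inclusion (𝓛.grade_le_fib q i) (s q)) hs) (fun p hp x => by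
      apply Submodule.inclusion_injective (𝓛.grade_le_fib p i)
      rw [hR, hR, h.comm_comm hU])
  convert hker using 2 with p
  ext x
  constructor
  · rintro ⟨y, hy, rfl⟩
    have h1 := congrArg Subtype.val (show h.comm p y = 0 from hy.2)
    exact ⟨⟨y, hy.1⟩, show R p ⟨y, hy.1⟩ = 0 from Subtype.ext h1, rfl⟩
  · rintro ⟨y, hy, rfl⟩
    refine ⟨Submodule.inclusion (𝓛.grade_le_fib p i) y, ⟨y.2, ?_⟩, rfl⟩
    change h.comm p _ = 0
    rw [← hR, show R p y = 0 from hy, map_zero]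

end

section Bundle

variable [IsManifold 𝓘(ℝ, EM) ∞ M] [ContMDiffVectorBundle ∞ FM V 𝓘(ℝ, EM)]
  (hU : U ⊆ 𝓛.base) (hχ : χ.IsLinear) (hm : 1 ≤ m)
  (hvan : ∀ p ∈ U, ∀ i, m + 1 < i → χ.kerGr p i = ⊥) (hUo : IsOpen U)

/-- The `L∞`-bundle obtained by transfer along the homotopy `η`. -/
def transfer : LInftyBundle EM FM V where
  base := U
  submanifold := by
    have h1 := (𝓛.restrict ⟨U, hUo⟩).submanifold
    rwa [show (𝓛.restrict ⟨U, hUo⟩).base = U from inter_eq_right.2 hU] at h1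
  grade := h.hGrade
  subbundle := h.isSmoothSubbundle_hGrade hU
  independent p hp := (𝓛.independent p (hU hp)).mono fun i => h.hGrade_le i p
  grade_zero p hp := by
    have := h.hGrade_le 0 p
    rwa [𝓛.grade_zero p (hU hp), le_bot_iff] at this
  bounded := by
    obtain ⟨n, hn⟩ := 𝓛.bounded
    refine ⟨n, fun i hi p hp => ?_⟩
    have := h.hGrade_le i p
    rwa [hn i hi p (hU hp), le_bot_iff] at this
  op p := IdealTransfer.mu (𝓛.op p) (Submodule.inclusion (h.iSup_hGrade_le p)) (h.pr hU p)
  curvedLInfty _ hp := (h.idealTransfer hU hχ hm hvan hp).isCurvedLInfty_mu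
  smooth := by
    intro k u hu s hs p hp
    have h1 : U ∩ u ⊆ U := inter_subset_left
    have h2 := 𝓛.smoothAlong_op (b := id) hp contMDiffWithinAt_id (h1.trans hU)
      (s := fun j q => Submodule.inclusion (h.iSup_hGrade_le q) (s j q)) (fun j => hs j p hp)
    exact SmoothAlong.sub h2 (h.smoothAlong_comm hU h1 hp h2)

/-- The inclusion morphism of the transferred `L∞`-bundle. -/
def transferHom : Hom (h.transfer hU hχ hm hvan hUo) 𝓛 id where
  mapsTo := hU
  contMDiffOn := contMDiffOn_id
  op p := IdealTransfer.phi (𝓛.op p) (h.η p) (Submodule.inclusion (h.iSup_hGrade_le p))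
  morphism _ hp := (h.idealTransfer hU hχ hm hvan hp).isLInftyMorphism_phi
  smooth := by
    intro k u hu s hs p hp
    have h1 : U ∩ u ⊆ U := inter_subset_left
    have h2 := 𝓛.smoothAlong_op (b := id) hp contMDiffWithinAt_id (h1.trans hU)
      (s := fun j q => Submodule.inclusion (h.iSup_hGrade_le q) (s j q)) (fun j => hs j p hp)
    have h3 : SmoothAlong EM EM FM id (U ∩ u) p (fun q =>
        ((_root_.ofLinear (Submodule.inclusion (h.iSup_hGrade_le q)) k fun j => s j q :
          𝓛.fib q) : V q)) := by
      match k with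
      | 1 => exact hs 0 p hp
      | 0 => exact SmoothAlong.zero contMDiffWithinAt_id
      | k + 2 => exact SmoothAlong.zero contMDiffWithinAt_id
    exact SmoothAlong.sub h3 (h.smooth _ p h1 hp _ h2)

/-- The restriction of the linear fibration `χ` to the transferred `L∞`-bundle. -/
def transferLin : Hom (h.transfer hU hχ hm hvan hUo) 𝓛' f :=
  Hom.ofLinear (χ.mapsTo.mono_left hU) (χ.contMDiffOn.mono hU)
    (fun p => χ.lin p ∘ₗ Submodule.inclusion (h.iSup_hGrade_le p))
    (fun p hp i x hx => χ.lin_mem (hU hp)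
      (x := Submodule.inclusion (h.iSup_hGrade_le p) x) (h.hGrade_le i p hx))
    (fun p hp n d x hx => by
      change χ.lin p (Submodule.inclusion (h.iSup_hGrade_le p) (h.pr hU p _)) = _
      rw [h.incl_pr, map_sub, h.lin_comm hU hχ hp, sub_zero]
      exact hχ.map_op (hU hp) n d _ fun j => h.hGrade_le _ p (hx j))
    (fun A p hA hp s hs => χ.smoothAlong_lin (b := id) hp (hA.trans hU)
      (s := fun q => Submodule.inclusion (h.iSup_hGrade_le q) (s q)) hs)

end Bundle

end KernelHomotopy

end LInftyBundle

namespace LInftyBundle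

open Filter Topology

variable {EM : Type*} [NormedAddCommGroup EM] [NormedSpace ℝ EM]
  {M : Type*} [TopologicalSpace M] [ChartedSpace EM M]
  {FM : Type*} [NormedAddCommGroup FM] [NormedSpace ℝ FM]
  {V : M → Type*} [∀ p, AddCommGroup (V p)] [∀ p, Module ℝ (V p)]
  [TopologicalSpace (TotalSpace FM V)] [∀ p, TopologicalSpace (V p)] [FiberBundle FM V]
  {EN : Type*} [NormedAddCommGroup EN] [NormedSpace ℝ EN]
  {N : Type*} [TopologicalSpace N] [ChartedSpace EN N]
  {FN : Type*} [NormedAddCommGroup FN] [NormedSpace ℝ FN]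
  {W : N → Type*} [∀ q, AddCommGroup (W q)] [∀ q, Module ℝ (W q)]
  [TopologicalSpace (TotalSpace FN W)] [∀ q, TopologicalSpace (W q)] [FiberBundle FN W]
  [VectorBundle ℝ FM V] [FiniteDimensional ℝ FM] [VectorBundle ℝ FN W] [FiniteDimensional ℝ FN]

variable {𝓛 : LInftyBundle EM FM V} {𝓛' : LInftyBundle EN FN W} {f : M → N}

/-! ### Reduction of the kernel of a fibration to degree one -/

lemma isSmoothSubbundle_mono {A U : Set M} (hU : U ⊆ A) {S : ∀ p, Submodule ℝ (V p)}
    (hS : IsSmoothSubbundle EM FM A S) : IsSmoothSubbundle EM FM U S := by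
  intro p hp
  obtain ⟨u, hu, hpu, r, s, hs, hs'⟩ := hS p (hU hp)
  exact ⟨u, hu, hpu, r, s, fun j => (hs j).mono (inter_subset_inter_left _ hU),
    fun q hq => hs' q ⟨hU hq.1, hq.2⟩⟩

lemma isSmoothSubbundle_bot {A : Set M} :
    IsSmoothSubbundle EM FM A (fun p => (⊥ : Submodule ℝ (V p))) :=
  fun _ _ => ⟨univ, isOpen_univ, trivial, 0, fun j => j.elim0, fun j => j.elim0,
    fun _ _ => ⟨linearIndependent_empty_type, by simp⟩⟩

/-- The filtration weight of degree `i`: degrees `m` and `m + 1` have the same weight, so that the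
part of `λ₁` between them preserves weights, and all the other operations increase them. -/
def weight (m i : ℕ) : ℕ := if i ≤ m then i else i - 1

lemma weight_le (m i : ℕ) : weight m i ≤ i := by
  unfold weight
  split_ifs <;> omega

namespace KernelHomotopy

variable {χ : Hom 𝓛 𝓛' f} {m : ℕ} {U : Set M} (h : KernelHomotopy χ m U)

variable (𝓛 m) in
/-- The filtration by weight. -/
def fil (k i : ℕ) (p : M) : Submodule ℝ (V p) := if k ≤ weight m i then 𝓛.grade i p else ⊥

lemma mem_fil {k i : ℕ} {p : M} {x : 𝓛.fib p} :
    x ∈ (fil 𝓛 m k i p).submoduleOf (𝓛.fib p) ↔ x = 0 ∨ k ≤ weight m i ∧ x ∈ 𝓛.gr p i := by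
  unfold fil
  split_ifs with hk
  · constructor
    · exact fun hx => Or.inr ⟨hk, hx⟩
    · rintro (rfl | ⟨-, hx⟩)
      · exact Submodule.zero_mem _
      · exact hx
  · constructor
    · intro hx
      exact Or.inl (Subtype.ext ((Submodule.mem_bot ℝ).1 hx))
    · rintro (rfl | ⟨hk', -⟩)
      · exact Submodule.zero_mem _
      · exact absurd hk' hk

lemma isTransferInput (hU : U ⊆ 𝓛.base) (hm : 1 ≤ m) {p : M} (hp : p ∈ U) :
    IsTransferInput (𝓛.gr p) (𝓛.op p) (𝓛.degDiff m p) (h.η p)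
      (fun k i => (fil 𝓛 m k i p).submoduleOf (𝓛.fib p)) where
  δ_degree i x hx := degDiff_mem_gr m (hU hp) hx
  δ_sq := degDiff_sq m (hU hp)
  η_degree i x hx := h.η_degree hU hp hx
  η_zero x hx := h.apply_of_ne p hp 0 (by omega) x hx
  η_sq := h.η_sq hU p
  contraction := h.η_degDiff_η hU p
  fil_zero i := by simp [fil]
  fil_anti k i := by
    intro x hx
    rw [mem_fil] at hx ⊢
    exact hx.imp_right fun hx => ⟨by omega, hx.2⟩
  fil_δ k i x hx := by
    rw [mem_fil] at hx ⊢
    rcases hx with rfl | ⟨hk, hx⟩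
    · exact Or.inl (map_zero _)
    · refine Or.inr ⟨hk.trans ?_, degDiff_mem_gr m (hU hp) hx⟩
      unfold weight
      split_ifs <;> omega
  fil_η k i x hx := by
    rw [mem_fil] at hx ⊢
    rcases hx with rfl | ⟨hk, hx⟩
    · exact Or.inl (map_zero _)
    · by_cases hi : i = m
      · subst hi
        refine Or.inr ⟨hk.trans ?_, h.η_degree hU hp hx⟩
        unfold weight
        split_ifs <;> omega
      · exact Or.inl (h.apply_of_ne p hp (i + 1) (by omega) x hx)
  filtered k a x hx := by
    -- `λ - δ` is evaluated on nonzero homogeneous elements of degrees `d j`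
    refine MultilinearMap.mem_of_homogeneous _
      (fun j i => (fil 𝓛 m (a j) i p).submoduleOf (𝓛.fib p)) _ (fun d y hy => ?_) x hx
    by_cases hzero : ∃ j, y j = 0
    · obtain ⟨j, hj⟩ := hzero
      rw [MultilinearMap.map_coord_zero _ j hj]
      exact Submodule.zero_mem _
    push Not at hzero
    have hy' : ∀ j, a j ≤ weight m (d j) ∧ y j ∈ 𝓛.gr p (d j) := fun j =>
      (mem_fil.1 (hy j)).resolve_left (hzero j)
    have hd1 : ∀ j, 1 ≤ d j := fun j => by
      by_contra h0
      have h1 := (hy' j).2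
      rw [show d j = 0 by omega, 𝓛.gr_zero (hU hp), Submodule.mem_bot] at h1
      exact hzero j h1
    have hdeg := (𝓛.curvedLInfty p (hU hp)).degree k d y fun j => (hy' j).2
    by_cases hδ : k = 1 ∧ ∃ j, d j = m
    · -- here `λ₁` agrees with `δ`
      obtain ⟨rfl, j, hj⟩ := hδ
      obtain rfl : j = 0 := Subsingleton.elim _ _
      have hyj := (hy' 0).2
      rw [hj] at hyj
      have h1 := degDiff_of_mem (hU hp) hyj
      rw [unary_apply] at h1
      have h2 : (𝓛.op p 1 - _root_.ofLinear (𝓛.degDiff m p) 1) y = 0 := by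
        rw [sub_apply, sub_eq_zero]
        change _ = 𝓛.degDiff m p (y 0)
        rw [h1]
        congr 1
        funext j
        rw [Subsingleton.elim j 0]
      rw [h2]
      exact Submodule.zero_mem _
    · have h1 : (𝓛.op p k - _root_.ofLinear (𝓛.degDiff m p) k) y = 𝓛.op p k y := by
        rw [sub_apply, sub_eq_self]
        match k with
        | 0 => rfl
        | 1 => exact degDiff_of_mem_ne (fun hd => hδ ⟨rfl, 0, hd⟩) (hU hp) (hy' 0).2
        | k + 2 => rfl
      rw [h1]
      refine Submodule.mem_iSup_of_mem ((∑ j, d j) + 1) (mem_fil.2 (Or.inr ⟨?_, hdeg⟩))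
      rcases Nat.eq_zero_or_pos k with rfl | hk
      · simp only [Finset.univ_eq_empty, Finset.sup_empty, Finset.sum_empty, weight]
        rw [if_pos (by omega)]
        exact le_rfl
      · refine Nat.succ_le_of_lt ((Finset.sup_lt_iff ?_).2 fun j _ => ?_)
        · rw [Nat.bot_eq_zero]
          unfold weight
          have := hd1 ⟨0, hk⟩
          have h2 := Finset.single_le_sum (f := d) (fun _ _ => Nat.zero_le _)
            (Finset.mem_univ ⟨0, hk⟩)
          split_ifs <;> omega
        · refine lt_of_le_of_lt (hy' j).1 ?_
          have h2 := Finset.add_sum_erase Finset.univ d (Finset.mem_univ j)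
          by_cases hk1 : k = 1
          · subst hk1
            have h3 : d j ≠ m := fun hd => hδ ⟨rfl, j, hd⟩
            unfold weight
            split_ifs <;> omega
          · have : ∃ i, i ∈ Finset.univ.erase j := by
              have : 0 < (Finset.univ.erase j).card := by
                rw [Finset.card_erase_of_mem (Finset.mem_univ j), Finset.card_univ,
                  Fintype.card_fin]
                omega
              exact Finset.card_pos.1 this
            obtain ⟨i, hi⟩ := this
            have h4 := Finset.single_le_sum (f := d) (fun _ _ => Nat.zero_le _) hi
            have h5 := hd1 i
            unfold weight
            split_ifs <;> omega

variable [IsManifold 𝓘(ℝ, EM) ∞ M] [ContMDiffVectorBundle ∞ FM V 𝓘(ℝ, EM)]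
  (hU : U ⊆ 𝓛.base) (hχ : χ.IsLinear) (hm : 1 ≤ m)
  (hvan : ∀ p ∈ U, ∀ i, m + 1 < i → χ.kerGr p i = ⊥) (hUo : IsOpen U)

lemma isTransferEmbedding {Z : Set M} (hZ : Z ⊆ U) :
    (h.transferHom hU hχ hm hvan hUo).IsTransferEmbedding Z := by
  refine ⟨⟨U, hUo, (inter_eq_right.2 hU).symm⟩, hZ, 𝓛.degDiff m, h.η, fil 𝓛 m,
    isSmoothMultilinear_ofLinear fun B p hB hp s hs =>
      smoothAlong_degDiff m (hB.trans hU) hp hs,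
    isSmoothMultilinear_ofLinear h.smooth, fun k i => ?_, ?_, fun p hp => ⟨fun k i => ?_,
      h.isTransferInput hU hm hp, fun i => rfl, h.iSup_hGrade_le p,
      (h.idealTransfer hU hχ hm hvan hp).isTransferOutput⟩⟩
  · unfold fil
    split_ifs
    · exact isSmoothSubbundle_mono hU (𝓛.subbundle i)
    · exact isSmoothSubbundle_bot
  · obtain ⟨n, hn⟩ := 𝓛.bounded
    refine ⟨n + 1, fun i p hp => ?_⟩
    unfold fil
    split_ifs with hi
    · exact hn i (hi.trans (weight_le m i)) p (hU hp)
    · rfl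
  · unfold fil
    split_ifs
    · exact le_rfl
    · exact bot_le

lemma isComposition_transfer :
    IsComposition (h.transferHom hU hχ hm hvan hUo) χ (h.transferLin hU hχ hm hvan hUo) := by
  intro p hp n d x hx
  have h1 := (h.idealTransfer hU hχ hm hvan hp).isLInftyMorphism_phi.zero
  have key : ∀ x : Fin n → ↥(⨆ i, h.hGrade i p),
      _root_.ofLinear (χ.lin p ∘ₗ Submodule.inclusion (h.iSup_hGrade_le p)) n x =
        bullet (χ.op p) (IdealTransfer.phi (𝓛.op p) (h.η p)
          (Submodule.inclusion (h.iSup_hGrade_le p))) d x := by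
    intro x
    rw [hχ.op_eq (hU hp), bullet_ofLinear_left _ _ h1, IdealTransfer.phi_apply, map_sub,
      (h.mem p hp _).2, sub_zero, comp_ofLinear]
  exact key x

lemma isLinear_transferLin : (h.transferLin hU hχ hm hvan hUo).IsLinear := by
  intro p hp k hk
  match k with
  | k + 2 => rfl

lemma lin_transferLin (p : M) (x : (h.transfer hU hχ hm hvan hUo).fib p) :
    (h.transferLin hU hχ hm hvan hUo).lin p x =
      χ.lin p (Submodule.inclusion (h.iSup_hGrade_le p) x) := rfl

lemma mem_gr_transfer {p : M} {i : ℕ} {x : 𝓛.fib p} (hx : x ∈ 𝓛.gr p i) (hx' : h.comm p x = 0) :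
    ∃ y ∈ (h.transfer hU hχ hm hvan hUo).gr p i,
      Submodule.inclusion (h.iSup_hGrade_le p) y = x := by
  have h1 : (x : V p) ∈ h.hGrade i p := ⟨x, ⟨hx, hx'⟩, rfl⟩
  exact ⟨⟨x, Submodule.mem_iSup_of_mem i h1⟩, h1, rfl⟩

lemma isFibration_transferLin (hfib : χ.IsFibration) :
    (h.transferLin hU hχ hm hvan hUo).IsFibration := by
  refine fun p hp => ⟨(hfib p (hU hp)).1, fun i y hy => ?_⟩
  obtain ⟨x, hx, rfl⟩ := (hfib p (hU hp)).2 i hy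
  obtain ⟨z, hz, hzx⟩ := h.mem_gr_transfer hU hχ hm hvan hUo (x := x - h.comm p x)
    (Submodule.sub_mem _ hx (h.comm_degree hU p hx)) (by rw [map_sub, h.comm_comm hU, sub_self])
  refine ⟨z, hz, ?_⟩
  rw [lin_transferLin, hzx, map_sub, h.lin_comm hU hχ hp, sub_zero]

lemma isIsoInDegree_transferLin (hfib : χ.IsFibration) {i : ℕ} (hi : m < i) :
    (h.transferLin hU hχ hm hvan hUo).IsIsoInDegree i := by
  intro p hp
  refine ⟨fun x hx => (h.transferLin hU hχ hm hvan hUo).lin_mem hp hx, fun x hx y hy hxy => ?_,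
    (h.isFibration_transferLin hU hχ hm hvan hUo hfib p hp).2 i⟩
  have hz : x - y ∈ (h.transfer hU hχ hm hvan hUo).gr p i := Submodule.sub_mem _ hx hy
  have hlin : (h.transferLin hU hχ hm hvan hUo).lin p (x - y) = 0 := by
    rw [map_sub, hxy, sub_self]
  rw [lin_transferLin] at hlin
  have hk : Submodule.inclusion (h.iSup_hGrade_le p) (x - y) ∈ χ.kerGr p i :=
    ⟨h.hGrade_le i p hz, hlin⟩
  have h0 : Submodule.inclusion (h.iSup_hGrade_le p) (x - y) = 0 := by
    by_cases hi' : i = m + 1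
    · subst hi'
      refine h.injective p hp _ hk ?_
      have h1 := congrArg (h.η p) (h.comm_incl hU p (x - y))
      rwa [comm_apply, map_add, h.η_degDiff_η hU, h.η_sq hU, add_zero, map_zero] at h1
    · rwa [hvan p hp i (by omega), Submodule.mem_bot] at hk
  exact sub_eq_zero.1 (Submodule.inclusion_injective _ (h0.trans (map_zero _).symm))

/-- A transfer does not change the curvature, which has degree one and is annihilated by `λ₁`. -/
lemma coe_curvature_transfer {p : M} (hp : p ∈ U) :
    ((h.transfer hU hχ hm hvan hUo).curvature p : V p) = 𝓛.curvature p := by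
  have h1 : h.comm p (𝓛.curvature p) = 0 := by
    rw [comm_apply, h.η_curvature hU hχ hm hvan hp, map_zero, zero_add, h.η_degDiff hU hp,
      lam_curvature (hU hp), map_zero]
  have h2 : Submodule.inclusion (h.iSup_hGrade_le p)
      ((h.transfer hU hχ hm hvan hUo).curvature p) = 𝓛.curvature p := by
    change Submodule.inclusion (h.iSup_hGrade_le p) (h.pr hU p (𝓛.op p 0 _)) = _
    rw [op_zero, h.incl_pr, h1, sub_zero]
  exact congrArg Subtype.val h2

lemma classicalLocus_transfer {p : M} (hp : p ∈ U) :
    p ∈ (h.transfer hU hχ hm hvan hUo).classicalLocus ↔ p ∈ 𝓛.classicalLocus := by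
  have h1 := h.coe_curvature_transfer hU hχ hm hvan hUo hp
  constructor
  · rintro ⟨-, h2⟩
    refine ⟨hU hp, Subtype.ext ?_⟩
    rw [← h1, h2]
    rfl
  · rintro ⟨-, h2⟩
    refine ⟨hp, Subtype.ext ?_⟩
    rw [h1, h2]
    rfl

lemma curvatureDeriv_transfer {p : M} (hp : p ∈ U) :
    (h.transfer hU hχ hm hvan hUo).curvatureDeriv p = 𝓛.curvatureDeriv p := by
  have h1 : (fun q => (trivializationAt FM V p (TotalSpace.mk' FM q
      ((h.transfer hU hχ hm hvan hUo).curvature q : V q))).2) =ᶠ[𝓝 p]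
      fun q => (trivializationAt FM V p (TotalSpace.mk' FM q (𝓛.curvature q : V q))).2 := by
    filter_upwards [hUo.mem_nhds hp] with q hq
    rw [h.coe_curvature_transfer hU hχ hm hvan hUo hq]
  unfold curvatureDeriv
  rw [h1.mfderiv_eq]

/-- At a classical point the transferred differential is the restriction of `λ₁`. -/
lemma lam_transfer {p : M} (hp : p ∈ U) (hp' : p ∈ 𝓛.classicalLocus)
    (x : (h.transfer hU hχ hm hvan hUo).fib p) :
    Submodule.inclusion (h.iSup_hGrade_le p) (unary ((h.transfer hU hχ hm hvan hUo).op p) x) =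
      unary (𝓛.op p) (Submodule.inclusion (h.iSup_hGrade_le p) x) := by
  have h0 : ∀ y, unary (𝓛.op p) (unary (𝓛.op p) y) = 0 := fun y =>
    LinearMap.congr_fun (𝓛.linearMap_ext (g := unary (𝓛.op p) ∘ₗ unary (𝓛.op p)) (g' := 0)
      fun i x hx => lam_lam hp' hx) y
  have key : ∀ x : ↥(⨆ i, h.hGrade i p), Submodule.inclusion (h.iSup_hGrade_le p) (h.pr hU p
      (unary (𝓛.op p) (Submodule.inclusion (h.iSup_hGrade_le p) x))) =
        unary (𝓛.op p) (Submodule.inclusion (h.iSup_hGrade_le p) x) := by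
    intro x
    rw [h.incl_pr, comm_apply, (h.idealTransfer hU hχ hm hvan hp).η_lam_one, map_zero, zero_add,
      h.η_degDiff hU hp, h0, map_zero, sub_zero]
  exact key x

/-- A transfer changes the kernel of `χ` only in degrees `m` and `m + 1`, so it stays exact below
degree `m`, and in degree `m` the elements to be lifted have lifts in degree `m - 1`, which is
unchanged. -/
lemma exactAt_transferLin {p : M} (hp : p ∈ U) (hex : χ.ExactAt (m + 1) p) :
    (h.transferLin hU hχ hm hvan hUo).ExactAt m p := by
  have hker : ∀ i, ∀ y ∈ (h.transferLin hU hχ hm hvan hUo).kerGr p i,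
      Submodule.inclusion (h.iSup_hGrade_le p) y ∈ χ.kerGr p i := fun i y hy =>
    ⟨h.hGrade_le i p hy.1, hy.2⟩
  have hlam := h.lam_transfer hU hχ hm hvan hUo hp hex.classical
  have hinj := Submodule.inclusion_injective (h.iSup_hGrade_le p)
  refine ⟨(h.classicalLocus_transfer hU hχ hm hvan hUo hp).2 hex.classical,
    fun i h1 h2 y hy hly => ?_, fun y hy hly => ?_, fun v hv hv' => ?_⟩
  · obtain ⟨z, hz, hzy⟩ := hex.exact i h1 (by omega) _ (hker _ y hy) (by
      rw [← hlam, hly]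
      exact map_zero (Submodule.inclusion (h.iSup_hGrade_le p)))
    obtain ⟨w, hw, hwz⟩ := h.mem_gr_transfer hU hχ hm hvan hUo hz.1
      (h.comm_of_ne hU hp (by omega) (by omega) hz.1)
    refine ⟨w, ⟨hw, ?_⟩, hinj ?_⟩
    · change (h.transferLin hU hχ hm hvan hUo).lin p w = 0
      rw [lin_transferLin, hwz]
      exact hz.2
    · rw [hlam, hwz, hzy]
  · obtain ⟨v, hv, hvy⟩ := hex.exact_one _ (hker _ y hy) (by
      rw [← hlam, hly]
      exact map_zero (Submodule.inclusion (h.iSup_hGrade_le p)))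
    refine ⟨v, hv, ?_⟩
    rw [h.curvatureDeriv_transfer hU hχ hm hvan hUo hp, hvy]
    rfl
  · rw [h.curvatureDeriv_transfer hU hχ hm hvan hUo hp] at hv'
    exact hex.exact_zero v hv hv'

end KernelHomotopy

section Step

variable [IsManifold 𝓘(ℝ, EM) ∞ M] [ContMDiffVectorBundle ∞ FM V 𝓘(ℝ, EM)]
  [IsManifold 𝓘(ℝ, EN) ∞ N] [ContMDiffVectorBundle ∞ FN W 𝓘(ℝ, EN)]

/-- If the kernel of a linear fibration vanishes in degrees above `m + 1`, a transfer makes it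
vanish in degree `m + 1`. -/
lemma exists_transferEmbedding (G : FibreMetric EM FM V) (hopen : IsOpen 𝓛.base) {χ : Hom 𝓛 𝓛' f}
    (hχ : χ.IsLinear) (hfib : χ.IsFibration) {m : ℕ} (hm : 1 ≤ m)
    (hiso : ∀ i, m + 1 < i → χ.IsIsoInDegree i) {Z : Set M} (hZ : ∀ p ∈ Z, χ.ExactAt (m + 1) p) :
    ∃ (𝓗 : LInftyBundle EM FM V) (κ : Hom 𝓗 𝓛 id) (χ' : Hom 𝓗 𝓛' f), κ.IsTransferEmbedding Z ∧
      IsComposition κ χ χ' ∧ χ'.IsLinear ∧ χ'.IsFibration ∧ (∀ i, m < i → χ'.IsIsoInDegree i) ∧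
      IsOpen 𝓗.base ∧ ∀ p ∈ Z, χ'.ExactAt m p := by
  obtain ⟨h⟩ := hχ.exists_kernelHomotopy hfib m G
  have hUo := hχ.isOpen_surjLocus hfib hopen m
  have hU : χ.surjLocus m ⊆ 𝓛.base := fun p hp => hp.1
  have hvan : ∀ p ∈ χ.surjLocus m, ∀ i, m + 1 < i → χ.kerGr p i = ⊥ := fun p hp i hi =>
    (hiso i hi).kerGr_eq_bot hp.1
  have hZU : Z ⊆ χ.surjLocus m := by
    intro p hp
    have hp0 := (hZ p hp).classical.1
    refine ⟨hp0, fun y hy => ?_⟩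
    obtain ⟨z, hz, hzy⟩ := (hZ p hp).exact m hm le_rfl y hy (by
      have h1 := hχ.lam_mem_kerGr hp0 hy
      rwa [(hiso (m + 1 + 1) (by omega)).kerGr_eq_bot hp0, Submodule.mem_bot] at h1)
    exact ⟨z, hz, hzy⟩
  exact ⟨_, h.transferHom hU hχ hm hvan hUo, h.transferLin hU hχ hm hvan hUo,
    h.isTransferEmbedding hU hχ hm hvan hUo hZU, h.isComposition_transfer hU hχ hm hvan hUo,
    h.isLinear_transferLin hU hχ hm hvan hUo, h.isFibration_transferLin hU hχ hm hvan hUo hfib,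
    fun i hi => h.isIsoInDegree_transferLin hU hχ hm hvan hUo hfib hi, hUo,
    fun p hp => h.exactAt_transferLin hU hχ hm hvan hUo (hZU hp) (hZ p hp)⟩

/-- A linear morphism, composed with a composition, is the composition of the compositions. -/
lemma IsComposition.comp_linear {𝓗 𝓚 : LInftyBundle EM FM V} {ι : Hom 𝓗 𝓛 id} {φ : Hom 𝓛 𝓛' f}
    (hφ : φ.IsLinear) {χ : Hom 𝓗 𝓛' f} (hχ : IsComposition ι φ χ)
    {κ : Hom 𝓚 𝓗 id} {χ' : Hom 𝓚 𝓛' f} (hχ' : IsComposition κ χ χ') {ι' : Hom 𝓚 𝓛 id}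
    (hι' : IsComposition κ ι ι') : IsComposition ι' φ χ' := by
  intro p hp n d x hx
  have hpH : p ∈ 𝓗.base := κ.mapsTo hp
  have hpL : p ∈ 𝓛.base := ι.mapsTo hpH
  have hlin : ∀ (k : ℕ) (y : Fin k → 𝓗.fib p),
      χ.op p k y = φ.lin p (ι.op p k y) := by
    intro k y
    have : χ.op p k = (φ.lin p).compMultilinearMap (ι.op p k) := by
      refine 𝓗.multilinearMap_ext fun e z hz => ?_
      rw [hχ p hpH k e z hz]
      change bullet (φ.op p) (ι.op p) e z = _
      rw [hφ.op_eq hpL, bullet_ofLinear_left _ _ (ι.morphism p hpH).zero]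
      rfl
    rw [this]
    rfl
  rw [hχ' p hp n d x hx]
  change bullet (χ.op p) (κ.op p) d x = bullet (φ.op p) (ι'.op p) d x
  rw [hφ.op_eq hpL, bullet_ofLinear_left _ _ (ι'.morphism p hp).zero, hι' p hp n d x hx]
  change _ = φ.lin p (bullet (ι.op p) (κ.op p) d x)
  unfold bullet
  rw [map_sum]
  refine Finset.sum_congr rfl fun c _ => ?_
  rw [map_smul, hlin]

/-- A sequence of transfer embeddings reduces the kernel of a linear fibration to degree one. -/
lemma exists_transferSequence (G : FibreMetric EM FM V) (hopen : IsOpen 𝓛.base) {φ : Hom 𝓛 𝓛' f}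
    (hφ : φ.IsLinear) (hfib : φ.IsFibration) {Z : Set M} (hZ : ∀ n, ∀ p ∈ Z, φ.ExactAt n p) :
    ∃ (𝓗 : LInftyBundle EM FM V) (ι : Hom 𝓗 𝓛 id) (χ : Hom 𝓗 𝓛' f), TransferSequence Z 𝓛 𝓗 ι ∧
      IsComposition ι φ χ ∧ χ.IsLinear ∧ χ.IsFibration ∧ (∀ i, 1 < i → χ.IsIsoInDegree i) ∧
      IsOpen 𝓗.base ∧ ∀ p ∈ Z, χ.ExactAt 1 p := by
  -- downward induction on `m`, starting above all the degrees that occur; at least one transfer is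
  -- carried out even if the kernel is already concentrated in degree one
  have key : ∀ k m, 𝓛.bound + 𝓛'.bound + 1 = m + k → 1 ≤ m →
      ∃ (𝓗 : LInftyBundle EM FM V) (ι : Hom 𝓗 𝓛 id) (χ : Hom 𝓗 𝓛' f), TransferSequence Z 𝓛 𝓗 ι ∧
        IsComposition ι φ χ ∧ χ.IsLinear ∧ χ.IsFibration ∧ (∀ i, m < i → χ.IsIsoInDegree i) ∧
        IsOpen 𝓗.base ∧ ∀ p ∈ Z, χ.ExactAt m p := by
    intro k
    induction k with
    | zero =>
      intro m hmk hm
      have hiso : ∀ i, m + 1 < i → φ.IsIsoInDegree i := by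
        intro i hi p hp
        have h1 : 𝓛.gr p i = ⊥ := 𝓛.gr_eq_bot hp (by omega)
        have h2 : 𝓛'.gr (f p) i = ⊥ := 𝓛'.gr_eq_bot (φ.mapsTo hp) (by omega)
        rw [h1, h2]
        refine ⟨?_, ?_, ?_⟩
        · rintro _ rfl
          exact map_zero _
        · rintro _ rfl _ rfl _
          rfl
        · rintro _ rfl
          exact ⟨0, rfl, map_zero _⟩
      obtain ⟨𝓗, κ, χ', h1, h2, h3, h4, h5, h6, h7⟩ :=
        exists_transferEmbedding G hopen hφ hfib hm hiso (hZ (m + 1))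
      exact ⟨𝓗, κ, χ', .single κ h1, h2, h3, h4, h5, h6, h7⟩
    | succ k ih =>
      intro m hmk hm
      obtain ⟨𝓗, ι, χ, h1, h2, h3, h4, h5, h6, h7⟩ := ih (m + 1) (by omega) (by omega)
      obtain ⟨𝓚, κ, χ', k1, k2, k3, k4, k5, k6, k7⟩ :=
        exists_transferEmbedding G h6 h3 h4 hm h5 h7
      have hc : IsComposition κ ι (κ.comp ι : Hom 𝓚 𝓛 id) := κ.isComposition_comp ι
      exact ⟨𝓚, κ.comp ι, χ', .step ι κ _ h1 k1 hc, h2.comp_linear hφ k2 hc, k3, k4, k5, k6, k7⟩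
  exact key (𝓛.bound + 𝓛'.bound) 1 (by omega) le_rfl

end Step

end LInftyBundle

/-! ### Local sections over slices -/

section Slices

open Filter Topology

variable {EM : Type*} [NormedAddCommGroup EM] [NormedSpace ℝ EM]
  {M : Type*} [TopologicalSpace M] [ChartedSpace EM M]
  {EN : Type*} [NormedAddCommGroup EN] [NormedSpace ℝ EN]
  {N : Type*} [TopologicalSpace N] [ChartedSpace EN N]

/-- A local diffeomorphism to the model space restricts to a chart. -/
lemma exists_chart_of_bijective_mfderiv [FiniteDimensional ℝ EM] [IsManifold 𝓘(ℝ, EM) ∞ M]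
    {G : M → EM} {p₀ : M} (hG : ∀ᶠ q in 𝓝 p₀, ContMDiffAt 𝓘(ℝ, EM) 𝓘(ℝ, EM) ∞ G q)
    (hbij : Function.Bijective (mfderiv 𝓘(ℝ, EM) 𝓘(ℝ, EM) G p₀)) {O : Set M} (hO : O ∈ 𝓝 p₀) :
    ∃ D ∈ IsManifold.maximalAtlas 𝓘(ℝ, EM) ∞ M, p₀ ∈ D.source ∧ D.source ⊆ O ∧
      ∀ q ∈ D.source, D q = G q := by
  have : CompleteSpace EM := FiniteDimensional.complete ℝ EM
  let e := chartAt EM p₀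
  let Φ : EM → EM := G ∘ e.symm
  have hps : p₀ ∈ e.source := mem_chart_source EM p₀
  have hpt : e p₀ ∈ e.target := mem_chart_target EM p₀
  have hsymm : e.symm (e p₀) = p₀ := e.left_inv hps
  have hΦs : ∀ᶠ x in 𝓝 (e p₀), ContDiffAt ℝ ∞ Φ x := by
    have h1 : Tendsto e.symm (𝓝 (e p₀)) (𝓝 p₀) := by
      have := e.continuousAt_symm hpt
      rwa [ContinuousAt, hsymm] at this
    filter_upwards [h1 hG, e.open_target.mem_nhds hpt] with x h2 h3
    rw [← contMDiffAt_iff_contDiffAt]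
    refine ContMDiffAt.comp x (show ContMDiffAt 𝓘(ℝ, EM) 𝓘(ℝ, EM) ∞ G (e.symm x) from h2) ?_
    exact (contMDiffOn_chart_symm (n := ∞) (x := p₀)).contMDiffAt (e.open_target.mem_nhds h3)
  let d : EM →L[ℝ] EM := mfderiv 𝓘(ℝ, EM) 𝓘(ℝ, EM) G p₀
  have hd : HasFDerivAt Φ d (e p₀) := by
    have h1 := (hG.self_of_nhds.mdifferentiableAt (by simp)).hasMFDerivAt.2
    simp only [writtenInExtChartAt, mfld_simps] at h1
    exact hasFDerivWithinAt_univ.1 h1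
  let L : EM ≃L[ℝ] EM := (LinearEquiv.ofBijective
    (d : EM →ₗ[ℝ] EM) hbij).toContinuousLinearEquiv
  have hL : (L : EM →L[ℝ] EM) = d := by
    ext x
    rfl
  rw [← hL] at hd
  have h0 := hΦs.self_of_nhds
  let K₀ := h0.toOpenPartialHomeomorph Φ hd (by simp)
  -- the derivative is invertible near `p₀`, which makes the local inverse smooth everywhere
  have hinv : ∀ᶠ x in 𝓝 (e p₀), ∃ L' : EM ≃L[ℝ] EM, (L' : EM →L[ℝ] EM) = fderiv ℝ Φ x := by
    have h1 : ContinuousAt (fderiv ℝ Φ) (e p₀) :=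
      (h0.fderiv_right (m := 0) (by simp)).continuousAt
    have h2 := ContinuousLinearEquiv.nhds L
    rw [← hd.fderiv] at h2
    exact h1 h2
  obtain ⟨T, hT, hTo, hpT⟩ := eventually_nhds_iff.1 (hΦs.and hinv)
  let K := K₀.restr T
  have hKs : K.source = K₀.source ∩ T := by
    rw [OpenPartialHomeomorph.restr_source, hTo.interior_eq]
  have hKmem : K ∈ contDiffGroupoid ∞ 𝓘(ℝ, EM) := by
    rw [contDiffGroupoid, mem_groupoid_of_pregroupoid]
    simp only [contDiffPregroupoid, mfld_simps]
    constructor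
    · intro x hx
      exact (hT x (by simpa [hTo.interior_eq] using hx.2)).1.contDiffWithinAt
    · intro y hy
      have hy1 : y ∈ K₀.target := hy.1
      have hy2 : K₀.symm y ∈ T := by simpa [hTo.interior_eq] using hy.2
      obtain ⟨h2, L', hL'⟩ := hT _ hy2
      refine (K₀.contDiffAt_symm (f₀' := L') hy1 ?_ h2).contDiffWithinAt
      rw [hL']
      exact (h2.differentiableAt (by simp)).hasFDerivAt
  let D := e ≫ₕ K
  have hD : D ∈ IsManifold.maximalAtlas 𝓘(ℝ, EM) ∞ M := by
    rw [IsManifold.maximalAtlas, mem_maximalAtlas_iff]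
    intro e' he'
    constructor
    · rw [OpenPartialHomeomorph.trans_symm_eq_symm_trans_symm, OpenPartialHomeomorph.trans_assoc]
      exact (contDiffGroupoid ∞ 𝓘(ℝ, EM)).trans ((contDiffGroupoid ∞ 𝓘(ℝ, EM)).symm hKmem)
        (StructureGroupoid.compatible _ (chart_mem_atlas EM p₀) he')
    · rw [← OpenPartialHomeomorph.trans_assoc]
      exact (contDiffGroupoid ∞ 𝓘(ℝ, EM)).trans
        (StructureGroupoid.compatible _ he' (chart_mem_atlas EM p₀)) hKmem
  obtain ⟨O', hO', hO'o, hpO'⟩ := mem_nhds_iff.1 hO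
  refine ⟨D.restr O', restr_mem_maximalAtlas _ hD hO'o, ?_, ?_, ?_⟩
  · rw [OpenPartialHomeomorph.restr_source, hO'o.interior_eq]
    refine ⟨?_, hpO'⟩
    rw [OpenPartialHomeomorph.trans_source, hKs]
    exact ⟨hps, h0.mem_toOpenPartialHomeomorph_source hd (by simp), hpT⟩
  · rw [OpenPartialHomeomorph.restr_source, hO'o.interior_eq]
    exact fun q hq => hO' hq.2
  · intro q hq
    rw [OpenPartialHomeomorph.restr_source, OpenPartialHomeomorph.trans_source] at hq
    change G (e.symm (e q)) = G q
    rw [e.left_inv hq.1.1]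

variable (EM EN) in
/-- The map `f` maps `Y ∩ u` bijectively to `v`, with inverse the smooth map `g`. -/
structure IsLocalSection (f : M → N) (Y u : Set M) (v : Set N) (g : N → M) : Prop where
  isOpen_left : IsOpen u
  isOpen_right : IsOpen v
  contMDiffOn : ContMDiffOn 𝓘(ℝ, EN) 𝓘(ℝ, EM) ∞ g v
  mapsTo : MapsTo g v (Y ∩ u)
  right_inv : ∀ y ∈ v, f (g y) = y
  left_inv : ∀ x ∈ Y ∩ u, f x ∈ v ∧ g (f x) = x

/-- If `(f, σ)` is a local diffeomorphism at `p₀`, the map `f` restricts to a local diffeomorphism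
on the slice `{σ = 0}`. -/
lemma exists_isLocalSection [FiniteDimensional ℝ EM] [IsManifold 𝓘(ℝ, EM) ∞ M]
    [FiniteDimensional ℝ EN] [IsManifold 𝓘(ℝ, EN) ∞ N] {S : Type*} [NormedAddCommGroup S]
    [NormedSpace ℝ S] [FiniteDimensional ℝ S] {f : M → N} {σ : M → S} {p₀ : M} {Y : Set M}
    (hf : ∀ᶠ q in 𝓝 p₀, ContMDiffAt 𝓘(ℝ, EM) 𝓘(ℝ, EN) ∞ f q)
    (hσ : ∀ᶠ q in 𝓝 p₀, ContMDiffAt 𝓘(ℝ, EM) 𝓘(ℝ, S) ∞ σ q)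
    (hinj : ∀ w : TangentSpace 𝓘(ℝ, EM) p₀, mfderiv 𝓘(ℝ, EM) 𝓘(ℝ, EN) f p₀ w = 0 →
      mfderiv 𝓘(ℝ, EM) 𝓘(ℝ, S) σ p₀ w = 0 → w = 0)
    (hsurj : ∀ (y : EN) (s : S), ∃ w : TangentSpace 𝓘(ℝ, EM) p₀,
      mfderiv 𝓘(ℝ, EM) 𝓘(ℝ, EN) f p₀ w = y ∧ mfderiv 𝓘(ℝ, EM) 𝓘(ℝ, S) σ p₀ w = s)
    (hY : ∀ᶠ q in 𝓝 p₀, q ∈ Y ↔ σ q = 0) :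
    ∃ (u : Set M) (v : Set N) (g : N → M), p₀ ∈ u ∧ IsLocalSection EM EN f Y u v g ∧
      ∃ e ∈ IsManifold.maximalAtlas 𝓘(ℝ, EM) ∞ M, e.source = u ∧
        ∃ T : Submodule ℝ EM, ∀ q ∈ u, q ∈ Y ↔ e q ∈ T := by
  let df : EM →L[ℝ] EN := mfderiv 𝓘(ℝ, EM) 𝓘(ℝ, EN) f p₀
  let dσ : EM →L[ℝ] S := mfderiv 𝓘(ℝ, EM) 𝓘(ℝ, S) σ p₀
  have hbij : Function.Bijective ((df : EM →ₗ[ℝ] EN).prod (dσ : EM →ₗ[ℝ] S)) := by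
    constructor
    · rw [← LinearMap.ker_eq_bot, LinearMap.ker_eq_bot']
      intro w hw
      exact hinj w (congrArg Prod.fst hw) (congrArg Prod.snd hw)
    · rintro ⟨y, s⟩
      obtain ⟨w, h1, h2⟩ := hsurj y s
      exact ⟨w, Prod.ext h1 h2⟩
  let A : (EN × S) ≃L[ℝ] EM := (LinearEquiv.ofBijective _ hbij).symm.toContinuousLinearEquiv
  let c := extChartAt 𝓘(ℝ, EN) (f p₀)
  have hcs : f p₀ ∈ c.source := mem_extChartAt_source (I := 𝓘(ℝ, EN)) (f p₀)
  have hco : IsOpen c.source := isOpen_extChartAt_source (I := 𝓘(ℝ, EN)) (f p₀)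
  let G : M → EM := fun q => A (c (f q), σ q)
  have hfsrc : ∀ᶠ q in 𝓝 p₀, f q ∈ c.source :=
    hf.self_of_nhds.continuousAt (hco.mem_nhds hcs)
  have hcf : ∀ q, ContMDiffAt 𝓘(ℝ, EM) 𝓘(ℝ, EN) ∞ f q → f q ∈ c.source →
      ContMDiffAt 𝓘(ℝ, EM) 𝓘(ℝ, EN) ∞ (fun q => c (f q)) q := fun q h1 h2 =>
    ContMDiffAt.comp q (contMDiffAt_extChartAt' (by simpa [c] using h2)) h1
  have hG : ∀ᶠ q in 𝓝 p₀, ContMDiffAt 𝓘(ℝ, EM) 𝓘(ℝ, EM) ∞ G q := by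
    filter_upwards [hf, hσ, hfsrc] with q h1 h2 h3
    exact (A.contDiff.contMDiff.contMDiffAt).comp q ((hcf q h1 h3).prodMk_space h2)
  have hdc : (mfderiv 𝓘(ℝ, EN) 𝓘(ℝ, EN) c (f p₀)).IsInvertible :=
    isInvertible_mfderiv_extChartAt (mem_extChartAt_source (I := 𝓘(ℝ, EN)) (f p₀))
  obtain ⟨C, hC⟩ := hdc
  have hGd : ∀ w : EM, mfderiv 𝓘(ℝ, EM) 𝓘(ℝ, EM) G p₀ w = A (C (df w), dσ w) := by
    intro w
    have h1 : HasMFDerivAt 𝓘(ℝ, EM) 𝓘(ℝ, EN) (fun q => c (f q)) p₀ _ :=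
      HasMFDerivAt.comp p₀ (((contMDiffAt_extChartAt (I := 𝓘(ℝ, EN)) (n := ∞)
        (x := f p₀)).mdifferentiableAt (by simp)).hasMFDerivAt)
        ((hf.self_of_nhds.mdifferentiableAt (by simp)).hasMFDerivAt)
    have h2 := (hσ.self_of_nhds.mdifferentiableAt (by simp)).hasMFDerivAt
    have h3 : HasMFDerivAt 𝓘(ℝ, EM) 𝓘(ℝ, EN × S) (fun q => (c (f q), σ q)) p₀ _ :=
      ⟨h1.1.prodMk h2.1, h1.2.prodMk h2.2⟩
    have h4 : HasMFDerivAt 𝓘(ℝ, EM) 𝓘(ℝ, EM) G p₀ _ :=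
      HasMFDerivAt.comp p₀ (A.toContinuousLinearMap.hasMFDerivAt) h3
    rw [h4.mfderiv]
    change A (mfderiv 𝓘(ℝ, EN) 𝓘(ℝ, EN) c (f p₀) (df w), dσ w) = _
    rw [← hC]
    rfl
  have hGbij : Function.Bijective (mfderiv 𝓘(ℝ, EM) 𝓘(ℝ, EM) G p₀) := by
    constructor
    · intro w w' hw
      have h1 := (hGd w).symm.trans (hw.trans (hGd w'))
      have h2 := A.injective h1
      have h3 := C.injective (congrArg Prod.fst h2)
      exact hbij.1 (Prod.ext h3 (show dσ w = dσ w' from congrArg Prod.snd h2))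
    · intro z
      obtain ⟨⟨y, s⟩, rfl⟩ := A.surjective z
      obtain ⟨y, rfl⟩ := C.surjective y
      obtain ⟨w, hw⟩ := hbij.2 (y, s)
      refine ⟨w, (hGd w).trans ?_⟩
      have h1 : df w = y := congrArg Prod.fst hw
      have h2 : dσ w = s := congrArg Prod.snd hw
      rw [h1, h2]
  obtain ⟨D, hD, hpD, hDO, hDG⟩ := exists_chart_of_bijective_mfderiv hG hGbij
    (O := {q | f q ∈ c.source ∧ (q ∈ Y ↔ σ q = 0)}) (hfsrc.and hY)
  let τ : N → EM := fun y => A (c y, 0)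
  have hτ : ContMDiffOn 𝓘(ℝ, EN) 𝓘(ℝ, EM) ∞ τ c.source := by
    intro y hy
    have h1 : ContMDiffAt 𝓘(ℝ, EN) 𝓘(ℝ, EN) ∞ c y :=
      contMDiffAt_extChartAt' (by simpa [c] using hy)
    exact ((A.contDiff.contMDiff.contMDiffAt).comp y
      (h1.prodMk_space contMDiffAt_const)).contMDiffWithinAt
  -- the inverse of `f` on the slice: in the chart `D = A ∘ (c ∘ f, σ)` it puts the second component
  -- to zero
  let v : Set N := c.source ∩ τ ⁻¹' D.target
  have hv : IsOpen v := hτ.continuousOn.isOpen_inter_preimage hco D.open_target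
  let g : N → M := fun y => D.symm (τ y)
  have hgu : ∀ y ∈ v, g y ∈ D.source := fun y hy => D.map_target hy.2
  have hDg : ∀ y ∈ v, c (f (g y)) = c y ∧ σ (g y) = 0 := fun y hy => by
    have h1 : D (g y) = τ y := D.right_inv hy.2
    rw [hDG _ (hgu y hy)] at h1
    have h2 := A.injective h1
    exact ⟨congrArg Prod.fst h2, congrArg Prod.snd h2⟩
  refine ⟨D.source, v, g, hpD, ⟨D.open_source, hv, ?_, fun y hy => ?_, fun y hy => ?_,
    fun x hx => ?_⟩, D, hD, rfl, (LinearMap.range (A.toLinearMap ∘ₗ LinearMap.inl ℝ EN S)),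
    fun q hq => ?_⟩
  · exact (contMDiffOn_symm_of_mem_maximalAtlas hD).comp (hτ.mono inter_subset_left) fun y hy => hy.2
  · exact ⟨(hDO (hgu y hy)).2.2 (hDg y hy).2, hgu y hy⟩
  · exact c.injOn (hDO (hgu y hy)).1 hy.1 (hDg y hy).1
  · have h0 : σ x = 0 := (hDO hx.2).2.1 hx.1
    have h1 : τ (f x) = D x := by
      rw [hDG x hx.2]
      change A (c (f x), 0) = A (c (f x), σ x)
      rw [h0]
    refine ⟨⟨(hDO hx.2).1, ?_⟩, ?_⟩
    · change τ (f x) ∈ D.target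
      rw [h1]
      exact D.map_source hx.2
    · change D.symm (τ (f x)) = x
      rw [h1, D.left_inv hx.2]
  · rw [(hDO hq).2, hDG q hq]
    constructor
    · intro h0
      exact ⟨c (f q), by simp [G, h0]⟩
    · rintro ⟨y, hy⟩
      exact (congrArg Prod.snd (A.injective hy)).symm

lemma IsLocalSection.inter {f : M → N} {Y u : Set M} {v : Set N} {g : N → M}
    (h : IsLocalSection EM EN f Y u v g) {O : Set M} (hO : IsOpen O) :
    IsLocalSection EM EN f (Y ∩ O) (u ∩ O) (v ∩ g ⁻¹' O) g where
  isOpen_left := h.isOpen_left.inter hO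
  isOpen_right := h.contMDiffOn.continuousOn.isOpen_inter_preimage h.isOpen_right hO
  contMDiffOn := h.contMDiffOn.mono inter_subset_left
  mapsTo y hy := ⟨⟨(h.mapsTo hy.1).1, hy.2⟩, (h.mapsTo hy.1).2, hy.2⟩
  right_inv y hy := h.right_inv y hy.1
  left_inv x hx := by
    have h1 := h.left_inv x ⟨hx.1.1, hx.2.1⟩
    refine ⟨⟨h1.1, ?_⟩, h1.2⟩
    change g (f x) ∈ O
    rw [h1.2]
    exact hx.1.2

variable (EM EN) in
/-- Near each point of `Y` the map `f` restricts to a diffeomorphism from `Y` to `N`. -/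
def HasLocalSections (f : M → N) (Y : Set M) : Prop :=
  ∀ p ∈ Y, ∃ (u : Set M) (v : Set N) (g : N → M), p ∈ u ∧ IsLocalSection EM EN f Y u v g

namespace HasLocalSections

variable {f : M → N} {Y : Set M} (h : HasLocalSections EM EN f Y)
include h

lemma inter {O : Set M} (hO : IsOpen O) : HasLocalSections EM EN f (Y ∩ O) := by
  rintro p ⟨hp, hpO⟩
  obtain ⟨u, v, g, hpu, hs⟩ := h p hp
  exact ⟨u ∩ O, v ∩ g ⁻¹' O, g, ⟨hpu, hpO⟩, hs.inter hO⟩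

lemma isOpen_image : IsOpen (f '' Y) := by
  rw [isOpen_iff_mem_nhds]
  rintro _ ⟨p, hp, rfl⟩
  obtain ⟨u, v, g, hpu, hs⟩ := h p hp
  refine mem_of_superset (hs.isOpen_right.mem_nhds (hs.left_inv p ⟨hp, hpu⟩).1) fun y hy => ?_
  exact ⟨g y, (hs.mapsTo hy).1, hs.right_inv y hy⟩

/-- If `f` is injective on `Y`, the local sections are the restrictions of a global one. -/
lemma exists_isLocalSection_univ [Nonempty M] (hinj : InjOn f Y) :
    ∃ g : N → M, IsLocalSection EM EN f Y univ (f '' Y) g := by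
  have hl : ∀ x ∈ Y, Function.invFunOn f Y (f x) = x := fun x hx => hinj.leftInvOn_invFunOn hx
  refine ⟨Function.invFunOn f Y, isOpen_univ, h.isOpen_image, ?_, ?_, ?_, fun x hx =>
    ⟨mem_image_of_mem f hx.1, hl x hx.1⟩⟩
  · rintro _ ⟨p, hp, rfl⟩
    obtain ⟨u, v, g, hpu, hs⟩ := h p hp
    have hv := hs.isOpen_right.mem_nhds (hs.left_inv p ⟨hp, hpu⟩).1
    have h1 : Function.invFunOn f Y =ᶠ[𝓝 (f p)] g := by
      filter_upwards [hv] with y hy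
      have h2 := hl (g y) (hs.mapsTo hy).1
      rwa [hs.right_inv y hy] at h2
    exact ((hs.contMDiffOn.contMDiffAt hv).congr_of_eventuallyEq h1).contMDiffWithinAt
  · rintro _ ⟨p, hp, rfl⟩
    rw [hl p hp]
    exact ⟨hp, trivial⟩
  · rintro _ ⟨p, hp, rfl⟩
    rw [hl p hp]

/-- If `f` is injective on a union `Z` of fibres of `f|_Y`, it is injective on a neighbourhood of
`Z` in `Y`.  Over the connected neighbourhood `Q z` of `f z`, for `z ∈ Z`, there is a section of
`f|_Y` through `z`, and two such sections that are defined on the same connected set agree if they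
agree at one point of `f '' Z`. -/
lemma exists_isOpen_injOn [T2Space M] [FiniteDimensional ℝ EN] [T2Space N]
    [SecondCountableTopology N] {Z O₀ : Set M} (hZY : Z ⊆ Y) (hO₀ : IsOpen O₀) (hZO : Z ⊆ O₀)
    (hf : ContinuousOn f O₀) (hfib : ∀ y ∈ Y, f y ∈ f '' Z → y ∈ Z) (hZ : InjOn f Z) :
    ∃ O : Set M, IsOpen O ∧ Z ⊆ O ∧ InjOn f (Y ∩ O) := by
  have : LocallyCompactSpace N := ChartedSpace.locallyCompactSpace EN N
  have : LocallyConnectedSpace N := ChartedSpace.locallyConnectedSpace EN N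
  let _ := TopologicalSpace.metrizableSpaceMetric N
  rcases Z.eq_empty_or_nonempty with rfl | ⟨z₀, -⟩
  · exact ⟨∅, isOpen_empty, le_rfl, by simp⟩
  have : Nonempty (N → M) := ⟨fun _ => z₀⟩
  choose! u v g hu hs using fun p (hp : p ∈ Z) => h p (hZY hp)
  have hv : ∀ p ∈ Z, f p ∈ v p := fun p hp => ((hs p hp).left_inv p ⟨hZY hp, hu p hp⟩).1
  have hex : ∀ p, ∃ r : ℝ, p ∈ Z → 0 < r ∧ Metric.ball (f p) r ⊆ v p := fun p => by
    by_cases hp : p ∈ Z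
    · obtain ⟨r, hr, hrv⟩ := Metric.isOpen_iff.1 (hs p hp).isOpen_right _ (hv p hp)
      exact ⟨r, fun _ => ⟨hr, hrv⟩⟩
    · exact ⟨0, fun h => absurd h hp⟩
  choose r hr using hex
  have hex : ∀ p, ∃ Q : Set N, p ∈ Z → Q ⊆ Metric.ball (f p) (r p / 3) ∧ IsOpen Q ∧ f p ∈ Q ∧
      IsConnected Q := fun p => by
    by_cases hp : p ∈ Z
    · obtain ⟨Q, h1, h2, h3, h4⟩ := locallyConnectedSpace_iff_subsets_isOpen_isConnected.1
        (inferInstance : LocallyConnectedSpace N) (f p) _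
        (Metric.ball_mem_nhds (f p) (show 0 < r p / 3 by linarith [(hr p hp).1]))
      exact ⟨Q, fun _ => ⟨h1, h2, h3, h4⟩⟩
    · exact ⟨∅, fun h => absurd h hp⟩
  choose Q hQ using hex
  have key : ∀ z₁ ∈ Z, ∀ z₂ ∈ Z, r z₂ ≤ r z₁ → ∀ y₁ ∈ Y ∩ u z₁, ∀ y₂ ∈ Y ∩ u z₂,
      f y₁ ∈ Q z₁ → f y₂ ∈ Q z₂ → f y₁ = f y₂ → y₁ = y₂ := by
    intro z₁ hz₁ z₂ hz₂ hr12 y₁ hy₁ y₂ hy₂ hq₁ hq₂ heq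
    obtain ⟨hQ₁, -, -, -⟩ := hQ z₁ hz₁
    obtain ⟨hQ₂, hQo, hfQ, hQc⟩ := hQ z₂ hz₂
    -- as `r z₂ ≤ r z₁` and `Q z₁` meets `Q z₂`, also the section through `z₁` is defined on `Q z₂`
    have hQv₁ : Q z₂ ⊆ v z₁ := fun q hq => by
      refine (hr z₁ hz₁).2 ?_
      have h1 := Metric.mem_ball.1 (hQ₂ hq)
      have h2 := Metric.mem_ball'.1 (hQ₂ hq₂)
      have h3 := Metric.mem_ball.1 (hQ₁ hq₁)
      rw [heq] at h3
      have h5 := dist_triangle q (f z₂) (f z₁)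
      have h6 := dist_triangle (f z₂) (f y₂) (f z₁)
      rw [Metric.mem_ball]
      linarith
    have hQv₂ : Q z₂ ⊆ v z₂ := fun q hq => by
      refine (hr z₂ hz₂).2 (Metric.ball_subset_ball ?_ (hQ₂ hq))
      linarith [(hr z₂ hz₂).1]
    have hg₁ := (hs z₁ hz₁).contMDiffOn.continuousOn.mono hQv₁
    have hg₂ := (hs z₂ hz₂).contMDiffOn.continuousOn.mono hQv₂
    have hU₁ : IsOpen (Q z₂ ∩ g z₁ ⁻¹' u z₂) :=
      hg₁.isOpen_inter_preimage hQo (hs z₂ hz₂).isOpen_left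
    have hU₂ : IsOpen (Q z₂ ∩ (fun q => (g z₁ q, g z₂ q)) ⁻¹' (diagonal M)ᶜ) :=
      (hg₁.prodMk hg₂).isOpen_inter_preimage hQo isClosed_diagonal.isOpen_compl
    have hagree : ∀ q ∈ Q z₂, g z₁ q ∈ u z₂ → g z₁ q = g z₂ q := fun q hq h1 => by
      have h2 := ((hs z₂ hz₂).left_inv _ ⟨((hs z₁ hz₁).mapsTo (hQv₁ hq)).1, h1⟩).2
      rw [(hs z₁ hz₁).right_inv q (hQv₁ hq)] at h2
      exact h2.symm
    -- the points where the two sections agree form a subset of `Q z₂` that is open and closed, and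
    -- contains `f z₂`, over which `z₂` is the only point of `Y`
    have hsub : Q z₂ ⊆ Q z₂ ∩ g z₁ ⁻¹' u z₂ := by
      refine IsPreconnected.subset_left_of_subset_union hU₁ hU₂ ?_ ?_ ?_ hQc.isPreconnected
      · rw [Set.disjoint_left]
        exact fun q h1 h2 => h2.2 (hagree q h1.1 h1.2)
      · intro q hq
        by_cases h1 : g z₁ q = g z₂ q
        · left
          refine ⟨hq, ?_⟩
          change g z₁ q ∈ u z₂
          rw [h1]
          exact ((hs z₂ hz₂).mapsTo (hQv₂ hq)).2
        · exact Or.inr ⟨hq, h1⟩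
      · have h1 := (hs z₁ hz₁).mapsTo (hQv₁ hfQ)
        have h2 := (hs z₁ hz₁).right_inv _ (hQv₁ hfQ)
        have h3 : g z₁ (f z₂) ∈ Z := hfib _ h1.1 (by rw [h2]; exact mem_image_of_mem f hz₂)
        refine ⟨f z₂, hfQ, hfQ, ?_⟩
        change g z₁ (f z₂) ∈ u z₂
        rw [hZ h3 hz₂ h2]
        exact hu z₂ hz₂
    have h1 := hagree _ hq₂ (hsub hq₂).2
    rw [((hs z₂ hz₂).left_inv _ hy₂).2, ← heq, ((hs z₁ hz₁).left_inv _ hy₁).2] at h1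
    exact h1
  refine ⟨⋃ z ∈ Z, u z ∩ (O₀ ∩ f ⁻¹' Q z), ?_, ?_, ?_⟩
  · exact isOpen_biUnion fun z hz =>
      (hs z hz).isOpen_left.inter (hf.isOpen_inter_preimage hO₀ (hQ z hz).2.1)
  · exact fun z hz => mem_biUnion hz ⟨hu z hz, hZO hz, (hQ z hz).2.2.1⟩
  · rintro y₁ ⟨hy₁, h1⟩ y₂ ⟨hy₂, h2⟩ heq
    simp only [mem_iUnion] at h1 h2
    obtain ⟨z₁, hz₁, hu₁, -, hq₁⟩ := h1
    obtain ⟨z₂, hz₂, hu₂, -, hq₂⟩ := h2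
    rcases le_total (r z₂) (r z₁) with hle | hle
    · exact key z₁ hz₁ z₂ hz₂ hle y₁ ⟨hy₁, hu₁⟩ y₂ ⟨hy₂, hu₂⟩ hq₁ hq₂ heq
    · exact (key z₂ hz₂ z₁ hz₁ hle y₂ ⟨hy₂, hu₂⟩ y₁ ⟨hy₁, hu₁⟩ hq₂ hq₁ heq.symm).symm

end HasLocalSections

end Slices

/-! ### Simple subbundles -/

section Algebra

variable {A B : Type*} [AddCommGroup A] [Module ℝ A] [AddCommGroup B] [Module ℝ B]

/-- A subspace closed under the operations of a curved `L∞[1]`-algebra is one itself. -/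
lemma IsCurvedLInfty.of_injective {G : ℕ → Submodule ℝ A} {G' : ℕ → Submodule ℝ B}
    {lam : Operations A A} {lam' : Operations B B} (h : IsCurvedLInfty G' lam') {i : A →ₗ[ℝ] B}
    (hi : Function.Injective i) (hG : ∀ n, ∀ x ∈ G n, i x ∈ G' n)
    (hop : ∀ (n : ℕ) (x : Fin n → A), i (lam n x) = lam' n (fun j => i (x j)))
    (hdeg : ∀ (k : ℕ) (d : Fin k → ℕ) (x : Fin k → A), (∀ j, x j ∈ G (d j)) →
      lam k x ∈ G ((∑ j, d j) + 1)) : IsCurvedLInfty G lam where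
  symmetric k d x hx σ := by
    apply hi
    rw [hop, map_smul, hop]
    exact h.symmetric k d (fun j => i (x j)) (fun j => hG _ _ (hx j)) σ
  degree := hdeg
  jacobi n d x hx := by
    apply hi
    rw [map_zero, ← h.jacobi n d (fun j => i (x j)) fun j => hG _ _ (hx j)]
    unfold insertOp
    rw [map_sum]
    refine Finset.sum_congr rfl fun S _ => ?_
    rw [map_smul, hop]
    congr 2
    funext j
    refine Fin.cases ?_ (fun j => ?_) j
    · simp only [Fin.cons_zero, hop]
    · simp only [Fin.cons_succ]

lemma Submodule.iSup_submoduleOf_eq_top {ι : Type*} (S : ι → Submodule ℝ A) :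
    ⨆ i, (S i).submoduleOf (⨆ i, S i) = ⊤ := by
  apply Submodule.map_injective_of_injective (⨆ i, S i).injective_subtype
  rw [Submodule.map_iSup, Submodule.map_top, Submodule.range_subtype]
  exact iSup_congr fun i => (Submodule.map_comap_subtype _ _).trans (inf_eq_right.2 (le_iSup S i))

end Algebra

namespace LInftyBundle

open Filter Topology

variable {EM : Type*} [NormedAddCommGroup EM] [NormedSpace ℝ EM]
  {M : Type*} [TopologicalSpace M] [ChartedSpace EM M]
  {FM : Type*} [NormedAddCommGroup FM] [NormedSpace ℝ FM]
  {V : M → Type*} [∀ p, AddCommGroup (V p)] [∀ p, Module ℝ (V p)]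
  [TopologicalSpace (TotalSpace FM V)] [∀ p, TopologicalSpace (V p)] [FiberBundle FM V]
  {EN : Type*} [NormedAddCommGroup EN] [NormedSpace ℝ EN]
  {N : Type*} [TopologicalSpace N] [ChartedSpace EN N]
  {FN : Type*} [NormedAddCommGroup FN] [NormedSpace ℝ FN]
  {W : N → Type*} [∀ q, AddCommGroup (W q)] [∀ q, Module ℝ (W q)]
  [TopologicalSpace (TotalSpace FN W)] [∀ q, TopologicalSpace (W q)] [FiberBundle FN W]
  [VectorBundle ℝ FM V] [FiniteDimensional ℝ FM] [VectorBundle ℝ FN W] [FiniteDimensional ℝ FN]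

variable {𝓛 : LInftyBundle EM FM V} {𝓛' : LInftyBundle EN FN W} {f : M → N}

variable (𝓛) in
/-- The data of a simple subbundle: a submanifold `Y` of the base and a subbundle `E ⊆ L¹|_Y` that
contains the curvature. -/
structure IsSimpleData (Y : Set M) (E : ∀ p, Submodule ℝ (V p)) : Prop where
  base_subset : Y ⊆ 𝓛.base
  submanifold : IsSubmanifold EM Y
  subbundle : IsSmoothSubbundle EM FM Y E
  le : ∀ p ∈ Y, E p ≤ 𝓛.grade 1 p
  curvature_mem : ∀ p ∈ Y, (𝓛.curvature p : V p) ∈ E p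

variable (𝓛) in
/-- The graded bundle `E ⊕ L^{≥ 2}`. -/
def simpleGrade (E : ∀ p, Submodule ℝ (V p)) : ℕ → ∀ p, Submodule ℝ (V p)
  | 0 => fun _ => ⊥
  | 1 => E
  | i + 2 => 𝓛.grade (i + 2)

variable {Y : Set M} {E : ∀ p, Submodule ℝ (V p)}

variable (𝓛 E) in
open Classical in
/-- The restriction of the operations to `E ⊕ L^{≥ 2}`, at the points where this subspace is closed
under them, and zero elsewhere; outside of `Y` nothing is known about `E`. -/
def simpleOp (p : M) : Operations ↥(⨆ i, 𝓛.simpleGrade E i p) ↥(⨆ i, 𝓛.simpleGrade E i p) :=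
  if h : ∃ hle : ⨆ i, 𝓛.simpleGrade E i p ≤ 𝓛.fib p,
      ∀ (k : ℕ) (x : Fin k → ↥(⨆ i, 𝓛.simpleGrade E i p)),
      (𝓛.op p k (fun a => Submodule.inclusion hle (x a)) : V p) ∈ ⨆ i, 𝓛.simpleGrade E i p then
    fun k => MultilinearMap.codRestrict ((𝓛.fib p).subtype.compMultilinearMap
      ((𝓛.op p k).compLinearMap fun _ => Submodule.inclusion h.choose)) _ (h.choose_spec k)
  else 0

namespace IsSimpleData

variable (h : IsSimpleData 𝓛 Y E)
include h

lemma grade_le {p : M} (hp : p ∈ Y) (i : ℕ) : 𝓛.simpleGrade E i p ≤ 𝓛.grade i p := by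
  match i with
  | 0 => exact bot_le
  | 1 => exact h.le p hp
  | i + 2 => exact le_rfl

lemma iSup_le {p : M} (hp : p ∈ Y) : ⨆ i, 𝓛.simpleGrade E i p ≤ 𝓛.fib p :=
  iSup_mono fun i => h.grade_le hp i

/-- An operation on elements of positive degree has degree at least two, unless it is the curvature.
-/
lemma op_mem_grade {p : M} (hp : p ∈ Y) {k : ℕ} {d : Fin k → ℕ} {x : Fin k → 𝓛.fib p}
    (hx : ∀ j, (x j : V p) ∈ 𝓛.simpleGrade E (d j) p) :
    (𝓛.op p k x : V p) ∈ 𝓛.simpleGrade E ((∑ j, d j) + 1) p := by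
  by_cases h0 : ∃ j, d j = 0
  · obtain ⟨j, hj⟩ := h0
    have h1 := hx j
    rw [hj] at h1
    have h2 : x j = 0 := Subtype.ext ((Submodule.mem_bot ℝ).1 h1)
    rw [(𝓛.op p k).map_coord_zero j h2]
    exact Submodule.zero_mem _
  · push Not at h0
    match k with
    | 0 =>
      rw [op_zero, Finset.univ_eq_empty, Finset.sum_empty]
      exact h.curvature_mem p hp
    | k + 1 =>
      have h1 : 1 ≤ ∑ j, d j :=
        (Nat.one_le_iff_ne_zero.2 (h0 0)).trans (Finset.single_le_sum (fun _ _ => Nat.zero_le _)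
          (Finset.mem_univ 0))
      obtain ⟨m, hm⟩ := Nat.exists_eq_add_of_le' h1
      have h2 := (𝓛.curvedLInfty p (h.base_subset hp)).degree (k + 1) d x fun j =>
        h.grade_le hp _ (hx j)
      rw [hm] at h2 ⊢
      exact h2

lemma op_mem {p : M} (hp : p ∈ Y) (k : ℕ) (x : Fin k → ↥(⨆ i, 𝓛.simpleGrade E i p)) :
    (𝓛.op p k (fun a => Submodule.inclusion (h.iSup_le hp) (x a)) : V p) ∈
      ⨆ i, 𝓛.simpleGrade E i p := by
  refine MultilinearMap.mem_of_homogeneous ((𝓛.fib p).subtype.compMultilinearMap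
    ((𝓛.op p k).compLinearMap fun _ => Submodule.inclusion (h.iSup_le hp)))
    (fun _ i => (𝓛.simpleGrade E i p).submoduleOf _) _ (fun d x hx => ?_) x fun j => ?_
  · exact le_iSup (fun i => 𝓛.simpleGrade E i p) _ (h.op_mem_grade hp hx)
  · rw [Submodule.iSup_submoduleOf_eq_top]
    trivial

lemma coe_simpleOp {p : M} (hp : p ∈ Y) (k : ℕ) (x : Fin k → ↥(⨆ i, 𝓛.simpleGrade E i p)) :
    (𝓛.simpleOp E p k x : V p) = 𝓛.op p k (fun a => Submodule.inclusion (h.iSup_le hp) (x a)) := by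
  unfold simpleOp
  rw [dif_pos ⟨h.iSup_le hp, h.op_mem hp⟩]
  rfl

/-- The simple subbundle with degree one part `E`. -/
def simpleBundle : LInftyBundle EM FM V where
  base := Y
  submanifold := h.submanifold
  grade := 𝓛.simpleGrade E
  subbundle i := by
    match i with
    | 0 => exact isSmoothSubbundle_bot
    | 1 => exact h.subbundle
    | i + 2 => exact isSmoothSubbundle_mono h.base_subset (𝓛.subbundle (i + 2))
  independent p hp := (𝓛.independent p (h.base_subset hp)).mono fun i => h.grade_le hp i
  grade_zero p _ := rfl
  bounded := by
    refine ⟨𝓛.bound, fun i hi p hp => ?_⟩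
    rw [eq_bot_iff, ← 𝓛.bounded.choose_spec i hi p (h.base_subset hp)]
    exact h.grade_le hp i
  op := 𝓛.simpleOp E
  curvedLInfty p hp := by
    refine (𝓛.curvedLInfty p (h.base_subset hp)).of_injective
      (i := Submodule.inclusion (h.iSup_le hp)) (Submodule.inclusion_injective _)
      (fun n x hx => h.grade_le hp n hx) (fun n x => Subtype.ext (h.coe_simpleOp hp n x))
      fun k d x hx => ?_
    change (𝓛.simpleOp E p k x : V p) ∈ 𝓛.simpleGrade E _ p
    rw [h.coe_simpleOp hp]
    exact h.op_mem_grade hp hx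
  smooth k u hu s hs p hp := by
    have h1 := 𝓛.smoothAlong_op (b := id) (s := fun j q => (𝓛.fib q).clip (s j q)) hp
      contMDiffWithinAt_id (fun q hq => h.base_subset hq.1) (k := k) fun j =>
      SmoothAlong.congr (hs j p hp) hp ?_
    · refine SmoothAlong.congr h1 hp ?_
      filter_upwards [eventually_mem_nhdsWithin] with q hq
      rw [h.coe_simpleOp hq.1]
      congr 3
      funext j
      exact Subtype.ext (Submodule.coe_clip (h.iSup_le hq.1 (s j q).2)).symm
    · filter_upwards [eventually_mem_nhdsWithin] with q hq
      exact Submodule.coe_clip (h.iSup_le hq.1 (s j q).2)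

end IsSimpleData

variable (𝓛 E) in
open Classical in
/-- The inclusion of `E ⊕ L^{≥ 2}` in `L`, and zero where it is not contained in `L`. -/
def simpleIncl (p : M) : ↥(⨆ i, 𝓛.simpleGrade E i p) →ₗ[ℝ] 𝓛.fib p :=
  if h : ⨆ i, 𝓛.simpleGrade E i p ≤ 𝓛.fib p then Submodule.inclusion h else 0

namespace IsSimpleData

variable (h : IsSimpleData 𝓛 Y E)
include h

lemma coe_simpleIncl {p : M} (hp : p ∈ Y) (x : ↥(⨆ i, 𝓛.simpleGrade E i p)) :
    (𝓛.simpleIncl E p x : V p) = x := by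
  unfold simpleIncl
  rw [dif_pos (h.iSup_le hp)]
  rfl

lemma simpleIncl_mem {p : M} (hp : p ∈ Y) {i : ℕ} {x : ↥(⨆ i, 𝓛.simpleGrade E i p)}
    (hx : (x : V p) ∈ 𝓛.simpleGrade E i p) : 𝓛.simpleIncl E p x ∈ 𝓛.gr p i := by
  rw [mem_gr, h.coe_simpleIncl hp]
  exact h.grade_le hp i hx

lemma simpleIncl_op {p : M} (hp : p ∈ Y) (k : ℕ) (x : Fin k → ↥(⨆ i, 𝓛.simpleGrade E i p)) :
    𝓛.simpleIncl E p (𝓛.simpleOp E p k x) = 𝓛.op p k (fun j => 𝓛.simpleIncl E p (x j)) := by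
  apply Subtype.ext
  rw [h.coe_simpleIncl hp, h.coe_simpleOp hp]
  congr 3
  funext j
  exact Subtype.ext (h.coe_simpleIncl hp _).symm

lemma smoothAlong_simpleIncl {A : Set M} {p : M} (hA : A ⊆ Y) (hp : p ∈ A)
    {s : ∀ q, ↥(⨆ i, 𝓛.simpleGrade E i q)} (hs : SmoothAlong EM EM FM id A p (fun q => (s q : V q))) :
    SmoothAlong EM EM FM id A p (fun q => (𝓛.simpleIncl E q (s q) : V q)) := by
  refine hs.congr hp ?_
  filter_upwards [eventually_mem_nhdsWithin] with q hq using h.coe_simpleIncl (hA hq) _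

/-- The inclusion of the simple subbundle. -/
def simpleHom : Hom h.simpleBundle 𝓛 id :=
  Hom.ofLinear h.base_subset contMDiffOn_id (𝓛.simpleIncl E)
    (fun _ hp _ _ hx => h.simpleIncl_mem hp hx) (fun _ hp n _ x _ => h.simpleIncl_op hp n x)
    (fun _ _ hA hp _ hs => h.smoothAlong_simpleIncl hA hp hs)

lemma isSimpleSubbundle_simpleHom : h.simpleHom.IsSimpleSubbundle where
  base_subset := h.base_subset
  grade_one_le := h.le
  curvature_mem := h.curvature_mem
  grade_eq p _ i hi := by
    obtain ⟨i, rfl⟩ := Nat.exists_eq_add_of_le' hi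
    rfl
  op_eq p hp _ k x := h.coe_simpleOp hp k x
  inclusion p hp hle := by
    change _root_.ofLinear (𝓛.simpleIncl E p) = _
    congr 1
    ext x
    exact h.coe_simpleIncl hp x

/-- The restriction of a linear morphism to the simple subbundle. -/
def simpleLin {χ : Hom 𝓛 𝓛' f} (hχ : χ.IsLinear) : Hom h.simpleBundle 𝓛' f :=
  Hom.ofLinear (χ.mapsTo.mono_left h.base_subset) (χ.contMDiffOn.mono h.base_subset)
    (fun p => χ.lin p ∘ₗ 𝓛.simpleIncl E p)
    (fun _ hp _ _ hx => χ.lin_mem (h.base_subset hp) (h.simpleIncl_mem hp hx))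
    (fun p hp n d x hx => by
      refine (congrArg (χ.lin p) (h.simpleIncl_op hp n x)).trans ?_
      exact hχ.map_op (h.base_subset hp) n d _ fun j => h.simpleIncl_mem hp (hx j))
    (fun _ _ hA hp _ hs => χ.smoothAlong_lin (b := id) hp (hA.trans h.base_subset)
      (h.smoothAlong_simpleIncl hA hp hs))

lemma isLinear_simpleLin {χ : Hom 𝓛 𝓛' f} (hχ : χ.IsLinear) : (h.simpleLin hχ).IsLinear :=
  fun _ _ _ hk => ofLinear_eq_zero _ hk.ne'

lemma isComposition_simpleLin {χ : Hom 𝓛 𝓛' f} (hχ : χ.IsLinear) :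
    IsComposition h.simpleHom χ (h.simpleLin hχ) := by
  intro p hp n d x _
  rw [show χ.op (id p) = _ from hχ.op_eq (h.base_subset hp)]
  refine Eq.trans ?_ (bullet_ofLinear_left (χ.lin p) (h.simpleHom.op p) rfl d x).symm
  exact (comp_ofLinear (𝓛.simpleIncl E p) (χ.lin p) n x).symm

end IsSimpleData

end LInftyBundle

/-! ### The orthogonal complement of the kernel -/

section Gram

variable {B : Type*} [AddCommGroup B] [Module ℝ B]

/-- The Gram matrix of linearly independent vectors is invertible. -/
lemma exists_mem_span_eq_of_linearIndependent {g : B →ₗ[ℝ] B →ₗ[ℝ] ℝ}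
    (hpos : ∀ x, x ≠ 0 → 0 < g x x) {κ : Type*} [Fintype κ] {k : κ → B}
    (hk : LinearIndependent ℝ k) (y : κ → ℝ) :
    ∃ x ∈ Submodule.span ℝ (range k), ∀ l, g x (k l) = y l := by
  let Φ : (κ → ℝ) →ₗ[ℝ] (κ → ℝ) :=
    LinearMap.pi fun l => g.flip (k l) ∘ₗ Fintype.linearCombination ℝ k
  have hΦ : ∀ c l, Φ c l = g (∑ j, c j • k j) (k l) := fun c l => rfl
  have hinj : Function.Injective Φ := by
    rw [← LinearMap.ker_eq_bot, LinearMap.ker_eq_bot']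
    intro c hc
    have h1 : g (∑ j, c j • k j) (∑ j, c j • k j) = 0 := by
      rw [map_sum]
      refine Finset.sum_eq_zero fun l _ => ?_
      rw [map_smul, ← hΦ, hc, Pi.zero_apply, smul_zero]
    have h2 : ∑ j, c j • k j = 0 := by
      by_contra h
      exact (hpos _ h).ne' h1
    exact funext (Fintype.linearIndependent_iff.1 hk c h2)
  obtain ⟨c, hc⟩ := LinearMap.injective_iff_surjective.1 hinj y
  refine ⟨∑ j, c j • k j, Submodule.sum_mem _ fun j _ => Submodule.smul_mem _ _
    (Submodule.subset_span (mem_range_self j)), fun l => ?_⟩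
  rw [← hΦ, hc]

end Gram

namespace LInftyBundle

open Filter Topology

variable {EM : Type*} [NormedAddCommGroup EM] [NormedSpace ℝ EM]
  {M : Type*} [TopologicalSpace M] [ChartedSpace EM M]
  {FM : Type*} [NormedAddCommGroup FM] [NormedSpace ℝ FM]
  {V : M → Type*} [∀ p, AddCommGroup (V p)] [∀ p, Module ℝ (V p)]
  [TopologicalSpace (TotalSpace FM V)] [∀ p, TopologicalSpace (V p)] [FiberBundle FM V]
  {EN : Type*} [NormedAddCommGroup EN] [NormedSpace ℝ EN]
  {N : Type*} [TopologicalSpace N] [ChartedSpace EN N]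
  {FN : Type*} [NormedAddCommGroup FN] [NormedSpace ℝ FN]
  {W : N → Type*} [∀ q, AddCommGroup (W q)] [∀ q, Module ℝ (W q)]
  [TopologicalSpace (TotalSpace FN W)] [∀ q, TopologicalSpace (W q)] [FiberBundle FN W]
  [VectorBundle ℝ FM V] [FiniteDimensional ℝ FM] [VectorBundle ℝ FN W] [FiniteDimensional ℝ FN]

variable {𝓛 : LInftyBundle EM FM V} {𝓛' : LInftyBundle EN FN W} {f : M → N}

lemma Hom.kerGrade_le_grade (χ : Hom 𝓛 𝓛' f) (i : ℕ) (p : M) : χ.kerGrade i p ≤ 𝓛.grade i p := by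
  rintro _ ⟨x, hx, rfl⟩
  exact hx.1

variable (G : FibreMetric EM FM V)

/-- The orthogonal complement, in degree one, of the kernel of the linear part of a morphism. -/
def Hom.orthKer (χ : Hom 𝓛 𝓛' f) (p : M) : Submodule ℝ (V p) where
  carrier := {x | x ∈ 𝓛.grade 1 p ∧ ∀ k ∈ χ.kerGrade 1 p, G.form p x k = 0}
  zero_mem' := ⟨Submodule.zero_mem _, fun k _ => by rw [map_zero, LinearMap.zero_apply]⟩
  add_mem' hx hy := ⟨Submodule.add_mem _ hx.1 hy.1, fun k hk => by
    rw [map_add, LinearMap.add_apply, hx.2 k hk, hy.2 k hk, add_zero]⟩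
  smul_mem' c x hx := ⟨Submodule.smul_mem _ c hx.1, fun k hk => by
    rw [map_smul, LinearMap.smul_apply, hx.2 k hk, smul_zero]⟩

variable {G}

lemma form_eq_zero {p : M} {x : V p} (h : G.form p x x = 0) : x = 0 := by
  by_contra h0
  exact (G.pos p x h0).ne' h

/-- Orthogonality to the kernel can be tested on a frame. -/
lemma Hom.mem_orthKer_iff_of_span {χ : Hom 𝓛 𝓛' f} {p : M} {κ : Type*} {k : κ → χ.kerGrade 1 p}
    (hk : Submodule.span ℝ (range k) = ⊤) {x : V p} (hx : x ∈ 𝓛.grade 1 p) :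
    x ∈ χ.orthKer G p ↔ ∀ l, G.form p x (k l) = 0 := by
  constructor
  · exact fun h l => h.2 _ (k l).2
  · intro h
    have h1 : Submodule.span ℝ (range k) ≤
        LinearMap.ker (G.form p x ∘ₗ (χ.kerGrade 1 p).subtype) := by
      rw [Submodule.span_le]
      rintro _ ⟨l, rfl⟩
      exact h l
    rw [hk] at h1
    exact ⟨hx, fun y hy => h1 (x := ⟨y, hy⟩) trivial⟩

/-- Locally the orthogonal complement is the kernel of the surjective map that pairs with a frame of
the kernel. -/
lemma Hom.IsFibration.isSmoothSubbundle_orthKer [IsManifold 𝓘(ℝ, EN) ∞ N]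
    [ContMDiffVectorBundle ∞ FN W 𝓘(ℝ, EN)] {χ : Hom 𝓛 𝓛' f} (hfib : χ.IsFibration) :
    IsSmoothSubbundle EM FM 𝓛.base (χ.orthKer G) := by
  rw [isSmoothSubbundle_iff]
  intro p₀ hp
  obtain ⟨ι, _, e, he⟩ := isSmoothSubbundle_iff.1 (𝓛.subbundle 1) p₀ hp
  obtain ⟨κ, _, k, hk⟩ := isSmoothSubbundle_iff.1 (hfib.isSmoothSubbundle_kerGrade 1) p₀ hp
  let B : ∀ p, 𝓛.grade 1 p →ₗ[ℝ] (κ → ℝ) := fun p =>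
    LinearMap.pi fun l => (G.form p).flip (k l p) ∘ₗ (𝓛.grade 1 p).subtype
  have hB : ∀ᶠ q in 𝓝[𝓛.base] p₀, ∀ j,
      ContMDiffWithinAt 𝓘(ℝ, EM) 𝓘(ℝ, κ → ℝ) ∞ (fun p => B p (e j p)) 𝓛.base q := by
    filter_upwards [he.smooth, hk.smooth] with q h1 h2 j
    exact contMDiffWithinAt_pi_space.2 fun l => G.smooth _ _ _ _ (h1 j) (h2 l)
  have hr : ∀ᶠ q in 𝓝[𝓛.base] p₀,
      Module.finrank ℝ (LinearMap.range (B q)) = Fintype.card κ := by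
    filter_upwards [hk.indep] with q h1
    have h2 : LinearMap.range (B q) = ⊤ := by
      rw [LinearMap.range_eq_top]
      intro y
      obtain ⟨x, hx, hxy⟩ := exists_mem_span_eq_of_linearIndependent (G.pos q)
        (h1.map' (χ.kerGrade 1 q).subtype (χ.kerGrade 1 q).ker_subtype) y
      have h3 : x ∈ 𝓛.grade 1 q := by
        refine (Submodule.span_le.2 ?_) hx
        rintro _ ⟨l, rfl⟩
        exact χ.kerGrade_le_grade 1 q (k l q).2
      exact ⟨⟨x, h3⟩, funext hxy⟩
    rw [h2, finrank_top, Module.finrank_fintype_fun_eq_card]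
  obtain ⟨κ', _, k', hk'⟩ := he.exists_frame_ker hp B hB _ hr
  refine ⟨κ', inferInstance, _, hk'.of_eventuallyEq ?_⟩
  filter_upwards [hk.span] with q h1
  ext x
  constructor
  · intro hx
    exact ⟨⟨x, hx.1⟩, funext ((Hom.mem_orthKer_iff_of_span h1 hx.1).1 hx), rfl⟩
  · rintro ⟨x, hx, rfl⟩
    exact (Hom.mem_orthKer_iff_of_span h1 x.2).2 fun l => congrFun hx l

/-- The orthogonal complement of the kernel is mapped onto the target. -/
lemma Hom.IsFibration.exists_mem_orthKer {χ : Hom 𝓛 𝓛' f} (hfib : χ.IsFibration) {p : M}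
    (hp : p ∈ 𝓛.base) {y : 𝓛'.fib (f p)} (hy : y ∈ 𝓛'.gr (f p) 1) :
    ∃ x : 𝓛.fib p, (x : V p) ∈ χ.orthKer G p ∧ χ.lin p x = y := by
  have : FiniteDimensional ℝ (V p) :=
    LinearEquiv.finiteDimensional ((trivializationAt FM V p).continuousLinearEquivAt ℝ p
      (mem_baseSet_trivializationAt FM V p)).symm.toLinearEquiv
  obtain ⟨x, hx, rfl⟩ := (hfib p hp).2 1 hy
  obtain ⟨σ, h1, h2⟩ := exists_pseudoinverse (g := G.form p) (G.pos p) (K₁ := χ.kerGrade 1 p)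
    (K₂ := χ.kerGrade 1 p) (T := LinearMap.id) (Submodule.map_id _)
  obtain ⟨-, -, h3, -⟩ := h2 x
  obtain ⟨z, hz, hzx⟩ := h1 x
  refine ⟨x - z, ⟨Submodule.sub_mem _ hx hz.1, fun k hk => ?_⟩, ?_⟩
  · have h4 := h3 k hk
    rw [← hzx] at h4
    change G.form p ((x : V p) - (z : V p)) k = 0
    rw [map_sub, LinearMap.sub_apply, ← h4]
    exact sub_self _
  · rw [map_sub, hz.2, sub_zero]

/-- The orthogonal complement of the kernel is mapped injectively to the target. -/
lemma Hom.eq_zero_of_mem_orthKer {χ : Hom 𝓛 𝓛' f} {p : M} {x : 𝓛.fib p}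
    (hx : (x : V p) ∈ χ.orthKer G p) (h0 : χ.lin p x = 0) : x = 0 :=
  Subtype.ext (form_eq_zero (hx.2 x ⟨x, ⟨hx.1, h0⟩, rfl⟩))

/-! ### The locus where the curvature is orthogonal to the kernel -/

variable (G) in
/-- The points of the base where the curvature is orthogonal to the kernel. -/
def Hom.orthLocus (χ : Hom 𝓛 𝓛' f) : Set M :=
  {p | p ∈ 𝓛.base ∧ (𝓛.curvature p : V p) ∈ χ.orthKer G p}

variable (𝓛) in
lemma smoothAlong_curvature {p : M} (hp : p ∈ 𝓛.base) :
    SmoothAlong EM EM FM id 𝓛.base p (fun q => (𝓛.curvature q : V q)) :=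
  𝓛.smoothAlong_op (b := id) (k := 0) (s := fun j _ => j.elim0) hp contMDiffWithinAt_id
    (mapsTo_id _) fun j => j.elim0

/-- Near a classical point where the kernel of the tangent complexes is exact in degrees zero and
one, the map `f` restricts to a local diffeomorphism on the locus where the curvature is orthogonal
to the kernel: the derivative of the component of the curvature in the kernel is an isomorphism from
the kernel of the derivative of `f` to the kernel of the linear part in degree one. -/
lemma Hom.ExactAt.exists_isLocalSection_orthLocus [FiniteDimensional ℝ EM]
    [IsManifold 𝓘(ℝ, EM) ∞ M] [FiniteDimensional ℝ EN] [IsManifold 𝓘(ℝ, EN) ∞ N]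
    [ContMDiffVectorBundle ∞ FM V 𝓘(ℝ, EM)] [ContMDiffVectorBundle ∞ FN W 𝓘(ℝ, EN)]
    (hopen : IsOpen 𝓛.base) (hopen' : IsOpen 𝓛'.base) {χ : Hom 𝓛 𝓛' f} (hχ : χ.IsLinear)
    (hfib : χ.IsFibration) (hiso : χ.IsIsoInDegree 2) {p : M} (hex : χ.ExactAt 1 p) :
    ∃ (u : Set M) (v : Set N) (g : N → M), p ∈ u ∧
      IsLocalSection EM EN f (χ.orthLocus G) u v g ∧
      ∃ e ∈ IsManifold.maximalAtlas 𝓘(ℝ, EM) ∞ M, e.source = u ∧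
        ∃ T : Submodule ℝ EM, ∀ q ∈ u, q ∈ χ.orthLocus G ↔ e q ∈ T := by
  have hp := hex.classical
  have hnh : 𝓝[𝓛.base] p = 𝓝 p := hopen.nhdsWithin_eq hp.1
  have hbase : ∀ᶠ q in 𝓝 p, q ∈ 𝓛.base := hopen.mem_nhds hp.1
  obtain ⟨κ, _, k, hk⟩ := isSmoothSubbundle_iff.1 (hfib.isSmoothSubbundle_kerGrade 1) p hp.1
  have hks := hk.smooth
  have hkspan := hk.span
  rw [hnh] at hks hkspan
  obtain ⟨ι, _, c, e, hc, he, hc0, hrep, he1, hD⟩ := 𝓛.exists_curvature_repr hopen hp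
  -- near `p` the locus is the set of zeros of the components of the curvature in a frame of the
  -- kernel
  let σ : M → κ → ℝ := fun q l => G.form q (𝓛.curvature q) (k l q)
  have hσd : ∀ (w : TangentSpace 𝓘(ℝ, EM) p) (l : κ),
      (mfderiv 𝓘(ℝ, EM) 𝓘(ℝ, κ → ℝ) σ p w : κ → ℝ) l =
        G.form p (𝓛.curvatureDeriv p w) (k l p) := by
    intro w l
    have h1 : σ =ᶠ[𝓝 p] fun q => ∑ j, c j q • (fun l => G.form q (e j q) (k l q) : κ → ℝ) := by
      filter_upwards [hrep] with q hq
      funext l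
      simp only [σ, hq, Submodule.coe_sum, Submodule.coe_smul, map_sum, map_smul,
        LinearMap.sum_apply, LinearMap.smul_apply, Finset.sum_apply, Pi.smul_apply]
    have h2 := mfderiv_sum_smul (a := fun j q => (fun l => G.form q (e j q) (k l q) : κ → ℝ)) hc
      (fun j => contMDiffAt_pi_space.2 fun l => (G.smooth 𝓛.base p _ _ ((he j).mono (subset_univ _))
        (hks.self_of_nhds l)).contMDiffAt hbase) hc0 w
    rw [h1.mfderiv_eq]
    refine (congrFun h2 l).trans ?_
    rw [hD]
    simp only [map_sum, map_smul, LinearMap.sum_apply, LinearMap.smul_apply, Finset.sum_apply,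
      Pi.smul_apply]
  have hlin : ∀ (w : TangentSpace 𝓘(ℝ, EM) p), mfderiv 𝓘(ℝ, EM) 𝓘(ℝ, EN) f p w = 0 →
      ∃ y ∈ χ.kerGr p 1, (y : V p) = 𝓛.curvatureDeriv p w := by
    intro w hw
    obtain ⟨y, hyw, hy⟩ := exists_curvatureDeriv hopen hp w
    refine ⟨y, ⟨hy, Subtype.ext ?_⟩, hyw⟩
    rw [hχ.lin_curvatureDeriv hopen hopen' hp w hyw, hw, map_zero]
    rfl
  refine exists_isLocalSection (σ := σ) (S := κ → ℝ) ?_ ?_ ?_ ?_ ?_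
  · filter_upwards [eventually_eventually_nhds.2 hbase] with q hq
    exact (χ.contMDiffOn q hq.self_of_nhds).contMDiffAt hq
  · filter_upwards [eventually_eventually_nhds.2 hbase, hks] with q hq h1
    exact contMDiffAt_pi_space.2 fun l => (G.smooth 𝓛.base q _ _
      (𝓛.smoothAlong_curvature hq.self_of_nhds) (h1 l)).contMDiffAt hq
  · intro w hw hw'
    obtain ⟨y, hy, hyw⟩ := hlin w hw
    refine hex.exact_zero w hw ?_
    rw [← hyw, Hom.eq_zero_of_mem_orthKer (G := G) (χ := χ) _ hy.2]
    · rfl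
    · refine (Hom.mem_orthKer_iff_of_span (hkspan.self_of_nhds) hy.1).2 fun l => ?_
      refine (congrArg (fun x => G.form p x (k l p)) hyw).trans ?_
      rw [← hσd, hw']
      rfl
  · intro y s
    obtain ⟨w₁, hw₁⟩ := (hfib p hp.1).1 y
    obtain ⟨x, hx, hxs⟩ := exists_mem_span_eq_of_linearIndependent (G.pos p)
      ((hk.indep.self_of_nhdsWithin hp.1).map' (χ.kerGrade 1 p).subtype (χ.kerGrade 1 p).ker_subtype)
      (fun l => s l - G.form p (𝓛.curvatureDeriv p w₁) (k l p))
    have hxK : x ∈ χ.kerGrade 1 p := by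
      refine (Submodule.span_le.2 ?_) hx
      rintro _ ⟨l, rfl⟩
      exact (k l p).2
    obtain ⟨z, hz, rfl⟩ := hxK
    have hz0 : unary (𝓛.op p) z = 0 := by
      have h1 := hχ.lam_mem_kerGr hp.1 hz
      rwa [hiso.kerGr_eq_bot hp.1, Submodule.mem_bot] at h1
    obtain ⟨w₂, hw₂, hw₂z⟩ := hex.exact_one z hz hz0
    refine ⟨w₁ + w₂, ?_, ?_⟩
    · rw [map_add, hw₁, hw₂]
      exact add_zero y
    · rw [map_add]
      funext l
      refine (congrArg₂ (· + ·) (hσd w₁ l) (hσd w₂ l)).trans ?_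
      rw [hw₂z]
      refine (congrArg (_ + ·) (hxs l)).trans ?_
      exact add_sub_cancel _ _
  · filter_upwards [hbase, hkspan] with q hq h1
    constructor
    · exact fun h => funext ((Hom.mem_orthKer_iff_of_span h1 h.2.1).1 h.2)
    · exact fun h => ⟨hq, (Hom.mem_orthKer_iff_of_span h1 (curvature_mem hq)).2 fun l => congrFun h l⟩

end LInftyBundle

/-! ### Linear isomorphisms -/

namespace LInftyBundle

open Filter Topology

variable {EM : Type*} [NormedAddCommGroup EM] [NormedSpace ℝ EM]
  {M : Type*} [TopologicalSpace M] [ChartedSpace EM M]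
  {FM : Type*} [NormedAddCommGroup FM] [NormedSpace ℝ FM]
  {V : M → Type*} [∀ p, AddCommGroup (V p)] [∀ p, Module ℝ (V p)]
  [TopologicalSpace (TotalSpace FM V)] [∀ p, TopologicalSpace (V p)] [FiberBundle FM V]
  {EN : Type*} [NormedAddCommGroup EN] [NormedSpace ℝ EN]
  {N : Type*} [TopologicalSpace N] [ChartedSpace EN N]
  {FN : Type*} [NormedAddCommGroup FN] [NormedSpace ℝ FN]
  {W : N → Type*} [∀ q, AddCommGroup (W q)] [∀ q, Module ℝ (W q)]
  [TopologicalSpace (TotalSpace FN W)] [∀ q, TopologicalSpace (W q)] [FiberBundle FN W]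
  [VectorBundle ℝ FM V] [FiniteDimensional ℝ FM] [VectorBundle ℝ FN W] [FiniteDimensional ℝ FN]

variable {𝓛 : LInftyBundle EM FM V} {𝓛' : LInftyBundle EN FN W} {f : M → N}

/-- Morphisms preserve degrees. -/
lemma Hom.proj_lin (χ : Hom 𝓛 𝓛' f) {p : M} (hp : p ∈ 𝓛.base) (i : ℕ) (x : 𝓛.fib p) :
    𝓛'.proj (f p) i (χ.lin p x) = χ.lin p (𝓛.proj p i x) := by
  refine LinearMap.congr_fun (f := 𝓛'.proj (f p) i ∘ₗ χ.lin p) (g := χ.lin p ∘ₗ 𝓛.proj p i)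
    (𝓛.linearMap_ext fun j y hy => ?_) x
  have h1 := χ.lin_mem hp hy
  rw [LinearMap.comp_apply, LinearMap.comp_apply]
  rcases eq_or_ne j i with rfl | hj
  · rw [proj_of_mem hp hy, proj_of_mem (χ.mapsTo hp) h1]
  · rw [proj_of_mem_ne hp hj hy, proj_of_mem_ne (χ.mapsTo hp) hj h1, map_zero]

lemma Hom.bijective_lin {χ : Hom 𝓛 𝓛' f} (h : ∀ i, χ.IsIsoInDegree i) {p : M} (hp : p ∈ 𝓛.base) :
    Function.Bijective (χ.lin p) := by
  constructor
  · rw [← LinearMap.ker_eq_bot, LinearMap.ker_eq_bot']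
    intro x hx
    rw [← 𝓛.sum_proj hp x]
    refine Finset.sum_eq_zero fun i _ => (h i p hp).injOn (proj_mem hp i x) (Submodule.zero_mem _) ?_
    rw [← χ.proj_lin hp, hx, map_zero, map_zero]
  · rw [← LinearMap.range_eq_top, eq_top_iff, ← 𝓛'.iSup_gr (f p), iSup_le_iff]
    intro i y hy
    obtain ⟨x, -, hx⟩ := (h i p hp).surjOn hy
    exact ⟨x, hx⟩

/-- The restriction of a morphism to open subsets. -/
def Hom.restrict [IsManifold 𝓘(ℝ, EM) ∞ M] [IsManifold 𝓘(ℝ, EN) ∞ N] (χ : Hom 𝓛 𝓛' f)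
    {u : TopologicalSpace.Opens M} {v : TopologicalSpace.Opens N}
    (h : MapsTo f (𝓛.base ∩ u) v) : Hom (𝓛.restrict u) (𝓛'.restrict v) f where
  mapsTo p hp := ⟨χ.mapsTo hp.1, h hp⟩
  contMDiffOn := χ.contMDiffOn.mono inter_subset_left
  op := χ.op
  morphism p hp := χ.morphism p hp.1
  smooth k w hw s hs := by
    have h1 : (𝓛.restrict u).base ∩ w = 𝓛.base ∩ (u ∩ w) := inter_assoc _ _ _
    rw [h1] at hs ⊢
    exact χ.smooth k (u ∩ w) (u.isOpen.inter hw) s hs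

/-- The linear part of a linear isomorphism, as a linear isomorphism with the fibre at `q = f p`. -/
lemma Hom.IsLinear.exists_linearEquiv {χ : Hom 𝓛 𝓛' f} (hχ : χ.IsLinear)
    (h : ∀ i, χ.IsIsoInDegree i) {p : M} (hp : p ∈ 𝓛.base) {q : N} (hq : f p = q) :
    ∃ E : 𝓛.fib p ≃ₗ[ℝ] 𝓛'.fib q,
      (∀ x, TotalSpace.mk' FN q (E x : W q) = TotalSpace.mk' FN (f p) (χ.lin p x : W (f p))) ∧
      (∀ i, ∀ y ∈ 𝓛'.gr q i, E.symm y ∈ 𝓛.gr p i) ∧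
      ∀ (n : ℕ) (d : Fin n → ℕ) (x : Fin n → 𝓛.fib p), (∀ j, x j ∈ 𝓛.gr p (d j)) →
        E (𝓛.op p n x) = 𝓛'.op q n (fun j => E (x j)) := by
  subst hq
  refine ⟨LinearEquiv.ofBijective (χ.lin p) (Hom.bijective_lin h hp), fun x => rfl,
    fun i y hy => ?_, fun n d x hx => hχ.map_op hp n d x hx⟩
  obtain ⟨x, hx, rfl⟩ := (h i p hp).surjOn hy
  convert! hx using 1
  exact LinearEquiv.symm_apply_apply (LinearEquiv.ofBijective (χ.lin p) (Hom.bijective_lin h hp)) x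

/-- A linear morphism that is an isomorphism in each degree, over a diffeomorphism, restricts to an
isomorphism. -/
lemma Hom.IsLinear.restrictsToIso [IsManifold 𝓘(ℝ, EM) ∞ M] [IsManifold 𝓘(ℝ, EN) ∞ N]
    [ContMDiffVectorBundle ∞ FM V 𝓘(ℝ, EM)] [ContMDiffVectorBundle ∞ FN W 𝓘(ℝ, EN)]
    {χ : Hom 𝓛 𝓛' f} (hχ : χ.IsLinear) (h : ∀ i, χ.IsIsoInDegree i)
    {u : TopologicalSpace.Opens M} {v : TopologicalSpace.Opens N} {g : N → M}
    (hg : IsLocalSection EM EN f 𝓛.base u v g) : χ.RestrictsToIso u v := by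
  classical
  have hmaps : MapsTo f (𝓛.base ∩ u) v := fun p hp => (hg.left_inv p hp).1
  choose E hE₁ hE₂ hE₃ using fun (q : N) (hq : q ∈ v) =>
    hχ.exists_linearEquiv h (hg.mapsTo hq).1 (hg.right_inv q hq)
  let L : ∀ q, 𝓛'.fib q →ₗ[ℝ] 𝓛.fib (g q) := fun q =>
    if hq : q ∈ v then (E q hq).symm.toLinearMap else 0
  have hL : ∀ q (hq : q ∈ v) y, L q y = (E q hq).symm y := fun q hq y => by
    simp only [L, dif_pos hq]
    rfl
  have hLdeg : ∀ q ∈ v, ∀ i, ∀ y ∈ 𝓛'.gr q i, L q y ∈ 𝓛.gr (g q) i := fun q hq i y hy => by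
    rw [hL q hq]
    exact hE₂ q hq i y hy
  have hLop : ∀ q ∈ v, ∀ (n : ℕ) (d : Fin n → ℕ) (y : Fin n → 𝓛'.fib q),
      (∀ j, y j ∈ 𝓛'.gr q (d j)) → L q (𝓛'.op q n y) = 𝓛.op (g q) n fun j => L q (y j) := by
    intro q hq n d y hy
    simp only [hL q hq]
    rw [LinearEquiv.symm_apply_eq, hE₃ q hq n d _ fun j => hE₂ q hq _ _ (hy j)]
    simp only [LinearEquiv.apply_symm_apply]
  have hLr : ∀ q ∈ v, ∀ y : 𝓛'.fib q,
      TotalSpace.mk' FN (f (g q)) (χ.lin (g q) (L q y) : W (f (g q))) =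
        TotalSpace.mk' FN q (y : W q) := fun q hq y => by
    rw [← hE₁ q hq, hL q hq, LinearEquiv.apply_symm_apply]
  have hgu : MapsTo g (𝓛'.restrict v).base (𝓛.restrict u).base := fun q hq => hg.mapsTo hq.2
  -- smoothness of the inverse: a frame of `𝓛` is mapped to smooth linearly independent sections,
  -- with respect to which smooth sections have smooth coefficients
  have hsm : ∀ (A : Set N) (q : N), A ⊆ (𝓛'.restrict v).base → q ∈ A → ∀ s : ∀ q, 𝓛'.fib q,
      SmoothAlong EN EN FN id A q (fun q => (s q : W q)) →
      SmoothAlong EN EM FM g A q (fun q => (L q (s q) : V (g q))) := by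
    intro A q₀ hA hq₀ s hs
    have hAv : ∀ q ∈ A, q ∈ v := fun q hq => (hA hq).2
    have hgA : MapsTo g A 𝓛.base := fun q hq => (hg.mapsTo (hAv q hq)).1
    have hgs : ContMDiffWithinAt 𝓘(ℝ, EN) 𝓘(ℝ, EM) ∞ g A q₀ :=
      (hg.contMDiffOn q₀ (hAv q₀ hq₀)).mono hAv
    obtain ⟨ι, _, e, he⟩ := isSmoothSubbundle_iff.1 𝓛.isSmoothSubbundle_fib (g q₀) (hgA hq₀)
    have he0 : ∀ j, SmoothAlong EN EM FM g A q₀ (fun q => (e j (g q) : V (g q))) := fun j =>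
      (he.smooth.self_of_nhdsWithin (hgA hq₀) j).comp hgs hgA
    let w : ι → ∀ q, W q := fun j q => if hq : q ∈ v then (E q hq (e j (g q)) : W q) else 0
    have hw : ∀ j q (hq : q ∈ v), w j q = E q hq (e j (g q)) := fun j q hq => by
      simp only [w, dif_pos hq]
    have hws : ∀ j, SmoothAlong EN EN FN id A q₀ (w j) := fun j => by
      have h1 : SmoothAlong EN EN FN (f ∘ g) A q₀
          (fun q => (χ.lin (g q) (e j (g q)) : W (f (g q)))) :=
        χ.smoothAlong_lin (b := g) hq₀ hgA (s := fun q => e j (g q)) (he0 j)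
      refine ContMDiffWithinAt.congr h1 (fun q hq => ?_) ?_
      · exact (congrArg (TotalSpace.mk' FN q) (hw j q (hAv q hq))).trans (hE₁ q (hAv q hq) _)
      · exact (congrArg (TotalSpace.mk' FN q₀) (hw j q₀ (hAv q₀ hq₀))).trans (hE₁ q₀ (hAv q₀ hq₀) _)
    have hex : ∀ᶠ q in 𝓝[A] q₀, ∃ c : ι → ℝ, ∑ j, c j • e j (g q) = L q (s q) := by
      filter_upwards [(hgs.continuousWithinAt.tendsto_nhdsWithin hgA) he.span] with q hq
      have h2 : L q (s q) ∈ Submodule.span ℝ (range fun j => e j (g q)) := by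
        rw [show Submodule.span ℝ (range fun j => e j (g q)) = ⊤ from hq]
        trivial
      exact (Submodule.mem_span_range_iff_exists_fun ℝ).1 h2
    let c : ι → N → ℝ := fun j q =>
      if h : ∃ c : ι → ℝ, ∑ j, c j • e j (g q) = L q (s q) then h.choose j else 0
    have hc : ∀ᶠ q in 𝓝[A] q₀, ∑ j, c j q • e j (g q) = L q (s q) := by
      filter_upwards [hex] with q hq
      have := hq.choose_spec
      simp only [c, dif_pos hq, this]
    have hcs : ∀ j, ContMDiffWithinAt 𝓘(ℝ, EN) 𝓘(ℝ, ℝ) ∞ (c j) A q₀ := by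
      refine SmoothAlong.coeff hq₀ hws hs ?_ ?_
      · have h1 := ((he.indep.self_of_nhdsWithin (hgA hq₀)).map' _
          (E q₀ (hAv q₀ hq₀)).ker).map' (𝓛'.fib q₀).subtype (𝓛'.fib q₀).ker_subtype
        rwa [show (fun j => w j q₀) = _ from funext fun j => hw j q₀ (hAv q₀ hq₀)]
      · filter_upwards [hc, eventually_mem_nhdsWithin] with q h1 hq
        rw [hL q (hAv q hq), LinearEquiv.eq_symm_apply, map_sum] at h1
        rw [← h1, Submodule.coe_sum]
        refine Finset.sum_congr rfl fun j _ => ?_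
        rw [map_smul, Submodule.coe_smul, hw j q (hAv q hq)]
    have h2 : SmoothAlong EN EM FM g A q₀ (fun q => ∑ j, c j q • (e j (g q) : V (g q))) :=
      SmoothAlong.sum _ hgs fun j _ => (he0 j).smul (hcs j)
    refine h2.congr hq₀ ?_
    filter_upwards [hc] with q hq
    rw [← hq]
    simp only [Submodule.coe_sum, Submodule.coe_smul]
  let ψ : Hom (𝓛'.restrict v) (𝓛.restrict u) g :=
    Hom.ofLinear hgu (hg.contMDiffOn.mono inter_subset_right) L
      (fun q hq => hLdeg q hq.2) (fun q hq => hLop q hq.2)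
      hsm
  have hzero : ∀ p p' : M, p' = p →
      TotalSpace.mk' FM p' (0 : V p') = TotalSpace.mk' FM p (0 : V p) := by
    rintro p _ rfl
    rfl
  have hzero' : ∀ p p' : N, p' = p →
      TotalSpace.mk' FN p' (0 : W p') = TotalSpace.mk' FN p (0 : W p) := by
    rintro p _ rfl
    rfl
  refine ⟨χ.restrict hmaps, fun _ _ => rfl, Or.inr ⟨g, ψ, ?_, ?_⟩⟩
  · intro p hp n d x hx
    have hfp := (hg.left_inv p hp).1
    have hgf := (hg.left_inv p hp).2
    have h1 : bullet (ψ.op (f p)) ((χ.restrict hmaps).op p) d x = L (f p) (χ.op p n x) :=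
      bullet_ofLinear_left (L (f p)) (χ.op p) (χ.morphism p hp.1).zero d x
    rw [h1, hχ.op_eq hp.1]
    match n with
    | 1 =>
      have key : ∀ p', p' = p → ∀ x : 𝓛.fib p, ∃ x' : 𝓛.fib p',
          TotalSpace.mk' FM p' (x' : V p') = TotalSpace.mk' FM p (x : V p) ∧
          TotalSpace.mk' FN (f p') (χ.lin p' x' : W (f p')) =
            TotalSpace.mk' FN (f p) (χ.lin p x : W (f p)) := by
        rintro _ rfl x
        exact ⟨x, rfl, rfl⟩
      obtain ⟨x', hx', hx''⟩ := key _ hgf (x 0)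
      refine Eq.trans ?_ hx'
      have h2 : L (f p) (χ.lin p (x 0)) = x' := by
        rw [hL _ hfp, LinearEquiv.symm_apply_eq]
        have h3 := (hE₁ (f p) hfp x').trans hx''
        exact Subtype.ext (eq_of_heq (TotalSpace.mk.inj h3).2).symm
      exact congrArg (fun z : 𝓛.fib (g (f p)) => TotalSpace.mk' FM (g (f p)) (z : V (g (f p)))) h2
    | 0 => exact (congrArg (fun z : 𝓛.fib (g (f p)) => TotalSpace.mk' FM (g (f p)) (z : V (g (f p))))
        (map_zero (L (f p)))).trans (hzero p _ hgf)
    | n + 2 => exact (congrArg (fun z : 𝓛.fib (g (f p)) =>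
        TotalSpace.mk' FM (g (f p)) (z : V (g (f p)))) (map_zero (L (f p)))).trans (hzero p _ hgf)
  · intro q hq n d y hy
    have hgq := hg.mapsTo hq.2
    have hfg := hg.right_inv q hq.2
    have h1 : bullet ((χ.restrict hmaps).op (g q)) (ψ.op q) d y =
        χ.lin (g q) (_root_.ofLinear (L q) n y) := by
      refine Eq.trans ?_ (bullet_ofLinear_left (χ.lin (g q)) (ψ.op q) rfl d y)
      rw [← hχ.op_eq hgq.1]
      rfl
    rw [h1]
    match n with
    | 1 => exact hLr q hq.2 (y 0)
    | 0 => exact (congrArg (fun z : 𝓛'.fib (f (g q)) => TotalSpace.mk' FN (f (g q)) (z : W (f (g q))))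
        (map_zero (χ.lin (g q)))).trans (hzero' q _ hfg)
    | n + 2 => exact (congrArg (fun z : 𝓛'.fib (f (g q)) =>
        TotalSpace.mk' FN (f (g q)) (z : W (f (g q)))) (map_zero (χ.lin (g q)))).trans (hzero' q _ hfg)

end LInftyBundle

/-! ### The simple subbundle of a linear fibration -/

lemma IsSubmanifold.inter {EM : Type*} [NormedAddCommGroup EM] [NormedSpace ℝ EM]
    {M : Type*} [TopologicalSpace M] [ChartedSpace EM M] [IsManifold 𝓘(ℝ, EM) ∞ M] {Y u : Set M}
    (hY : IsSubmanifold EM Y) (hu : IsOpen u) : IsSubmanifold EM (Y ∩ u) := by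
  rintro p ⟨hp, hpu⟩
  obtain ⟨e, he, hpe, S, hS⟩ := hY p hp
  refine ⟨e.restr u, restr_mem_maximalAtlas _ he hu, ?_, S, fun q hq => ?_⟩
  · rw [OpenPartialHomeomorph.restr_source, hu.interior_eq]
    exact ⟨hpe, hpu⟩
  · rw [OpenPartialHomeomorph.restr_source, hu.interior_eq] at hq
    exact (and_iff_left hq.2).trans (hS q hq.1)

namespace LInftyBundle

open Filter Topology

variable {EM : Type*} [NormedAddCommGroup EM] [NormedSpace ℝ EM]
  {M : Type*} [TopologicalSpace M] [ChartedSpace EM M]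
  {FM : Type*} [NormedAddCommGroup FM] [NormedSpace ℝ FM]
  {V : M → Type*} [∀ p, AddCommGroup (V p)] [∀ p, Module ℝ (V p)]
  [TopologicalSpace (TotalSpace FM V)] [∀ p, TopologicalSpace (V p)] [FiberBundle FM V]
  {EN : Type*} [NormedAddCommGroup EN] [NormedSpace ℝ EN]
  {N : Type*} [TopologicalSpace N] [ChartedSpace EN N]
  {FN : Type*} [NormedAddCommGroup FN] [NormedSpace ℝ FN]
  {W : N → Type*} [∀ q, AddCommGroup (W q)] [∀ q, Module ℝ (W q)]
  [TopologicalSpace (TotalSpace FN W)] [∀ q, TopologicalSpace (W q)] [FiberBundle FN W]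
  [VectorBundle ℝ FM V] [FiniteDimensional ℝ FM] [VectorBundle ℝ FN W] [FiniteDimensional ℝ FN]

variable {𝓛 : LInftyBundle EM FM V} {𝓛' : LInftyBundle EN FN W} {f : M → N}

/-- The relation of a morphism in arity zero expresses the curvature of the target by that of the
source, because morphisms have no component of arity zero. -/
lemma Hom.mapsTo_classicalLocus (χ : Hom 𝓛 𝓛' f) : MapsTo f 𝓛.classicalLocus 𝓛'.classicalLocus := by
  intro p hp
  refine ⟨χ.mapsTo hp.1, ?_⟩
  have h := (χ.morphism p hp.1).comm 0 (fun j => j.elim0) (fun j => j.elim0) fun j => j.elim0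
  unfold insertOp at h
  rw [Fintype.sum_unique, bullet_zero] at h
  have h1 := insertOp_univ (χ.op p) (𝓛.op p) (n := 0) (fun j => j.elim0) (fun j => j.elim0)
  rw [op_zero, hp.2, map_zero] at h1
  exact h.symm.trans h1

section Simple

variable {G : FibreMetric EM FM V} [IsManifold 𝓘(ℝ, EM) ∞ M] [IsManifold 𝓘(ℝ, EN) ∞ N]
  [ContMDiffVectorBundle ∞ FM V 𝓘(ℝ, EM)] [ContMDiffVectorBundle ∞ FN W 𝓘(ℝ, EN)]
  {χ : Hom 𝓛 𝓛' f} (hχ : χ.IsLinear) (hfib : χ.IsFibration) (hiso : ∀ i, 1 < i → χ.IsIsoInDegree i)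

/-- The orthogonal complement of the kernel contains the curvature over the points where the
curvature is orthogonal to the kernel. -/
lemma Hom.IsFibration.isSimpleData (hfib : χ.IsFibration) {O : Set M}
    (hO : IsSubmanifold EM (χ.orthLocus G ∩ O)) :
    IsSimpleData 𝓛 (χ.orthLocus G ∩ O) (χ.orthKer G) where
  base_subset _ hp := hp.1.1
  submanifold := hO
  subbundle := isSmoothSubbundle_mono (fun _ hp => hp.1.1) hfib.isSmoothSubbundle_orthKer
  le _ _ _ hx := hx.1
  curvature_mem _ hp := hp.1.2

include hfib hiso in
lemma Hom.IsLinear.isIsoInDegree_simpleLin (hχ : χ.IsLinear) {O : Set M}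
    (hO : IsSubmanifold EM (χ.orthLocus G ∩ O)) (i : ℕ) :
    ((hfib.isSimpleData hO).simpleLin hχ).IsIsoInDegree i := by
  intro p hp
  have h := hfib.isSimpleData hO
  have hpb : p ∈ 𝓛.base := h.base_subset hp
  have hlin : ∀ x, (h.simpleLin hχ).lin p x = χ.lin p (𝓛.simpleIncl (χ.orthKer G) p x) :=
    fun x => rfl
  have hinj : ∀ x y, 𝓛.simpleIncl (χ.orthKer G) p x = 𝓛.simpleIncl (χ.orthKer G) p y → x = y :=
    fun x y hxy => Subtype.ext (by
      rw [← h.coe_simpleIncl hp, ← h.coe_simpleIncl hp, hxy])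
  -- an element of the fibre of `𝓛` in the subspace comes from the subbundle
  have hlift : ∀ x : 𝓛.fib p, (x : V p) ∈ 𝓛.simpleGrade (χ.orthKer G) i p →
      ∃ y ∈ h.simpleBundle.gr p i, 𝓛.simpleIncl (χ.orthKer G) p y = x := fun x hx =>
    ⟨⟨x, h.simpleBundle.grade_le_fib p i hx⟩, hx, Subtype.ext (h.coe_simpleIncl hp _)⟩
  refine ⟨fun x hx => (h.simpleLin hχ).lin_mem hp hx, ?_, ?_⟩
  · intro x hx y hy hxy
    apply hinj
    have hx' := h.simpleIncl_mem hp hx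
    have hy' := h.simpleIncl_mem hp hy
    rw [hlin, hlin] at hxy
    match i with
    | 0 =>
      rw [𝓛.gr_zero hpb, Submodule.mem_bot] at hx' hy'
      rw [hx', hy']
    | 1 =>
      refine sub_eq_zero.1 (Hom.eq_zero_of_mem_orthKer (G := G) (χ := χ) ?_ ?_)
      · have h1 : ((𝓛.simpleIncl (χ.orthKer G) p x -
            𝓛.simpleIncl (χ.orthKer G) p y : 𝓛.fib p) : V p) = x - y := congrArg₂ (· - ·) (h.coe_simpleIncl hp x) (h.coe_simpleIncl hp y)
        rw [h1]
        exact Submodule.sub_mem _ hx hy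
      · rw [map_sub, hxy, sub_self]
    | i + 2 => exact (hiso (i + 2) (by omega) p hpb).injOn hx' hy' hxy
  · intro y hy
    match i with
    | 0 =>
      rw [𝓛'.gr_zero (χ.mapsTo hpb)] at hy
      refine ⟨0, Submodule.zero_mem _, ?_⟩
      rw [map_zero, (Submodule.mem_bot ℝ).1 hy]
    | 1 =>
      obtain ⟨x, hx, rfl⟩ := hfib.exists_mem_orthKer (G := G) hpb hy
      obtain ⟨z, hz, rfl⟩ := hlift x hx
      exact ⟨z, hz, rfl⟩
    | i + 2 =>
      obtain ⟨x, hx, rfl⟩ := (hiso (i + 2) (by omega) p hpb).surjOn hy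
      obtain ⟨z, hz, rfl⟩ := hlift x hx
      exact ⟨z, hz, rfl⟩

include hχ hfib hiso in
/-- The locus where the curvature is orthogonal to the kernel is a submanifold near the points where
the tangent complexes of the kernel are exact. -/
lemma Hom.IsLinear.exists_hasLocalSections [FiniteDimensional ℝ EM] [FiniteDimensional ℝ EN]
    (G : FibreMetric EM FM V) (hopen : IsOpen 𝓛.base) (hopen' : IsOpen 𝓛'.base) {Z : Set M}
    (hZ : ∀ p ∈ Z, χ.ExactAt 1 p) : ∃ O : Set M, IsOpen O ∧ Z ⊆ χ.orthLocus G ∩ O ∧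
      IsSubmanifold EM (χ.orthLocus G ∩ O) ∧ HasLocalSections EM EN f (χ.orthLocus G ∩ O) := by
  have h1 : ∀ z : Z, ∃ (u : Set M) (v : Set N) (g : N → M), z.1 ∈ u ∧
      IsLocalSection EM EN f (χ.orthLocus G) u v g ∧
      ∃ e ∈ IsManifold.maximalAtlas 𝓘(ℝ, EM) ∞ M, e.source = u ∧
        ∃ T : Submodule ℝ EM, ∀ q ∈ u, q ∈ χ.orthLocus G ↔ e q ∈ T := fun z =>
    (hZ z z.2).exists_isLocalSection_orthLocus hopen hopen' hχ hfib (hiso 2 (by omega))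
  choose u v g hu hs e he heu T hT using h1
  have hO : IsOpen (⋃ z, u z) := isOpen_iUnion fun z => (hs z).isOpen_left
  refine ⟨⋃ z, u z, hO, fun z hz => ⟨⟨(hZ z hz).classical.1, ?_⟩, mem_iUnion.2 ⟨⟨z, hz⟩, hu _⟩⟩,
    fun p hp => ?_, fun p hp => ?_⟩
  · rw [(hZ z hz).classical.2]
    exact Submodule.zero_mem _
  · obtain ⟨z, hz⟩ := mem_iUnion.1 hp.2
    refine ⟨e z, he z, (heu z).symm ▸ hz, T z, fun q hq => ?_⟩
    have hq' : q ∈ u z := heu z ▸ hq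
    rw [← hT z q hq']
    exact and_iff_left (mem_iUnion.2 ⟨z, hq'⟩)
  · obtain ⟨z, hz⟩ := mem_iUnion.1 hp.2
    exact ⟨u z ∩ ⋃ z, u z, v z ∩ g z ⁻¹' ⋃ z, u z, g z, ⟨hz, hp.2⟩, (hs z).inter hO⟩

end Simple

end LInftyBundle

end

theorem theorem2p1
    {EM : Type*} [NormedAddCommGroup EM] [NormedSpace ℝ EM] [FiniteDimensional ℝ EM]
    {M : Type*} [TopologicalSpace M] [ChartedSpace EM M] [IsManifold 𝓘(ℝ, EM) ∞ M]
    [T2Space M] [SecondCountableTopology M]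
    {FM : Type*} [NormedAddCommGroup FM] [NormedSpace ℝ FM] [FiniteDimensional ℝ FM]
    {V : M → Type*} [∀ p, AddCommGroup (V p)] [∀ p, Module ℝ (V p)]
    [TopologicalSpace (TotalSpace FM V)] [∀ p, TopologicalSpace (V p)]
    [FiberBundle FM V] [VectorBundle ℝ FM V] [ContMDiffVectorBundle ∞ FM V 𝓘(ℝ, EM)]
    {EN : Type*} [NormedAddCommGroup EN] [NormedSpace ℝ EN] [FiniteDimensional ℝ EN]
    {N : Type*} [TopologicalSpace N] [ChartedSpace EN N] [IsManifold 𝓘(ℝ, EN) ∞ N]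
    [T2Space N] [SecondCountableTopology N]
    {FN : Type*} [NormedAddCommGroup FN] [NormedSpace ℝ FN] [FiniteDimensional ℝ FN]
    {W : N → Type*} [∀ q, AddCommGroup (W q)] [∀ q, Module ℝ (W q)]
    [TopologicalSpace (TotalSpace FN W)] [∀ q, TopologicalSpace (W q)]
    [FiberBundle FN W] [VectorBundle ℝ FN W] [ContMDiffVectorBundle ∞ FN W 𝓘(ℝ, EN)]
    (𝓜 : LInftyBundle EM FM V) (h𝓜 : 𝓜.base = univ)
    (𝓝 : LInftyBundle EN FN W) (h𝓝 : 𝓝.base = univ)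
    (f : M → N) (φ : Hom 𝓜 𝓝 f) (hlin : φ.IsLinear) (hfib : φ.IsFibration) :
    -- (1)
    (∀ Z : Set M, Z ⊆ 𝓜.classicalLocus → (∀ p ∈ Z, φ.IsEtaleAt p) →
      ∃ (𝓤 : LInftyBundle EM FM V) (ι : Hom 𝓤 𝓜 id) (χ : Hom 𝓤 𝓝 f)
        (𝓨 : LInftyBundle EM FM V) (j : Hom 𝓨 𝓤 id) (ψ : Hom 𝓨 𝓝 f),
        TransferSequence Z 𝓜 𝓤 ι ∧ j.IsSimpleSubbundle ∧
        Z ⊆ 𝓨.base ∧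
        IsComposition ι φ χ ∧ χ.IsLinear ∧ χ.IsFibration ∧ (∀ i, 2 ≤ i → χ.IsIsoInDegree i) ∧
        IsComposition j χ ψ ∧ ψ.IsLinear ∧ ψ.IsLocalIso ∧ IsOpen (f '' 𝓨.base)) ∧
    -- (2)
    (φ.IsWeakEquivalence →
      ∃ (𝓤 : LInftyBundle EM FM V) (ι : Hom 𝓤 𝓜 id) (χ : Hom 𝓤 𝓝 f)
        (𝓨 : LInftyBundle EM FM V) (j : Hom 𝓨 𝓤 id) (ψ : Hom 𝓨 𝓝 f),
        TransferSequence 𝓜.classicalLocus 𝓜 𝓤 ι ∧ j.IsSimpleSubbundle ∧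
        𝓜.classicalLocus ⊆ 𝓨.base ∧
        IsComposition ι φ χ ∧ χ.IsLinear ∧ χ.IsFibration ∧ (∀ i, 2 ≤ i → χ.IsIsoInDegree i) ∧
        IsComposition j χ ψ ∧ ψ.IsLinear ∧
        ∃ v : TopologicalSpace.Opens N, (v : Set N) = f '' 𝓨.base ∧ ψ.RestrictsToIso ⊤ v) := by
  obtain ⟨G⟩ := exists_fibreMetric (EM := EM) (FM := FM) (V := V)
  have hopen : IsOpen 𝓜.base := h𝓜 ▸ isOpen_univ
  have hopen' : IsOpen 𝓝.base := h𝓝 ▸ isOpen_univ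
  constructor
  · intro Z hZ het
    obtain ⟨𝓤, ι, χ, hseq, hcomp, hχ, hχfib, hiso, hUo, hex⟩ := exists_transferSequence G hopen hlin
      hfib fun n p hp => (het p hp).exactAt hlin hfib hopen hopen' n
    obtain ⟨O, hO, hZO, hsub, hloc⟩ := hχ.exists_hasLocalSections hχfib hiso G hUo hopen' hex
    have h := hχfib.isSimpleData hsub
    refine ⟨𝓤, ι, χ, h.simpleBundle, h.simpleHom, h.simpleLin hχ, hseq,
      h.isSimpleSubbundle_simpleHom, hZO, hcomp, hχ, hχfib, hiso, h.isComposition_simpleLin hχ,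
      h.isLinear_simpleLin hχ, fun p hp => ?_, hloc.isOpen_image⟩
    obtain ⟨u, v, g, hpu, hs⟩ := hloc p hp
    exact ⟨⟨u, hs.isOpen_left⟩, ⟨v, hs.isOpen_right⟩, hpu, (h.isLinear_simpleLin hχ).restrictsToIso
      (hχ.isIsoInDegree_simpleLin hχfib hiso hsub) hs⟩
  · intro hwe
    obtain ⟨𝓤, ι, χ, hseq, hcomp, hχ, hχfib, hiso, hUo, hex⟩ := exists_transferSequence G hopen hlin
      hfib fun n p hp => (hwe.1 p hp).exactAt hlin hfib hopen hopen' n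
    obtain ⟨O, hO, hZO, hsub, hloc⟩ := hχ.exists_hasLocalSections hχfib hiso G hUo hopen' hex
    -- a point `y` of `Y` over the classical locus of `𝓝` is classical: its curvature is mapped to
    -- zero and orthogonal to the kernel; so the classical locus is a union of fibres of `f|_Y`
    obtain ⟨O', hO', hZO', hinj⟩ := hloc.exists_isOpen_injOn hZO hUo (fun p hp => (hZO hp).1.1)
      χ.contMDiffOn.continuousOn (fun y hy hfy => by
        rw [hwe.2.image_eq] at hfy
        refine ι.mapsTo_classicalLocus ⟨hy.1.1, Hom.eq_zero_of_mem_orthKer hy.1.2 ?_⟩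
        rw [hχ.lin_curvature hy.1.1]
        exact hfy.2) hwe.2.injOn
    rw [inter_assoc] at hinj
    have hsub' : IsSubmanifold EM (χ.orthLocus G ∩ (O ∩ O')) := by
      rw [← inter_assoc]
      exact hsub.inter hO'
    have hloc' : HasLocalSections EM EN f (χ.orthLocus G ∩ (O ∩ O')) := by
      rw [← inter_assoc]
      exact hloc.inter hO'
    have h := hχfib.isSimpleData hsub'
    refine ⟨𝓤, ι, χ, h.simpleBundle, h.simpleHom, h.simpleLin hχ, hseq,
      h.isSimpleSubbundle_simpleHom, fun p hp => ⟨(hZO hp).1, (hZO hp).2, hZO' hp⟩, hcomp, hχ,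
      hχfib, hiso, h.isComposition_simpleLin hχ, h.isLinear_simpleLin hχ,
      ⟨_, hloc'.isOpen_image⟩, rfl, ?_⟩
    rcases isEmpty_or_nonempty M with hM | hM
    -- without a point of `M` there is no map `N → M`, and the isomorphism is one of empty bundles
    · refine ⟨(h.simpleLin hχ).restrict fun p _ => isEmptyElim p, fun _ _ => rfl, Or.inl ⟨?_, ?_⟩⟩
      · exact eq_empty_of_isEmpty _
      · refine eq_empty_of_forall_notMem ?_
        rintro _ ⟨-, p, -, -⟩
        exact isEmptyElim p
    · obtain ⟨g, hg⟩ := hloc'.exists_isLocalSection_univ hinj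
      exact (h.isLinear_simpleLin hχ).restrictsToIso
        (hχ.isIsoInDegree_simpleLin hχfib hiso hsub') hg
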